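/- Let $n\in\mathbb N$ and write points of phase space $\mathbb R^{2n}=\mathbb R^n\times\mathbb R^n$ as $(x,\xi)$. A symbol is a real function $q(t,x,\xi)$, $t\in[0,1]$, which is smooth in $(x,\xi)$ and continuous in $t$ (all derivatives $\partial_x^\alpha\partial_\xi^\beta q$ are continuous in $(t,x,\xi)$). For a symbol $a$ let $\chi(t,s)$ be the Hamilton flow of $\dot x=a_\xi(t,x,\xi)$, $\dot\xi=-a_x(t,x,\xi)$, from time $s$ to time $t$. A symbol $q$ belongs to $S^{(k)}L^1_\chi$ if there are constants $c^q_{\alpha\beta}$ with $$\sup_{x,\xi}\int_0^1\bigl|\partial_x^\alpha\partial_\xi^\beta q\bigl(t,\chi(t,0)(x,\xi)\bigr)\bigr|\,dt\le c^q_{\alpha\beta}\qquad\text{for all } |\alpha|+|\beta|\ge k,$$ where, as long as $\chi$ is not known to be globally defined, the integral is taken over those intervals $[0,T]\subseteq[0,1]$ on which the trajectory starting at $(x,\xi)$ at time $0$ exists. (a) Let $a\in S^{(2)}L^1_\chi$, where $\chi$ is the Hamilton flow of $a$ itself. Then the Hamilton flow is globally well defined: for every $s\in[0,1]$ and every initial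 point at time $s$ there is a unique trajectory, it exists on all of $[0,1]$, and every trajectory on a subinterval of $[0,1]$ is part of such a one. The flow is bilipschitz: there is $L>0$ such that for all $s,t\in[0,1]$ and all $z,w\in\mathbb R^{2n}$ $$L^{-1}|z-w|\le|\chi(t,s)z-\chi(t,s)w|\le L|z-w|.$$ (b) There is $N_0=N_0(n)$ such that for every integer $N\ge N_0$ there are $\varepsilon>0$ and $C>0$, depending only on $n$ and $N$, with the following property. Let $a\in S^{(2)}L^1_\chi$ and $b\in S^{(1)}L^1_\chi$ with $\chi$ the Hamilton flow of $a$, and let $c^a_{\alpha\beta}$, $c^b_{\alpha\beta}$ be constants as above. Put $$\kappa_m=\max_{2\le|\alpha|+|\beta|\le m}c^a_{\alpha\beta}+\max_{1\le|\alpha|+|\beta|\le m}c^b_{\alpha\beta}\quad(m\ge2),\qquad \kappa_0=\max_{|\alpha|+|\beta|=2}c^a_{\alpha\beta}+\max_{|\alpha|+|\beta|=1}c^b_{\alpha\beta}$$ (a maximum over no multi-indices, which occurs only for $n=0$, is $0$), and suppose that $$M=\sup_{x,\xi}\ \sup_{0\le t_0\le t_1\le1}\int_{t_0}^{t_1}b\bigl(t,\chi(t,0)(x,\xi)\bigr)\,dt<\infty,\qquad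 e^{2M}\kappa_0\,\kappa_{4N}\le\varepsilon .$$ Then the forward Cauchy problem for $(D_t+a^w(t,x,D)+ib^w(t,x,D))u=0$, $D_t=-i\partial_t$, with Weyl quantization, is well posed in $L^2(\mathbb R^n)$ on $[0,1]$: there are bounded evolution operators $S(t,s)$, $0\le s\le t\le1$, on $L^2(\mathbb R^n)$ such that $t\mapsto S(t,s)u_0$ is the unique weak solution in $C([s,1];L^2(\mathbb R^n))$ with value $u_0$ at time $s$ (weak: tested against Schwartz functions, and integrated in time; uniqueness holds also on shorter intervals $[s,T]$). Let $$Tf(x,\xi)=2^{-n/2}\pi^{-3n/4}\int_{\mathbb R^n}e^{-\frac12|x-y|^2}e^{i\xi\cdot(x-y)}f(y)\,dy$$ be the Bargmann transform, an isometry from $L^2(\mathbb R^n)$ into $L^2(\mathbb R^{2n})$. For all $0\le s\le t\le1$ the operator $T\,S(t,s)\,T^*$ on $L^2(\mathbb R^{2n})$ has a continuous integral kernel $K(t,x,\xi,s,y,\eta)$, and for all $(x,\xi),(y,\eta)\in\mathbb R^{2n}$ $$|K(t,x,\xi,s,y,\eta)|\le C\,e^{M}\,\bigl(1+|(x,\xi)-\chi(t,s)(y,\eta)|\bigr)^{-N}.$$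 -/

import Mathlib

open MeasureTheory FourierTransform Set
open scoped ENNReal SchwartzMap ContDiff ComplexConjugate

namespace PhaseSpace

/-- Configuration space `ℝⁿ` with its Euclidean norm. -/
abbrev Pos (n : ℕ) : Type := EuclideanSpace ℝ (Fin n)

/-- Phase space `ℝⁿ × ℝⁿ`, with points `(x, ξ)`. -/
abbrev Phase (n : ℕ) : Type := Pos n × Pos n

/-- The Euclidean distance on phase space `ℝ²ⁿ` (the built-in distance of a product type is the
maximum of the two distances). -/
noncomputable def phaseDist {n : ℕ} (z w : Phase n) : ℝ :=
  Real.sqrt (‖z.1 - w.1‖ ^ 2 + ‖z.2 - w.2‖ ^ 2)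

/-! ## Symbols, Hamilton flow, symbol classes -/

/-- A real symbol `q(t, x, ξ)` on the time interval `[0, 1]`: smooth in `(x, ξ)` and continuous in
`t`, in the sense that all its `(x, ξ)`-derivatives are continuous in `(t, x, ξ)`. -/
def IsSymbol {n : ℕ} (q : ℝ → Phase n → ℝ) : Prop :=
  (∀ t ∈ Icc (0 : ℝ) 1, ContDiff ℝ ∞ (q t)) ∧
  ∀ m : ℕ, ContinuousOn (fun p : ℝ × Phase n => iteratedFDeriv ℝ m (q p.1) p.2)
    (Icc (0 : ℝ) 1 ×ˢ univ)

/-- The coordinate direction of `x_i` in phase space. -/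
noncomputable def dirX {n : ℕ} (i : Fin n) : Phase n := (EuclideanSpace.single i 1, 0)

/-- The coordinate direction of `ξ_i` in phase space. -/
noncomputable def dirXi {n : ℕ} (i : Fin n) : Phase n := (0, EuclideanSpace.single i 1)

/-- The directional derivative of a function on phase space. -/
noncomputable def partialD {n : ℕ} (v : Phase n) (q : Phase n → ℝ) : Phase n → ℝ :=
  fun z => fderiv ℝ q z v

/-- The derivative `∂_x^α ∂_ξ^β q` for multi-indices `α`, `β`. -/
noncomputable def multiD {n : ℕ} (α β : Fin n → ℕ) (q : Phase n → ℝ) : Phase n → ℝ :=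
  (List.finRange n).foldr (fun i f => (partialD (dirX i))^[α i] f)
    ((List.finRange n).foldr (fun i f => (partialD (dirXi i))^[β i] f) q)

/-- The order `|α| + |β|` of a pair of multi-indices. -/
def order {n : ℕ} (α β : Fin n → ℕ) : ℕ := ∑ i, α i + ∑ i, β i

/-- The Hamilton vector field `(a_ξ, -a_x)`. -/
noncomputable def hamField {n : ℕ} (a : ℝ → Phase n → ℝ) (t : ℝ) (z : Phase n) : Phase n :=
  (gradient (fun ξ => a t (z.1, ξ)) z.2, -gradient (fun x => a t (x, z.2)) z.1)

/-- `z` solves Hamilton's equations `x' = a_ξ`, `ξ' = -a_x` on the set `I` of times, i.e. it is a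
bicharacteristic on `I`. -/
def IsTrajectory {n : ℕ} (a : ℝ → Phase n → ℝ) (I : Set ℝ) (z : ℝ → Phase n) : Prop :=
  ∀ t ∈ I, HasDerivWithinAt z (hamField a t (z t)) I t

/-- `χ` is a globally defined Hamilton flow of `a` on `[0, 1]`: for every initial time `s` and
initial point `z`, the curve `t ↦ χ t s z` solves Hamilton's equations on all of `[0, 1]` and
equals `z` at `t = s`. -/
def IsHamiltonFlow {n : ℕ} (a : ℝ → Phase n → ℝ) (χ : ℝ → ℝ → Phase n → Phase n) : Prop :=
  ∀ s ∈ Icc (0 : ℝ) 1, ∀ z, χ s s z = z ∧ IsTrajectory a (Icc 0 1) fun t => χ t s z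

/-- The bounds `sup_{x,ξ} ∫₀¹ |∂_x^α ∂_ξ^β q (t, χ(t,0)(x,ξ))| dt ≤ c α β` for `|α| + |β| ≥ k`, where
`χ` is the Hamilton flow of `a`. Since the flow is not known in advance to be defined on all of
`[0, 1]`, the integral is taken over the part of `[0, 1]` on which the trajectory issued from a point
at time `0` exists: the bound is required for every trajectory on every interval `[0, T]`, `T ≤ 1`.
When the flow is global this amounts to the integrals over `[0, 1]`. -/
def SymbolBound {n : ℕ} (k : ℕ) (a q : ℝ → Phase n → ℝ)
    (c : (Fin n → ℕ) → (Fin n → ℕ) → ℝ) : Prop :=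
  ∀ α β : Fin n → ℕ, k ≤ order α β → ∀ T ∈ Icc (0 : ℝ) 1, ∀ z : ℝ → Phase n,
    IsTrajectory a (Icc 0 T) z → ∫ t in (0 : ℝ)..T, |multiD α β (q t) (z t)| ≤ c α β

/-- The symbol `q` belongs to `S^{(k)} L¹_χ`, with `χ` the Hamilton flow of `a`. -/
def InSymbolClass {n : ℕ} (k : ℕ) (a q : ℝ → Phase n → ℝ) : Prop :=
  IsSymbol q ∧ ∃ c, SymbolBound k a q c

/-- The maximum of `c α β` over `l ≤ |α| + |β| ≤ m` (a finite set of multi-indices). -/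
noncomputable def maxBound {n : ℕ} (c : (Fin n → ℕ) → (Fin n → ℕ) → ℝ) (l m : ℕ) : ℝ :=
  sSup {r : ℝ | ∃ α β : Fin n → ℕ, l ≤ order α β ∧ order α β ≤ m ∧ r = c α β}

/-- `κ_N = max_{2 ≤ |α|+|β| ≤ N} c^a_{αβ} + max_{1 ≤ |α|+|β| ≤ N} c^b_{αβ}`. -/
noncomputable def kappa {n : ℕ} (ca cb : (Fin n → ℕ) → (Fin n → ℕ) → ℝ) (N : ℕ) : ℝ :=
  maxBound ca 2 N + maxBound cb 1 N

/-- `κ_0 = max_{|α|+|β| = 2} c^a_{αβ} + max_{|α|+|β| = 1} c^b_{αβ}`. This is separate notation, not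
the case `N = 0` of `kappa`. -/
noncomputable def kappaZero {n : ℕ} (ca cb : (Fin n → ℕ) → (Fin n → ℕ) → ℝ) : ℝ :=
  maxBound ca 2 2 + maxBound cb 1 1

/-- The values `∫_{t₀}^{t₁} b(t, χ(t,0)(x,ξ)) dt`, over all `0 ≤ t₀ ≤ t₁ ≤ 1` and all `(x, ξ)`. -/
def growthSet {n : ℕ} (b : ℝ → Phase n → ℝ) (χ : ℝ → ℝ → Phase n → Phase n) : Set ℝ :=
  {r : ℝ | ∃ t₀ t₁ : ℝ, ∃ z : Phase n, 0 ≤ t₀ ∧ t₀ ≤ t₁ ∧ t₁ ≤ 1 ∧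
    r = ∫ t in t₀..t₁, b t (χ t 0 z)}

/-! ## Weyl quantization and the evolution equation -/

/-- The Weyl quantization
`q^w(x,D) φ (x) = (2π)⁻ⁿ ∫∫ exp (i (x-y)·ξ) q((x+y)/2, ξ) φ(y) dy dξ` (iterated integral). -/
noncomputable def weyl {n : ℕ} (q : Phase n → ℝ) (φ : Pos n → ℂ) (x : Pos n) : ℂ :=
  (((2 * Real.pi) ^ n : ℝ) : ℂ)⁻¹ * ∫ ξ : Pos n, ∫ y : Pos n,
    Complex.exp (Complex.I * ((inner ℝ (x - y) ξ : ℝ) : ℂ)) *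
      (q ((1 / 2 : ℝ) • (x + y), ξ) : ℂ) * φ y

/-- With `D_t = -i ∂_t`, the equation `(D_t + a^w + i b^w) u = 0` reads
`∂_t u = (-i a^w + b^w) u`. This is the formal adjoint `i a^w + b^w` of its right-hand side, at time
`t`, applied to a test function `φ`. -/
noncomputable def adjGen {n : ℕ} (a b : ℝ → Phase n → ℝ) (t : ℝ) (φ : Pos n → ℂ)
    (x : Pos n) : ℂ :=
  Complex.I * weyl (a t) φ x + weyl (b t) φ x

/-- `L²(ℝⁿ)`. -/
abbrev L2Pos (n : ℕ) : Type := Lp ℂ 2 (volume : Measure (Pos n))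

/-- `L²(ℝ²ⁿ)`. -/
abbrev L2Phase (n : ℕ) : Type := Lp ℂ 2 (volume : Measure (Phase n))

/-- `u ∈ C([s, T]; L²)` is a weak solution of `(D_t + a^w + i b^w) u = 0` on `[s, T]`: for every
Schwartz function `φ`,
`⟨φ, u(t)⟩ - ⟨φ, u(s)⟩ = ∫ₛᵗ ⟨(i a^w(τ) + b^w(τ)) φ, u(τ)⟩ dτ`, all the pairings being meaningful. -/
def IsWeakSolution {n : ℕ} (a b : ℝ → Phase n → ℝ) (s T : ℝ) (u : ℝ → L2Pos n) : Prop :=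
  ContinuousOn u (Icc s T) ∧
  ∀ φ : 𝓢(Pos n, ℂ),
    (∀ᵐ τ ∂(volume.restrict (Icc s T)), MemLp (adjGen a b τ φ) 2 volume) ∧
    IntervalIntegrable (fun τ => ∫ x, conj (adjGen a b τ φ x) * u τ x) volume s T ∧
    ∀ t ∈ Icc s T, (∫ x, conj (φ x) * u t x) - (∫ x, conj (φ x) * u s x) =
      ∫ τ in s..t, ∫ x, conj (adjGen a b τ φ x) * u τ x

/-- The forward Cauchy problem for `(D_t + a^w + i b^w) u = 0` on `[0, 1]` is well posed in `L²`, and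
the bounded operators `S t s`, `0 ≤ s ≤ t ≤ 1`, are its evolution operators: `t ↦ S t s u₀` is a
solution with value `u₀` at time `s`, and every solution is of this form. -/
def IsEvolution {n : ℕ} (a b : ℝ → Phase n → ℝ) (S : ℝ → ℝ → L2Pos n →L[ℂ] L2Pos n) : Prop :=
  ∀ s T : ℝ, 0 ≤ s → s ≤ T → T ≤ 1 →
    (∀ u₀ : L2Pos n, S s s u₀ = u₀ ∧ IsWeakSolution a b s T fun t => S t s u₀) ∧
    ∀ u : ℝ → L2Pos n, IsWeakSolution a b s T u → ∀ t ∈ Icc s T, u t = S t s (u s)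

/-- `K` is the integral kernel of the bounded operator `A` on `L²(ℝ²ⁿ)`. -/
def IsIntegralKernel {n : ℕ} (A : L2Phase n →L[ℂ] L2Phase n) (K : Phase n → Phase n → ℂ) : Prop :=
  ∀ v : L2Phase n, ∀ᵐ z : Phase n,
    Integrable (fun w => K z w * v w) ∧ A v z = ∫ w, K z w * v w

/-! ## The Bargmann transform -/

/-- The constant `2 ^ (-n/2) * π ^ (-3n/4)` of the Bargmann transform. -/
noncomputable def bargmannConst (n : ℕ) : ℝ :=
  (2 : ℝ) ^ (-(n : ℝ) / 2) * Real.pi ^ (-(3 * (n : ℝ)) / 4)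

/-- The Bargmann transform
`T f (x, ξ) = 2 ^ (-n/2) π ^ (-3n/4) ∫ exp (-(x-y)²/2) exp (i ξ·(x-y)) f y dy`. -/
noncomputable def bargmann {n : ℕ} (f : Pos n → ℂ) (z : Phase n) : ℂ :=
  (bargmannConst n : ℂ) * ∫ y : Pos n,
    Complex.exp (-(((1 / 2 : ℝ) * ‖z.1 - y‖ ^ 2 : ℝ) : ℂ)) *
      Complex.exp (Complex.I * ((inner ℝ z.2 (z.1 - y) : ℝ) : ℂ)) * f y

/-- On `L¹ ∩ L²` the integral Fourier transform agrees with the `L²` Fourier transform. -/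
theorem fourier_ae_eq {n : ℕ} {g : Pos n → ℂ} (h1 : Integrable g) (h2 : MemLp g 2) :
    (𝓕 g : Pos n → ℂ) =ᵐ[volume] (𝓕 (h2.toLp g) : Lp ℂ 2 (volume : Measure (Pos n))) := by
  have hc : Continuous (𝓕 g : Pos n → ℂ) :=
    VectorFourier.fourierIntegral_continuous Real.continuous_fourierChar
      (L := innerₗ (Pos n)) continuous_inner h1
  refine ae_eq_of_integral_contDiff_smul_eq hc.locallyIntegrable
    ((Lp.memLp _).locallyIntegrable (by norm_num)) ?_
  intro φ hφ hs
  have hg₁ : HasCompactSupport (Complex.ofRealCLM ∘ φ) := hs.comp_left rfl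
  have hg₂ : ContDiff ℝ ((⊤ : ℕ∞) : WithTop ℕ∞) (Complex.ofRealCLM ∘ φ) :=
    Complex.ofRealCLM.contDiff.comp hφ
  set ψ : 𝓢(Pos n, ℂ) := hg₁.toSchwartzMap hg₂ with hψ
  have e1 : ∫ x, (𝓕 ψ) x • g x = ∫ x, ψ x • (𝓕 g : Pos n → ℂ) x := by
    have := VectorFourier.integral_fourierIntegral_smul_eq_flip (L := innerₗ (Pos n))
      Real.continuous_fourierChar continuous_inner (ψ.integrable (μ := volume)) h1
    rw [SchwartzMap.fourier_coe]
    rw [flip_innerₗ] at this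
    exact this
  have e2 := congrArg (fun T => T ψ) (Lp.fourier_toTemperedDistribution_eq (h2.toLp g))
  simp only [TemperedDistribution.fourier_apply, Lp.toTemperedDistribution_apply] at e2
  have e3 : ∫ x, (𝓕 ψ) x • (h2.toLp g) x = ∫ x, (𝓕 ψ) x • g x := by
    refine integral_congr_ae ?_
    filter_upwards [h2.coeFn_toLp] with x hx
    rw [hx]
  have e4 := e1.symm.trans (e3.symm.trans e2)
  simpa [hψ] using e4

theorem lintegral_fourier_sq {n : ℕ} {g : Pos n → ℂ} (h1 : Integrable g) (h2 : MemLp g 2) :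
    ∫⁻ w, ‖(𝓕 g : Pos n → ℂ) w‖ₑ ^ 2 = ∫⁻ y, ‖g y‖ₑ ^ 2 := by
  have key : ∀ f : Lp ℂ 2 (volume : Measure (Pos n)), ∫⁻ y, ‖f y‖ₑ ^ 2 = ‖f‖ₑ ^ 2 := by
    intro f
    rw [Lp.enorm_def, eLpNorm_eq_lintegral_rpow_enorm_toReal (by norm_num) (by norm_num)]
    simp only [ENNReal.toReal_ofNat, one_div, ENNReal.rpow_ofNat]
    rw [← ENNReal.rpow_natCast, ← ENNReal.rpow_mul]
    norm_num
  calc _ = ∫⁻ w, ‖(𝓕 (h2.toLp g) : Lp ℂ 2 (volume : Measure (Pos n))) w‖ₑ ^ 2 := by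
        refine lintegral_congr_ae ?_
        filter_upwards [fourier_ae_eq h1 h2] with x hx
        rw [hx]
    _ = ∫⁻ y, ‖h2.toLp g y‖ₑ ^ 2 := by
        rw [key, key, ← ofReal_norm, ← ofReal_norm, Lp.norm_fourier_eq]
    _ = _ := by
        refine lintegral_congr_ae ?_
        filter_upwards [h2.coeFn_toLp] with x hx
        rw [hx]

theorem gauss_memLp {n : ℕ} (x : Pos n) :
    MemLp (fun y : Pos n => Complex.exp (-(((1 / 2 : ℝ) * ‖x - y‖ ^ 2 : ℝ) : ℂ))) 2 := by
  have hc : Continuous (fun y : Pos n =>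
      Complex.exp (-(((1 / 2 : ℝ) * ‖x - y‖ ^ 2 : ℝ) : ℂ))) := by fun_prop
  rw [memLp_two_iff_integrable_sq_norm hc.aestronglyMeasurable]
  have hi : Integrable (fun y : Pos n => Real.exp (-1 * ‖y‖ ^ 2)) := by
    have := GaussianFourier.integrable_cexp_neg_mul_sq_norm_add (V := Pos n) (b := 1) (by simp) 0 0
    have h := this.norm
    refine h.congr (Filter.Eventually.of_forall fun y => ?_)
    simp only [Complex.norm_exp]
    congr 1
    simp [← Complex.ofReal_pow]
  have hi2 := hi.comp_sub_left x
  refine hi2.congr (Filter.Eventually.of_forall fun y => ?_)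
  simp only [Complex.norm_exp, ← Real.exp_nat_mul]
  congr 1
  simp [← Complex.ofReal_pow]

theorem gauss_mul_integrable {n : ℕ} {f : Pos n → ℂ} (hf : MemLp f 2) (x : Pos n) :
    Integrable (fun y => Complex.exp (-(((1 / 2 : ℝ) * ‖x - y‖ ^ 2 : ℝ) : ℂ)) * f y) :=
  (gauss_memLp x).integrable_mul hf

theorem gauss_mul_memLp {n : ℕ} {f : Pos n → ℂ} (hf : MemLp f 2) (x : Pos n) :
    MemLp (fun y => Complex.exp (-(((1 / 2 : ℝ) * ‖x - y‖ ^ 2 : ℝ) : ℂ)) * f y) 2 := by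
  have hc : Continuous (fun y : Pos n =>
      Complex.exp (-(((1 / 2 : ℝ) * ‖x - y‖ ^ 2 : ℝ) : ℂ))) := by fun_prop
  refine hf.of_le (hc.aestronglyMeasurable.mul hf.1) (Filter.Eventually.of_forall fun y => ?_)
  rw [norm_mul, Complex.norm_exp]
  refine mul_le_of_le_one_left (norm_nonneg _) ?_
  rw [Real.exp_le_one_iff, Complex.neg_re, Complex.ofReal_re]
  have := sq_nonneg ‖x - y‖
  linarith

theorem bargmann_integrable {n : ℕ} {f : Pos n → ℂ} (hf : MemLp f 2) (z : Phase n) :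
    Integrable (fun y => Complex.exp (-(((1 / 2 : ℝ) * ‖z.1 - y‖ ^ 2 : ℝ) : ℂ)) *
      Complex.exp (Complex.I * ((inner ℝ z.2 (z.1 - y) : ℝ) : ℂ)) * f y) := by
  have hc : Continuous (fun y : Pos n =>
      Complex.exp (-(((1 / 2 : ℝ) * ‖z.1 - y‖ ^ 2 : ℝ) : ℂ)) *
      Complex.exp (Complex.I * ((inner ℝ z.2 (z.1 - y) : ℝ) : ℂ))) := by fun_prop
  refine (gauss_mul_integrable hf z.1).mono (hc.aestronglyMeasurable.mul hf.1)
    (Filter.Eventually.of_forall fun y => ?_)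
  rw [norm_mul, norm_mul, norm_mul, mul_comm Complex.I, Complex.norm_exp_ofReal_mul_I, mul_one]

theorem bargmann_eq_fourier {n : ℕ} (f : Pos n → ℂ) (x ξ : Pos n) :
    bargmann f (x, ξ) = (bargmannConst n : ℂ) *
      (Complex.exp (Complex.I * ((inner ℝ ξ x : ℝ) : ℂ)) *
      (𝓕 (fun y => Complex.exp (-(((1 / 2 : ℝ) * ‖x - y‖ ^ 2 : ℝ) : ℂ)) * f y) : Pos n → ℂ)
        ((2 * Real.pi)⁻¹ • ξ)) := by
  unfold bargmann
  congr 1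
  rw [Real.fourier_eq', ← integral_const_mul]
  refine integral_congr_ae (Filter.Eventually.of_forall fun y => ?_)
  dsimp only
  have : Complex.exp (Complex.I * ((inner ℝ ξ (x - y) : ℝ) : ℂ)) =
      Complex.exp (Complex.I * ((inner ℝ ξ x : ℝ) : ℂ)) *
      Complex.exp (((-2 * Real.pi * inner ℝ y ((2 * Real.pi)⁻¹ • ξ) : ℝ) : ℂ) * Complex.I) := by
    rw [← Complex.exp_add]
    congr 1
    rw [inner_smul_right, inner_sub_right, real_inner_comm ξ y]
    have hpi : (Real.pi : ℂ) ≠ 0 := by exact_mod_cast Real.pi_ne_zero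
    push_cast
    field_simp
    ring
  rw [this, smul_eq_mul]
  ring

theorem lintegral_gauss {n : ℕ} (y : Pos n) :
    ∫⁻ x : Pos n, ‖Complex.exp (-(((1 / 2 : ℝ) * ‖x - y‖ ^ 2 : ℝ) : ℂ))‖ₑ ^ 2 =
      ENNReal.ofReal (Real.pi ^ ((n : ℝ) / 2)) := by
  have h0 := GaussianFourier.integral_rexp_neg_mul_sq_norm (V := Pos n) (b := 1) one_pos
  rw [finrank_euclideanSpace_fin, div_one] at h0
  have hi : Integrable (fun y : Pos n => Real.exp (-1 * ‖y‖ ^ 2)) := by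
    by_contra hcon
    rw [integral_undef hcon] at h0
    exact (Real.rpow_pos_of_pos Real.pi_pos _).ne h0
  rw [← h0, ofReal_integral_eq_lintegral_ofReal hi
    (Filter.Eventually.of_forall fun _ => (Real.exp_pos _).le)]
  rw [← lintegral_sub_right_eq_self (μ := (volume : Measure (Pos n)))
    (fun x => ENNReal.ofReal (Real.exp (-1 * ‖x‖ ^ 2))) y]
  refine lintegral_congr fun x => ?_
  rw [← ofReal_norm, ← ENNReal.ofReal_pow (norm_nonneg _), Complex.norm_exp,
    ← Real.exp_nat_mul, Complex.neg_re, Complex.ofReal_re]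
  congr 2
  push_cast
  ring

theorem bargmannConst_sq (n : ℕ) :
    bargmannConst n ^ 2 * (2 * Real.pi) ^ n * Real.pi ^ ((n : ℝ) / 2) = 1 := by
  unfold bargmannConst
  rw [mul_pow, ← Real.rpow_natCast _ 2, ← Real.rpow_natCast _ 2, ← Real.rpow_mul (by norm_num),
    ← Real.rpow_mul Real.pi_pos.le, mul_pow, ← Real.rpow_natCast 2 n,
    ← Real.rpow_natCast Real.pi n]
  have : ∀ a b c d e : ℝ, a * b * (c * d) * e = (a * c) * (b * d * e) := by intros; ring
  rw [this, ← Real.rpow_add (by norm_num), ← Real.rpow_add Real.pi_pos,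
    ← Real.rpow_add Real.pi_pos]
  have e1 : -(n : ℝ) / 2 * ((2 : ℕ) : ℝ) + n = 0 := by push_cast; ring
  have e2 : -(3 * (n : ℝ)) / 4 * ((2 : ℕ) : ℝ) + n + (n : ℝ) / 2 = 0 := by push_cast; ring
  rw [e1, e2]
  simp

theorem bargmann_congr {n : ℕ} {f g : Pos n → ℂ} (h : f =ᵐ[volume] g) :
    bargmann f = bargmann g := by
  funext z
  unfold bargmann
  congr 1
  refine integral_congr_ae ?_
  filter_upwards [h] with y hy
  rw [hy]

theorem bargmann_measurable {n : ℕ} {f : Pos n → ℂ} (hf : MemLp f 2) :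
    StronglyMeasurable (bargmann f) := by
  have hm := hf.1.stronglyMeasurable_mk
  rw [bargmann_congr hf.1.ae_eq_mk]
  unfold bargmann
  refine StronglyMeasurable.const_mul ?_ _
  refine StronglyMeasurable.integral_prod_right (f := fun (z : Phase n) (y : Pos n) =>
    Complex.exp (-(((1 / 2 : ℝ) * ‖z.1 - y‖ ^ 2 : ℝ) : ℂ)) *
      Complex.exp (Complex.I * ((inner ℝ z.2 (z.1 - y) : ℝ) : ℂ)) * hf.1.mk f y) ?_
  have hc : Continuous (fun p : Phase n × Pos n =>
      Complex.exp (-(((1 / 2 : ℝ) * ‖p.1.1 - p.2‖ ^ 2 : ℝ) : ℂ)) *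
      Complex.exp (Complex.I * ((inner ℝ p.1.2 (p.1.1 - p.2) : ℝ) : ℂ))) := by fun_prop
  exact hc.stronglyMeasurable.mul (hm.comp_measurable measurable_snd)

theorem lintegral_bargmann_sq {n : ℕ} {f : Pos n → ℂ} (hf : MemLp f 2) :
    ∫⁻ z : Phase n, ‖bargmann f z‖ₑ ^ 2 = ∫⁻ y, ‖f y‖ₑ ^ 2 := by
  have hm : AEMeasurable (fun z : Phase n => ‖bargmann f z‖ₑ ^ 2) :=
    ((bargmann_measurable hf).measurable.enorm.pow_const 2).aemeasurable
  have hpi : (0 : ℝ) < 2 * Real.pi := by positivity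
  rw [Measure.volume_eq_prod, lintegral_prod _ (by rwa [← Measure.volume_eq_prod])]
  have inner_eq : ∀ x : Pos n, ∫⁻ ξ : Pos n, ‖bargmann f (x, ξ)‖ₑ ^ 2 =
      ENNReal.ofReal (bargmannConst n ^ 2 * (2 * Real.pi) ^ n) *
      ∫⁻ y, ‖Complex.exp (-(((1 / 2 : ℝ) * ‖x - y‖ ^ 2 : ℝ) : ℂ)) * f y‖ₑ ^ 2 := by
    intro x
    rw [← lintegral_fourier_sq (gauss_mul_integrable hf x) (gauss_mul_memLp hf x)]
    set G : Pos n → ℂ :=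
      𝓕 (fun y => Complex.exp (-(((1 / 2 : ℝ) * ‖x - y‖ ^ 2 : ℝ) : ℂ)) * f y) with hG
    have hGc : Continuous G :=
      VectorFourier.fourierIntegral_continuous Real.continuous_fourierChar
        (L := innerₗ (Pos n)) continuous_inner (gauss_mul_integrable hf x)
    have e1 : ∀ ξ : Pos n, ‖bargmann f (x, ξ)‖ₑ ^ 2 =
        ENNReal.ofReal (bargmannConst n ^ 2) * ‖G ((2 * Real.pi)⁻¹ • ξ)‖ₑ ^ 2 := by
      intro ξ
      rw [bargmann_eq_fourier, ← hG, enorm_mul, enorm_mul, mul_pow, mul_pow]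
      rw [← ofReal_norm (Complex.exp _), mul_comm Complex.I,
        Complex.norm_exp_ofReal_mul_I, ENNReal.ofReal_one, one_pow, one_mul]
      congr 1
      rw [← ofReal_norm, ← ENNReal.ofReal_pow (norm_nonneg _), Complex.norm_real,
        Real.norm_eq_abs, sq_abs]
    simp_rw [e1]
    rw [lintegral_const_mul' _ _ ENNReal.ofReal_ne_top, ENNReal.ofReal_mul (sq_nonneg _), mul_assoc]
    congr 1
    have hmG : Measurable (fun w : Pos n => ‖G w‖ₑ ^ 2) := (hGc.measurable.enorm.pow_const 2)
    rw [← lintegral_map (f := fun w : Pos n => ‖G w‖ₑ ^ 2) hmG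
      (measurable_const_smul (2 * Real.pi)⁻¹), Measure.map_addHaar_smul _ (inv_ne_zero hpi.ne'),
      lintegral_smul_measure, finrank_euclideanSpace_fin, inv_pow, inv_inv, abs_of_pos (by positivity),
      smul_eq_mul]
  simp_rw [inner_eq]
  rw [lintegral_const_mul' _ _ ENNReal.ofReal_ne_top]
  have hsw : AEMeasurable (Function.uncurry fun x y : Pos n =>
      ‖Complex.exp (-(((1 / 2 : ℝ) * ‖x - y‖ ^ 2 : ℝ) : ℂ)) * f y‖ₑ ^ 2)
      ((volume : Measure (Pos n)).prod volume) := by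
    have hc : Continuous (fun p : Pos n × Pos n =>
      Complex.exp (-(((1 / 2 : ℝ) * ‖p.1 - p.2‖ ^ 2 : ℝ) : ℂ))) := by fun_prop
    exact ((hc.aestronglyMeasurable.mul hf.1.comp_snd).enorm.pow_const 2)
  rw [lintegral_lintegral_swap hsw]
  have e2 : ∀ y : Pos n, ∫⁻ x : Pos n,
      ‖Complex.exp (-(((1 / 2 : ℝ) * ‖x - y‖ ^ 2 : ℝ) : ℂ)) * f y‖ₑ ^ 2 =
      ENNReal.ofReal (Real.pi ^ ((n : ℝ) / 2)) * ‖f y‖ₑ ^ 2 := by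
    intro y
    simp_rw [enorm_mul, mul_pow]
    rw [lintegral_mul_const' _ _ (by simp), lintegral_gauss]
  simp_rw [e2]
  rw [lintegral_const_mul' _ _ ENNReal.ofReal_ne_top, ← mul_assoc,
    ← ENNReal.ofReal_mul (by positivity), bargmannConst_sq, ENNReal.ofReal_one, one_mul]

theorem eLpNorm_bargmann {n : ℕ} {f : Pos n → ℂ} (hf : MemLp f 2) :
    eLpNorm (bargmann f) 2 volume = eLpNorm f 2 volume := by
  rw [eLpNorm_eq_lintegral_rpow_enorm_toReal (by norm_num) (by norm_num),
    eLpNorm_eq_lintegral_rpow_enorm_toReal (by norm_num) (by norm_num)]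
  simp only [ENNReal.toReal_ofNat, ENNReal.rpow_ofNat]
  rw [lintegral_bargmann_sq hf]

theorem bargmann_memLp {n : ℕ} {f : Pos n → ℂ} (hf : MemLp f 2) :
    MemLp (bargmann f) 2 volume :=
  ⟨(bargmann_measurable hf).aestronglyMeasurable, by rw [eLpNorm_bargmann hf]; exact hf.2⟩

/-- The Bargmann transform as a linear isometry from `L²(ℝⁿ)` to `L²(ℝ²ⁿ)`. -/
noncomputable def bargmannL2 (n : ℕ) :
    Lp ℂ 2 (volume : Measure (Pos n)) →ₗᵢ[ℂ] Lp ℂ 2 (volume : Measure (Phase n)) where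
  toFun f := (bargmann_memLp (Lp.memLp f)).toLp (bargmann f)
  map_add' f g := by
    rw [← MemLp.toLp_add]
    refine MemLp.toLp_congr _ _ (Filter.Eventually.of_forall fun z => ?_)
    rw [bargmann_congr (Lp.coeFn_add f g), Pi.add_apply]
    unfold bargmann
    rw [← mul_add, ← integral_add (bargmann_integrable (Lp.memLp f) z)
      (bargmann_integrable (Lp.memLp g) z)]
    simp only [Pi.add_apply, mul_add]
  map_smul' c f := by
    rw [RingHom.id_apply, ← MemLp.toLp_const_smul]
    refine MemLp.toLp_congr _ _ (Filter.Eventually.of_forall fun z => ?_)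
    rw [bargmann_congr (Lp.coeFn_smul c f), Pi.smul_apply]
    unfold bargmann
    rw [smul_eq_mul, mul_left_comm, ← integral_const_mul c]
    congr 2
    funext y
    simp only [Pi.smul_apply, smul_eq_mul]
    ring
  norm_map' f := by
    change ‖(bargmann_memLp (Lp.memLp f)).toLp (bargmann f)‖ = ‖f‖
    rw [Lp.norm_toLp, eLpNorm_bargmann (Lp.memLp f), Lp.norm_def]

/-- The phase space operator `T A T*` of a bounded operator `A` on `L²(ℝⁿ)`. -/
noncomputable def phaseConj {n : ℕ} (A : L2Pos n →L[ℂ] L2Pos n) : L2Phase n →L[ℂ] L2Phase n :=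
  (bargmannL2 n).toContinuousLinearMap ∘L A ∘L
    ContinuousLinearMap.adjoint (bargmannL2 n).toContinuousLinearMap

end PhaseSpace

open PhaseSpace

namespace PhaseSpace

noncomputable section
open ENNReal (ofReal ofReal_mul ofReal_ne_top ofReal_le_ofReal ofReal_add
  toReal_nonneg ofReal_toReal ofReal_sum_of_nonneg mul_ne_top sum_ne_top add_ne_top ofReal_le_ofReal_iff)
open Complex (exp I norm_real exp_add norm_exp_ofReal_mul_I conj_ofReal norm_I conj_I
  exp_conj ofRealCLM I_sq ofReal_exp)
open Real (norm_of_nonneg norm_eq_abs pi_pos one_le_exp)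
open Finset (sum_nonneg sum_le_sum sum_mul sum_congr single_le_sum mul_sum sum_add_distrib)
open Function (iterate_succ_apply uncurry comp_def iterate_one)
open MeasureTheory.Measure (restrict_mono quasiMeasurePreserving_fst volume_eq_prod)
open intervalIntegral (integral_of_le)
open EuclideanSpace (single inner_single_right)
open ContinuousLinearMap (adjoint)
open Prod (snd_sub fst_sub smul_snd smul_fst)
open List (mem_finRange nodup_finRange mem_cons_of_mem mem_cons)
open Filter (atTop Tendsto)
open Sum (inl inr)
local notation "rexp" => Real.exp
local notation:max "cis" x:max => Complex.exp ((x : ℝ) * Complex.I)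
local notation "𝕋" => Icc (0 : ℝ) 1
local notation "μ𝕋" => Measure.restrict volume 𝕋
local notation "ν𝕋" => Measure.prod μ𝕋 volume
variable {n K : ℕ}
set_option hygiene false
local notation "Φ" => Phase n
local notation "𝕁" => Fin n ⊕ Fin n
local notation "d₁" => 2 * n + 1
local notation "d₃" => 2 * n + 3
local notation:max "pd" j:max => partialD (ph j)
local notation:max "dph" j:max => dirD (ph j)
set_option hygiene true
variable {q : Φ → ℝ} {a b : ℝ → Φ → ℝ} {X Y : ℝ → Φ → Φ} {L : ℝ}
variable (φ : 𝓢(Pos n, ℂ)) (j : 𝕁) (z w v : Φ)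

lemma integral_ext {α E : Type*} [MeasurableSpace α] {μ : Measure α} [NormedAddCommGroup E]
    [NormedSpace ℝ E] {f g : α → E} (h : ∀ x, f x = g x) : ∫ x, f x ∂μ = ∫ x, g x ∂μ :=
  integral_congr_ae (.of_forall h)

section ODE
open Metric Filter Topology
open scoped NNReal

variable {E : Type*} [NormedAddCommGroup E] [NormedSpace ℝ E]

/-- A Gronwall inequality with variable coefficient, where the differential inequality is only
known as long as the function is small. -/
lemma norm_le_exp_integral_right {y y' : ℝ → E} {k : ℝ → ℝ} {p q r d η : ℝ}
    (hk : Continuous k) (hd : 0 < d) (hη : 0 < η) (hy : ContinuousOn y (Icc p q))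
    (hy' : ∀ τ ∈ Ico p q, HasDerivWithinAt y (y' τ) (Ici τ) τ)
    (hb : ∀ τ ∈ Ico p q, ‖y τ‖ ≤ r → ‖y' τ‖ ≤ k τ * ‖y τ‖) (h0 : ‖y p‖ ≤ d)
    (hr : ∀ t ∈ Icc p q, d * rexp (∫ τ in p..t, (k τ + η)) ≤ r) :
    ∀ t ∈ Icc p q, ‖y t‖ ≤ d * rexp (∫ τ in p..t, (k τ + η)) := by
  have hB : ∀ x, HasDerivAt (fun t => d * rexp (∫ τ in p..t, (k τ + η)))
      (d * (rexp (∫ τ in p..x, (k τ + η)) * (k x + η))) x := fun x =>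
    ((hk.add continuous_const).integral_hasStrictDerivAt p x).hasDerivAt.exp.const_mul d
  refine fun t ht => image_norm_le_of_norm_deriv_right_lt_deriv_boundary hy hy' (by simpa using h0)
    hB ?_ ht
  intro x hx hxe
  have h1 := hb x hx (hxe ▸ hr x (Ico_subset_Icc_self hx))
  have h2 : 0 < ‖y x‖ := by rw [hxe]; positivity
  calc ‖y' x‖ ≤ k x * ‖y x‖ := h1
    _ < (k x + η) * ‖y x‖ := by nlinarith
    _ = _ := by rw [hxe]; ring

lemma norm_le_exp_integral {y y' : ℝ → E} {k : ℝ → ℝ} {p q s r d η : ℝ}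
    (hk : Continuous k) (hk0 : ∀ τ, 0 ≤ k τ) (hd : 0 < d) (hη : 0 < η) (hs : s ∈ Icc p q)
    (hy : ∀ τ ∈ Icc p q, HasDerivWithinAt y (y' τ) (Icc p q) τ)
    (hb : ∀ τ ∈ Icc p q, ‖y τ‖ ≤ r → ‖y' τ‖ ≤ k τ * ‖y τ‖) (h0 : ‖y s‖ ≤ d)
    (hr : d * rexp (∫ τ in p..q, (k τ + η)) ≤ r) :
    ∀ t ∈ Icc p q, ‖y t‖ ≤ d * rexp (∫ τ in p..q, (k τ + η)) := by
  have hyc : ContinuousOn y (Icc p q) := fun τ hτ => (hy τ hτ).continuousWithinAt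
  have hint : ∀ u v, IntervalIntegrable (fun τ => k τ + η) volume u v := fun u v =>
    (hk.add continuous_const).intervalIntegrable u v
  have hmono : ∀ u v, p ≤ u → u ≤ v → v ≤ q →
      ∫ τ in u..v, (k τ + η) ≤ ∫ τ in p..q, (k τ + η) := by
    intro u v hu huv hv; refine intervalIntegral.integral_mono_interval hu huv hv ?_ (hint p q)
    exact Eventually.of_forall fun τ => by have := hk0 τ; simp only [Pi.zero_apply]; linarith
  have hmul : ∀ u v, p ≤ u → u ≤ v → v ≤ q → d * rexp (∫ τ in u..v, (k τ + η)) ≤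
      d * rexp (∫ τ in p..q, (k τ + η)) := fun u v hu huv hv => by
    gcongr; exact hmono u v hu huv hv
  intro t ht
  rcases le_total s t with hst | hst
  · refine (norm_le_exp_integral_right (y := y) (y' := y') (q := q) (r := r) hk hd hη
      (hyc.mono (Icc_subset_Icc_left hs.1)) ?_ ?_ h0 ?_ t ⟨hst, ht.2⟩).trans
      (hmul s t hs.1 hst ht.2)
    · intro τ hτ; have hτ' : τ ∈ Icc p q := ⟨hs.1.trans hτ.1, hτ.2.le⟩
      refine ((hy τ hτ').mono_of_mem_nhdsWithin ?_)
      exact mem_of_superset (Icc_mem_nhdsGE hτ.2) (Icc_subset_Icc_left hτ'.1)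
    · exact fun τ hτ => hb τ ⟨hs.1.trans hτ.1, hτ.2.le⟩
    · exact fun t ht => (hmul s t hs.1 ht.1 ht.2).trans hr
  · have key := norm_le_exp_integral_right (y := fun τ => y (-τ)) (y' := fun τ => -y' (-τ))
      (k := fun τ => k (-τ)) (p := -s) (q := -p) (r := r) (d := d) (η := η)
      (hk.comp continuous_neg) hd hη ?_ ?_ ?_ (by simpa using h0) ?_ (-t)
      ⟨by linarith, by linarith [ht.1]⟩
    · have e : ∫ τ in -s..-t, (k (-τ) + η) = ∫ τ in t..s, (k τ + η) := by
        rw [intervalIntegral.integral_comp_neg fun τ => k τ + η]; simp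
      simp only [neg_neg] at key; rw [e] at key; exact key.trans (hmul t s ht.1 hst hs.2)
    · refine hyc.comp continuous_neg.continuousOn fun τ hτ => ?_
      exact ⟨by linarith [hτ.2], by linarith [hτ.1, hs.2]⟩
    · intro τ hτ; have hτ' : -τ ∈ Icc p q := ⟨by linarith [hτ.2], by linarith [hτ.1, hs.2]⟩
      have h1 : HasDerivWithinAt (fun τ => -τ) (-1) (Icc τ (-p)) τ :=
        (hasDerivAt_neg τ).hasDerivWithinAt
      have h2 := (hy _ hτ').scomp τ h1 (t' := Icc p q) (fun σ hσ =>
        ⟨by linarith [hσ.2], by linarith [hσ.1, hτ.1, hs.2]⟩)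
      simp only [neg_smul, one_smul] at h2; exact h2.mono_of_mem_nhdsWithin (Icc_mem_nhdsGE hτ.2)
    · intro τ hτ h; simpa using hb (-τ) ⟨by linarith [hτ.2], by linarith [hτ.1, hs.2]⟩ h
    · intro u hu
      have e : ∫ τ in -s..u, (k (-τ) + η) = ∫ τ in -u..s, (k τ + η) := by
        rw [intervalIntegral.integral_comp_neg fun τ => k τ + η]; simp
      rw [e]; exact (hmul _ _ (by linarith [hu.2]) (by linarith [hu.1]) hs.2).trans hr

/-- An integral curve of the time dependent vector field `v` on the set of times `I`. -/
def IsCurve (v : ℝ → E → E) (I : Set ℝ) (γ : ℝ → E) : Prop :=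
  ∀ t ∈ I, HasDerivWithinAt γ (v t (γ t)) I t

lemma IsCurve.mono {v : ℝ → E → E} {I J : Set ℝ} {γ : ℝ → E} (h : IsCurve v I γ) (hJ : J ⊆ I) :
    IsCurve v J γ := fun t ht => (h t (hJ ht)).mono hJ

lemma IsCurve.continuousOn {v : ℝ → E → E} {I : Set ℝ} {γ : ℝ → E} (h : IsCurve v I γ) :
    ContinuousOn γ I := fun t ht => (h t ht).continuousWithinAt

lemma IsCurve.congr {v : ℝ → E → E} {I : Set ℝ} {γ γ' : ℝ → E} (h : IsCurve v I γ)
    (he : EqOn γ' γ I) : IsCurve v I γ' := fun t ht => by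
  rw [he ht]; exact (h t ht).congr he (he ht)

lemma IsCurve.congr_field {v v' : ℝ → E → E} {I : Set ℝ} {γ : ℝ → E} (h : IsCurve v I γ)
    (he : ∀ t ∈ I, v' t (γ t) = v t (γ t)) : IsCurve v' I γ := fun t ht => by
  rw [he t ht]; exact h t ht

lemma IsCurve.glue {v : ℝ → E → E} {p q r : ℝ} {γ γ' : ℝ → E} (hpq : p ≤ q) (hqr : q ≤ r)
    (h : IsCurve v (Icc p q) γ) (h' : IsCurve v (Icc q r) γ') (he : γ q = γ' q) :
    IsCurve v (Icc p r) fun t => if t ≤ q then γ t else γ' t := by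
  set δ : ℝ → E := fun t => if t ≤ q then γ t else γ' t
  have e1 : EqOn δ γ (Icc p q) := fun t ht => if_pos ht.2
  have e2 : EqOn δ γ' (Icc q r) := fun t ht => by
    by_cases h : t ≤ q
    · have : t = q := le_antisymm h ht.1; simp [δ, this, he]
    · exact if_neg h
  have c1 := h.congr e1
  have c2 := h'.congr e2
  intro t ht
  rw [← Icc_union_Icc_eq_Icc hpq hqr]
  rcases lt_trichotomy t q with h1 | h1 | h1
  · refine (c1 t ⟨ht.1, h1.le⟩).union ?_; refine HasFDerivWithinAt.of_notMem_closure ?_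
    rw [isClosed_Icc.closure_eq]; exact fun h => absurd h.1 (not_le.2 h1)
  · exact (c1 t ⟨ht.1, h1.le⟩).union (c2 t ⟨h1.ge, ht.2⟩)
  · refine HasDerivWithinAt.union ?_ (c2 t ⟨h1.le, ht.2⟩)
    refine HasFDerivWithinAt.of_notMem_closure ?_
    rw [isClosed_Icc.closure_eq]; exact fun h => absurd h.2 (not_le.2 h1)

/-- A continuous vector field which is locally Lipschitz in space, with `k` as a bound of the local
Lipschitz constant. -/
structure IsLipField (v : ℝ → E → E) (k : ℝ → E → ℝ) : Prop where
  cont : Continuous (uncurry v)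
  diff : ∀ t, Differentiable ℝ (v t)
  contk : Continuous (uncurry k)
  bound : ∀ t z, ‖fderiv ℝ (v t) z‖ ≤ k t z

variable {v : ℝ → E → E} {k : ℝ → E → ℝ}

lemma IsLipField.nonneg (hv : IsLipField v k) (t : ℝ) (z : E) : 0 ≤ k t z :=
  (norm_nonneg _).trans (hv.bound t z)

variable [FiniteDimensional ℝ E]

lemma IsLipField.exists_bound (hv : IsLipField v k) (p q R : ℝ) :
    ∃ C : ℝ≥0, ∀ t ∈ Icc p q, ∀ z ∈ closedBall (0 : E) R, k t z ≤ C ∧ ‖v t z‖ ≤ C := by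
  have : ProperSpace E := FiniteDimensional.proper ℝ E
  have hc : IsCompact (Icc p q ×ˢ closedBall (0 : E) R) :=
    isCompact_Icc.prod (isCompact_closedBall _ _)
  obtain ⟨C1, h1⟩ := hc.exists_bound_of_continuousOn hv.contk.continuousOn
  obtain ⟨C2, h2⟩ := hc.exists_bound_of_continuousOn hv.cont.continuousOn
  refine ⟨⟨max (max C1 C2) 0, le_max_right _ _⟩, fun t ht z hz => ⟨?_, ?_⟩⟩
  · exact (le_abs_self _).trans ((h1 (t, z) ⟨ht, hz⟩).trans
      ((le_max_left _ _).trans (le_max_left _ _)))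
  · exact (h2 (t, z) ⟨ht, hz⟩).trans ((le_max_right _ _).trans (le_max_left _ _))

lemma IsLipField.lipschitzOnWith (hv : IsLipField v k) (p q R : ℝ) :
    ∃ C : ℝ≥0, ∀ t ∈ Icc p q, LipschitzOnWith C (v t) (closedBall (0 : E) R) := by
  obtain ⟨C, hC⟩ := hv.exists_bound p q R
  refine ⟨C, fun t ht => (convex_closedBall _ _).lipschitzOnWith_of_nnnorm_fderiv_le
    (fun z _ => (hv.diff t) z) fun z hz => ?_⟩
  exact (hv.bound t z).trans (hC t ht z hz).1

lemma IsLipField.unique (hv : IsLipField v k) {p q s : ℝ} {γ γ' : ℝ → E} (hs : s ∈ Icc p q)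
    (h : IsCurve v (Icc p q) γ) (h' : IsCurve v (Icc p q) γ') (he : γ s = γ' s) :
    EqOn γ γ' (Icc p q) := by
  obtain ⟨R1, h1⟩ := isCompact_Icc.exists_bound_of_continuousOn h.continuousOn
  obtain ⟨R2, h2⟩ := isCompact_Icc.exists_bound_of_continuousOn h'.continuousOn
  obtain ⟨C, hC⟩ := hv.lipschitzOnWith p q (max R1 R2)
  have m1 : ∀ t ∈ Icc p q, γ t ∈ closedBall (0 : E) (max R1 R2) := fun t ht => by
    simpa using Or.inl (h1 t ht)
  have m2 : ∀ t ∈ Icc p q, γ' t ∈ closedBall (0 : E) (max R1 R2) := fun t ht => by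
    simpa using Or.inr (h2 t ht)
  have key1 : EqOn γ γ' (Icc s q) := by
    have sub : Icc s q ⊆ Icc p q := Icc_subset_Icc_left hs.1
    have gd : ∀ δ, IsCurve v (Icc p q) δ → ∀ t ∈ Ico s q,
        HasDerivWithinAt δ (v t (δ t)) (Ici t) t := fun δ hδ t ht =>
      (hδ t (sub (Ico_subset_Icc_self ht))).mono_of_mem_nhdsWithin
        (mem_of_superset (Icc_mem_nhdsGE ht.2) (Icc_subset_Icc_left (hs.1.trans ht.1)))
    exact ODE_solution_unique_of_mem_Icc_right (K := C) (s := fun _ => closedBall 0 (max R1 R2))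
      (fun t ht => hC t (sub (Ico_subset_Icc_self ht))) (h.continuousOn.mono sub) (gd γ h)
      (fun t ht => m1 t (sub (Ico_subset_Icc_self ht))) (h'.continuousOn.mono sub) (gd γ' h')
      (fun t ht => m2 t (sub (Ico_subset_Icc_self ht))) he
  have key2 : EqOn γ γ' (Icc p s) := by
    have sub : Icc p s ⊆ Icc p q := Icc_subset_Icc_right hs.2
    have gd : ∀ δ, IsCurve v (Icc p q) δ → ∀ t ∈ Ioc p s,
        HasDerivWithinAt δ (v t (δ t)) (Iic t) t := fun δ hδ t ht =>
      (hδ t (sub (Ioc_subset_Icc_self ht))).mono_of_mem_nhdsWithin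
        (mem_of_superset (Icc_mem_nhdsLE ht.1) (Icc_subset_Icc_right (ht.2.trans hs.2)))
    exact ODE_solution_unique_of_mem_Icc_left (K := C) (s := fun _ => closedBall 0 (max R1 R2))
      (fun t ht => hC t (sub (Ioc_subset_Icc_self ht))) (h.continuousOn.mono sub) (gd γ h)
      (fun t ht => m1 t (sub (Ioc_subset_Icc_self ht))) (h'.continuousOn.mono sub) (gd γ' h')
      (fun t ht => m2 t (sub (Ioc_subset_Icc_self ht))) he
  intro t ht
  rcases le_total s t with h | h
  · exact key1 ⟨h, ht.2⟩
  · exact key2 ⟨ht.1, h⟩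

lemma IsLipField.exists_truncated_flow (hv : IsLipField v k) {p q s : ℝ} (hs : s ∈ Icc p q)
    {R : ℝ} (hR : 0 < R) (R' : ℝ) :
    ∃ (w : ℝ → E → E) (Γ : E → ℝ → E) (K : ℝ≥0), (∀ t, ∀ z ∈ closedBall (0 : E) R, w t z = v t z) ∧
      (∀ z ∈ closedBall (0 : E) R', Γ z s = z ∧ IsCurve w (Icc p q) (Γ z)) ∧
      ∀ t ∈ Icc p q, LipschitzOnWith K (Γ · t) (closedBall (0 : E) R') := by
  let ρ : ContDiffBump (0 : E) := ⟨R, R + 1, hR, by linarith⟩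
  obtain ⟨C, hC⟩ := hv.exists_bound p q (R + 1)
  have hρd : Differentiable ℝ ρ := (ρ.contDiff (n := 1)).differentiable (by norm_num)
  have : ProperSpace E := FiniteDimensional.proper ℝ E
  obtain ⟨D, hD⟩ := (isCompact_closedBall (0 : E) (R + 1)).exists_bound_of_continuousOn
    ((ρ.contDiff (n := 1)).continuous_fderiv (by norm_num)).continuousOn
  set w : ℝ → E → E := fun t z => ρ z • v t z with hw
  have hwv : ∀ t, ∀ z ∈ closedBall (0 : E) R, w t z = v t z := fun t z hz => by
    simp only [hw, ρ.one_of_mem_closedBall hz, one_smul]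
  have hsupp : ∀ t, ∀ z ∉ closedBall (0 : E) (R + 1), w t =ᶠ[𝓝 z] fun _ => 0 := by
    intro t z hz; filter_upwards [isClosed_closedBall.isOpen_compl.mem_nhds hz] with y hy
    have : ρ y = 0 := ρ.zero_of_le_dist (by
      simp only [mem_compl_iff, mem_closedBall, not_le] at hy; exact hy.le)
    simp [hw, this]
  have hwn : ∀ t ∈ Icc p q, ∀ z, ‖w t z‖ ≤ C := by
    intro t ht z; by_cases hz : z ∈ closedBall (0 : E) (R + 1)
    · rw [hw, norm_smul, norm_eq_abs, abs_of_nonneg ρ.nonneg]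
      exact (mul_le_of_le_one_left (norm_nonneg _) ρ.le_one).trans (hC t ht z hz).2
    · rw [(hsupp t z hz).eq_of_nhds]; simp
  have hD0 : 0 ≤ D := (norm_nonneg _).trans (hD 0 (by simp; positivity))
  set K : ℝ≥0 := C + ⟨D, hD0⟩ * C
  have hwl : ∀ t ∈ Icc p q, LipschitzWith K (w t) := by
    intro t ht
    refine lipschitzWith_of_nnnorm_fderiv_le (fun z => (hρd z).smul (hv.diff t z)) fun z => ?_
    by_cases hz : z ∈ closedBall (0 : E) (R + 1)
    · rw [← NNReal.coe_le_coe, coe_nnnorm, hw, fderiv_fun_smul (hρd z) (hv.diff t z)]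
      refine (norm_add_le _ _).trans ?_; rw [norm_smul, norm_eq_abs, abs_of_nonneg ρ.nonneg]
      push_cast; refine add_le_add ?_ ?_
      · exact (mul_le_of_le_one_left (norm_nonneg _) ρ.le_one).trans
          ((hv.bound t z).trans (hC t ht z hz).1)
      · refine (ContinuousLinearMap.norm_smulRight_apply _ _).le.trans ?_
        exact mul_le_mul (hD z hz) (hC t ht z hz).2 (norm_nonneg _) hD0
    · rw [(hsupp t z hz).fderiv_eq]; simp
  set A : ℝ≥0 := C * Real.toNNReal (max (q - s) (s - p)) + Real.toNNReal R'
  have hpl : IsPicardLindelof w (⟨s, hs⟩ : Icc p q) (0 : E) A (Real.toNNReal R') C K := by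
    refine ⟨fun t ht => (hwl t ht).lipschitzOnWith, fun z _ => ?_, fun t ht z _ => hwn t ht z, ?_⟩
    · have h1 : Continuous fun t => v t z := hv.cont.comp (by fun_prop : Continuous fun t => (t, z))
      exact (h1.const_smul (ρ z)).continuousOn
    · simp only [A, NNReal.coe_add, NNReal.coe_mul, add_sub_cancel_right]; gcongr
      exact Real.le_coe_toNNReal _
  obtain ⟨Γ, h1, L', h2⟩ := hpl.exists_forall_mem_closedBall_eq_hasDerivWithinAt_lipschitzOnWith
  have sub : closedBall (0 : E) R' ⊆ closedBall (0 : E) (Real.toNNReal R') :=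
    closedBall_subset_closedBall (Real.le_coe_toNNReal _)
  exact ⟨w, Γ, L', hwv, fun z hz => h1 z (sub hz), fun t ht => (h2 t ht).mono sub⟩

end ODE

section ODE
open Metric Filter Topology
open scoped NNReal

variable {E : Type*} [NormedAddCommGroup E] [NormedSpace ℝ E] [FiniteDimensional ℝ E]
variable {v : ℝ → E → E} {k : ℝ → E → ℝ}

lemma IsLipField.stability (hv : IsLipField v k) {p q s c R : ℝ} (hs : s ∈ Icc p q)
    {w : ℝ → E → E} (hw : ∀ t, ∀ z ∈ closedBall (0 : E) R, w t z = v t z) {γ : ℝ → E}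
    (hγ : IsCurve v (Icc p q) γ) (hγR : ∀ t ∈ Icc p q, ‖γ t‖ ≤ R - 1)
    (hc : ∫ τ in p..q, k τ (γ τ) ≤ c) :
    ∃ r, 0 < r ∧ ∀ γ', IsCurve w (Icc p q) γ' → ∀ d, 0 < d → ‖γ' s - γ s‖ ≤ d →
      d * rexp (c + 1) ≤ r → ∀ t ∈ Icc p q, ‖γ' t - γ t‖ ≤ d * rexp (c + 1) := by
  have hpq : p ≤ q := hs.1.trans hs.2
  have : ProperSpace E := FiniteDimensional.proper ℝ E
  set η : ℝ := (2 * (q - p + 1))⁻¹ with hη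
  have hη0 : 0 < η := by have : 0 < q - p + 1 := by linarith
                         positivity
  have hη1 : 2 * η * (q - p) ≤ 1 := by
    have : 0 < q - p + 1 := by linarith
    rw [hη, mul_inv, ← mul_assoc, mul_inv_cancel₀ two_ne_zero, one_mul, ← div_eq_inv_mul,
      div_le_one this]
    linarith
  have huc := ((isCompact_Icc (a := p) (b := q)).prod
    (isCompact_closedBall (0 : E) R)).uniformContinuousOn_of_continuous hv.contk.continuousOn
  obtain ⟨r0, hr0, hr⟩ := Metric.uniformContinuousOn_iff.1 huc η hη0
  set r : ℝ := min 1 (r0 / 2) with hrdef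
  have hrpos : 0 < r := lt_min one_pos (by linarith)
  have hrR : ∀ t ∈ Icc p q, closedBall (γ t) r ⊆ closedBall (0 : E) R := by
    intro t ht z hz; rw [mem_closedBall, dist_eq_norm] at hz; rw [mem_closedBall, dist_zero_right]
    have h1 : ‖z‖ ≤ ‖z - γ t‖ + ‖γ t‖ := by simpa using norm_add_le (z - γ t) (γ t)
    have := hγR t ht; have := min_le_left (1 : ℝ) (r0 / 2); linarith
  set kh : ℝ → ℝ := fun τ => k (projIcc p q hpq τ) (γ (projIcc p q hpq τ)) + η with hkh
  have hcγ : Continuous fun τ => γ (projIcc p q hpq τ) :=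
    hγ.continuousOn.comp_continuous (continuous_subtype_val.comp continuous_projIcc)
      fun τ => (projIcc p q hpq τ).2
  have hkc : Continuous kh := by
    refine Continuous.add ?_ continuous_const
    exact hv.contk.comp ((continuous_subtype_val.comp (continuous_projIcc (h := hpq))).prodMk hcγ)
  have hkeq : ∀ τ ∈ Icc p q, kh τ = k τ (γ τ) + η := fun τ hτ => by
    simp only [hkh, projIcc_of_mem hpq hτ]
  have hint : ∫ τ in p..q, (kh τ + η) ≤ c + 1 := by
    have e : ∫ τ in p..q, (kh τ + η) = (∫ τ in p..q, k τ (γ τ)) + 2 * η * (q - p) := by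
      have : ∫ τ in p..q, (kh τ + η) = ∫ τ in p..q, (k τ (γ τ) + 2 * η) := by
        refine intervalIntegral.integral_congr fun τ hτ => ?_; rw [uIcc_of_le hpq] at hτ
        simp only [hkeq τ hτ]; ring
      rw [this, intervalIntegral.integral_add, intervalIntegral.integral_const, smul_eq_mul]
      · ring
      · refine ContinuousOn.intervalIntegrable ?_; rw [uIcc_of_le hpq]
        have := (hkc.sub continuous_const).continuousOn (s := Icc p q) (f := fun τ => kh τ - η)
        exact this.congr fun τ hτ => by simp only [hkeq τ hτ]; ring
      · exact intervalIntegrable_const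
    rw [e]; linarith
  refine ⟨r, hrpos, fun γ' hγ' d hd h0 hdr t ht => ?_⟩
  have hexp : rexp (∫ τ in p..q, (kh τ + η)) ≤ rexp (c + 1) := Real.exp_le_exp.2 hint
  have hle : d * rexp (∫ τ in p..q, (kh τ + η)) ≤ d * rexp (c + 1) := by gcongr
  refine (norm_le_exp_integral (y := fun τ => γ' τ - γ τ)
    (y' := fun τ => w τ (γ' τ) - v τ (γ τ)) (k := kh) (r := r) hkc ?_ hd hη0 hs
    (fun τ hτ => (hγ' τ hτ).sub (hγ τ hτ)) ?_ h0 (hle.trans hdr) t ht).trans hle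
  · intro τ; have := hv.nonneg (projIcc p q hpq τ) (γ (projIcc p q hpq τ))
    simp only [hkh]; linarith
  · intro τ hτ hn; have m1 : γ' τ ∈ closedBall (γ τ) r := by rwa [mem_closedBall, dist_eq_norm]
    rw [hw τ _ (hrR τ hτ m1), hkeq τ hτ]
    refine (convex_closedBall (γ τ) r).norm_image_sub_le_of_norm_fderiv_le
      (fun z _ => hv.diff τ z) (fun z hz => ?_) (mem_closedBall_self hrpos.le) m1
    refine (hv.bound τ z).trans ?_
    have h3 := hr (τ, z) ⟨hτ, hrR τ hτ hz⟩ (τ, γ τ)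
      ⟨hτ, hrR τ hτ (mem_closedBall_self hrpos.le)⟩ (by
        rw [Prod.dist_eq, dist_self, max_lt_iff]
        exact ⟨hr0, (mem_closedBall.1 hz).trans_lt ((min_le_right _ _).trans_lt (by linarith))⟩)
    rw [Real.dist_eq, abs_lt] at h3; simp only [uncurry] at h3; linarith [h3.2]

lemma IsLipField.exists_curve_near (hv : IsLipField v k) {p q s c : ℝ} (hs : s ∈ Icc p q)
    (hc : ∀ γ, IsCurve v (Icc p q) γ → ∫ τ in p..q, k τ (γ τ) ≤ c) {ζ : ℝ → E}
    (hζ : IsCurve v (Icc p q) ζ) (x : E) :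
    ∃ γ, γ s = x ∧ IsCurve v (Icc p q) γ ∧
      ∀ t ∈ Icc p q, ‖γ t - ζ t‖ ≤ rexp (c + 1) * ‖x - ζ s‖ := by
  have hpq : p ≤ q := hs.1.trans hs.2
  have hc0 : 0 ≤ c := le_trans
    (intervalIntegral.integral_nonneg hpq fun τ _ => hv.nonneg _ _) (hc ζ hζ)
  rcases eq_or_ne x (ζ s) with rfl | hne
  · exact ⟨ζ, rfl, hζ, fun t _ => by simp⟩
  set d := ‖x - ζ s‖ with hd
  have hd0 : 0 < d := norm_pos_iff.2 (sub_ne_zero.2 hne)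
  set A := rexp (c + 1) with hA
  have hA1 : 1 ≤ A := one_le_exp (by linarith)
  obtain ⟨R0, hR0⟩ := isCompact_Icc.exists_bound_of_continuousOn hζ.continuousOn
  have hR00 : 0 ≤ R0 := (norm_nonneg _).trans (hR0 s hs)
  have hAd : d ≤ A * d := le_mul_of_one_le_left hd0.le hA1
  set R := R0 + A * d + 1 with hR
  obtain ⟨w, Γ, K, hw, hΓ, hΓL⟩ := hv.exists_truncated_flow hs (R := R) (by positivity) R
  set pr : ℝ → ℝ := fun θ => projIcc (0 : ℝ) 1 zero_le_one θ with hpr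
  have hprc : Continuous pr := continuous_subtype_val.comp continuous_projIcc
  have hpr1 : ∀ θ ∈ 𝕋, pr θ = θ := fun θ hθ => by simp [hpr, projIcc_of_mem _ hθ]
  set pt : ℝ → E := fun θ => ζ s + pr θ • (x - ζ s) with hpt
  have hptm : ∀ θ, pt θ ∈ closedBall (0 : E) R := by
    intro θ; rw [mem_closedBall, dist_zero_right]; refine (norm_add_le _ _).trans ?_
    have h1 := hR0 s hs
    have h2 : ‖pr θ • (x - ζ s)‖ ≤ d := by
      rw [norm_smul, norm_eq_abs, abs_of_nonneg (projIcc (0 : ℝ) 1 zero_le_one θ).2.1]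
      exact mul_le_of_le_one_left (norm_nonneg _) (projIcc (0 : ℝ) 1 zero_le_one θ).2.2
    linarith
  set S : Set ℝ := ⋂ t ∈ Icc p q, {θ | ‖Γ (pt θ) t - ζ t‖ ≤ A * θ * d} with hS
  have hSm : ∀ θ, θ ∈ S ↔ ∀ t ∈ Icc p q, ‖Γ (pt θ) t - ζ t‖ ≤ A * θ * d := fun θ => by
    simp [hS]
  have hScl : IsClosed S := by
    refine isClosed_biInter fun t ht => isClosed_le ?_ (by fun_prop)
    refine ((Continuous.sub ?_ continuous_const)).norm
    exact (hΓL t ht).continuousOn.comp_continuous (by fun_prop) hptm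
  have hζw : IsCurve w (Icc p q) ζ := hζ.congr_field fun t ht => hw t _ (by
    rw [mem_closedBall, dist_zero_right]; exact (hR0 t ht).trans (by rw [hR]; nlinarith))
  have hS0 : (0 : ℝ) ∈ S := by
    obtain ⟨r, hr, hst⟩ := hv.stability hs hw hζ (fun t ht => (hR0 t ht).trans (by
      rw [hR]; nlinarith)) (hc ζ hζ)
    rw [hSm]; intro t ht; have e0 : pt 0 = ζ s := by simp [hpt, hpr]
    have h1 := hΓ (pt 0) (hptm 0)
    have h2 : ∀ e, 0 < e → ‖Γ (pt 0) t - ζ t‖ ≤ 0 + e := by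
      intro e he; set e' := min e r; have he' : 0 < e' := lt_min he hr
      have h3 := hst _ h1.2 (e' / A) (by positivity) (by rw [h1.1, e0, sub_self, norm_zero]
                                                         positivity)
        (by rw [← hA, div_mul_cancel₀ _ (by positivity)]; exact min_le_right _ _) t ht
      rw [← hA, div_mul_cancel₀ _ (by positivity)] at h3; rw [zero_add]
      exact h3.trans (min_le_left _ _)
    simpa using le_of_forall_pos_le_add h2
  have hcurve : ∀ θ ∈ 𝕋, θ ∈ S → IsCurve v (Icc p q) (Γ (pt θ)) ∧
      ∀ t ∈ Icc p q, ‖Γ (pt θ) t‖ ≤ R - 1 := by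
    intro θ hθ hθS
    have hb : ∀ t ∈ Icc p q, ‖Γ (pt θ) t‖ ≤ R - 1 := by
      intro t ht; have h1 := (hSm θ).1 hθS t ht
      have h2 : A * θ * d ≤ A * d := by
        rw [mul_right_comm]; exact mul_le_of_le_one_right (by positivity) hθ.2
      have h3 : ‖Γ (pt θ) t‖ ≤ ‖Γ (pt θ) t - ζ t‖ + ‖ζ t‖ := by
        simpa using norm_add_le (Γ (pt θ) t - ζ t) (ζ t)
      have := hR0 t ht; linarith
    refine ⟨(hΓ _ (hptm θ)).2.congr_field fun t ht => (hw t _ ?_).symm, hb⟩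
    rw [mem_closedBall, dist_zero_right]; linarith [hb t ht]
  have hall : 𝕋 ⊆ S := by
    refine IsClosed.Icc_subset_of_forall_exists_gt (hScl.inter isClosed_Icc) hS0 ?_; intro θ hθ y hy
    have hθ1 : θ ∈ 𝕋 := Ico_subset_Icc_self hθ.2; obtain ⟨h1, h2⟩ := hcurve θ hθ1 hθ.1
    obtain ⟨r, hr, hst⟩ := hv.stability hs hw h1 h2 (hc _ h1)
    set h := min (min (1 - θ) (y - θ)) (r / (A * d)) with hh
    have hpos : 0 < h := lt_min (lt_min (by linarith [hθ.2.2]) (by linarith [mem_Ioi.1 hy]))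
      (by positivity)
    have hb1 : h ≤ 1 - θ := (min_le_left _ _).trans (min_le_left _ _)
    have hb2 : h ≤ y - θ := (min_le_left _ _).trans (min_le_right _ _)
    have hb3 : h * (A * d) ≤ r := (le_div_iff₀ (by positivity)).1 (min_le_right _ _)
    have hm : θ + h ∈ 𝕋 := ⟨by linarith [hθ1.1], by linarith⟩
    refine ⟨θ + h, (hSm _).2 fun t ht => ?_, by linarith, by linarith⟩
    have h3 := hΓ _ (hptm (θ + h))
    have h4 := hst _ h3.2 (h * d) (by positivity) (by
      rw [h3.1, (hΓ _ (hptm θ)).1]; simp only [hpt, hpr1 _ hm, hpr1 _ hθ1]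
      rw [add_sub_add_left_eq_sub, ← sub_smul, norm_smul, add_sub_cancel_left, norm_eq_abs,
        abs_of_pos hpos]) (by rw [← hA]; linarith) t ht
    rw [← hA] at h4; have h5 := (hSm θ).1 hθ.1 t ht
    have h6 := norm_sub_le_norm_sub_add_norm_sub (Γ (pt (θ + h)) t) (Γ (pt θ) t) (ζ t)
    calc _ ≤ _ := h6
      _ ≤ h * d * A + A * θ * d := add_le_add h4 h5
      _ = _ := by ring
  have h1 : (1 : ℝ) ∈ S := hall ⟨zero_le_one, le_rfl⟩
  refine ⟨Γ (pt 1), ?_, (hcurve 1 ⟨zero_le_one, le_rfl⟩ h1).1, fun t ht => ?_⟩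
  · rw [(hΓ _ (hptm 1)).1]; simp [hpt, hpr]
  · simpa using (hSm 1).1 h1 t ht

lemma IsLipField.exists_local_curve (hv : IsLipField v k) {T : ℝ} (hT : T ∈ 𝕋) :
    ∃ δ, 0 < δ ∧ ∃ γ, IsCurve v (Icc (max 0 (T - δ)) (min 1 (T + δ))) γ := by
  obtain ⟨w, Γ, K, hw, hΓ, -⟩ := hv.exists_truncated_flow hT (R := 1) one_pos 0
  obtain ⟨h0, h1⟩ := hΓ 0 (by simp)
  have hct := h1.continuousOn T hT
  obtain ⟨δ, hδ, h2⟩ := Metric.continuousWithinAt_iff.1 hct 1 one_pos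
  refine ⟨δ / 2, by positivity, Γ 0, ?_⟩
  have sub : Icc (max 0 (T - δ / 2)) (min 1 (T + δ / 2)) ⊆ 𝕋 :=
    Icc_subset_Icc (le_max_left _ _) (min_le_left _ _)
  refine (h1.mono sub).congr_field fun t ht => (hw t _ ?_).symm
  have := h2 (sub ht) (by
    rw [Real.dist_eq, abs_lt]; constructor
    · linarith [(le_max_right 0 (T - δ / 2)).trans ht.1]
    · linarith [ht.2.trans (min_le_right 1 (T + δ / 2))])
  rw [h0] at this
  exact this.le

lemma IsLipField.exists_curve (hv : IsLipField v k) {c : ℝ}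
    (hc : ∀ T ∈ 𝕋, ∀ γ, IsCurve v (Icc 0 T) γ → ∫ τ in (0 : ℝ)..T, k τ (γ τ) ≤ c) :
    ∃ ζ, IsCurve v 𝕋 ζ := by
  set S : Set ℝ := {T | T ∈ 𝕋 ∧ ∃ ζ, IsCurve v (Icc 0 T) ζ} with hS
  have hne : S.Nonempty := by
    obtain ⟨δ, hδ, γ, hγ⟩ := hv.exists_local_curve (T := 0) ⟨le_rfl, zero_le_one⟩
    refine ⟨0, ⟨le_rfl, zero_le_one⟩, γ, hγ.mono ?_⟩
    exact Icc_subset_Icc (by simp [hδ.le]) (by simp [hδ.le])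
  have hbdd : BddAbove S := ⟨1, fun T hT => hT.1.2⟩
  set T := sSup S with hTdef
  have hT : T ∈ 𝕋 := by
    obtain ⟨T0, h0⟩ := hne
    exact ⟨h0.1.1.trans (le_csSup hbdd h0), csSup_le ⟨T0, h0⟩ fun T hT => hT.1.2⟩
  obtain ⟨δ, hδ, γ, hγ⟩ := hv.exists_local_curve hT
  obtain ⟨T1, hT1, hlt⟩ := exists_lt_of_lt_csSup hne (show T - δ < sSup S by linarith)
  have hle : T1 ≤ T := le_csSup hbdd hT1
  obtain ⟨ζ, hζ⟩ := hT1.2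
  obtain ⟨γ1, h1, h2, -⟩ := hv.exists_curve_near (s := T1) ⟨hT1.1.1, le_rfl⟩ (hc T1 hT1.1) hζ (γ T1)
  have h12 : T1 ≤ min 1 (T + δ) := le_min hT1.1.2 (by linarith)
  have h3 := h2.glue hT1.1.1 h12 (hγ.mono (Icc_subset_Icc_left (max_le hT1.1.1 hlt.le))) h1
  have hmem : min 1 (T + δ) ∈ S := ⟨⟨hT1.1.1.trans h12, min_le_left _ _⟩, _, h3⟩
  have h4 : min 1 (T + δ) ≤ T := le_csSup hbdd hmem
  have h5 : min 1 (T + δ) = 1 := by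
    rcases min_choice 1 (T + δ) with h | h
    · exact h
    · rw [h] at h4; linarith
  rw [h5] at hmem
  exact hmem.2

lemma IsLipField.exists_flow (hv : IsLipField v k) {c : ℝ}
    (hc : ∀ T ∈ 𝕋, ∀ γ, IsCurve v (Icc 0 T) γ → ∫ τ in (0 : ℝ)..T, k τ (γ τ) ≤ c) :
    ∃ χ : ℝ → ℝ → E → E, ∀ s ∈ 𝕋, ∀ z,
      χ s s z = z ∧ IsCurve v 𝕋 fun t => χ t s z := by
  obtain ⟨ζ, hζ⟩ := hv.exists_curve hc
  have h : ∀ s, ∀ z, ∃ γ, s ∈ 𝕋 → γ s = z ∧ IsCurve v 𝕋 γ := by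
    intro s z; by_cases hs : s ∈ 𝕋
    · obtain ⟨γ, h1, h2, -⟩ := hv.exists_curve_near hs (hc 1 ⟨zero_le_one, le_rfl⟩) hζ z
      exact ⟨γ, fun _ => ⟨h1, h2⟩⟩
    · exact ⟨0, fun h => absurd h hs⟩
  choose χ hχ using h
  exact ⟨fun t s z => χ s z t, fun s hs z => hχ s z hs⟩

lemma IsLipField.curve_dist_le (hv : IsLipField v k) {c : ℝ}
    (hc : ∀ γ, IsCurve v 𝕋 γ → ∫ τ in (0 : ℝ)..1, k τ (γ τ) ≤ c) {γ γ' : ℝ → E}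
    (h : IsCurve v 𝕋 γ) (h' : IsCurve v 𝕋 γ') {s t : ℝ} (hs : s ∈ 𝕋)
    (ht : t ∈ 𝕋) : ‖γ t - γ' t‖ ≤ rexp (c + 1) * ‖γ s - γ' s‖ := by
  obtain ⟨δ, h1, h2, h3⟩ := hv.exists_curve_near hs hc h' (γ s)
  have := hv.unique hs h2 h h1
  rw [← this ht]
  exact h3 t ht

lemma IsLipField.curve_eq (hv : IsLipField v k) {χ : ℝ → ℝ → E → E}
    (hχ : ∀ s ∈ 𝕋, ∀ z, χ s s z = z ∧ IsCurve v 𝕋 fun t => χ t s z)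
    {s T : ℝ} (hs : 0 ≤ s) (hT : T ≤ 1) {γ : ℝ → E} (h : IsCurve v (Icc s T) γ) {r t : ℝ}
    (hr : r ∈ Icc s T) (ht : t ∈ Icc s T) : γ t = χ t r (γ r) := by
  have hr' : r ∈ 𝕋 := Icc_subset_Icc hs hT hr
  obtain ⟨h1, h2⟩ := hχ r hr' (γ r)
  exact hv.unique hr h (h2.mono (Icc_subset_Icc hs hT)) h1.symm ht

lemma IsLipField.flow_inv (hv : IsLipField v k) {χ : ℝ → ℝ → E → E}
    (hχ : ∀ s ∈ 𝕋, ∀ z, χ s s z = z ∧ IsCurve v 𝕋 fun t => χ t s z)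
    {s t : ℝ} (hs : s ∈ 𝕋) (ht : t ∈ 𝕋) (z : E) : χ s t (χ t s z) = z := by
  rw [← hv.curve_eq hχ le_rfl le_rfl (hχ s hs z).2 ht hs, (hχ s hs z).1]

lemma IsLipField.flow_lip (hv : IsLipField v k) {χ : ℝ → ℝ → E → E}
    (hχ : ∀ s ∈ 𝕋, ∀ z, χ s s z = z ∧ IsCurve v 𝕋 fun t => χ t s z) {c : ℝ}
    (hc : ∀ γ, IsCurve v 𝕋 γ → ∫ τ in (0 : ℝ)..1, k τ (γ τ) ≤ c) {s t : ℝ} (hs : s ∈ 𝕋)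
    (ht : t ∈ 𝕋) (z w : E) : ‖χ t s z - χ t s w‖ ≤ rexp (c + 1) * ‖z - w‖ := by
  have := hv.curve_dist_le hc (hχ s hs z).2 (hχ s hs w).2 hs ht
  rwa [(hχ s hs z).1, (hχ s hs w).1] at this

end ODE

/-! ### Coordinates and derivatives on phase space -/

/-- The coordinate directions of phase space. -/
def ph (j : 𝕁) : Φ := Sum.elim dirX dirXi j

/-- The coordinates on phase space. -/
def pc (j : 𝕁) (v : Φ) : ℝ :=
  Sum.elim (fun i => v.1 i) (fun i => v.2 i) j

lemma sum_pc_smul_ph : ∑ j, pc j v • ph j = v := by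
  have h : ∀ x, ∑ i, x i • (single i (1 : ℝ) : Pos n) = x := fun x => by
    ext k; simp [Finset.sum_apply, Pi.single_apply]
  rw [Fintype.sum_sum_type]
  simp only [pc, ph, Sum.elim_inl, Sum.elim_inr, dirX, dirXi]
  refine Prod.ext ?_ ?_
  · simpa [Prod.fst_sum] using h v.1
  · simpa [Prod.snd_sum] using h v.2

lemma abs_pc_le (v : Φ) : |pc j v| ≤ ‖v‖ := by
  rcases j with i | i
  · exact (PiLp.norm_apply_le v.1 i).trans (norm_fst_le v)
  · exact (PiLp.norm_apply_le v.2 i).trans (norm_snd_le v)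

lemma norm_ph_le : ‖(ph j : Φ)‖ ≤ 1 := by
  rcases j with i | i <;> simp [ph, dirX, dirXi, Prod.norm_def]

lemma norm_le_sum_pc : ‖v‖ ≤ ∑ j, |pc j v| := by
  conv_lhs => rw [← sum_pc_smul_ph v]
  refine (norm_sum_le _ _).trans (sum_le_sum fun j _ => ?_)
  rw [norm_smul, norm_eq_abs]
  exact mul_le_of_le_one_right (abs_nonneg _) (norm_ph_le j)

/-- The sum of the absolute values of the first derivatives. -/
def gradSum (q : Φ → ℝ) (z : Φ) : ℝ := ∑ j, |pd j q z|

/-- The sum of the absolute values of the second derivatives. -/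
def hessSum (q : Φ → ℝ) (z : Φ) : ℝ :=
  ∑ j, gradSum (pd j q) z

lemma gradSum_nonneg (q : Φ → ℝ) (z : Φ) : 0 ≤ gradSum q z :=
  sum_nonneg fun _ _ => abs_nonneg _

lemma hessSum_nonneg (q : Φ → ℝ) (z : Φ) : 0 ≤ hessSum q z :=
  sum_nonneg fun _ _ => gradSum_nonneg _ _

lemma fderiv_eq_sum (q : Φ → ℝ) (z v : Φ) :
    fderiv ℝ q z v = ∑ j, pc j v * pd j q z := by
  conv_lhs => rw [← sum_pc_smul_ph v]
  simp [map_sum, partialD]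

lemma abs_fderiv_le_gradSum (q : Φ → ℝ) (z v : Φ) :
    |fderiv ℝ q z v| ≤ gradSum q z * ‖v‖ := by
  rw [fderiv_eq_sum, gradSum, sum_mul]
  refine (Finset.abs_sum_le_sum_abs _ _).trans (sum_le_sum fun j _ => ?_)
  rw [abs_mul, mul_comm]
  exact mul_le_mul_of_nonneg_left (abs_pc_le j v) (abs_nonneg _)

lemma contDiff_partialD (hq : ContDiff ℝ ∞ q) (e : Φ) :
    ContDiff ℝ ∞ (partialD e q) :=
  (hq.fderiv_right (m := ∞) (by simp)).clm_apply contDiff_const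

lemma partialD_iteratedFDeriv (hq : ContDiff ℝ ∞ q) {m : ℕ} (e : Φ) (v : Fin m → Φ) :
    partialD e (fun z => iteratedFDeriv ℝ m q z v) =
      fun z => iteratedFDeriv ℝ (m + 1) q z (Fin.cons e v) := by
  funext z
  have hd : DifferentiableAt ℝ (iteratedFDeriv ℝ m q) z :=
    (hq.differentiable_iteratedFDeriv (by exact_mod_cast WithTop.coe_lt_top _)) z
  have := hd.hasFDerivAt.continuousMultilinear_apply_const v
  rw [iteratedFDeriv_succ_apply_left]
  simp only [partialD, this.fderiv]
  simp

lemma partialD_iterate_eq (hq : ContDiff ℝ ∞ q) (e : Φ) (m : ℕ) :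
    (partialD e)^[m] q = fun z => iteratedFDeriv ℝ m q z (fun _ => e) := by
  induction m with
  | zero => simp
  | succ m ih =>
    rw [Function.iterate_succ_apply', ih, partialD_iteratedFDeriv hq]; funext z; congr 1; funext i
    refine Fin.cases ?_ (fun i => ?_) i <;> simp

lemma partialD_eq (hq : ContDiff ℝ ∞ q) (e : Φ) :
    partialD e q = fun z => iteratedFDeriv ℝ 1 q z (fun _ => e) := partialD_iterate_eq hq e 1

lemma partialD_partialD_eq (hq : ContDiff ℝ ∞ q) (e e' : Φ) :
    partialD e (partialD e' q) =
      fun z => iteratedFDeriv ℝ 2 q z (Fin.cons e (fun _ => e')) := by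
  rw [partialD_eq hq, partialD_iteratedFDeriv hq]

lemma partialD_comm (hq : ContDiff ℝ ∞ q) (e e' : Φ) :
    partialD e (partialD e' q) = partialD e' (partialD e q) := by
  funext z
  have hd : DifferentiableAt ℝ (fderiv ℝ q) z :=
    ((hq.fderiv_right (m := 1) (by norm_cast)).differentiable (by norm_num)) z
  have h1 : ∀ u w, partialD u (partialD w q) z = fderiv ℝ (fderiv ℝ q) z u w := by
    intro u w; have := hd.hasFDerivAt.clm_apply (hasFDerivAt_const w z)
    change fderiv ℝ (fun y => (fderiv ℝ q y) w) z u = _; rw [this.fderiv]; simp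
  rw [h1, h1]
  exact (hq.contDiffAt (x := z)).isSymmSndFDerivAt (by simp; norm_cast) e e'

/-! ### Multi-indices -/

section MultiIndex
variable {X : Type*} (g : Fin n → X → X)

lemma foldr_iterate_zero (l : List (Fin n)) (α : Fin n → ℕ) (h : ∀ i ∈ l, α i = 0) (x : X) :
    l.foldr (fun i f => (g i)^[α i] f) x = x := by
  induction l with
  | nil => rfl
  | cons i l ih =>
    rw [List.foldr_cons, ih fun k hk => h k (mem_cons_of_mem _ hk), h i List.mem_cons_self]; rfl

lemma foldr_iterate_single {l : List (Fin n)} (hl : l.Nodup) {i : Fin n} (hi : i ∈ l) (m : ℕ)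
    (α : Fin n → ℕ) (hα : α i = m) (h0 : ∀ k ∈ l, k ≠ i → α k = 0) (x : X) :
    l.foldr (fun i f => (g i)^[α i] f) x = (g i)^[m] x := by
  induction l with
  | nil => simp at hi
  | cons k l ih =>
    rw [List.foldr_cons]; have hn := List.nodup_cons.1 hl; by_cases hki : k = i
    · subst hki
      rw [foldr_iterate_zero g l α (fun j hj => h0 j (mem_cons_of_mem _ hj)
        (fun h => hn.1 (h ▸ hj))), hα]
    · rw [ih hn.2 ((mem_cons.1 hi).resolve_left fun h => hki h.symm)
        (fun j hj => h0 j (mem_cons_of_mem _ hj)), h0 k List.mem_cons_self hki]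
      rfl

lemma foldr_iterate_pair {l : List (Fin n)} (hl : l.Nodup) {i j : Fin n} (hi : i ∈ l) (hj : j ∈ l)
    (hij : i ≠ j) (α : Fin n → ℕ) (hαi : α i = 1) (hαj : α j = 1)
    (h0 : ∀ k ∈ l, k ≠ i → k ≠ j → α k = 0) (x : X) :
    l.foldr (fun i f => (g i)^[α i] f) x = g i (g j x) ∨
      l.foldr (fun i f => (g i)^[α i] f) x = g j (g i x) := by
  induction l with
  | nil => simp at hi
  | cons k l ih =>
    rw [List.foldr_cons]; have hn := List.nodup_cons.1 hl; by_cases hki : k = i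
    · left; subst hki
      rw [foldr_iterate_single g hn.2 ((mem_cons.1 hj).resolve_left hij.symm) 1 α hαj
        (fun r hr hrj => h0 r (mem_cons_of_mem _ hr) (fun h => hn.1 (h ▸ hr)) hrj), hαi]
      rfl
    · by_cases hkj : k = j
      · right; subst hkj
        rw [foldr_iterate_single g hn.2 ((mem_cons.1 hi).resolve_left hij) 1 α hαi
          (fun r hr hri => h0 r (mem_cons_of_mem _ hr) hri (fun h => hn.1 (h ▸ hr))), hαj]
        rfl
      · rw [h0 k List.mem_cons_self hki hkj]
        exact ih hn.2 ((mem_cons.1 hi).resolve_left fun h => hki h.symm)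
          ((mem_cons.1 hj).resolve_left fun h => hkj h.symm)
          (fun r hr => h0 r (mem_cons_of_mem _ hr))

end MultiIndex

section
variable (i : Fin n)

lemma foldr_zero {X : Type*} (g : Fin n → X → X) (x : X) : (List.finRange n).foldr
    (fun k f => (g k)^[(0 : Fin n → ℕ) k] f) x = x := foldr_iterate_zero g _ 0 (by simp) x

lemma foldr_single {X : Type*} (g : Fin n → X → X) (m : ℕ) (x : X) : (List.finRange n).foldr
    (fun k f => (g k)^[(Pi.single i m : Fin n → ℕ) k] f) x = (g i)^[m] x :=
  foldr_iterate_single g (nodup_finRange n) (mem_finRange i) m _ (by simp)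
    (fun k _ hk => by simp [hk]) x

lemma foldr_pair (e : Fin n → Φ) {k : Fin n} (hik : i ≠ k) (hq : ContDiff ℝ ∞ q) :
    (List.finRange n).foldr
      (fun r f => (partialD (e r))^[(Pi.single i 1 + Pi.single k 1 : Fin n → ℕ) r] f) q =
      partialD (e i) (partialD (e k) q) :=
  (foldr_iterate_pair (fun r => partialD (e r)) (nodup_finRange n) (mem_finRange i)
    (mem_finRange k) hik _ (by simp [hik]) (by simp [hik.symm]) (fun r _ h1 h2 => by simp [h1, h2])
    q).elim id (·.trans (partialD_comm hq _ _))

end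

lemma exists_multiD_pure (m : ℕ) :
    ∃ α β, order α β = m ∧ ∀ q, multiD α β q = (pd j)^[m] q := by
  rcases j with i | i
  · exact ⟨Pi.single i m, 0, by simp [order], fun q => by rw [multiD, foldr_zero, foldr_single]; rfl⟩
  · exact ⟨0, Pi.single i m, by simp [order], fun q => by rw [multiD, foldr_zero, foldr_single]; rfl⟩

lemma exists_multiD_mixed (j l : 𝕁) :
    ∃ α β, order α β = 2 ∧ ∀ q, ContDiff ℝ ∞ q →
      multiD α β q = pd j (pd l q) := by
  by_cases hjl : j = l
  · subst hjl; obtain ⟨α, β, h1, h2⟩ := exists_multiD_pure j 2; exact ⟨α, β, h1, fun q _ => h2 q⟩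
  rcases j with i | i <;> rcases l with k | k
  · exact ⟨Pi.single i 1 + Pi.single k 1, 0, by simp [order, sum_add_distrib], fun q hq => by
      rw [multiD, foldr_zero, foldr_pair i _ (fun h => hjl (by rw [h])) hq]; rfl⟩
  · exact ⟨Pi.single i 1, Pi.single k 1, by simp [order], fun q _ => by
      rw [multiD, foldr_single, foldr_single]; rfl⟩
  · exact ⟨Pi.single k 1, Pi.single i 1, by simp [order], fun q hq => by
      rw [multiD, foldr_single, foldr_single]; exact partialD_comm hq _ _⟩
  · exact ⟨0, Pi.single i 1 + Pi.single k 1, by simp [order, sum_add_distrib], fun q hq => by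
      rw [multiD, foldr_zero, foldr_pair i _ (fun h => hjl (by rw [h])) hq]; rfl⟩

lemma le_maxBound (c : (Fin n → ℕ) → (Fin n → ℕ) → ℝ) {l m : ℕ} {α β : Fin n → ℕ}
    (hl : l ≤ order α β) (hm : order α β ≤ m) : c α β ≤ maxBound c l m := by
  refine le_csSup (Set.Finite.bddAbove ?_) ⟨α, β, hl, hm, rfl⟩
  have hfin : (Set.univ.pi fun _ : Fin n => Set.Iic m).Finite := Set.Finite.pi fun _ => Set.finite_Iic m
  refine ((hfin.prod hfin).image fun p => c p.1 p.2).subset ?_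
  rintro r ⟨α, β, -, h, rfl⟩
  refine ⟨(α, β), ⟨fun i _ => ?_, fun i _ => ?_⟩, rfl⟩
  · have := single_le_sum (f := α) (fun _ _ => Nat.zero_le _) (Finset.mem_univ i)
    unfold order at h; simp only [mem_Iic]; omega
  · have := single_le_sum (f := β) (fun _ _ => Nat.zero_le _) (Finset.mem_univ i)
    unfold order at h; simp only [mem_Iic]; omega

lemma maxBound_mono (c : (Fin n → ℕ) → (Fin n → ℕ) → ℝ) {l m m' : ℕ} (hm : m ≤ m')
    (hc : ∀ α β, l ≤ order α β → 0 ≤ c α β) : maxBound c l m ≤ maxBound c l m' := by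
  refine Real.sSup_le ?_ (Real.sSup_nonneg ?_)
  · rintro r ⟨α, β, h1, h2, rfl⟩; exact le_maxBound c h1 (h2.trans hm)
  grind

lemma maxBound_nonneg (c : (Fin n → ℕ) → (Fin n → ℕ) → ℝ) {l m : ℕ}
    (hc : ∀ α β, l ≤ order α β → 0 ≤ c α β) : 0 ≤ maxBound c l m := by
  refine Real.sSup_nonneg ?_
  grind

lemma SymbolBound.nonneg {k : ℕ} {a q : ℝ → Φ → ℝ} {c : (Fin n → ℕ) → (Fin n → ℕ) → ℝ}
    (h : SymbolBound k a q c) (α β : Fin n → ℕ) (hk : k ≤ order α β) : 0 ≤ c α β := by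
  have := h α β hk 0 ⟨le_rfl, zero_le_one⟩ (fun _ => 0) (fun t ht => by
    rw [Icc_self, mem_singleton_iff] at ht; rw [ht, Icc_self]
    exact HasFDerivWithinAt.of_subsingleton subsingleton_singleton)
  simpa using this

/-! ### Symbols depending on time -/

/-- A symbol which is jointly continuous for all times. -/
structure IsTimeSym (q : ℝ → Φ → ℝ) : Prop where
  smooth : ∀ t, ContDiff ℝ ∞ (q t)
  cont : ∀ m : ℕ, Continuous fun p : ℝ × Φ => iteratedFDeriv ℝ m (q p.1) p.2

/-- The symbol frozen outside of the time interval `[0, 1]`. -/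
def clamp (q : ℝ → Φ → ℝ) (t : ℝ) : Φ → ℝ :=
  q (projIcc (0 : ℝ) 1 zero_le_one t)

lemma clamp_eq (q : ℝ → Φ → ℝ) {t : ℝ} (ht : t ∈ 𝕋) : clamp q t = q t := by
  rw [clamp, projIcc_of_mem _ ht]

lemma IsSymbol.isTimeSym {q : ℝ → Φ → ℝ} (hq : IsSymbol q) :
    IsTimeSym (clamp q) where
  smooth t := hq.1 _ (projIcc (0 : ℝ) 1 zero_le_one t).2
  cont m := by
    have h : Continuous fun p : ℝ × Φ =>
        (((projIcc (0 : ℝ) 1 zero_le_one p.1 : 𝕋) : ℝ), p.2) :=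
      (continuous_subtype_val.comp (continuous_projIcc.comp continuous_fst)).prodMk continuous_snd
    exact (hq.2 m).comp_continuous h fun p => ⟨(projIcc (0 : ℝ) 1 zero_le_one p.1).2, mem_univ _⟩

namespace IsTimeSym
variable {q : ℝ → Φ → ℝ} (hq : IsTimeSym q)
include hq

lemma cont_iterate (e : Φ) (m : ℕ) :
    Continuous fun p : ℝ × Φ => (partialD e)^[m] (q p.1) p.2 := by
  simp_rw [partialD_iterate_eq (hq.smooth _) e m]
  have := hq.cont m
  fun_prop

lemma cont_uncurry : Continuous fun p : ℝ × Φ => q p.1 p.2 :=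
  hq.cont_iterate 0 0

lemma cont_partialD (e : Φ) :
    Continuous fun p : ℝ × Φ => partialD e (q p.1) p.2 := hq.cont_iterate e 1

lemma cont_partialD_partialD (e e' : Φ) :
    Continuous fun p : ℝ × Φ => partialD e (partialD e' (q p.1)) p.2 := by
  simp_rw [partialD_partialD_eq (hq.smooth _) e e']
  have := hq.cont 2
  fun_prop

lemma cont_hessSum : Continuous fun p : ℝ × Φ => hessSum (q p.1) p.2 := by
  exact continuous_finsetSum _ fun j _ => continuous_finsetSum _ fun l _ =>
    (hq.cont_partialD_partialD _ _).abs

lemma cont_gradSum : Continuous fun p : ℝ × Φ => gradSum (q p.1) p.2 := by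
  exact continuous_finsetSum _ fun l _ => (hq.cont_partialD _).abs

end IsTimeSym

/-- The symplectic duals of the coordinate directions. -/
def phDual (j : 𝕁) : Φ :=
  Sum.elim (fun i => -dirXi i) dirX j

lemma norm_phDual_le : ‖(phDual j : Φ)‖ ≤ 1 := by
  rcases j with i | i <;> simp [phDual, dirX, dirXi, Prod.norm_def]

lemma gradient_apply {f : Pos n → ℝ} (x : Pos n) (i : Fin n) :
    gradient f x i = fderiv ℝ f x (single i 1) := by
  have := InnerProductSpace.toDual_symm_apply (𝕜 := ℝ) (x := (single i 1 : Pos n))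
    (y := fderiv ℝ f x)
  rw [← this, inner_single_right]
  simp [gradient]

lemma hamField_eq {t : ℝ} (ha : Differentiable ℝ (a t)) (z : Φ) :
    hamField a t z = ∑ j, pd j (a t) z • phDual j := by
  have hsum : ∀ c, ∑ i, c i • (single i (1 : ℝ) : Pos n) =
      WithLp.toLp 2 c := fun c => by
    ext k; simp [Finset.sum_apply, Pi.single_apply]
  have h2 : ∀ i, fderiv ℝ (fun ξ => a t (z.1, ξ)) z.2 (single i 1) =
      partialD (dirXi i) (a t) z := fun i => by
    have h := HasFDerivAt.comp (g := a t) (f := fun ξ => (z.1, ξ)) z.2 (ha z).hasFDerivAt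
      ((hasFDerivAt_const z.1 z.2).prodMk (hasFDerivAt_id z.2))
    change fderiv ℝ (a t ∘ fun ξ => (z.1, ξ)) z.2 _ = _; rw [h.fderiv]; simp [partialD, dirXi]
  have h1 : ∀ i, fderiv ℝ (fun x => a t (x, z.2)) z.1 (single i 1) =
      partialD (dirX i) (a t) z := fun i => by
    have h := HasFDerivAt.comp (g := a t) (f := fun x => (x, z.2)) z.1 (ha z).hasFDerivAt
      ((hasFDerivAt_id z.1).prodMk (hasFDerivAt_const z.2 z.1))
    change fderiv ℝ (a t ∘ fun x => (x, z.2)) z.1 _ = _; rw [h.fderiv]; simp [partialD, dirX]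
  rw [Fintype.sum_sum_type]
  simp only [ph, phDual, Sum.elim_inl, Sum.elim_inr, hamField]
  refine Prod.ext ?_ ?_
  · simp only [Prod.fst_add, Prod.fst_sum, smul_fst, dirX, dirXi, Prod.fst_neg, neg_zero,
      smul_zero, Finset.sum_const_zero, zero_add]
    rw [hsum]; ext i; rw [gradient_apply, h2]; rfl
  · simp only [Prod.snd_add, Prod.snd_sum, smul_snd, dirX, dirXi, Prod.snd_neg,
      smul_zero, Finset.sum_const_zero, add_zero, smul_neg, Finset.sum_neg_distrib]
    rw [hsum]; congr 1; ext i; rw [gradient_apply, h1]; rfl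

lemma IsTimeSym.isLipField (ha : IsTimeSym a) :
    IsLipField (hamField a) (fun t z => hessSum (a t) z) := by
  have hd : ∀ t, Differentiable ℝ (a t) := fun t => (ha.smooth t).differentiable (by simp)
  have he : ∀ t, hamField a t = fun z => ∑ j, pd j (a t) z • phDual j := fun t =>
    funext fun z => hamField_eq (hd t) z
  have hdj : ∀ t j, Differentiable ℝ (pd j (a t)) := fun t j =>
    (contDiff_partialD (ha.smooth t) _).differentiable (by simp)
  refine ⟨?_, fun t => ?_, ha.cont_hessSum, fun t z => ?_⟩
  · have : uncurry (hamField a) =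
        fun p : ℝ × Φ => ∑ j, pd j (a p.1) p.2 • phDual j := by
      funext p; exact hamField_eq (hd p.1) p.2
    rw [this]; exact continuous_finsetSum _ fun j _ => (ha.cont_partialD _).smul continuous_const
  · rw [he]; fun_prop
  · refine ContinuousLinearMap.opNorm_le_bound _ (hessSum_nonneg _ _) fun v => ?_
    have h := HasFDerivAt.fun_sum (u := Finset.univ) fun j _ =>
      ((hdj t j) z).hasFDerivAt.smul_const (phDual j)
    rw [he, h.fderiv]; rw [sum_apply, hessSum, sum_mul]
    refine (norm_sum_le _ _).trans (sum_le_sum fun j _ => ?_)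
    rw [ContinuousLinearMap.smulRight_apply, norm_smul]
    exact (mul_le_of_le_one_right (norm_nonneg _) (norm_phDual_le j)).trans
      (abs_fderiv_le_gradSum _ _ _)

lemma isTrajectory_clamp_iff {I : Set ℝ} (hI : I ⊆ Icc 0 1)
    {z : ℝ → Φ} : IsTrajectory a I z ↔ IsCurve (hamField (clamp a)) I z := by
  have h : ∀ t ∈ I, hamField (clamp a) t (z t) = hamField a t (z t) := fun t ht => by
    simp only [hamField, clamp_eq a (hI ht)]
  exact ⟨fun H t ht => by rw [h t ht]; exact H t ht, fun H t ht => by rw [← h t ht]; exact H t ht⟩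

/-! ### Increments along Lipschitz paths -/

lemma abs_sub_le_integral_gradSum {F : Φ → ℝ} (hF : ContDiff ℝ ∞ F) {γ : ℝ → Φ}
    {l : ℝ} (hl : 0 ≤ l) (hγ : ∀ θ θ', ‖γ θ - γ θ'‖ ≤ l * |θ - θ'|) :
    |F (γ 1) - F (γ 0)| ≤ ∫ θ in (0 : ℝ)..1, l * gradSum F (γ θ) := by
  have hγc : Continuous γ := by
    refine (LipschitzWith.of_dist_le_mul (K := ⟨l, hl⟩) fun θ θ' => ?_).continuous; exact hγ θ θ'
  have hgc : Continuous (gradSum F) := by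
    exact continuous_finsetSum _ fun l _ => (contDiff_partialD hF _).continuous.abs
  have hc : Continuous fun θ => l * gradSum F (γ θ) := continuous_const.mul (hgc.comp hγc)
  have hB : ∀ x, HasDerivAt (fun t => ∫ θ in (0 : ℝ)..t, l * gradSum F (γ θ))
      (l * gradSum F (γ x)) x := fun x => (hc.integral_hasStrictDerivAt 0 x).hasDerivAt
  refine image_le_of_liminf_slope_right_le_deriv_boundary (a := 0) (b := 1)
    (f := fun t => |F (γ t) - F (γ 0)|)
    ((((hF.continuous.comp hγc).sub continuous_const).abs).continuousOn) (by simp)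
    (fun x _ => (hB x).continuousAt.continuousWithinAt) (fun x _ => (hB x).hasDerivWithinAt) ?_
    ⟨zero_le_one, le_rfl⟩
  intro x _ r hr
  refine Filter.Eventually.frequently ?_
  set η := (r - l * gradSum F (γ x)) / (l + 1) with hη
  have hη0 : 0 < η := div_pos (by linarith) (by linarith)
  have hd := ((hF.differentiable (by simp)) (γ x)).hasFDerivAt
  have h1 := hd.isLittleO.bound hη0
  have h2 := (hγc.tendsto x).eventually h1
  filter_upwards [mem_nhdsWithin_of_mem_nhds h2, self_mem_nhdsWithin] with y hy hxy
  have hxy' : 0 < y - x := sub_pos.2 hxy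
  rw [slope_def_field, div_lt_iff₀ hxy']
  have h3 := hγ y x
  rw [abs_of_pos hxy'] at h3
  have h4 := abs_fderiv_le_gradSum F (γ x) (γ y - γ x)
  have h5 : |F (γ y) - F (γ x)| ≤ η * ‖γ y - γ x‖ + gradSum F (γ x) * ‖γ y - γ x‖ := by
    calc |F (γ y) - F (γ x)| = |(F (γ y) - F (γ x) - fderiv ℝ F (γ x) (γ y - γ x)) +
          fderiv ℝ F (γ x) (γ y - γ x)| := by ring
      _ ≤ _ := (abs_add_le _ _).trans (add_le_add hy h4)
  have h6 : |F (γ y) - F (γ 0)| - |F (γ x) - F (γ 0)| ≤ |F (γ y) - F (γ x)| := by grind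
  have hg := gradSum_nonneg F (γ x)
  have h8 : η * (l + 1) = r - l * gradSum F (γ x) := by
    rw [hη]; field_simp
  nlinarith

/-! ### The Hamilton flow -/

lemma integral_hessSum_le {c : (Fin n → ℕ) → (Fin n → ℕ) → ℝ}
    (ha : IsSymbol a) (hc : SymbolBound 2 a a c) {B : ℝ}
    (hB : ∀ α β, order α β = 2 → c α β ≤ B) {T : ℝ} (hT : T ∈ 𝕋) {γ : ℝ → Φ}
    (hγ : IsCurve (hamField (clamp a)) (Icc 0 T) γ) :
    ∫ τ in (0 : ℝ)..T, hessSum (clamp a τ) (γ τ) ≤ (2 * n) ^ 2 * B := by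
  have hsub : Icc (0 : ℝ) T ⊆ Icc 0 1 := Icc_subset_Icc_right hT.2
  have hts := ha.isTimeSym
  have hint : ∀ j l, IntervalIntegrable
      (fun τ => |pd l (pd j (clamp a τ)) (γ τ)|) volume 0 T := by
    intro j l; refine ContinuousOn.intervalIntegrable ?_; rw [uIcc_of_le hT.1]
    exact ((hts.cont_partialD_partialD _ _).comp_continuousOn
      (continuousOn_id.prodMk hγ.continuousOn)).abs
  have hjl : ∀ j l,
      ∫ τ in (0 : ℝ)..T, |pd l (pd j (clamp a τ)) (γ τ)| ≤ B := by
    intro j l; obtain ⟨α, β, h1, h2⟩ := exists_multiD_mixed l j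
    have h3 := hc α β h1.ge T hT γ ((isTrajectory_clamp_iff hsub).2 hγ)
    refine le_trans (le_of_eq ?_) (h3.trans (hB α β h1))
    refine intervalIntegral.integral_congr fun τ hτ => ?_; rw [uIcc_of_le hT.1] at hτ
    simp only [h2 (a τ) (ha.1 τ (hsub hτ)), clamp_eq a (hsub hτ)]
  calc ∫ τ in (0 : ℝ)..T, hessSum (clamp a τ) (γ τ)
      = ∑ j, ∑ l,
        ∫ τ in (0 : ℝ)..T, |pd l (pd j (clamp a τ)) (γ τ)| := by
        unfold hessSum gradSum; rw [intervalIntegral.integral_finsetSum fun j _ => ?_]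
        · exact sum_congr rfl fun j _ =>
            intervalIntegral.integral_finsetSum fun l _ => hint j l
        · have := IntervalIntegrable.sum Finset.univ fun l _ => hint j l
          simpa only [Finset.sum_fn] using this
    _ ≤ ∑ _j, ∑ _l, B :=
        sum_le_sum fun j _ => sum_le_sum fun l _ => hjl j l
    _ = (2 * n) ^ 2 * B := by simp; ring

lemma norm_le_phaseDist : ‖z - w‖ ≤ phaseDist z w := by
  refine max_le ?_ ?_
  · exact Real.le_sqrt_of_sq_le (by simp)
  · exact Real.le_sqrt_of_sq_le (by simp)

lemma phaseDist_le_norm : phaseDist z w ≤ 2 * ‖z - w‖ := by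
  refine Real.sqrt_le_iff.2 ⟨by positivity, ?_⟩
  have h1 := norm_fst_le (z - w)
  have h2 := norm_snd_le (z - w)
  simp only [fst_sub, snd_sub] at h1 h2
  have h3 := pow_le_pow_left₀ (norm_nonneg _) h1 2
  have h4 := pow_le_pow_left₀ (norm_nonneg _) h2 2
  nlinarith [sq_nonneg ‖z - w‖]

lemma hamilton_flow_exists (h : InSymbolClass 2 a a) :
      ∃ χ, IsHamiltonFlow a χ ∧
        (∀ (s T : ℝ) (z : ℝ → Φ), 0 ≤ s → s ≤ T → T ≤ 1 → IsTrajectory a (Set.Icc s T) z →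
          ∀ r ∈ Set.Icc s T, ∀ t ∈ Set.Icc s T, z t = χ t r (z r)) ∧
        ∃ L, 0 < L ∧ ∀ s ∈ 𝕋, ∀ t ∈ 𝕋, ∀ z w,
          L⁻¹ * phaseDist z w ≤ phaseDist (χ t s z) (χ t s w) ∧
          phaseDist (χ t s z) (χ t s w) ≤ L * phaseDist z w := by
  obtain ⟨ha, c, hc⟩ := h
  have hv := ha.isTimeSym.isLipField
  set C := (2 * n) ^ 2 * maxBound c 2 2 with hC
  have hb : ∀ T ∈ 𝕋, ∀ γ, IsCurve (hamField (clamp a)) (Icc 0 T) γ →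
      ∫ τ in (0 : ℝ)..T, hessSum (clamp a τ) (γ τ) ≤ C := fun T hT γ hγ =>
    integral_hessSum_le ha hc (fun α β h => le_maxBound c h.ge h.le) hT hγ
  obtain ⟨χ, hχ⟩ := hv.exists_flow hb
  have hiff := fun z => isTrajectory_clamp_iff (a := a) (Subset.refl 𝕋) (z := z)
  refine ⟨χ, fun s hs z => ⟨(hχ s hs z).1, (hiff _).2 (hχ s hs z).2⟩, ?_, ?_⟩
  · intro s T z hs _ hT hz r hr t ht
    exact hv.curve_eq hχ hs hT ((isTrajectory_clamp_iff (Icc_subset_Icc hs hT)).1 hz) hr ht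
  · have key : ∀ s ∈ 𝕋, ∀ t ∈ 𝕋, ∀ z w,
        phaseDist (χ t s z) (χ t s w) ≤ 2 * rexp (C + 1) * phaseDist z w := by
      intro s hs t ht z w; have h1 := hv.flow_lip hχ (hb 1 ⟨zero_le_one, le_rfl⟩) hs ht z w
      calc _ ≤ 2 * ‖χ t s z - χ t s w‖ := phaseDist_le_norm _ _
        _ ≤ 2 * (rexp (C + 1) * ‖z - w‖) := by gcongr
        _ ≤ 2 * (rexp (C + 1) * phaseDist z w) := by gcongr; exact norm_le_phaseDist z w
        _ = _ := by ring
    refine ⟨2 * rexp (C + 1), by positivity, fun s hs t ht z w => ⟨?_, key s hs t ht z w⟩⟩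
    rw [inv_mul_le_iff₀ (by positivity)]
    simpa only [hv.flow_inv hχ hs ht] using key t ht s hs (χ t s z) (χ t s w)

/-- The flow `X t` from time `0` to time `t` of the Hamilton field of `a`, with inverse `Y t`, frozen
outside of the time interval `[0, 1]`. -/
structure IsPhaseFlow (a : ℝ → Φ → ℝ) (X Y : ℝ → Φ → Φ) (L : ℝ) : Prop where
  one_le : 1 ≤ L
  left_inv : ∀ t z, Y t (X t z) = z
  right_inv : ∀ t z, X t (Y t z) = z
  zero : ∀ z, X 0 z = z
  lip : ∀ t z w, ‖X t z - X t w‖ ≤ L * ‖z - w‖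
  lip_inv : ∀ t z w, ‖Y t z - Y t w‖ ≤ L * ‖z - w‖
  continuous : Continuous fun p : ℝ × Φ => X p.1 p.2
  deriv : ∀ z, ∀ t ∈ 𝕋,
    HasDerivWithinAt (fun t => X t z) (hamField a t (X t z)) 𝕋 t

lemma IsPhaseFlow.cont_inv
    (h : IsPhaseFlow a X Y L) : Continuous fun p : ℝ × Φ => Y p.1 p.2 := by
  rw [continuous_iff_continuousAt]
  rintro ⟨t0, z0⟩
  rw [ContinuousAt, tendsto_iff_norm_sub_tendsto_zero]
  have h1 : Continuous fun p : ℝ × Φ => L * ‖p.2 - X p.1 (Y t0 z0)‖ := by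
    have := h.continuous; fun_prop
  have h2 := h1.tendsto (t0, z0)
  simp only [h.right_inv, sub_self, norm_zero, mul_zero] at h2
  refine squeeze_zero (fun _ => norm_nonneg _) (fun p => ?_) h2
  have := h.lip_inv p.1 p.2 (X p.1 (Y t0 z0))
  rwa [h.left_inv] at this

lemma isCurve_of_isHamiltonFlow {χ : ℝ → ℝ → Φ → Φ} (hχ : IsHamiltonFlow a χ) : ∀ s ∈ 𝕋, ∀ z,
    χ s s z = z ∧ IsCurve (hamField (clamp a)) 𝕋 fun t => χ t s z := fun s hs z =>
  ⟨(hχ s hs z).1, (isTrajectory_clamp_iff Subset.rfl).1 (hχ s hs z).2⟩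

lemma isPhaseFlow_of_isHamiltonFlow (ha : IsSymbol a)
    {χ : ℝ → ℝ → Φ → Φ} (hχ : IsHamiltonFlow a χ) {c : ℝ}
    (hc : ∀ γ, IsCurve (hamField (clamp a)) 𝕋 γ →
      ∫ τ in (0 : ℝ)..1, hessSum (clamp a τ) (γ τ) ≤ c) :
    IsPhaseFlow (clamp a) (fun t => χ (projIcc (0 : ℝ) 1 zero_le_one t) 0)
      (fun t => χ 0 (projIcc (0 : ℝ) 1 zero_le_one t)) (rexp (c + 1)) := by
  have hv := ha.isTimeSym.isLipField
  have hχ' := isCurve_of_isHamiltonFlow hχ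
  have h0 : (0 : ℝ) ∈ 𝕋 := ⟨le_rfl, zero_le_one⟩
  have hc0 : 0 ≤ c := le_trans (intervalIntegral.integral_nonneg zero_le_one fun τ _ =>
    hessSum_nonneg _ _) (hc _ (hχ' 0 h0 0).2)
  set pr := fun t => projIcc (0 : ℝ) 1 zero_le_one t with hpr
  refine ⟨one_le_exp (by linarith), fun t => hv.flow_inv hχ' h0 (pr t).2,
    fun t => hv.flow_inv hχ' (pr t).2 h0, fun z => ?_, fun t => hv.flow_lip hχ' hc h0 (pr t).2,
    fun t => hv.flow_lip hχ' hc (pr t).2 h0, ?_, fun z t ht => ?_⟩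
  · have : ((pr 0 : 𝕋) : ℝ) = 0 := by simp [hpr]
    grind
  · rw [continuous_iff_continuousAt]; rintro ⟨t0, z0⟩
    have h1 : Continuous fun t => χ (pr t) 0 z0 :=
      (hχ' 0 h0 z0).2.continuousOn.comp_continuous
        (continuous_subtype_val.comp continuous_projIcc) fun t => (pr t).2
    have h2 : Continuous fun p : ℝ × Φ =>
        rexp (c + 1) * ‖p.2 - z0‖ + ‖χ (pr p.1) 0 z0 - χ (pr t0) 0 z0‖ := by
      have h1' : Continuous fun p : ℝ × Φ => χ (pr p.1) 0 z0 := h1.comp continuous_fst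
      exact (continuous_const.mul (continuous_snd.sub continuous_const).norm).add
        (h1'.sub continuous_const).norm
    have h3 := h2.tendsto (t0, z0); simp only [sub_self, norm_zero, mul_zero, add_zero] at h3
    rw [ContinuousAt, tendsto_iff_norm_sub_tendsto_zero]
    refine squeeze_zero (fun _ => norm_nonneg _) (fun p => ?_) h3
    exact (norm_sub_le_norm_sub_add_norm_sub _ (χ (pr p.1) 0 z0) _).trans
      (add_le_add (hv.flow_lip hχ' hc h0 (pr p.1).2 p.2 z0) le_rfl)
  · have h1 := (hχ' 0 h0 z).2.congr (γ' := fun t => χ (pr t) 0 z) fun t ht => by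
      simp only [hpr, projIcc_of_mem _ ht]
    exact h1 t ht

/-! ### Liouville's theorem -/

/-- The symplectic form of phase space. -/
def sympl (n : ℕ) : LinearMap.BilinForm ℝ Φ :=
  LinearMap.mk₂ ℝ (fun h k : Φ => inner ℝ h.1 k.2 - inner ℝ h.2 k.1)
    (fun h h' k => by simp [inner_add_left]; ring)
    (fun c h k => by simp [inner_smul_left]; ring)
    (fun h k k' => by simp [inner_add_right]; ring)
    (fun c h k => by simp [inner_smul_right]; ring)

lemma sympl_apply (h k : Φ) : sympl n h k = inner ℝ h.1 k.2 - inner ℝ h.2 k.1 := rfl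

lemma sympl_swap (h k : Φ) : sympl n h k = -sympl n k h := by
  simp only [sympl_apply, real_inner_comm]; ring

lemma sympl_phDual (v : Φ) : sympl n (phDual j) v = pc j v := by
  rcases j with i | i <;> simp [sympl_apply, phDual, pc, dirX, dirXi, EuclideanSpace.inner_single_left]

lemma sympl_nondegenerate (n : ℕ) : (sympl n).Nondegenerate := by
  have h : ∀ x, (∀ y, sympl n x y = 0) → x = 0 := by
    intro x hx; have h1 := hx (0, x.1); have h2 := hx (x.2, 0)
    simp only [sympl_apply, inner_zero_right, sub_zero, zero_sub, neg_eq_zero,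
      inner_self_eq_zero] at h1 h2
    exact Prod.ext h1 h2
  exact ⟨h, fun y hy => h y fun x => by rw [sympl_swap, hy x, neg_zero]⟩

lemma abs_det_eq_one_of_sympl {A : Φ →ₗ[ℝ] Φ}
    (hA : ∀ h k, sympl n (A h) (A k) = sympl n h k) : |LinearMap.det A| = 1 := by
  set b := Module.finBasis ℝ Φ
  have hcomp : (sympl n).comp A A = sympl n := by
    exact LinearMap.ext fun h => LinearMap.ext fun k => hA h k
  have h1 := LinearMap.BilinForm.toMatrix_comp b b (sympl n) A A
  rw [hcomp] at h1
  have h2 := congrArg Matrix.det h1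
  rw [Matrix.det_mul, Matrix.det_mul, Matrix.det_transpose, LinearMap.det_toMatrix] at h2
  have h3 := (LinearMap.BilinForm.nondegenerate_iff_det_ne_zero b).1 (sympl_nondegenerate n)
  have h4 : LinearMap.det A ^ 2 = 1 := by
    have : (LinearMap.BilinForm.toMatrix b (sympl n)).det * (LinearMap.det A ^ 2 - 1) = 0 := by
      linear_combination -h2
    rcases mul_eq_zero.1 this with h | h
    · exact absurd h h3
    · linarith
  have h5 := sq_abs (LinearMap.det A)
  rw [h4] at h5
  exact (pow_eq_one_iff_of_nonneg (abs_nonneg _) two_ne_zero).1 h5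

lemma cont_sympl : Continuous fun p : Φ × Φ => sympl n p.1 p.2 := by
  simp only [sympl_apply]; fun_prop

instance isAddHaarMeasure_volume_phase : (volume : Measure Φ).IsAddHaarMeasure := by
  rw [volume_eq_prod]; infer_instance

lemma volume_image_eq_zero_of_lipschitz {f : Φ → Φ} {K : NNReal}
    (hf : LipschitzWith K f) {s : Set Φ} (hs : volume s = 0) : volume (f '' s) = 0 := by
  have e := Measure.isAddLeftInvariant_eq_smul (volume : Measure Φ)
    (Measure.hausdorffMeasure (Module.finrank ℝ Φ))
  have e' := Measure.isAddLeftInvariant_eq_smul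
    (Measure.hausdorffMeasure (Module.finrank ℝ Φ)) (volume : Measure Φ)
  have h1 : Measure.hausdorffMeasure (Module.finrank ℝ Φ) s = 0 := by
    rw [e', Measure.smul_apply, hs, smul_zero]
  have h2 := (hf.lipschitzOnWith (s := s)).hausdorffMeasure_image_le
    (d := Module.finrank ℝ Φ) (Nat.cast_nonneg _)
  rw [h1, mul_zero] at h2
  rw [e, Measure.smul_apply, le_antisymm h2 bot_le, smul_zero]

namespace IsPhaseFlow
lemma sympl_increment (h : IsPhaseFlow a X Y L) (ha : IsTimeSym a) (z : Φ) {η : ℝ}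
    (hη : 0 < η) : ∃ r, 0 < r ∧ ∀ u v, ‖u‖ ≤ r → ‖v‖ ≤ r → ∀ t ∈ 𝕋,
      |sympl n (X t (z + u) - X t z) (X t (z + v) - X t z) - sympl n u v| ≤ η * (‖u‖ * ‖v‖) := by
  have hL := h.one_le
  set D : ℝ := ((Fintype.card 𝕁 : ℕ) : ℝ) with hD
  set η' := η / (2 * (D ^ 2 + 1) * L ^ 2) with hη'
  have hη'0 : 0 < η' := by positivity
  have hXc : Continuous fun t => X t z := h.continuous.comp (by fun_prop : Continuous fun t => (t, z))
  obtain ⟨R, hR⟩ := isCompact_Icc.exists_bound_of_continuousOn (hXc.continuousOn (s := 𝕋))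
  have hG : Continuous fun p : ℝ × Φ => fun j l : 𝕁 =>
      pd l (pd j (a p.1)) p.2 :=
    continuous_pi fun j => continuous_pi fun l => ha.cont_partialD_partialD _ _
  have huc := ((isCompact_Icc (a := (0 : ℝ)) (b := 1)).prod
    (isCompact_closedBall (0 : Φ) (R + 1))).uniformContinuousOn_of_continuous hG.continuousOn
  obtain ⟨δ, hδ, hclose⟩ := Metric.uniformContinuousOn_iff.1 huc η' hη'0
  set ρ := min 1 (δ / 2) with hρ
  have hρ0 : 0 < ρ := lt_min one_pos (by linarith)
  -- the remainder of the derivatives of `a`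
  have hrem : ∀ t ∈ 𝕋, ∀ e, ‖e‖ ≤ ρ → ∀ j,
      |pd j (a t) (X t z + e) - pd j (a t) (X t z) -
        fderiv ℝ (pd j (a t)) (X t z) e| ≤ D * η' * ‖e‖ := by
    intro t ht e he j; have hs := contDiff_partialD (ha.smooth t) (ph j)
    have hd : Differentiable ℝ (pd j (a t)) := hs.differentiable (by simp)
    have key := (convex_closedBall (X t z) ρ).norm_image_sub_le_of_norm_fderiv_le (𝕜 := ℝ)
      (f := fun y => pd j (a t) y - fderiv ℝ (pd j (a t)) (X t z) y)
      (C := D * η') (x := X t z) (y := X t z + e)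
      (fun y _ => (hd y).sub (ContinuousLinearMap.differentiableAt _)) (fun y hy => ?_)
      (Metric.mem_closedBall_self hρ0.le) (by simpa using he)
    · rw [norm_eq_abs, add_sub_cancel_left] at key; refine le_trans (le_of_eq ?_) key
      rw [map_add]; ring
    · rw [fderiv_fun_sub (hd y) (ContinuousLinearMap.differentiableAt _), ContinuousLinearMap.fderiv]
      refine ContinuousLinearMap.opNorm_le_bound _ (by positivity) fun w => ?_
      rw [sub_apply, fderiv_eq_sum, fderiv_eq_sum, ← Finset.sum_sub_distrib]
      refine (norm_sum_le _ _).trans ?_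
      have hyR : y ∈ Metric.closedBall (0 : Φ) (R + 1) := by
        rw [mem_closedBall_zero_iff]; have h1 := hR t ht
        have h2 : ‖y - X t z‖ ≤ ρ := by simpa [dist_eq_norm] using hy
        have h3 : ‖y‖ ≤ ‖y - X t z‖ + ‖X t z‖ := by simpa using norm_add_le (y - X t z) (X t z)
        have := min_le_left 1 (δ / 2); linarith
      have hclo := hclose (t, y) ⟨ht, hyR⟩ (t, X t z) ⟨ht, by
        rw [mem_closedBall_zero_iff]; linarith [hR t ht]⟩ (by
        rw [Prod.dist_eq, dist_self, max_lt_iff]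
        exact ⟨hδ, (Metric.mem_closedBall.1 hy).trans_lt ((min_le_right _ _).trans_lt (by linarith))⟩)
      calc ∑ l, ‖pc l w * pd l (pd j (a t)) y -
            pc l w * pd l (pd j (a t)) (X t z)‖
          ≤ ∑ _l, η' * ‖w‖ := by
            refine sum_le_sum fun l _ => ?_; rw [← mul_sub, norm_mul, mul_comm]
            refine mul_le_mul ?_ (abs_pc_le l w) (norm_nonneg _) hη'0.le
            have h1 := (dist_le_pi_dist _ _ l).trans ((dist_le_pi_dist _ _ j).trans hclo.le)
            rwa [dist_eq_norm] at h1
        _ = D * η' * ‖w‖ := by simp [hD]; ring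
  refine ⟨ρ / L, by positivity, fun u v hu hv t ht => ?_⟩
  set du : ℝ → Φ := fun τ => X τ (z + u) - X τ z with hdu
  set dv : ℝ → Φ := fun τ => X τ (z + v) - X τ z with hdv
  have hbound : ∀ w, ∀ τ, ‖X τ (z + w) - X τ z‖ ≤ L * ‖w‖ := fun w τ => by
    simpa using h.lip τ (z + w) z
  have hsmall : ∀ w, ‖w‖ ≤ ρ / L → ∀ τ, ‖X τ (z + w) - X τ z‖ ≤ ρ := fun w hw τ =>
    (hbound w τ).trans (by rwa [← le_div_iff₀' (by linarith)])
  have hder : ∀ w, ∀ τ ∈ 𝕋, HasDerivWithinAt (fun τ => X τ (z + w) - X τ z)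
      (hamField a τ (X τ (z + w)) - hamField a τ (X τ z)) 𝕋 τ := fun w τ hτ =>
    (h.deriv (z + w) τ hτ).sub (h.deriv z τ hτ)
  have hfield : ∀ τ, ∀ p q w, sympl n (hamField a τ p - hamField a τ q) w =
      ∑ j, (pd j (a τ) p - pd j (a τ) q) * pc j w := by
    intro τ p q w; have hdi : Differentiable ℝ (a τ) := (ha.smooth τ).differentiable (by simp)
    rw [hamField_eq hdi, hamField_eq hdi, ← Finset.sum_sub_distrib, map_sum, LinearMap.sum_apply]
    refine sum_congr rfl fun j _ => ?_
    rw [← sub_smul, map_smul, LinearMap.smul_apply, sympl_phDual, smul_eq_mul]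
  have hderiv : ∀ τ ∈ 𝕋, HasDerivWithinAt (fun τ => sympl n (du τ) (dv τ))
      (sympl n (hamField a τ (X τ (z + u)) - hamField a τ (X τ z)) (dv τ) +
        sympl n (du τ) (hamField a τ (X τ (z + v)) - hamField a τ (X τ z))) 𝕋 τ := by
    intro τ hτ; have h1 := hder u τ hτ; have h2 := hder v τ hτ
    have a1 := (hasFDerivAt_fst.comp_hasDerivWithinAt τ h1)
    have a2 := (hasFDerivAt_snd.comp_hasDerivWithinAt τ h1)
    have b1 := (hasFDerivAt_fst.comp_hasDerivWithinAt τ h2)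
    have b2 := (hasFDerivAt_snd.comp_hasDerivWithinAt τ h2)
    have := (a1.inner ℝ b2).sub (a2.inner ℝ b1); refine this.congr_deriv ?_
    simp only [sympl_apply, hdu, hdv, Function.comp_apply, ContinuousLinearMap.coe_fst',
      ContinuousLinearMap.coe_snd']
    ring
  have hsym : ∀ τ, ∑ j, fderiv ℝ (pd j (a τ)) (X τ z) (du τ) * pc j (dv τ) =
      ∑ j, fderiv ℝ (pd j (a τ)) (X τ z) (dv τ) * pc j (du τ) := by
    intro τ; simp only [fderiv_eq_sum, sum_mul]; rw [Finset.sum_comm]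
    refine sum_congr rfl fun j _ => sum_congr rfl fun l _ => ?_
    rw [partialD_comm (ha.smooth τ) (ph j) (ph l)]; ring
  have hbd : ∀ τ ∈ Ico (0 : ℝ) 1,
      ‖sympl n (hamField a τ (X τ (z + u)) - hamField a τ (X τ z)) (dv τ) +
        sympl n (du τ) (hamField a τ (X τ (z + v)) - hamField a τ (X τ z))‖ ≤ η * (‖u‖ * ‖v‖) := by
    intro τ hτ; have hτ' := Ico_subset_Icc_self hτ; rw [sympl_swap (du τ), hfield, hfield]
    set r : Φ → 𝕁 → ℝ := fun e j =>
      pd j (a τ) (X τ z + e) - pd j (a τ) (X τ z) -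
        fderiv ℝ (pd j (a τ)) (X τ z) e with hr
    have eu : X τ (z + u) = X τ z + du τ := by simp [hdu]
    have ev : X τ (z + v) = X τ z + dv τ := by simp [hdv]
    have e1 : (∑ j, (pd j (a τ) (X τ (z + u)) - pd j (a τ) (X τ z)) *
        pc j (dv τ)) + -∑ j, (pd j (a τ) (X τ (z + v)) - pd j (a τ) (X τ z)) *
        pc j (du τ) = ∑ j, (r (du τ) j * pc j (dv τ) - r (dv τ) j * pc j (du τ)) := by
      have := hsym τ; simp only [hr, eu, ev, sub_mul, Finset.sum_sub_distrib] at this ⊢; linarith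
    rw [e1]; have nu := hbound u τ; have nv := hbound v τ
    have bu : ∀ j, |r (du τ) j| ≤ D * η' * (L * ‖u‖) := fun j =>
      (hrem τ hτ' (du τ) (hsmall u hu τ) j).trans (by gcongr)
    have bv : ∀ j, |r (dv τ) j| ≤ D * η' * (L * ‖v‖) := fun j =>
      (hrem τ hτ' (dv τ) (hsmall v hv τ) j).trans (by gcongr)
    calc ‖∑ j, (r (du τ) j * pc j (dv τ) - r (dv τ) j * pc j (du τ))‖
        ≤ ∑ _j, (D * η' * (L * ‖u‖) * (L * ‖v‖) + D * η' * (L * ‖v‖) * (L * ‖u‖)) := by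
          refine (norm_sum_le _ _).trans (sum_le_sum fun j _ => ?_)
          refine (norm_sub_le _ _).trans ?_; rw [norm_mul, norm_mul]
          have p1 := (abs_pc_le j (dv τ)).trans nv; have p2 := (abs_pc_le j (du τ)).trans nu
          exact add_le_add (mul_le_mul (bu j) p1 (abs_nonneg _) (by positivity))
            (mul_le_mul (bv j) p2 (abs_nonneg _) (by positivity))
      _ = 2 * D ^ 2 * L ^ 2 * η' * (‖u‖ * ‖v‖) := by simp [hD]; ring
      _ ≤ η * (‖u‖ * ‖v‖) := by
          gcongr; rw [hη', mul_div_assoc', div_le_iff₀ (by positivity)]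
          nlinarith [mul_pos hη (by positivity : 0 < L ^ 2)]
  have := norm_image_sub_le_of_norm_deriv_le_segment' hderiv hbd t ht
  simp only [hdu, hdv, h.zero, add_sub_cancel_left, norm_eq_abs] at this
  refine this.trans ?_
  rw [sub_zero]
  exact mul_le_of_le_one_right (by positivity) ht.2

lemma sympl_fderiv (h : IsPhaseFlow a X Y L) (ha : IsTimeSym a) {t : ℝ}
    (ht : t ∈ 𝕋) {z : Φ} {A : Φ →L[ℝ] Φ}
    (hA : HasFDerivAt (X t) A z) (u v : Φ) : sympl n (A u) (A v) = sympl n u v := by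
  refine eq_of_abs_sub_le_all fun ε hε => ?_
  set η := ε / (‖u‖ * ‖v‖ + 1) with hη
  have hη0 : 0 < η := by positivity
  obtain ⟨r, hr, hb⟩ := h.sympl_increment ha z hη0
  have hc : Tendsto (fun m : ℕ => ‖(m : ℝ)‖) atTop atTop := by
    simpa using tendsto_natCast_atTop_atTop (R := ℝ)
  have lu := hA.lim u hc
  have lv := hA.lim v hc
  have l1 := (cont_sympl.tendsto (A u, A v)).comp (lu.prodMk_nhds lv)
  have l2 := (l1.sub_const (sympl n u v)).abs
  have sm : ∀ w : Φ, ∀ᶠ m : ℕ in atTop, ‖(m : ℝ)⁻¹ • w‖ ≤ r := by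
    intro w
    have : Tendsto (fun m : ℕ => ‖(m : ℝ)⁻¹ • w‖) atTop (nhds 0) := by
      have := ((tendsto_inv_atTop_nhds_zero_nat (𝕜 := ℝ)).smul_const w).norm; simpa using this
    exact (this.eventually (gt_mem_nhds hr)).mono fun _ h => h.le
  refine le_of_tendsto l2 ?_
  filter_upwards [sm u, sm v, Filter.eventually_gt_atTop 0] with m h1 h2 hm
  have hm' : (0 : ℝ) < m := Nat.cast_pos.2 hm
  have h3 := hb _ _ h1 h2 t ht
  simp only [Function.comp_apply, map_smul, LinearMap.smul_apply, smul_eq_mul] at h3 ⊢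
  set S := sympl n (X t (z + (m : ℝ)⁻¹ • u) - X t z) (X t (z + (m : ℝ)⁻¹ • v) - X t z)
  have e : (m : ℝ) * (m * S) - sympl n u v =
      m ^ 2 * (S - (m : ℝ)⁻¹ * ((m : ℝ)⁻¹ * sympl n u v)) := by field_simp
  rw [e, abs_mul, abs_of_pos (by positivity)]
  rw [norm_smul, norm_smul, norm_inv, norm_of_nonneg hm'.le] at h3
  calc (m : ℝ) ^ 2 * |S - (m : ℝ)⁻¹ * ((m : ℝ)⁻¹ * sympl n u v)|
      ≤ m ^ 2 * (η * ((m : ℝ)⁻¹ * ‖u‖ * ((m : ℝ)⁻¹ * ‖v‖))) := by gcongr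
    _ = η * (‖u‖ * ‖v‖) := by field_simp
    _ ≤ ε := by
      rw [hη, div_mul_eq_mul_div, div_le_iff₀ (by positivity)]; nlinarith

/-- **Liouville's theorem**: the Hamilton flow preserves the volume. -/
lemma measurePreserving (h : IsPhaseFlow a X Y L) (ha : IsTimeSym a) {t : ℝ}
    (ht : t ∈ 𝕋) : MeasurePreserving (X t) := by
  have hL := h.one_le
  have hlip : LipschitzWith ⟨L, by linarith⟩ (X t) := LipschitzWith.of_dist_le_mul fun z w => by
    exact h.lip t z w
  have hinj : Function.Injective (X t) := fun z w hzw => by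
    rw [← h.left_inv t z, hzw, h.left_inv]
  have himage : ∀ s, MeasurableSet s → volume (X t '' s) = volume s := by
    intro s hs; set D : Set Φ := {z | DifferentiableAt ℝ (X t) z} with hD
    have hDm : MeasurableSet D := measurableSet_of_differentiableAt ℝ (X t)
    have hDc : volume Dᶜ = 0 := hlip.ae_differentiableAt
    have h1 : volume (s \ D) = 0 := measure_mono_null (fun z hz => hz.2) hDc
    have h2 := volume_image_eq_zero_of_lipschitz hlip h1
    have h3 : volume (X t '' (s ∩ D)) = volume (s ∩ D) := by
      rw [← lintegral_abs_det_fderiv_eq_addHaar_image volume (hs.inter hDm)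
        (f' := fun z => fderiv ℝ (X t) z)
        (fun z hz => (show DifferentiableAt ℝ (X t) z from hz.2).hasFDerivAt.hasFDerivWithinAt)
        hinj.injOn, ← setLIntegral_one]
      refine setLIntegral_congr_fun (hs.inter hDm) fun z hz => ?_
      have hz' : DifferentiableAt ℝ (X t) z := hz.2
      have := abs_det_eq_one_of_sympl (A := (fderiv ℝ (X t) z : Φ →ₗ[ℝ] Φ))
        (fun u v => h.sympl_fderiv ha ht hz'.hasFDerivAt u v)
      simp only [ContinuousLinearMap.det, this, ENNReal.ofReal_one]
    refine le_antisymm ?_ ?_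
    · calc volume (X t '' s) ≤ volume (X t '' (s ∩ D)) + volume (X t '' (s \ D)) := by
            rw [← inter_union_sdiff s D, image_union, inter_union_sdiff]; exact measure_union_le _ _
        _ ≤ volume s := by rw [h2, add_zero, h3]; exact measure_mono inter_subset_left
    · calc volume s ≤ volume (s ∩ D) + volume (s \ D) := measure_le_inter_add_sdiff _ _ _
        _ ≤ volume (X t '' s) := by
            rw [h1, add_zero, ← h3]; exact measure_mono (image_mono inter_subset_left)
  have hmeas : Measurable (X t) := hlip.continuous.measurable
  refine ⟨hmeas, Measure.ext fun s hs => ?_⟩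
  rw [Measure.map_apply hmeas hs, ← himage _ (hmeas hs), image_preimage_eq]
  exact fun z => ⟨Y t z, h.right_inv t z⟩

end IsPhaseFlow

/-! ### Directional derivatives -/

section Directional
variable {E F : Type*} [NormedAddCommGroup E] [NormedSpace ℝ E] [NormedAddCommGroup F]
  [NormedSpace ℝ F]

/-- The directional derivative. -/
def dirD (e : E) (f : E → F) : E → F := fun x => fderiv ℝ f x e

lemma contDiff_dirD {f : E → F} (hf : ContDiff ℝ ∞ f) (e : E) :
    ContDiff ℝ ∞ (dirD e f) :=
  (hf.fderiv_right (by simp)).clm_apply contDiff_const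

lemma contDiff_iterD {f : E → F} (hf : ContDiff ℝ ∞ f) (e : E) (m : ℕ) :
    ContDiff ℝ ∞ ((dirD e)^[m] f) := by
  induction m generalizing f with
  | zero => exact hf
  | succ m ih => exact ih (contDiff_dirD hf e)

lemma dirD_add {f g : E → F} (hf : ContDiff ℝ ∞ f) (hg : ContDiff ℝ ∞ g) (e : E) :
    dirD e (fun x => f x + g x) = fun x => dirD e f x + dirD e g x := by
  funext x
  rw [dirD, fderiv_fun_add (hf.differentiable (by simp) x) (hg.differentiable (by simp) x)]
  rfl

lemma iterD_add {f g : E → F} (hf : ContDiff ℝ ∞ f) (hg : ContDiff ℝ ∞ g) (e : E)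
    (m : ℕ) : (dirD e)^[m] (fun x => f x + g x) =
      fun x => (dirD e)^[m] f x + (dirD e)^[m] g x := by
  induction m generalizing f g with
  | zero => rfl
  | succ m ih =>
    rw [iterate_succ_apply, dirD_add hf hg,
      ih (contDiff_dirD hf e) (contDiff_dirD hg e)]
    rfl

lemma dirD_mul {A : Type*} [NormedCommRing A] [NormedAlgebra ℝ A] {f g : E → A} (hf : ContDiff ℝ ∞ f) (hg : ContDiff ℝ ∞ g) (e : E) :
    dirD e (fun x => f x * g x) = fun x => dirD e f x * g x + f x * dirD e g x := by
  funext x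
  rw [dirD, fderiv_fun_mul (hf.differentiable (by simp) x) (hg.differentiable (by simp) x)]
  simp only [dirD, add_apply, smul_apply, smul_eq_mul]
  ring

lemma norm_iterD_mul_le {A : Type*} [NormedCommRing A] [NormedAlgebra ℝ A]
    {f g : E → A} (hf : ContDiff ℝ ∞ f) (hg : ContDiff ℝ ∞ g)
    (e : E) (m : ℕ) (x : E) {G : ℝ} (hG : ∀ j ≤ m, ‖(dirD e)^[j] g x‖ ≤ G) :
    ‖(dirD e)^[m] (fun x => f x * g x) x‖ ≤
      2 ^ m * ((∑ i ∈ Finset.range (m + 1), ‖(dirD e)^[i] f x‖) * G) := by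
  induction m generalizing f g with
  | zero =>
    have := hG 0 le_rfl; simp only [Function.iterate_zero, id] at this
    simp only [Function.iterate_zero, id, pow_zero, one_mul, zero_add, Finset.sum_range_one]
    exact (norm_mul_le _ _).trans (by gcongr)
  | succ m ih =>
    have hf' := contDiff_dirD hf e; have hg' := contDiff_dirD hg e
    have hG0 : 0 ≤ G := (norm_nonneg _).trans (hG 0 (Nat.zero_le _))
    rw [iterate_succ_apply, dirD_mul hf hg,
      iterD_add (hf'.mul hg) (hf.mul hg')]
    refine (norm_add_le _ _).trans ?_
    have h1 := ih hf' hg fun j hj => hG j (hj.trans (Nat.le_succ m))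
    have h2 := ih hf hg' fun j hj => by
      have := hG (j + 1) (Nat.succ_le_succ hj)
      rwa [iterate_succ_apply] at this
    have e1 : ∑ i ∈ Finset.range (m + 1), ‖(dirD e)^[i] (dirD e f) x‖ ≤
        ∑ i ∈ Finset.range (m + 2), ‖(dirD e)^[i] f x‖ := by
      rw [Finset.sum_range_succ' _ (m + 1)]; simp
    have e2 : ∑ i ∈ Finset.range (m + 1), ‖(dirD e)^[i] f x‖ ≤
        ∑ i ∈ Finset.range (m + 2), ‖(dirD e)^[i] f x‖ := by
      rw [Finset.sum_range_succ _ (m + 1)]; exact le_add_of_nonneg_right (norm_nonneg _)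
    set S := ∑ i ∈ Finset.range (m + 2), ‖(dirD e)^[i] f x‖
    calc _ ≤ 2 ^ m * (S * G) + 2 ^ m * (S * G) := by
          refine add_le_add (h1.trans ?_) (h2.trans ?_) <;> gcongr
      _ = 2 ^ (m + 1) * (S * G) := by ring

lemma iterD_ofReal {q : E → ℝ} (hq : ContDiff ℝ ∞ q) (e : E) (m : ℕ) :
    (dirD e)^[m] (fun x => (q x : ℂ)) = fun x => (((dirD e)^[m] q x : ℝ) : ℂ) := by
  induction m generalizing q with
  | zero => rfl
  | succ m ih =>
    rw [iterate_succ_apply, iterate_succ_apply, ← ih (contDiff_dirD hq e)]; congr 1; funext x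
    have := (ofRealCLM.hasFDerivAt.comp x (hq.differentiable (by simp) x).hasFDerivAt).fderiv
    change fderiv ℝ (ofRealCLM ∘ q) x e = _; rw [this]; rfl

lemma iterD_comp_sub (f : E → F) (e c : E) (m : ℕ) :
    (dirD e)^[m] (fun x => f (x - c)) = fun x => (dirD e)^[m] f (x - c) := by
  induction m generalizing f with
  | zero => rfl
  | succ m ih =>
    rw [iterate_succ_apply, iterate_succ_apply, ← ih (dirD e f)]; congr 1; funext x
    simp only [dirD, fderiv_comp_sub]

lemma iterD_comp_smul {f : E → F} (hf : ContDiff ℝ ∞ f) (e : E) (s : ℝ) (m : ℕ) :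
    (dirD e)^[m] (fun x => f (s • x)) = fun x => s ^ m • (dirD e)^[m] f (s • x) := by
  induction m generalizing f with
  | zero => simp
  | succ m ih =>
    have h1 : dirD e (fun x => f (s • x)) = fun x => (s • dirD e f) (s • x) := by
      funext x
      have h := ((hf.differentiable (by simp) (s • x)).hasFDerivAt.comp x
        ((hasFDerivAt_id x).const_smul s)).fderiv
      change fderiv ℝ (f ∘ fun x => s • x) x e = _; erw [h]; simp [dirD]
    have h2 : ∀ (m : ℕ) (g : E → F), (dirD e)^[m] (s • g) = s • (dirD e)^[m] g := by
      intro m; induction m with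
      | zero => intro g; rfl
      | succ m ih' =>
        intro g; rw [iterate_succ_apply, iterate_succ_apply, ← ih']; congr 1; funext x
        simp only [dirD, Pi.smul_apply]; rw [fderiv_const_smul_field s]; rfl
    rw [iterate_succ_apply, h1,
      ih (f := s • dirD e f) ((contDiff_dirD hf e).const_smul s), h2]
    simp only [Pi.smul_apply, smul_smul, pow_succ, iterate_succ_apply]

end Directional

/-! ### Integration by parts against an oscillating factor -/

section Oscillatory
set_option linter.unusedSectionVars false
variable {E : Type*} [NormedAddCommGroup E] [NormedSpace ℝ E] [FiniteDimensional ℝ E]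
  [MeasurableSpace E] [BorelSpace E] {μ : Measure E} [μ.IsAddHaarMeasure]

lemma hasFDerivAt_cexp_mul_I (l : E →L[ℝ] ℝ) (x : E) :
    HasFDerivAt (fun x => exp ((l x : ℂ) * I))
      ((exp ((l x : ℂ) * I) * I) • (ofRealCLM ∘L l)) x := by
  have h1 : HasFDerivAt (fun x => (l x : ℂ) * I) (I • (ofRealCLM ∘L l)) x := by
    have h := (ofRealCLM ∘L l).hasFDerivAt (x := x); exact (h.mul_const I)
  have := h1.cexp
  rw [smul_smul] at this
  exact this

lemma norm_cexp_ofReal_mul_I (l : ℝ) : ‖exp ((l : ℂ) * I)‖ = 1 :=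
  norm_exp_ofReal_mul_I l

lemma integrable_cexp_mul (l : E →L[ℝ] ℝ) {f : E → ℂ} (hf : Integrable f μ) :
    Integrable (fun x => exp ((l x : ℂ) * I) * f x) μ := by
  have hc : Continuous fun x => exp ((l x : ℂ) * I) := by fun_prop
  refine hf.mono (hc.aestronglyMeasurable.mul hf.1) (.of_forall fun x => ?_)
  rw [norm_mul, norm_cexp_ofReal_mul_I, one_mul]

lemma integral_cexp_mul_dirD (l : E →L[ℝ] ℝ) {f : E → ℂ} (hf : ContDiff ℝ ∞ f) (e : E)
    (h0 : Integrable f μ) (h1 : Integrable (dirD e f) μ) :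
    ∫ x, exp ((l x : ℂ) * I) * dirD e f x ∂μ =
      -(I * l e) * ∫ x, exp ((l x : ℂ) * I) * f x ∂μ := by
  have hd : ∀ x, fderiv ℝ (fun x => exp ((l x : ℂ) * I)) x e = (I * l e) * exp ((l x : ℂ) * I) := by
    intro x; rw [(hasFDerivAt_cexp_mul_I l x).fderiv]
    simp only [smul_apply, ContinuousLinearMap.comp_apply,
      Complex.ofRealCLM_apply, smul_eq_mul]
    ring
  have := integral_mul_fderiv_eq_neg_fderiv_mul_of_integrable (μ := μ) (v := e)
    (f := fun x => exp ((l x : ℂ) * I)) (g := f) ?_ (integrable_cexp_mul l h1)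
    (integrable_cexp_mul l h0) (fun x _ => (hasFDerivAt_cexp_mul_I l x).differentiableAt)
    (fun x _ => hf.differentiable (by simp) x)
  · rw [show (fun x => exp ((l x : ℂ) * I) * dirD e f x) =
      fun x => exp ((l x : ℂ) * I) * fderiv ℝ f x e from rfl, this]
    simp only [hd, mul_assoc, integral_const_mul, neg_mul]
  · simp only [hd, mul_assoc]; exact ((integrable_cexp_mul l h0).const_mul _).const_mul _

lemma norm_integral_cexp_mul_le (l : E →L[ℝ] ℝ) {f : E → ℂ} (hf : ContDiff ℝ ∞ f) (e : E)
    (m : ℕ) (hi : ∀ i ≤ m, Integrable ((dirD e)^[i] f) μ) :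
    |l e| ^ m * ‖∫ x, exp ((l x : ℂ) * I) * f x ∂μ‖ ≤
      ∫ x, ‖(dirD e)^[m] f x‖ ∂μ := by
  have key : |l e| ^ m * ‖∫ x, exp ((l x : ℂ) * I) * f x ∂μ‖ =
      ‖∫ x, exp ((l x : ℂ) * I) * (dirD e)^[m] f x ∂μ‖ := by
    induction m generalizing f with
    | zero => simp
    | succ m ih =>
      simp only [iterate_succ_apply]
      have hi' : ∀ i ≤ m, Integrable ((dirD e)^[i] (dirD e f)) μ := fun i hi'' => by
        have := hi (i + 1) (Nat.succ_le_succ hi'')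
        rwa [iterate_succ_apply] at this
      rw [← ih (contDiff_dirD hf e) hi', integral_cexp_mul_dirD l hf e (hi 0 (Nat.zero_le _))
        (hi 1 (Nat.succ_le_succ (Nat.zero_le _)))]
      simp only [norm_mul, norm_neg, norm_I, one_mul, norm_real, norm_eq_abs]; ring
  rw [key]
  refine (norm_integral_le_integral_norm _).trans (le_of_eq ?_)
  simp

end Oscillatory

/-! ### Polynomial weights -/

section Weights
variable {E : Type*} [NormedAddCommGroup E]

/-- The weight `(1 + ‖x‖) ^ (-K)`. -/
def wt (K : ℕ) (x : E) : ℝ := ((1 + ‖x‖) ^ K)⁻¹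

lemma wt_pos (K : ℕ) (x : E) : 0 < wt K x := by unfold wt; positivity

lemma wt_nonneg (K : ℕ) (x : E) : 0 ≤ wt K x := (wt_pos K x).le

lemma wt_le_one (K : ℕ) (x : E) : wt K x ≤ 1 :=
  inv_le_one_of_one_le₀ (one_le_pow₀ (by linarith [norm_nonneg x]))

lemma wt_neg (K : ℕ) (x : E) : wt K (-x) = wt K x := by simp [wt]

lemma wt_sub_comm (K : ℕ) (x y : E) : wt K (x - y) = wt K (y - x) := by
  rw [← wt_neg, neg_sub]

@[fun_prop]
lemma cont_wt (K : ℕ) : Continuous (wt K : E → ℝ) := by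
  exact Continuous.inv₀ (by fun_prop) fun x => by positivity

lemma wt_add (K K' : ℕ) (x : E) : wt (K + K') x = wt K x * wt K' x := by
  simp [wt, pow_add, mul_comm]

lemma wt_anti {K K' : ℕ} (h : K ≤ K') (x : E) : wt K' x ≤ wt K x := by
  unfold wt
  gcongr
  · linarith [norm_nonneg x]

lemma wt_mul_pow (K : ℕ) (x : E) : wt K x * (1 + ‖x‖) ^ K = 1 :=
  inv_mul_cancel₀ (by positivity)

lemma le_mul_wt_iff {x : E} {a C : ℝ} : a ≤ C * wt K x ↔ a * (1 + ‖x‖) ^ K ≤ C := by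
  rw [wt, ← div_eq_mul_inv, le_div_iff₀ (by positivity)]

/-- Peetre's inequality: comparison of weights at points whose distance is controlled. -/
lemma wt_le_of_norm_le {F : Type*} [NormedAddCommGroup F] (K : ℕ) {x : E} {y : F} {c : ℝ}
    (hc : 1 ≤ c) (h : ‖y‖ ≤ c * ‖x‖) : wt K x ≤ c ^ K * wt K y := by
  rw [le_mul_wt_iff, wt, inv_mul_le_iff₀ (by positivity), ← mul_pow]
  gcongr
  nlinarith [norm_nonneg x]

lemma wt_sub_le (K : ℕ) (x y : E) : wt K (x - y) ≤ (1 + ‖y‖) ^ K * wt K x := by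
  rw [le_mul_wt_iff, wt, inv_mul_le_iff₀ (by positivity), ← mul_pow]
  gcongr
  nlinarith [norm_sub_norm_le x y, mul_nonneg (norm_nonneg (x - y)) (norm_nonneg y)]

lemma wt_two_smul_sub_le [NormedSpace ℝ E] (K : ℕ) (x y : E) :
    wt K ((2 : ℝ) • x - y) ≤ (1 + ‖y‖) ^ K * wt K x := by
  refine (wt_sub_le K _ y).trans (mul_le_mul_of_nonneg_left ?_ (by positivity))
  simpa using wt_le_of_norm_le K le_rfl (x := (2 : ℝ) • x) (y := x) (by
    rw [norm_smul, norm_of_nonneg zero_le_two]; linarith [norm_nonneg x])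

lemma wt_mul_wt_le (K : ℕ) (x y : E) : wt K x * wt K y ≤ 2 ^ K * wt K (x + y) * (wt K x + wt K y) := by
  have h : ∀ u v : E, ‖u‖ ≤ ‖v‖ → wt K v ≤ 2 ^ K * wt K (u + v) := fun u v huv =>
    wt_le_of_norm_le K one_le_two ((norm_add_le u v).trans (by linarith))
  have hx := wt_nonneg K x
  have hy := wt_nonneg K y
  have hz := wt_nonneg K (x + y)
  rcases le_total ‖x‖ ‖y‖ with hxy | hxy
  · have := mul_le_mul_of_nonneg_left (h x y hxy) hx
    have := mul_nonneg (mul_nonneg (pow_nonneg zero_le_two K) hz) hy; nlinarith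
  · have := mul_le_mul_of_nonneg_left (h y x hxy) hy; rw [add_comm y x] at this
    have := mul_nonneg (mul_nonneg (pow_nonneg zero_le_two K) hz) hx; nlinarith

variable [NormedSpace ℝ E] [FiniteDimensional ℝ E] [MeasurableSpace E] [BorelSpace E]
  {μ : Measure E} [μ.IsAddHaarMeasure]

lemma integrable_wt (hK : Module.finrank ℝ E < K) : Integrable (wt K : E → ℝ) μ := by
  have := integrable_one_add_norm (μ := μ) (E := E) (r := K) (by exact_mod_cast hK)
  refine this.congr (.of_forall fun x => ?_)
  simp only [wt]
  simp

lemma integrable_wt_sub (hK : Module.finrank ℝ E < K) (z : E) :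
    Integrable (fun w => wt K (z - w)) μ := (integrable_wt hK).comp_sub_left z

lemma integral_wt_mul_wt_le (hK : Module.finrank ℝ E < K) (z u : E) :
    ∫ w, wt K (z - w) * wt K (w - u) ∂μ ≤ 2 ^ (K + 1) * (∫ w, wt K w ∂μ) * wt K (z - u) := by
  have i1 := integrable_wt_sub (μ := μ) hK z
  have i2 : Integrable (fun w => wt K (w - u)) μ := (integrable_wt hK).comp_sub_right u
  have e1 : ∫ w, wt K (z - w) ∂μ = ∫ w, wt K w ∂μ := integral_sub_left_eq_self (wt K) μ z
  have e2 : ∫ w, wt K (w - u) ∂μ = ∫ w, wt K w ∂μ := integral_sub_right_eq_self (wt K) u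
  calc ∫ w, wt K (z - w) * wt K (w - u) ∂μ
      ≤ ∫ w, 2 ^ K * wt K (z - u) * (wt K (z - w) + wt K (w - u)) ∂μ := by
        refine integral_mono_of_nonneg (.of_forall fun w =>
          mul_nonneg (wt_nonneg _ _) (wt_nonneg _ _)) ((i1.add i2).const_mul _)
          (.of_forall fun w => ?_)
        have := wt_mul_wt_le K (z - w) (w - u)
        rwa [sub_add_sub_cancel] at this
    _ = _ := by
        rw [integral_const_mul, integral_add i1 i2, e1, e2]; ring

lemma integrable_wt_mul_wt (hK : Module.finrank ℝ E < K) (z u : E) :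
    Integrable (fun w => wt K (z - w) * wt K (w - u)) μ := by
  refine (integrable_wt_sub (μ := μ) hK z).mono'
    (by fun_prop : Continuous fun w => wt K (z - w) * wt K (w - u)).aestronglyMeasurable
    (.of_forall fun w => ?_)
  rw [norm_of_nonneg (mul_nonneg (wt_nonneg _ _) (wt_nonneg _ _))]
  exact mul_le_of_le_one_right (wt_nonneg _ _) (wt_le_one _ _)

end Weights

/-! ### Gaussians as Schwartz functions -/

section Schwartz
variable {E F : Type*} [NormedAddCommGroup E] [NormedSpace ℝ E] [NormedAddCommGroup F]
  [NormedSpace ℝ F]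

lemma pow_mul_exp_neg_sq_le {b : ℝ} (hb : 0 < b) (k : ℕ) :
    ∃ C, 0 ≤ C ∧ ∀ r, 0 ≤ r → (1 + r) ^ k * rexp (-b * r ^ 2) ≤ C := by
  refine ⟨2 ^ k * (1 + k.factorial / b ^ k), by positivity, fun r hr => ?_⟩
  have h1 : (b * r ^ 2) ^ k / k.factorial ≤ rexp (b * r ^ 2) :=
    Real.pow_div_factorial_le_exp _ (by positivity) k
  have h2 : (r ^ 2) ^ k * rexp (-b * r ^ 2) ≤ k.factorial / b ^ k := by
    rw [neg_mul, Real.exp_neg, ← div_eq_mul_inv, div_le_div_iff₀ (Real.exp_pos _) (by positivity)]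
    rw [div_le_iff₀ (by positivity), mul_pow] at h1; linarith
  have h3 : rexp (-b * r ^ 2) ≤ 1 := by
    rw [Real.exp_le_one_iff]; nlinarith [sq_nonneg r]
  have h4 : (1 + r) ^ k ≤ 2 ^ k * (1 + (r ^ 2) ^ k) := by
    rcases le_total r 1 with h | h
    · calc (1 + r) ^ k ≤ 2 ^ k := by gcongr; linarith
        _ ≤ _ := le_mul_of_one_le_right (by positivity) (by linarith [pow_nonneg (sq_nonneg r) k])
    · calc (1 + r) ^ k ≤ (2 * r ^ 2) ^ k := by gcongr; nlinarith
        _ = 2 ^ k * (r ^ 2) ^ k := mul_pow _ _ _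
        _ ≤ _ := by gcongr; linarith
  calc (1 + r) ^ k * rexp (-b * r ^ 2) ≤ 2 ^ k * (1 + (r ^ 2) ^ k) * rexp (-b * r ^ 2) := by
        gcongr
    _ = 2 ^ k * (rexp (-b * r ^ 2) + (r ^ 2) ^ k * rexp (-b * r ^ 2)) := by ring
    _ ≤ _ := by gcongr

lemma norm_iteratedFDeriv_real_exp (i : ℕ) (x : ℝ) :
    ‖iteratedFDeriv ℝ i rexp x‖ = rexp x := by
  rw [norm_iteratedFDeriv_eq_norm_iteratedDeriv, iteratedDeriv_eq_iterate, Real.iter_deriv_exp,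
    norm_of_nonneg (Real.exp_pos x).le]

/-- The exponential of a function of temperate growth that tends to `-∞` quadratically. -/
def expSchwartz (h : E → ℝ) (hh : h.HasTemperateGrowth) (b : ℝ) (hb : 0 < b)
    (hle : ∀ x, h x ≤ -b * ‖x‖ ^ 2) : 𝓢(E, ℝ) where
  toFun x := rexp (h x)
  smooth' := Real.contDiff_exp.comp hh.1
  decay' := by
    intro k m; obtain ⟨l, C, hC0, hC⟩ := hh.norm_iteratedFDeriv_le_uniform m
    obtain ⟨C', hC'0, hC'⟩ := pow_mul_exp_neg_sq_le hb (k + l * m)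
    refine ⟨m.factorial * (1 + C) ^ m * C', fun x => ?_⟩
    have h1 := norm_iteratedFDeriv_comp_le (n := m) (N := ∞) Real.contDiff_exp hh.1
      (by exact_mod_cast le_top) x
      (C := rexp (h x)) (D := (1 + C) * (1 + ‖x‖) ^ l)
      (fun i _ => (norm_iteratedFDeriv_real_exp i _).le) (fun i hi1 him => by
        refine (hC i him x).trans ?_
        have h2 : 1 ≤ (1 + C) * (1 + ‖x‖) ^ l :=
          one_le_mul_of_one_le_of_one_le (by linarith) (one_le_pow₀ (by linarith [norm_nonneg x]))
        calc C * (1 + ‖x‖) ^ l ≤ ((1 + C) * (1 + ‖x‖) ^ l) ^ 1 := by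
              rw [pow_one]; gcongr; linarith
          _ ≤ _ := pow_le_pow_right₀ h2 hi1)
    have h3 := hC' ‖x‖ (norm_nonneg x)
    calc ‖x‖ ^ k * ‖iteratedFDeriv ℝ m (rexp ∘ h) x‖
        ≤ (1 + ‖x‖) ^ k * (m.factorial * rexp (-b * ‖x‖ ^ 2) * ((1 + C) * (1 + ‖x‖) ^ l) ^ m) := by
          gcongr
          · linarith
          · refine h1.trans ?_; gcongr; exact hle x
      _ = m.factorial * (1 + C) ^ m * ((1 + ‖x‖) ^ (k + l * m) * rexp (-b * ‖x‖ ^ 2)) := by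
          rw [mul_pow, ← pow_mul, pow_add]; ring
      _ ≤ _ := by gcongr

lemma hasTemperateGrowth_cexp_I : (fun s : ℝ => exp (s * I)).HasTemperateGrowth := by
  have hs : ContDiff ℝ ∞ fun s : ℝ => exp (s * I) := by
    have : ContDiff ℝ ∞ fun s : ℝ => (s : ℂ) := ofRealCLM.contDiff
    exact (this.mul contDiff_const).cexp
  refine ⟨hs, fun m => ⟨0, 1, fun s => ?_⟩⟩
  have hd : ∀ s : ℝ, HasDerivAt (fun s : ℝ => exp (s * I)) (exp (s * I) * I) s := fun s => by
    have := ((ofRealCLM.hasDerivAt (x := s)).mul_const I).cexp; simpa using this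
  have key : iteratedDeriv m (fun s : ℝ => exp (s * I)) =
      fun s : ℝ => exp (s * I) * I ^ m := by
    induction m with
    | zero => simp
    | succ m ih =>
      rw [iteratedDeriv_succ, ih]; funext s; rw [((hd s).mul_const _).deriv]; ring
  rw [norm_iteratedFDeriv_eq_norm_iteratedDeriv, key]
  simp [norm_exp_ofReal_mul_I]

lemma schwartz_coe_iterD (φ : 𝓢(E, F)) (e : E) (m : ℕ) :
    ∃ ψ : 𝓢(E, F), (ψ : E → F) = (dirD e)^[m] φ := by
  induction m generalizing φ with
  | zero => exact ⟨φ, rfl⟩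
  | succ m ih =>
    obtain ⟨ψ, hψ⟩ := ih (SchwartzMap.evalCLM ℝ E F e (SchwartzMap.fderivCLM ℝ E F φ))
    exact ⟨ψ, by rw [hψ]; rfl⟩

lemma schwartz_norm_le_wt (φ : 𝓢(E, F)) (K : ℕ) :
    ∃ C, 0 ≤ C ∧ ∀ x, ‖φ x‖ ≤ C * wt K x := by
  refine ⟨2 ^ K * (Finset.Iic (K, 0)).sup (fun m => SchwartzMap.seminorm ℝ m.1 m.2) φ,
    by positivity, fun x => ?_⟩
  have := SchwartzMap.one_add_le_sup_seminorm_apply (𝕜 := ℝ) (m := (K, 0)) (k := K) (n := 0)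
    le_rfl le_rfl φ x
  rw [norm_iteratedFDeriv_zero] at this
  rw [le_mul_wt_iff, mul_comm]
  exact this

lemma schwartz_norm_iterD_le_wt (φ : 𝓢(E, F)) (e : E) (m K : ℕ) :
    ∃ C, 0 ≤ C ∧ ∀ i ≤ m, ∀ x, ‖(dirD e)^[i] φ x‖ ≤ C * wt K x := by
  have : ∀ i, ∃ C, 0 ≤ C ∧ ∀ x, ‖(dirD e)^[i] φ x‖ ≤ C * wt K x := fun i => by
    obtain ⟨ψ, hψ⟩ := schwartz_coe_iterD φ e i; rw [← hψ]; exact schwartz_norm_le_wt ψ K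
  choose C hC0 hC using this
  refine ⟨∑ i ∈ Finset.range (m + 1), C i, sum_nonneg fun i _ => hC0 i, fun i hi x =>
    (hC i x).trans ?_⟩
  gcongr
  · exact wt_nonneg _ _
  · exact single_le_sum (f := C) (fun i _ => hC0 i) (Finset.mem_range.2 (Nat.lt_succ_of_le hi))

end Schwartz

/-! ### Coherent states and the reproducing kernel -/

/-- The Gaussian `exp (-b |x|²)` as a Schwartz function. -/
def gaussianSchwartz (n : ℕ) (b : ℝ) (hb : 0 < b) : 𝓢(Pos n, ℂ) :=
  (expSchwartz (fun x : Pos n => -b * ‖x‖ ^ 2)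
    ((Function.HasTemperateGrowth.const (-b)).mul (Function.hasTemperateGrowth_norm_sq _)) b hb
    (fun _ => le_rfl)).postcompCLM ofRealCLM

lemma gaussianSchwartz_apply (b : ℝ) (hb : 0 < b) (x : Pos n) :
    gaussianSchwartz n b hb x = (rexp (-b * ‖x‖ ^ 2) : ℂ) := rfl

lemma hasTemperateGrowth_phase (w : Φ) :
    (fun y => cis (inner ℝ w.2 (y - w.1))).HasTemperateGrowth := by
  have h1 : (fun y => (inner ℝ w.2 (y - w.1) : ℝ)).HasTemperateGrowth := by fun_prop
  exact hasTemperateGrowth_cexp_I.comp h1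

/-- The coherent state centred at the phase space point `w`. -/
def coherent (w : Φ) : 𝓢(Pos n, ℂ) :=
  (bargmannConst n : ℂ) • SchwartzMap.smulLeftCLM ℂ
    (fun y : Pos n => cis (inner ℝ w.2 (y - w.1)))
    ((gaussianSchwartz n (1 / 2) (by norm_num)).compSubConstCLM ℂ w.1)

lemma coherent_apply (w : Φ) (y : Pos n) :
    coherent w y = (bargmannConst n : ℂ) * (cis (inner ℝ w.2 (y - w.1)) *
      (rexp (-(1 / 2) * ‖y - w.1‖ ^ 2) : ℂ)) := by
  rw [coherent, smul_apply, SchwartzMap.smulLeftCLM_apply_apply (hasTemperateGrowth_phase w),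
    SchwartzMap.compSubConstCLM_apply, gaussianSchwartz_apply]
  rfl

lemma conj_coherent (w : Φ) (y : Pos n) :
    conj (coherent w y) = (bargmannConst n : ℂ) * (exp (-(((1 / 2 : ℝ) * ‖w.1 - y‖ ^ 2 : ℝ) : ℂ)) *
      exp (I * ((inner ℝ w.2 (w.1 - y) : ℝ) : ℂ))) := by
  rw [coherent_apply, map_mul, map_mul, conj_ofReal, conj_ofReal, ← exp_conj,
    norm_sub_rev w.1 y, ← neg_sub y w.1, inner_neg_right, mul_comm (exp _)]
  simp [mul_comm]

lemma bargmann_eq_integral (f : Pos n → ℂ) (z : Φ) :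
    bargmann f z = ∫ y, conj (coherent z y) * f y := by
  rw [bargmann, ← integral_const_mul]
  simp only [conj_coherent]
  ring

lemma memLp_schwartz : MemLp φ 2 volume := φ.memLp 2 volume

/-- The square of the Euclidean norm of phase space. -/
def sqNorm (v : Φ) : ℝ := ‖v.1‖ ^ 2 + ‖v.2‖ ^ 2

lemma sq_norm_le_sqNorm : ‖v‖ ^ 2 ≤ sqNorm v := by
  rw [sqNorm, Prod.norm_def]
  rcases max_choice ‖v.1‖ ‖v.2‖ with h | h <;> rw [h]
  · linarith [sq_nonneg ‖v.2‖]
  · linarith [sq_nonneg ‖v.1‖]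

/-- The kernel `⟨φ_z, φ_w⟩` of the projection onto the range of the Bargmann transform. -/
def repKer (z w : Φ) : ℂ :=
  (((2 * Real.pi) ^ n)⁻¹ * rexp (-(1 / 4) * sqNorm (z - w)) : ℝ) *
    cis (1 / 2 * inner ℝ (z.2 + w.2) (z.1 - w.1))

lemma bargmann_coherent : bargmann (coherent w) z = repKer z w := by
  set m : Pos n := (1 / 2 : ℝ) • (z.1 + w.1) with hm
  rw [bargmann_eq_integral, ← integral_add_right_eq_self _ m]
  have hpt : ∀ v, conj (coherent z (v + m)) * coherent w (v + m) =
      ((bargmannConst n ^ 2 * rexp (-(1 / 4) * ‖z.1 - w.1‖ ^ 2) : ℝ) : ℂ) *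
        cis (1 / 2 * inner ℝ (z.2 + w.2) (z.1 - w.1)) *
        exp (-(1 : ℂ) * ‖v‖ ^ 2 + -I * (inner ℝ (z.2 - w.2) v : ℝ)) := by
    intro v; rw [conj_coherent, coherent_apply]
    have e1 : z.1 - (v + m) = (1 / 2 : ℝ) • (z.1 - w.1) - v := by
      module
    have e2 : v + m - w.1 = (1 / 2 : ℝ) • (z.1 - w.1) + v := by
      module
    rw [e1, e2]; set d := z.1 - w.1
    have n1 : ‖(1 / 2 : ℝ) • d - v‖ ^ 2 = 1 / 4 * ‖d‖ ^ 2 - inner ℝ d v + ‖v‖ ^ 2 := by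
      rw [norm_sub_sq_real, norm_smul, real_inner_smul_left]; norm_num; ring
    have n2 : ‖(1 / 2 : ℝ) • d + v‖ ^ 2 = 1 / 4 * ‖d‖ ^ 2 + inner ℝ d v + ‖v‖ ^ 2 := by
      rw [norm_add_sq_real, norm_smul, real_inner_smul_left]; norm_num; ring
    rw [n1, n2]
    simp only [inner_sub_right, inner_add_right, inner_sub_left, inner_add_left, inner_smul_right]
    push_cast
    have t1 : ∀ a b c d e : ℂ, a * (b * c) * (a * (d * e)) = a ^ 2 * (b * c * d * e) := by
      intros; ring
    have t2 : ∀ b c d, (bargmannConst n : ℂ) ^ 2 * b * c * d =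
        (bargmannConst n : ℂ) ^ 2 * (b * c * d) := by intros; ring
    rw [t1, t2]; simp only [← exp_add]; ring
  simp only [hpt]
  rw [integral_const_mul, GaussianFourier.integral_cexp_neg_mul_sq_norm_add (by simp), repKer,
    finrank_euclideanSpace_fin]
  have hc := bargmannConst_sq n
  have hpi : ((Real.pi : ℂ) / 1) ^ ((n : ℂ) / 2) = ((Real.pi ^ ((n : ℝ) / 2) : ℝ) : ℂ) := by
    rw [div_one, Complex.ofReal_cpow pi_pos.le]; push_cast; rfl
  have hg : exp ((-I) ^ 2 * ‖z.2 - w.2‖ ^ 2 / (4 * 1)) =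
      ((rexp (-(1 / 4) * ‖z.2 - w.2‖ ^ 2) : ℝ) : ℂ) := by
    rw [neg_sq, I_sq]; push_cast; ring
  rw [hpi, hg]
  have hs : rexp (-(1 / 4) * sqNorm (z - w)) =
      rexp (-(1 / 4) * ‖z.1 - w.1‖ ^ 2) * rexp (-(1 / 4) * ‖z.2 - w.2‖ ^ 2) := by
    rw [← Real.exp_add, sqNorm]; simp only [fst_sub, snd_sub]; ring
  have hc' : ((2 * Real.pi) ^ n)⁻¹ = bargmannConst n ^ 2 * Real.pi ^ ((n : ℝ) / 2) := by grind
  rw [hs, hc']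
  push_cast
  ring

lemma conj_repKer : conj (repKer z w) = repKer w z := by
  rw [repKer, repKer, map_mul, conj_ofReal, ← exp_conj, map_mul, conj_I,
    conj_ofReal]
  have h1 : sqNorm (z - w) = sqNorm (w - z) := by
    simp only [sqNorm, fst_sub, snd_sub, norm_sub_rev]
  rw [h1, add_comm w.2, ← neg_sub z.1 w.1, inner_neg_right]
  push_cast
  ring

lemma norm_repKer :
    ‖repKer z w‖ = ((2 * Real.pi) ^ n)⁻¹ * rexp (-(1 / 4) * sqNorm (z - w)) := by
  rw [repKer, norm_mul, norm_exp_ofReal_mul_I, mul_one, norm_real,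
    norm_of_nonneg (by positivity)]

@[fun_prop]
lemma cont_repKer : Continuous fun p : Φ × Φ => repKer p.1 p.2 := by
  unfold repKer sqNorm
  fun_prop

lemma exists_repKer_le (n K : ℕ) :
    ∃ C : ℝ, 0 ≤ C ∧ ∀ z w : Φ, ‖repKer z w‖ ≤ C * wt K (z - w) := by
  obtain ⟨C, hC0, hC⟩ := pow_mul_exp_neg_sq_le (b := 1 / 4) (by norm_num) K
  refine ⟨((2 * Real.pi) ^ n)⁻¹ * C, by positivity, fun z w => ?_⟩
  rw [norm_repKer, le_mul_wt_iff, mul_assoc]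
  gcongr
  refine le_trans ?_ (hC ‖z - w‖ (norm_nonneg _))
  rw [mul_comm]
  have := sq_norm_le_sqNorm (z - w)
  exact mul_le_mul_of_nonneg_left (Real.exp_le_exp.2 (by linarith)) (by positivity)

/-! ### Inner products and the Bargmann transform -/

lemma integral_conj_mul_eq_inner (f g : L2Pos n) :
    ∫ x, conj (f x) * g x = inner ℂ f g := by
  rw [L2.inner_def]
  simp [mul_comm]

lemma integral_conj_mul_eq_inner_phase (f g : L2Phase n) :
    ∫ x, conj (f x) * g x = inner ℂ f g := by
  rw [L2.inner_def]
  simp [mul_comm]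

lemma bargmannL2_ae (f : L2Pos n) : bargmannL2 n f =ᵐ[volume] bargmann f :=
  (bargmann_memLp (Lp.memLp f)).coeFn_toLp

lemma integral_conj_bargmann_mul (f g : L2Pos n) :
    ∫ z, conj (bargmann f z) * bargmann g z = ∫ x, conj (f x) * g x := by
  rw [integral_conj_mul_eq_inner, ← (bargmannL2 n).inner_map_map, ← integral_conj_mul_eq_inner_phase]
  refine integral_congr_ae ?_
  filter_upwards [bargmannL2_ae f, bargmannL2_ae g] with z h1 h2
  rw [h1, h2]

lemma integral_conj_bargmann_mul' {f g : Pos n → ℂ} (hf : MemLp f 2) (hg : MemLp g 2) :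
    ∫ z, conj (bargmann f z) * bargmann g z = ∫ x, conj (f x) * g x := by
  rw [← bargmann_congr hf.coeFn_toLp, ← bargmann_congr hg.coeFn_toLp, integral_conj_bargmann_mul]
  refine integral_congr_ae ?_
  filter_upwards [hf.coeFn_toLp, hg.coeFn_toLp] with z h1 h2
  rw [h1, h2]

lemma bargmann_eq_integral_repKer {f : Pos n → ℂ} (hf : MemLp f 2) (z : Φ) :
    bargmann f z = ∫ w, repKer z w * bargmann f w := by
  rw [bargmann_eq_integral, ← integral_conj_bargmann_mul' (memLp_schwartz (coherent z)) hf]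
  simp only [bargmann_coherent, conj_repKer]

/-- The coherent state as an element of `L²`. -/
def cohL2 (z : Φ) : L2Pos n := (memLp_schwartz (coherent z)).toLp _

lemma bargmann_eq_inner (f : L2Pos n) (z : Φ) :
    bargmann f z = inner ℂ (cohL2 z) f := by
  rw [bargmann_eq_integral, ← integral_conj_mul_eq_inner]
  refine integral_congr_ae ?_
  filter_upwards [(memLp_schwartz (coherent z)).coeFn_toLp] with x h1
  rw [cohL2, h1]

lemma inner_cohL2 :
    inner ℂ (cohL2 z) (cohL2 w) = repKer z w := by
  rw [← bargmann_eq_inner, ← bargmann_coherent]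
  exact congrFun (bargmann_congr (memLp_schwartz (coherent w)).coeFn_toLp) z

lemma norm_cohL2_le : ‖cohL2 z‖ ≤ 1 := by
  have h := inner_cohL2 z z
  have h2 := congrArg norm h
  rw [inner_self_eq_norm_sq_to_K, norm_repKer] at h2
  simp only [sub_self] at h2
  have h0 : sqNorm (0 : Φ) = 0 := by simp [sqNorm]
  rw [h0, mul_zero, Real.exp_zero, mul_one] at h2
  have h3 : ‖cohL2 z‖ ^ 2 ≤ 1 := by
    have : ((2 * Real.pi) ^ n)⁻¹ ≤ 1 := inv_le_one_of_one_le₀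
      (one_le_pow₀ (by linarith [Real.pi_gt_three]))
    rw [← h2] at this; simpa using this
  exact (sq_le_one_iff₀ (norm_nonneg _)).1 h3

lemma norm_bargmann_le (f : L2Pos n) (z : Φ) : ‖bargmann f z‖ ≤ ‖f‖ := by
  rw [bargmann_eq_inner]
  refine (norm_inner_le_norm _ _).trans ?_
  exact mul_le_of_le_one_left (norm_nonneg _) (norm_cohL2_le z)

lemma cont_of_cont_inner {X H : Type*} [TopologicalSpace X] [NormedAddCommGroup H]
    [InnerProductSpace ℂ H] {f : X → H}
    (hf : Continuous fun p : X × X => (inner ℂ (f p.1) (f p.2) : ℂ)) : Continuous f := by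
  rw [continuous_iff_continuousAt]
  intro z0
  rw [ContinuousAt, tendsto_iff_norm_sub_tendsto_zero]
  have h1 : ∀ z, ‖f z - f z0‖ ^ 2 =
      ‖(inner ℂ (f z) (f z) - inner ℂ (f z) (f z0) - (inner ℂ (f z0) (f z) -
        inner ℂ (f z0) (f z0)) : ℂ)‖ := by
    intro z; rw [← inner_sub_right, ← inner_sub_right, ← inner_sub_left, inner_self_eq_norm_sq_to_K]
    simp
  have c1 : Continuous fun z => (inner ℂ (f z) (f z) : ℂ) :=
    hf.comp (continuous_id.prodMk continuous_id)
  have c2 : Continuous fun z => (inner ℂ (f z) (f z0) : ℂ) :=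
    hf.comp (continuous_id.prodMk continuous_const)
  have c3 : Continuous fun z => (inner ℂ (f z0) (f z) : ℂ) :=
    hf.comp (continuous_const.prodMk continuous_id)
  have c4 : Continuous fun z => Real.sqrt ‖(inner ℂ (f z) (f z) - inner ℂ (f z) (f z0) -
      (inner ℂ (f z0) (f z) - inner ℂ (f z0) (f z0)) : ℂ)‖ :=
    ((c1.sub c2).sub (c3.sub continuous_const)).norm.sqrt
  have h3 := c4.tendsto z0
  rw [sub_self, norm_zero, Real.sqrt_zero] at h3
  refine h3.congr fun z => ?_
  rw [← h1, Real.sqrt_sq (norm_nonneg _)]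

lemma cont_cohL2 : Continuous (cohL2 : Φ → L2Pos n) := by
  refine cont_of_cont_inner ?_
  simp only [inner_cohL2]
  exact cont_repKer

lemma cont_bargmann (f : L2Pos n) : Continuous (bargmann f) := by
  have : bargmann f = fun z => inner ℂ (cohL2 z) f := funext (bargmann_eq_inner f)
  rw [this]
  exact cont_cohL2.inner continuous_const

/-! ### Decay of the Bargmann transform of Schwartz functions -/

lemma exists_one_add_sum_pow_le {ι : Type*} (s : Finset ι) (m : ℕ) :
    ∃ C : ℝ, 0 ≤ C ∧ ∀ c : ι → ℝ, (∀ j, 0 ≤ c j) →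
      (1 + ∑ j ∈ s, c j) ^ m ≤ C * (1 + ∑ j ∈ s, c j ^ m) := by
  classical
  induction s using Finset.induction_on with
  | empty => exact ⟨1, zero_le_one, fun c _ => by simp⟩
  | insert a s ha ih =>
    obtain ⟨C, hC0, hC⟩ := ih; refine ⟨2 ^ (m - 1) * (C + 1), by positivity, fun c hc => ?_⟩
    rw [Finset.sum_insert ha, Finset.sum_insert ha]
    have h0 : 0 ≤ ∑ j ∈ s, c j := sum_nonneg fun j _ => hc j
    have h0' : 0 ≤ ∑ j ∈ s, c j ^ m := sum_nonneg fun j _ => pow_nonneg (hc j) m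
    calc (1 + (c a + ∑ j ∈ s, c j)) ^ m = ((1 + ∑ j ∈ s, c j) + c a) ^ m := by ring
      _ ≤ 2 ^ (m - 1) * ((1 + ∑ j ∈ s, c j) ^ m + c a ^ m) := add_pow_le (by positivity) (hc a) m
      _ ≤ 2 ^ (m - 1) * (C * (1 + ∑ j ∈ s, c j ^ m) + c a ^ m) := by gcongr; exact hC c hc
      _ ≤ 2 ^ (m - 1) * ((C + 1) * (1 + (c a ^ m + ∑ j ∈ s, c j ^ m))) := by
          gcongr; nlinarith [pow_nonneg (hc a) m, mul_nonneg hC0 (pow_nonneg (hc a) m)]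
      _ = _ := by ring

lemma exists_one_add_norm_pow_le {E ι : Type*} [NormedAddCommGroup E] [Fintype ι] (m : ℕ) :
    ∃ C : ℝ, 0 ≤ C ∧ ∀ (x : E) (c : ι → ℝ), ‖x‖ ≤ ∑ j, |c j| →
      (1 + ‖x‖) ^ m ≤ C * (1 + ∑ j, |c j| ^ m) := by
  obtain ⟨C, hC0, hC⟩ := exists_one_add_sum_pow_le (Finset.univ : Finset ι) m
  refine ⟨C, hC0, fun x c h => le_trans ?_ (hC (fun j => |c j|) fun j => abs_nonneg _)⟩
  gcongr

lemma exists_decay_integral_cexp {E ι F : Type*} [NormedAddCommGroup E] [NormedSpace ℝ E]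
    [FiniteDimensional ℝ E] [MeasurableSpace E] [BorelSpace E] [Fintype ι] [NormedAddCommGroup F]
    (e : ι → E) (m : ℕ) :
    ∃ C, 0 ≤ C ∧ ∀ (μ : Measure E) [μ.IsAddHaarMeasure] (l : E →L[ℝ] ℝ) (x : F) (f : E → ℂ),
      ‖x‖ ≤ ∑ j, |l (e j)| → ContDiff ℝ ∞ f → Integrable f μ →
      (∀ j, ∀ i ≤ m, Integrable ((dirD (e j))^[i] f) μ) →
      (1 + ‖x‖) ^ m * ‖∫ y, exp ((l y : ℂ) * Complex.I) * f y ∂μ‖ ≤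
        C * (∫ y, ‖f y‖ ∂μ + ∑ j, ∫ y, ‖(dirD (e j))^[m] f y‖ ∂μ) := by
  obtain ⟨C, hC0, hC⟩ := exists_one_add_norm_pow_le (E := F) (ι := ι) m
  refine ⟨C, hC0, fun μ _ l x f hx hf h0 hi => ?_⟩
  have h1 := hC x (fun j => l (e j)) hx
  set I := ‖∫ y, exp ((l y : ℂ) * Complex.I) * f y ∂μ‖ with hI
  have h2 : I ≤ ∫ y, ‖f y‖ ∂μ := by
    have := norm_integral_cexp_mul_le (μ := μ) l hf 0 0 (fun i hi => by
      rw [Nat.le_zero.1 hi]; exact h0)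
    simpa using this
  calc (1 + ‖x‖) ^ m * I ≤ C * (1 + ∑ j, |l (e j)| ^ m) * I := by gcongr
    _ = C * (I + ∑ j, |l (e j)| ^ m * I) := by rw [mul_assoc, add_mul, one_mul, sum_mul]
    _ ≤ _ := by
      gcongr with j; exact norm_integral_cexp_mul_le (μ := μ) l hf (e j) m (hi j)

lemma norm_le_sum_abs_coord (ξ : Pos n) : ‖ξ‖ ≤ ∑ i, |ξ i| := by
  simpa [pc, Fintype.sum_sum_type] using norm_le_sum_pc (ξ, (0 : Pos n))

lemma wt_fst_mul_wt_snd_le (K : ℕ) (w : Φ) : wt K w.1 * wt K w.2 ≤ wt K w := by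
  rw [wt, wt, wt, ← mul_inv, ← mul_pow]
  gcongr
  rw [Prod.norm_def]
  rcases max_choice ‖w.1‖ ‖w.2‖ with h | h <;> rw [h] <;>
    nlinarith [norm_nonneg w.1, norm_nonneg w.2, mul_nonneg (norm_nonneg w.1) (norm_nonneg w.2)]

lemma exists_bargmann_schwartz_le (K : ℕ) :
    ∃ C, 0 ≤ C ∧ ∀ w, ‖bargmann φ w‖ ≤ C * wt K w := by
  set γ := gaussianSchwartz n (1 / 2) (by norm_num) with hγ
  set e : Fin n → Pos n := fun i => single i 1 with he
  obtain ⟨C1, hC1, hIBP⟩ := exists_decay_integral_cexp (F := Pos n) e K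
  -- bounds on the derivatives
  have hb : ∀ v, ∃ A, 0 ≤ A ∧ ∀ i ≤ K, ∀ x y,
      ‖(dirD v)^[i] (fun y => φ y * γ (y - x)) y‖ ≤ A * (wt (n + 1) y * wt K x) := by
    intro v; obtain ⟨A1, hA1, h1⟩ := schwartz_norm_iterD_le_wt φ v K (n + 1 + K)
    obtain ⟨A2, hA2, h2⟩ := schwartz_norm_iterD_le_wt γ v K K
    refine ⟨2 ^ K * ((K + 1) * A1 * A2), by positivity, fun i hi x y => ?_⟩
    have hγs : ContDiff ℝ ∞ fun y => γ (y - x) := (γ.smooth ⊤).comp (contDiff_id.sub contDiff_const)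
    have h3 := norm_iterD_mul_le (φ.smooth ⊤) hγs v i y (G := A2 * wt K (y - x))
      (fun j hj => by
        rw [iterD_comp_sub]; exact h2 j (hj.trans hi) _)
    refine h3.trans ?_
    have h4 : ∑ j ∈ Finset.range (i + 1), ‖(dirD v)^[j] (φ : Pos n → ℂ) y‖ ≤
        (K + 1) * (A1 * wt (n + 1 + K) y) := by
      calc _ ≤ ∑ j ∈ Finset.range (i + 1), A1 * wt (n + 1 + K) y :=
            sum_le_sum fun j hj => h1 j (by have := Finset.mem_range.1 hj; omega) y
        _ = (i + 1) * (A1 * wt (n + 1 + K) y) := by simp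
        _ ≤ _ := by
          have := wt_nonneg (n + 1 + K) y; gcongr
    have h5 : wt K y * wt K (y - x) ≤ wt K x := by
      calc _ ≤ wt K y * ((1 + ‖y‖) ^ K * wt K x) := by
            rw [wt_sub_comm]; exact mul_le_mul_of_nonneg_left (wt_sub_le K x y) (wt_nonneg _ _)
        _ = (wt K y * (1 + ‖y‖) ^ K) * wt K x := by ring
        _ = wt K x := by rw [wt_mul_pow, one_mul]
    have w0 := wt_nonneg (n + 1) y; have w2 := wt_nonneg K (y - x)
    calc 2 ^ i * ((∑ j ∈ Finset.range (i + 1), ‖(dirD v)^[j] (φ : Pos n → ℂ) y‖) *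
          (A2 * wt K (y - x)))
        ≤ 2 ^ K * ((K + 1) * (A1 * wt (n + 1 + K) y) * (A2 * wt K (y - x))) := by
          have := one_le_two (α := ℝ); gcongr
      _ = 2 ^ K * ((K + 1) * A1 * A2) * (wt (n + 1) y * (wt K y * wt K (y - x))) := by
          rw [wt_add]; ring
      _ ≤ _ := by gcongr
  have hint : Integrable (wt (n + 1) : Pos n → ℝ) :=
    integrable_wt (by rw [finrank_euclideanSpace_fin]; omega)
  choose A hA0 hA using hb
  have hfs : ∀ x, ContDiff ℝ ∞ fun y => φ y * γ (y - x) := fun x =>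
    (φ.smooth ⊤).mul ((γ.smooth ⊤).comp (contDiff_id.sub contDiff_const))
  have hfi : ∀ (v x : Pos n), ∀ i ≤ K,
      Integrable ((dirD v)^[i] fun y => φ y * γ (y - x)) := fun v x i hi =>
    ((hint.mul_const (wt K x)).const_mul (A v)).mono'
      (contDiff_iterD (hfs x) v i).continuous.aestronglyMeasurable
      (.of_forall fun y => hA v i hi x y)
  have hfb : ∀ (v x : Pos n), ∀ i ≤ K, ∫ y, ‖(dirD v)^[i] (fun y => φ y * γ (y - x)) y‖ ≤
      A v * (∫ y, wt (n + 1) y) * wt K x := fun v x i hi => by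
    calc _ ≤ ∫ y, A v * (wt (n + 1) y * wt K x) :=
          integral_mono (hfi v x i hi).norm ((hint.mul_const (wt K x)).const_mul (A v))
            fun y => hA v i hi x y
      _ = _ := by rw [integral_const_mul, integral_mul_const, mul_assoc]
  have hI0 : 0 ≤ ∫ y : Pos n, wt (n + 1) y := integral_nonneg fun y => wt_nonneg _ _
  set I := ∫ y : Pos n, wt (n + 1) y
  refine ⟨|bargmannConst n| * (C1 * (A 0 * I + ∑ j, A (e j) * I)), by
    have := hA0 0; have : 0 ≤ ∑ j, A (e j) * I := sum_nonneg fun j _ => mul_nonneg (hA0 _) hI0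
    positivity, fun w => ?_⟩
  have hform : bargmann φ w = (bargmannConst n : ℂ) * (cis (inner ℝ w.2 w.1) *
        ∫ y, cis (-(innerSL ℝ w.2) y) * (φ y * γ (y - w.1))) := by
    rw [bargmann_eq_integral, ← integral_const_mul, ← integral_const_mul]
    refine integral_ext fun y => ?_
    simp only [conj_coherent, hγ, gaussianSchwartz_apply, innerSL_apply_apply]
    have : exp (Complex.I * ((inner ℝ w.2 (w.1 - y) : ℝ) : ℂ)) =
        cis (inner ℝ w.2 w.1) *
          cis (-(inner ℝ w.2 y)) := by
      rw [← exp_add, inner_sub_right]; push_cast; ring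
    rw [this, norm_sub_rev y w.1]; push_cast; ring
  have h1 := hIBP volume (-(innerSL ℝ w.2)) w.2 (fun y => φ y * γ (y - w.1)) (by
      simp only [neg_apply, innerSL_apply_apply, abs_neg, he,
        inner_single_right, one_mul]
      simpa using norm_le_sum_abs_coord w.2) (hfs _) (hfi 0 _ 0 (Nat.zero_le _)) (fun j i hi => hfi _ _ i hi)
  have h2 := hfb 0 w.1 0 (Nat.zero_le _)
  have h3 : ∑ j, ∫ y, ‖(dirD (e j))^[K] (fun y => φ y * γ (y - w.1)) y‖ ≤
      ∑ j, A (e j) * I * wt K w.1 := sum_le_sum fun j _ => hfb (e j) w.1 K le_rfl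
  simp only [Function.iterate_zero, id] at h2
  rw [hform, norm_mul, norm_mul, norm_exp_ofReal_mul_I, one_mul, norm_real,
    norm_eq_abs, mul_assoc]
  gcongr
  set J := ‖∫ y, cis (-(innerSL ℝ w.2) y) * (φ y * γ (y - w.1))‖
  have h4 : J ≤ C1 * (A 0 * I * wt K w.1 + ∑ j, A (e j) * I * wt K w.1) * wt K w.2 := by
    rw [le_mul_wt_iff, mul_comm]; refine h1.trans ?_; gcongr
  refine h4.trans ?_
  rw [← sum_mul, ← add_mul, mul_assoc, mul_assoc, mul_assoc]
  have : 0 ≤ A 0 * I + ∑ j, A (e j) * I := add_nonneg (mul_nonneg (hA0 _) hI0)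
    (sum_nonneg fun j _ => mul_nonneg (hA0 _) hI0)
  gcongr
  exact wt_fst_mul_wt_snd_le K w

/-! ### Wigner functions of coherent states -/

/-- The midpoint of two phase space points. -/
def mid (z w : Φ) : Φ := (1 / 2 : ℝ) • (z + w)

lemma mid_comm : mid z w = mid w z := by rw [mid, mid, add_comm]

lemma hasTemperateGrowth_sqNorm : (sqNorm : Φ → ℝ).HasTemperateGrowth := by
  have h1 := (Function.hasTemperateGrowth_norm_sq (Pos n)).comp
    (ContinuousLinearMap.fst ℝ (Pos n) (Pos n)).hasTemperateGrowth
  have h2 := (Function.hasTemperateGrowth_norm_sq (Pos n)).comp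
    (ContinuousLinearMap.snd ℝ (Pos n) (Pos n)).hasTemperateGrowth
  exact h1.add h2

/-- The Gaussian `exp (-|v|²)` on phase space as a real Schwartz function. -/
def realGauss (n : ℕ) : 𝓢(Φ, ℝ) :=
  expSchwartz (fun v : Φ => -1 * sqNorm v)
    ((Function.HasTemperateGrowth.const (-1)).mul hasTemperateGrowth_sqNorm) 1 one_pos
    (fun v => by have := sq_norm_le_sqNorm v; linarith)

lemma realGauss_apply :
    realGauss n v = rexp (-1 * sqNorm v) := rfl

/-- The Gaussian `exp (-|v|²)` on phase space as a Schwartz function. -/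
def gauss (n : ℕ) : 𝓢(Φ, ℂ) :=
  (realGauss n).postcompCLM ofRealCLM

lemma gauss_apply :
    gauss n v = (rexp (-1 * sqNorm v) : ℂ) := rfl

/-- The linear phase of the Wigner function. -/
def wigPhase (ζ : Φ) : Φ →L[ℝ] ℝ :=
  (innerSL ℝ ζ.1).comp (ContinuousLinearMap.snd ℝ (Pos n) (Pos n)) -
    (innerSL ℝ ζ.2).comp (ContinuousLinearMap.fst ℝ (Pos n) (Pos n))

lemma wigPhase_apply (ζ v : Φ) :
    wigPhase ζ v = inner ℝ ζ.1 v.2 - inner ℝ ζ.2 v.1 := rfl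

lemma wigPhase_inl (ζ : Φ) (i : Fin n) : wigPhase ζ (ph (inl i)) = -ζ.2 i := by
  simp [wigPhase_apply, ph, dirX, inner_single_right]

lemma wigPhase_inr (ζ : Φ) (i : Fin n) : wigPhase ζ (ph (inr i)) = ζ.1 i := by
  simp [wigPhase_apply, ph, dirXi, inner_single_right]

lemma norm_le_sum_wigPhase (ζ : Φ) : ‖ζ‖ ≤ ∑ j, |wigPhase ζ (ph j)| := by
  refine (norm_le_sum_pc ζ).trans (le_of_eq ?_)
  rw [Fintype.sum_sum_type, Fintype.sum_sum_type, add_comm]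
  simp only [wigPhase_inl, wigPhase_inr, abs_neg, pc, Sum.elim_inl, Sum.elim_inr]

/-- The normalisation of the Wigner functions. -/
def wigConst (n : ℕ) : ℝ := (Real.pi ^ n)⁻¹ * ((2 * Real.pi) ^ n)⁻¹

lemma wigConst_pos (n : ℕ) : 0 < wigConst n := by
  unfold wigConst; positivity

/-- The Wigner function of a pair of coherent states. -/
def wig (z w v : Φ) : ℂ :=
  (wigConst n : ℂ) * cis (inner ℝ (mid z w).2 (z.1 - w.1)) *
    (cis (wigPhase (z - w) (v - mid z w)) * gauss n (v - mid z w))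

lemma cont_wig : Continuous fun p : Φ × Φ × Φ => wig p.1 p.2.1 p.2.2 := by
  unfold wig mid
  simp only [wigPhase_apply]
  fun_prop

lemma norm_wig (z w v : Φ) :
    ‖wig z w v‖ = wigConst n * ‖gauss n (v - mid z w)‖ := by
  rw [wig, norm_mul, norm_mul, norm_mul, norm_exp_ofReal_mul_I, norm_exp_ofReal_mul_I,
    mul_one, one_mul, norm_real, norm_of_nonneg (wigConst_pos n).le]

lemma exists_wig_le (n K : ℕ) : ∃ C : ℝ, 0 ≤ C ∧ ∀ z w v : Φ,
    ‖wig z w v‖ ≤ C * wt K (v - mid z w) := by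
  obtain ⟨C, hC0, hC⟩ := schwartz_norm_le_wt (gauss n) K
  refine ⟨wigConst n * C, mul_nonneg (wigConst_pos n).le hC0, fun z w v => ?_⟩
  rw [norm_wig, mul_assoc]
  exact mul_le_mul_of_nonneg_left (hC _) (wigConst_pos n).le

lemma conj_wig (z w v : Φ) : conj (wig z w v) = wig w z v := by
  rw [wig, wig, map_mul, map_mul, map_mul, conj_ofReal, ← exp_conj, ← exp_conj,
    map_mul, map_mul, conj_I, conj_ofReal, conj_ofReal, gauss_apply,
    gauss_apply, conj_ofReal, mid_comm w z]
  have h1 : wigPhase (w - z) (v - mid z w) = -wigPhase (z - w) (v - mid z w) := by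
    simp only [wigPhase_apply, fst_sub, snd_sub, inner_sub_left]; ring
  have h2 : inner ℝ (mid z w).2 (w.1 - z.1) = -inner ℝ (mid z w).2 (z.1 - w.1) := by
    rw [← inner_neg_right, neg_sub]
  rw [h1, h2]
  push_cast
  simp only [neg_mul, mul_neg]

lemma wig_eq (z w v : Φ) :
    wig z w v = ((Real.pi ^ n)⁻¹ : ℝ) * cis (2 * inner ℝ v.2 (z.1 - v.1)) *
      repKer ((2 : ℝ) • v - z) w := by
  have h1 : sqNorm ((2 : ℝ) • v - z - w) = 4 * sqNorm (v - mid z w) := by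
    have : (2 : ℝ) • v - z - w = (2 : ℝ) • (v - mid z w) := by rw [mid]; module
    rw [this]; simp only [sqNorm, smul_fst, smul_snd, norm_smul]; norm_num; ring
  rw [wig, repKer, gauss_apply, h1, wigConst]
  have t1 : ∀ a b p q r : ℂ, a * b * p * (q * r) = a * b * r * (p * q) := by intros; ring
  have t2 : ∀ a b p q r : ℂ, a * p * (b * r * q) = a * b * r * (p * q) := by intros; ring
  push_cast
  rw [t1, t2]
  rw [← exp_add, ← exp_add, ← add_mul, ← add_mul]
  have h4 : ∀ x y : Pos n, inner ℝ x y = inner ℝ y x := fun x y => real_inner_comm y x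
  simp only [wigPhase_apply, mid, fst_sub, snd_sub, smul_fst, smul_snd,
    Prod.fst_add, Prod.snd_add, inner_sub_left, inner_sub_right, inner_add_left, inner_add_right,
    real_inner_smul_left, real_inner_smul_right, h4 z.1 v.2, h4 w.1 v.2, h4 z.2 v.1, h4 w.2 v.1,
    h4 z.1 z.2, h4 w.1 z.2, h4 z.1 w.2, h4 w.1 w.2]
  push_cast
  ring

/-! ### Moments -/

lemma integral_cexp_wigPhase_mul_gaussian (ζ : Φ) :
    ∫ u, cis (wigPhase ζ u) * gauss n u =
      (Real.pi ^ n * rexp (-(1 / 4) * sqNorm ζ) : ℝ) := by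
  have h1 : ∀ u, cis (wigPhase ζ u) * gauss n u =
      exp (-(1 : ℂ) * ‖u.1‖ ^ 2 + -I * (inner ℝ ζ.2 u.1 : ℝ)) *
        exp (-(1 : ℂ) * ‖u.2‖ ^ 2 + I * (inner ℝ ζ.1 u.2 : ℝ)) := by
    intro u
    rw [gauss_apply, wigPhase_apply, ofReal_exp, ← exp_add, ← exp_add,
      sqNorm]
    push_cast; ring
  simp only [h1]
  rw [volume_eq_prod, integral_prod_mul
    (f := fun x => exp (-(1 : ℂ) * ‖x‖ ^ 2 + -I * (inner ℝ ζ.2 x : ℝ)))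
    (g := fun x => exp (-(1 : ℂ) * ‖x‖ ^ 2 + I * (inner ℝ ζ.1 x : ℝ))),
    GaussianFourier.integral_cexp_neg_mul_sq_norm_add (by simp),
    GaussianFourier.integral_cexp_neg_mul_sq_norm_add (by simp), finrank_euclideanSpace_fin]
  have hpi : ((Real.pi : ℂ) / 1) ^ ((n : ℂ) / 2) = ((Real.pi ^ ((n : ℝ) / 2) : ℝ) : ℂ) := by
    rw [div_one, Complex.ofReal_cpow pi_pos.le]; push_cast; rfl
  have hg : ∀ c : ℂ, c ^ 2 = -1 → ∀ x : Pos n, exp (c ^ 2 * ‖x‖ ^ 2 / (4 * 1)) =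
      ((rexp (-(1 / 4) * ‖x‖ ^ 2) : ℝ) : ℂ) := by
    intro c hc x; rw [ofReal_exp, hc]; push_cast; ring
  rw [hpi, hg _ (by rw [neg_sq, I_sq]), hg _ I_sq]
  have hp : Real.pi ^ n = Real.pi ^ ((n : ℝ) / 2) * Real.pi ^ ((n : ℝ) / 2) := by
    rw [← Real.rpow_add pi_pos, add_halves, Real.rpow_natCast]
  have hs : rexp (-(1 / 4) * sqNorm ζ) =
      rexp (-(1 / 4) * ‖ζ.1‖ ^ 2) * rexp (-(1 / 4) * ‖ζ.2‖ ^ 2) := by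
    rw [← Real.exp_add, sqNorm]; ring
  rw [hp, hs]
  push_cast
  ring

lemma repKer_eq :
    repKer z w = (wigConst n : ℂ) * cis (inner ℝ (mid z w).2 (z.1 - w.1)) *
      (Real.pi ^ n * rexp (-(1 / 4) * sqNorm (z - w)) : ℝ) := by
  rw [repKer, wigConst, mid, smul_snd, real_inner_smul_left, Prod.snd_add]
  push_cast
  field_simp

lemma integral_wig : ∫ v, wig z w v = repKer z w := by
  simp only [wig]
  rw [integral_const_mul, repKer_eq, ← integral_cexp_wigPhase_mul_gaussian,
    integral_sub_right_eq_self (fun u => cis (wigPhase (z - w) u) *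
      gauss n u)]

lemma dirD_gauss (u : Φ) :
    dph j (gauss n) u = -2 * (pc j u : ℂ) * gauss n u := by
  have h1 : HasFDerivAt (fun u => -1 * sqNorm u)
      ((-1 : ℝ) • ((2 • (innerSL ℝ u.1)).comp (ContinuousLinearMap.fst ℝ (Pos n) (Pos n)) +
        (2 • (innerSL ℝ u.2)).comp (ContinuousLinearMap.snd ℝ (Pos n) (Pos n)))) u := by
    have a := (hasStrictFDerivAt_norm_sq u.1).hasFDerivAt.comp u (hasFDerivAt_fst (𝕜 := ℝ) (p := u))
    have b := (hasStrictFDerivAt_norm_sq u.2).hasFDerivAt.comp u (hasFDerivAt_snd (𝕜 := ℝ) (p := u))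
    exact (a.add b).const_mul (-1)
  have h2 := ofRealCLM.hasFDerivAt.comp u h1.exp
  have h3 : dph j (gauss n) u = _ := congrArg (fun l => l (ph j)) h2.fderiv
  rw [h3, gauss_apply]
  rcases j with i | i
  · simp [pc, ph, dirX, inner_single_right]; ring
  · simp [pc, ph, dirXi, inner_single_right]; ring

lemma integrable_dirD_gauss :
    Integrable (dph j (gauss n)) := by
  obtain ⟨ψ, hψ⟩ := schwartz_coe_iterD (gauss n) (ph j) 1
  rw [iterate_one] at hψ
  exact hψ ▸ ψ.integrable

lemma integrable_pc_mul_gauss :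
    Integrable fun u => (pc j u : ℂ) * gauss n u := by
  refine ((integrable_dirD_gauss j).const_mul (-(1 / 2 : ℂ))).congr
    (.of_forall fun u => ?_)
  simp only [dirD_gauss]
  ring

lemma integrable_pc_mul_wig (z w : Φ) :
    Integrable fun v => (pc j (v - mid z w) : ℂ) * wig z w v := by
  have h := ((integrable_cexp_mul (wigPhase (z - w)) (integrable_pc_mul_gauss j)).const_mul
    ((wigConst n : ℂ) * cis (inner ℝ (mid z w).2 (z.1 - w.1)))).comp_sub_right (mid z w)
  refine h.congr (.of_forall fun v => ?_)
  simp only [wig]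
  ring

lemma integral_pc_mul_wig (z w : Φ) :
    ∫ v, (pc j (v - mid z w) : ℂ) * wig z w v =
      I / 2 * wigPhase (z - w) (ph j) * repKer z w := by
  have h1 := integral_cexp_mul_dirD (μ := volume) (wigPhase (z - w)) ((gauss n).smooth ⊤)
    (ph j) (gauss n).integrable (integrable_dirD_gauss j)
  have h2 : ∫ u, (pc j u : ℂ) * (cis (wigPhase (z - w) u) *
      gauss n u) = I / 2 * wigPhase (z - w) (ph j) *
        ∫ u, cis (wigPhase (z - w) u) * gauss n u := by
    have h3 : ∫ u, cis (wigPhase (z - w) u) *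
        dph j (gauss n) u = -2 * ∫ u, (pc j u : ℂ) *
          (cis (wigPhase (z - w) u) * gauss n u) := by
      rw [← integral_const_mul]; refine integral_ext fun u => ?_; simp only [dirD_gauss]; ring
    rw [h3] at h1
    linear_combination (-1 / 2 : ℂ) * h1
  have h4 : ∫ v, (pc j (v - mid z w) : ℂ) * wig z w v =
      ((wigConst n : ℂ) * cis (inner ℝ (mid z w).2 (z.1 - w.1))) *
      ∫ u, (pc j u : ℂ) * (cis (wigPhase (z - w) u) *
        gauss n u) := by
    rw [← integral_const_mul, ← integral_sub_right_eq_self (fun u => (wigConst n : ℂ) *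
      cis (inner ℝ (mid z w).2 (z.1 - w.1)) * ((pc j u : ℂ) *
      (cis (wigPhase (z - w) u) * gauss n u))) (mid z w)]
    refine integral_ext fun v => ?_; simp only [wig]; ring
  rw [h4, h2, integral_cexp_wigPhase_mul_gaussian, repKer_eq]
  ring

/-! ### Matrix elements of Weyl operators between coherent states -/

/-- The matrix element of the Weyl operator with symbol `q` between coherent states. -/
def symKer (q : Φ → ℝ) (z w : Φ) : ℂ := ∫ v, (q v : ℂ) * wig z w v

lemma conj_symKer (q : Φ → ℝ) (z w : Φ) : conj (symKer q z w) = symKer q w z := by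
  rw [symKer, ← integral_conj, symKer]
  simp only [map_mul, conj_ofReal, conj_wig]

/-- The integrals that control matrix elements. -/
def wtInt (K : ℕ) (q : Φ → ℝ) (c : Φ) : ℝ≥0∞ :=
  ∫⁻ v, ofReal (|q v| * wt K (v - c))

lemma integrable_of_wtInt_ne_top {c : Φ} (hq : Continuous q)
    (h : wtInt K q c ≠ ⊤) : Integrable fun v => |q v| * wt K (v - c) := by
  have hc : Continuous fun v => |q v| * wt K (v - c) := by fun_prop
  refine ⟨hc.aestronglyMeasurable, ?_⟩
  rw [hasFiniteIntegral_iff_ofReal (.of_forall fun v =>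
    mul_nonneg (abs_nonneg _) (wt_nonneg _ _))]
  exact h.lt_top

lemma ofReal_integral_eq_wtInt {c : Φ} (hq : Continuous q)
    (h : wtInt K q c ≠ ⊤) : ofReal (∫ v, |q v| * wt K (v - c)) = wtInt K q c :=
  ofReal_integral_eq_lintegral_ofReal (integrable_of_wtInt_ne_top hq h)
    (.of_forall fun v => mul_nonneg (abs_nonneg _) (wt_nonneg _ _))

lemma exists_decay_symKer (n m K : ℕ) : ∃ C : ℝ, 0 < C ∧
    ∀ q : Φ → ℝ, ContDiff ℝ ∞ q → ∀ z w : Φ,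
      ofReal ((1 + ‖z - w‖) ^ m) * ‖symKer q z w‖ₑ ≤ ofReal C *
        (wtInt K q (mid z w) + ∑ j : 𝕁, ∑ i ∈ Finset.range (m + 1),
          wtInt K ((dph j)^[i] q) (mid z w)) := by
  obtain ⟨C1, hC1, hIBP⟩ := exists_decay_integral_cexp (F := Φ) (ph : 𝕁 → Φ) m
  have hG : ∀ j, ∃ A, 0 ≤ A ∧ ∀ i ≤ m, ∀ x,
      ‖(dph j)^[i] (gauss n) x‖ ≤ A * wt K x := fun j =>
    schwartz_norm_iterD_le_wt (gauss n) (ph j) m K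
  choose A hA0 hA using hG
  obtain ⟨A', hA'0, hA'⟩ := schwartz_norm_le_wt (gauss n) K
  set B := A' + 2 ^ m * ∑ j, A j with hB
  have hAj : ∀ j, 2 ^ m * A j ≤ B := fun j => by
    have := single_le_sum (f := A) (fun i _ => hA0 i) (Finset.mem_univ j)
    have := mul_le_mul_of_nonneg_left this (pow_nonneg zero_le_two m); linarith
  have hA'B : A' ≤ B := by
    have : 0 ≤ ∑ j, A j := sum_nonneg fun j _ => hA0 j
    exact le_add_of_nonneg_right (mul_nonneg (by positivity) this)
  have hB0 : 0 ≤ B := hA'0.trans hA'B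
  refine ⟨wigConst n * (C1 * B) + 1, by have := wigConst_pos n; positivity, fun q hq z w => ?_⟩
  set c := mid z w
  set R := wtInt K q c + ∑ j, ∑ i ∈ Finset.range (m + 1),
    wtInt K ((dph j)^[i] q) c with hR
  by_cases htop : R = ⊤
  · rw [htop, ENNReal.mul_top]
    · exact le_top
    · have := wigConst_pos n; positivity
  obtain ⟨t0, t1⟩ := add_ne_top.1 htop
  have tj : ∀ j, ∀ i ≤ m, wtInt K ((dph j)^[i] q) c ≠ ⊤ := fun j i hi =>
    sum_ne_top.1 (sum_ne_top.1 t1 j (Finset.mem_univ j)) i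
      (Finset.mem_range.2 (Nat.lt_succ_of_le hi))
  have hqs : ContDiff ℝ ∞ fun v => (q v : ℂ) := ofRealCLM.contDiff.comp hq
  have hgs : ContDiff ℝ ∞ fun v => gauss n (v - c) :=
    ((gauss n).smooth ⊤).comp (contDiff_id.sub contDiff_const)
  set f : Φ → ℂ := fun v => (q v : ℂ) * gauss n (v - c) with hf
  have hfs : ContDiff ℝ ∞ f := hqs.mul hgs
  have hDc : ∀ j i, Continuous ((dph j)^[i] q) := fun j i =>
    (contDiff_iterD hq (ph j) i).continuous
  have i0 := integrable_of_wtInt_ne_top hq.continuous t0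
  have ij := fun j i hi => integrable_of_wtInt_ne_top (hDc j i) (tj j i hi)
  have b0 : ∀ v, ‖f v‖ ≤ B * (|q v| * wt K (v - c)) := fun v => by
    rw [hf, norm_mul, norm_real, norm_eq_abs]; have := hA' (v - c); have h2 := wt_nonneg K (v - c)
    calc |q v| * ‖gauss n (v - c)‖ ≤ |q v| * (B * wt K (v - c)) := by
          gcongr; exact this.trans (by gcongr)
      _ = _ := by ring
  have bj : ∀ j, ∀ i ≤ m, ∀ v, ‖(dph j)^[i] f v‖ ≤
      B * ∑ k ∈ Finset.range (i + 1), |(dph j)^[k] q v| * wt K (v - c) := by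
    intro j i hi v
    have h1 := norm_iterD_mul_le hqs hgs (ph j) i v (G := A j * wt K (v - c))
      (fun k hk => by rw [iterD_comp_sub]; exact hA j k (hk.trans hi) _)
    refine h1.trans ?_; have h2 := wt_nonneg K (v - c)
    simp only [iterD_ofReal hq, norm_real, norm_eq_abs]; rw [← sum_mul]
    calc 2 ^ i * ((∑ k ∈ Finset.range (i + 1), |(dph j)^[k] q v|) * (A j * wt K (v - c)))
        ≤ 2 ^ m * ((∑ k ∈ Finset.range (i + 1), |(dph j)^[k] q v|) *
          (A j * wt K (v - c))) := by
          have := hA0 j; have := one_le_two (α := ℝ); gcongr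
      _ = (2 ^ m * A j) * ((∑ k ∈ Finset.range (i + 1), |(dph j)^[k] q v|) *
          wt K (v - c)) := by ring
      _ ≤ _ := by gcongr; exact hAj j
  have isum : ∀ j, ∀ i ≤ m, Integrable fun v =>
      ∑ k ∈ Finset.range (i + 1), |(dph j)^[k] q v| * wt K (v - c) := fun j i hi =>
    integrable_finsetSum _ fun k hk => ij j k (by have := Finset.mem_range.1 hk; omega)
  have if0 : Integrable f := (i0.const_mul B).mono' hfs.continuous.aestronglyMeasurable
    (.of_forall b0)
  have ifj : ∀ j, ∀ i ≤ m, Integrable ((dph j)^[i] f) := fun j i hi =>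
    ((isum j i hi).const_mul B).mono'
      (contDiff_iterD hfs (ph j) i).continuous.aestronglyMeasurable
      (.of_forall (bj j i hi))
  have hmain := hIBP volume (wigPhase (z - w)) (z - w) f (norm_le_sum_wigPhase _) hfs if0 ifj
  set S := ∫ v, |q v| * wt K (v - c) + ∑ j, ∑ i ∈ Finset.range (m + 1),
    |(dph j)^[i] q v| * wt K (v - c) with hS
  have i2 : Integrable fun v => ∑ j, ∑ i ∈ Finset.range (m + 1),
      |(dph j)^[i] q v| * wt K (v - c) :=
    integrable_finsetSum _ fun j _ => isum j m le_rfl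
  have hSR : ofReal S = R := by
    rw [hS, integral_add i0 i2, ofReal_add
      (integral_nonneg fun v => mul_nonneg (abs_nonneg _) (wt_nonneg _ _))
      (integral_nonneg fun v => sum_nonneg fun j _ => sum_nonneg fun i _ =>
        mul_nonneg (abs_nonneg _) (wt_nonneg _ _)), ofReal_integral_eq_wtInt hq.continuous t0, hR,
      integral_finsetSum _ fun j _ => isum j m le_rfl, ofReal_sum_of_nonneg fun j _ =>
        integral_nonneg fun v => sum_nonneg fun i _ => mul_nonneg (abs_nonneg _) (wt_nonneg _ _)]
    congr 1; refine sum_congr rfl fun j _ => ?_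
    rw [integral_finsetSum _ fun i hi => ij j i (by have := Finset.mem_range.1 hi; omega),
      ofReal_sum_of_nonneg fun i _ =>
        integral_nonneg fun v => mul_nonneg (abs_nonneg _) (wt_nonneg _ _)]
    exact sum_congr rfl fun i hi =>
      ofReal_integral_eq_wtInt (hDc j i) (tj j i (by have := Finset.mem_range.1 hi; omega))
  have hle : (∫ v, ‖f v‖) + ∑ j, ∫ v, ‖(dph j)^[m] f v‖ ≤ B * S := by
    rw [hS, integral_add i0 i2, integral_finsetSum _ fun j _ => isum j m le_rfl, mul_add,
      mul_sum, ← integral_const_mul]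
    refine add_le_add (integral_mono if0.norm (i0.const_mul B) b0) (sum_le_sum fun j _ => ?_)
    rw [← integral_const_mul]
    exact integral_mono (ifj j m le_rfl).norm ((isum j m le_rfl).const_mul B) (bj j m le_rfl)
  have hform : ‖symKer q z w‖ = wigConst n *
      ‖∫ v, cis (wigPhase (z - w) v) * f v‖ := by
    have : symKer q z w = (wigConst n : ℂ) * (cis (inner ℝ c.2 (z.1 - w.1)) *
        (cis (-wigPhase (z - w) c) *
        ∫ v, cis (wigPhase (z - w) v) * f v)) := by
      rw [symKer, ← integral_const_mul, ← integral_const_mul, ← integral_const_mul]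
      refine integral_ext fun v => ?_; simp only [wig, hf]
      have : cis (wigPhase (z - w) (v - mid z w)) =
          cis (-wigPhase (z - w) c) *
            cis (wigPhase (z - w) v) := by
        rw [← exp_add, map_sub]; congr 1; push_cast; ring
      rw [this]; ring
    rw [this, norm_mul, norm_mul, norm_mul, norm_exp_ofReal_mul_I,
      norm_exp_ofReal_mul_I, one_mul, one_mul, norm_real,
      norm_of_nonneg (wigConst_pos n).le]
  rw [← hSR, ← ofReal_norm, ← ofReal_mul (by positivity),
    ← ofReal_mul (by have := wigConst_pos n; positivity)]
  refine ofReal_le_ofReal ?_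
  have hS0 : 0 ≤ S := integral_nonneg fun v => add_nonneg (mul_nonneg (abs_nonneg _) (wt_nonneg _ _))
    (sum_nonneg fun j _ => sum_nonneg fun i _ => mul_nonneg (abs_nonneg _) (wt_nonneg _ _))
  rw [hform]
  have := wigConst_pos n
  calc (1 + ‖z - w‖) ^ m * (wigConst n * ‖∫ v, cis (wigPhase (z - w) v) * f v‖)
      = wigConst n * ((1 + ‖z - w‖) ^ m *
        ‖∫ v, cis (wigPhase (z - w) v) * f v‖) := by ring
    _ ≤ wigConst n * (C1 * (B * S)) := by
        exact mul_le_mul_of_nonneg_left (hmain.trans (mul_le_mul_of_nonneg_left hle hC1)) this.le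
    _ ≤ (wigConst n * (C1 * B) + 1) * S := by nlinarith

/-! ### Dominated convergence in `L²` -/

lemma tendsto_toLp_of_dominated {α ι : Type*} [MeasurableSpace α] {μ : Measure α} {l : Filter ι}
    [l.IsCountablyGenerated] {f : ι → α → ℂ} {f₀ : α → ℂ} {g : α → ℝ} (hg : MemLp g 2 μ)
    (hf : ∀ i, MemLp (f i) 2 μ) (hf₀ : MemLp f₀ 2 μ) (hb : ∀ i, ∀ᵐ x ∂μ, ‖f i x‖ ≤ g x)
    (hlim : ∀ᵐ x ∂μ, Tendsto (fun i => f i x) l (nhds (f₀ x))) :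
    Tendsto (fun i => (hf i).toLp (f i)) l (nhds (hf₀.toLp f₀)) := by
  rw [Lp.tendsto_Lp_iff_tendsto_eLpNorm'']
  have hG : MemLp (fun x => g x + ‖f₀ x‖) 2 μ := hg.add hf₀.norm
  have h1 : Tendsto (fun i => ∫⁻ x, ‖f i x - f₀ x‖ₑ ^ (2 : ℝ) ∂μ) l (nhds 0) := by
    have h0 : (∫⁻ _x, (0 : ℝ≥0∞) ∂μ) = 0 := by simp
    rw [← h0]
    refine tendsto_lintegral_filter_of_dominated_convergence'
      (fun x => ‖g x + ‖f₀ x‖‖ₑ ^ (2 : ℝ)) (.of_forall fun i =>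
        ((hf i).1.sub hf₀.1).enorm.pow_const 2) (.of_forall fun i => ?_) ?_ ?_
    · filter_upwards [hb i] with x hx; refine ENNReal.rpow_le_rpow ?_ zero_le_two
      rw [enorm_le_iff_norm_le]; refine (norm_sub_le _ _).trans ?_
      rw [norm_of_nonneg (add_nonneg ((norm_nonneg _).trans hx) (norm_nonneg _))]; linarith
    · have := lintegral_rpow_enorm_lt_top_of_eLpNorm_lt_top (by norm_num) (by norm_num) hG.2
      simpa using this.ne
    · filter_upwards [hlim] with x hx
      have h2 : Tendsto (fun i => ‖f i x - f₀ x‖ₑ) l (nhds ‖f₀ x - f₀ x‖ₑ) :=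
        (continuous_enorm.tendsto _).comp (hx.sub_const _)
      have h3 := ((ENNReal.continuous_rpow_const (y := 2)).tendsto _).comp h2
      simpa [comp_def] using h3
  have h2 := ((ENNReal.continuous_rpow_const (y := 1 / 2)).tendsto 0).comp h1
  rw [ENNReal.zero_rpow_of_pos (by norm_num)] at h2
  refine h2.congr fun i => ?_
  rw [eLpNorm_eq_lintegral_rpow_enorm_toReal (by norm_num) (by norm_num)]
  simp

/-! ### Weyl operators in phase space -/

lemma weyl_eq (q : Φ → ℝ) (φ : Pos n → ℂ) (x : Pos n) :
    weyl q φ x = ((Real.pi ^ n)⁻¹ : ℝ) * ∫ ξ, ∫ u,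
      cis (2 * inner ℝ (x - u) ξ) * (q (u, ξ) * φ ((2 : ℝ) • u - x)) := by
  rw [weyl]
  have h1 : ∀ ξ, ∫ y, exp (Complex.I * ((inner ℝ (x - y) ξ : ℝ) : ℂ)) *
      (q ((1 / 2 : ℝ) • (x + y), ξ) : ℂ) * φ y = (2 ^ n : ℝ) * ∫ u,
      cis (2 * inner ℝ (x - u) ξ) * (q (u, ξ) * φ ((2 : ℝ) • u - x)) := by
    intro ξ; rw [← integral_sub_right_eq_self _ x]
    have h2 := Measure.integral_comp_smul (volume : Measure (Pos n)) (fun y =>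
      exp (Complex.I * ((inner ℝ (x - (y - x)) ξ : ℝ) : ℂ)) *
      (q ((1 / 2 : ℝ) • (x + (y - x)), ξ) : ℂ) * φ (y - x)) 2
    rw [finrank_euclideanSpace_fin, abs_of_pos (by positivity)] at h2
    have h3 : ∀ I J, J = ((2 : ℝ) ^ n)⁻¹ • I → I = ((2 ^ n : ℝ) : ℂ) * J := by simp
    refine (h3 _ _ h2).trans ?_; congr 1; refine integral_ext fun u => ?_
    have e1 : x - ((2 : ℝ) • u - x) = (2 : ℝ) • (x - u) := by module
    have e2 : (1 / 2 : ℝ) • (x + ((2 : ℝ) • u - x)) = u := by module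
    simp only [e1, e2, real_inner_smul_left]; rw [mul_comm Complex.I, mul_assoc]
  simp only [h1]
  rw [integral_const_mul, ← mul_assoc]
  congr 1
  rw [← Complex.ofReal_inv, ← Complex.ofReal_mul, mul_pow]
  field_simp

/-- The reflection of the function `φ` in the phase space point `v`. -/
def refl (φ : Pos n → ℂ) (v : Φ) (x : Pos n) : ℂ :=
  cis (2 * inner ℝ (x - v.1) v.2) * φ ((2 : ℝ) • v.1 - x)

lemma norm_refl (φ : Pos n → ℂ) (v : Φ) (x : Pos n) :
    ‖refl φ v x‖ = ‖φ ((2 : ℝ) • v.1 - x)‖ := by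
  rw [refl, norm_mul, norm_exp_ofReal_mul_I, one_mul]

lemma cont_refl :
    Continuous fun p : Pos n × Φ => refl φ p.2 p.1 := by
  unfold refl
  fun_prop

lemma cont_refl_left (x : Pos n) : Continuous fun v => refl φ v x := by
  unfold refl
  fun_prop

lemma cont_refl_right (v : Φ) : Continuous (refl φ v) := by
  unfold refl
  fun_prop

lemma exists_schwartz_le : ∃ C, 0 ≤ C ∧ ∀ x, ‖φ x‖ ≤ C := by
  obtain ⟨C, hC0, hC⟩ := schwartz_norm_le_wt φ 0
  exact ⟨C, hC0, fun x => by simpa [wt] using hC x⟩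

lemma aesmeas_ofReal {α : Type*} [MeasurableSpace α] {μ : Measure α} {q : α → ℝ}
    (hq : Integrable q μ) : AEStronglyMeasurable (fun v => (q v : ℂ)) μ :=
  Complex.continuous_ofReal.comp_aestronglyMeasurable hq.1

lemma integrable_mul_refl (hq : Integrable q) (φ : 𝓢(Pos n, ℂ)) (x : Pos n) :
    Integrable fun v => (q v : ℂ) * refl φ v x := by
  obtain ⟨C, hC0, hC⟩ := exists_schwartz_le φ
  have hc := cont_refl_left φ x
  refine (hq.norm.mul_const C).mono' ((aesmeas_ofReal hq).mul hc.aestronglyMeasurable)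
    (.of_forall fun v => ?_)
  rw [norm_mul, norm_refl, norm_real]
  exact mul_le_mul_of_nonneg_left (hC _) (norm_nonneg _)

lemma weyl_eq_integral_refl (hq : Integrable q) (φ : 𝓢(Pos n, ℂ)) (x : Pos n) :
    weyl q φ x = ((Real.pi ^ n)⁻¹ : ℝ) * ∫ v, (q v : ℂ) * refl φ v x := by
  rw [weyl_eq]
  have h := integrable_mul_refl hq φ x
  rw [volume_eq_prod] at h ⊢
  rw [integral_prod_symm _ h]
  simp only [refl]
  congr 2
  funext ξ
  congr 1
  funext u
  ring

lemma bargmann_refl (φ : Pos n → ℂ) (v z : Φ) :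
    bargmann (refl φ v) z = cis (2 * inner ℝ v.2 (z.1 - v.1)) *
      bargmann φ ((2 : ℝ) • v - z) := by
  rw [bargmann_eq_integral, bargmann_eq_integral, ← integral_const_mul,
    ← integral_sub_left_eq_self _ _ ((2 : ℝ) • v.1)]
  refine integral_ext fun y => ?_
  simp only [conj_coherent, refl, sub_sub_cancel, fst_sub, snd_sub, smul_fst,
    smul_snd]
  have e1 : z.1 - ((2 : ℝ) • v.1 - y) = -((2 : ℝ) • v.1 - z.1 - y) := by abel
  rw [e1, norm_neg]
  have e2 : exp (I * ((inner ℝ z.2 (-((2 : ℝ) • v.1 - z.1 - y)) : ℝ) : ℂ)) *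
      cis (2 * inner ℝ ((2 : ℝ) • v.1 - y - v.1) v.2) =
      cis (2 * inner ℝ v.2 (z.1 - v.1)) *
      exp (I * ((inner ℝ ((2 : ℝ) • v.2 - z.2) ((2 : ℝ) • v.1 - z.1 - y) : ℝ) : ℂ)) := by
    rw [← exp_add, ← exp_add]
    rw [mul_comm I, mul_comm I, ← add_mul, ← add_mul, ← Complex.ofReal_add,
      ← Complex.ofReal_add]
    rw [real_inner_comm v.2]
    simp only [inner_neg_right, inner_sub_left, inner_sub_right, real_inner_smul_left,
      real_inner_smul_right]
    ring
  linear_combination (bargmannConst n : ℂ) *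
    exp (-(((1 / 2 : ℝ) * ‖(2 : ℝ) • v.1 - z.1 - y‖ ^ 2 : ℝ) : ℂ)) * φ y * e2

/-- The function against which a symbol has to be integrated to obtain the Bargmann transform of its
Weyl operator applied to `φ`. -/
def wigFun (φ : Pos n → ℂ) (z v : Φ) : ℂ :=
  ((Real.pi ^ n)⁻¹ : ℝ) * cis (2 * inner ℝ v.2 (z.1 - v.1)) *
    bargmann φ ((2 : ℝ) • v - z)

lemma wigFun_coherent (z w v : Φ) : wigFun (coherent w) z v = wig z w v := by
  rw [wigFun, wig_eq, bargmann_coherent]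

lemma wigFun_eq_integral (z v : Φ) :
    wigFun φ z v = ∫ w, wig z w v * bargmann φ w := by
  simp only [wig_eq, mul_assoc]
  rw [wigFun, integral_const_mul, integral_const_mul,
    bargmann_eq_integral_repKer (memLp_schwartz φ), mul_assoc]

lemma memLp_weyl_of_integrable (hq : Integrable q) (φ : 𝓢(Pos n, ℂ)) :
    MemLp (weyl q φ) 2 volume := by
  obtain ⟨C, hC0, hC⟩ := exists_schwartz_le φ
  have hsm : AEStronglyMeasurable (fun p => (q p.2 : ℂ) * refl φ p.2 p.1)
      (volume.prod volume) :=
    (aesmeas_ofReal hq).comp_snd.mul (cont_refl φ).aestronglyMeasurable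
  have hI : Integrable (fun p : Pos n × Φ => (q p.2 : ℂ) * refl φ p.2 p.1)
      (volume.prod volume) := by
    rw [integrable_prod_iff' hsm]
    have hφi : ∀ v : Φ, Integrable fun x => ‖φ ((2 : ℝ) • v.1 - x)‖ := fun v =>
      (φ.integrable (μ := volume)).norm.comp_sub_left ((2 : ℝ) • v.1)
    refine ⟨Filter.Eventually.of_forall fun v => ?_, ?_⟩
    · have hc := cont_refl_right φ v
      have h1 : Integrable (refl φ v) :=
        (hφi v).mono' hc.aestronglyMeasurable (.of_forall fun x => (norm_refl _ _ _).le)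
      exact h1.const_mul (q v : ℂ)
    · have : ∀ v, ∫ x, ‖(q v : ℂ) * refl φ v x‖ = ‖q v‖ * ∫ x, ‖φ x‖ := fun v => by
        simp only [norm_mul, norm_refl, norm_real]
        rw [integral_const_mul, integral_sub_left_eq_self (fun x => ‖φ x‖)]
      simp only [this]; exact hq.norm.mul_const _
  have h1 : Integrable (weyl q φ) := by
    have := hI.integral_prod_left.const_mul (((Real.pi ^ n)⁻¹ : ℝ) : ℂ)
    refine this.congr (.of_forall fun x => ?_); rw [weyl_eq_integral_refl hq]
  have hbd : ∀ x, ‖weyl q φ x‖ ≤ (Real.pi ^ n)⁻¹ * ((∫ v, ‖q v‖) * C) := by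
    intro x
    rw [weyl_eq_integral_refl hq, norm_mul, norm_real, norm_of_nonneg (by positivity),
      ← integral_mul_const]
    gcongr; refine norm_integral_le_of_norm_le (hq.norm.mul_const C) (.of_forall fun v => ?_)
    rw [norm_mul, norm_refl, norm_real]; exact mul_le_mul_of_nonneg_left (hC _) (norm_nonneg _)
  rw [memLp_two_iff_integrable_sq_norm h1.1]
  refine (h1.norm.const_mul ((Real.pi ^ n)⁻¹ * ((∫ v, ‖q v‖) * C))).mono' (h1.1.norm.pow 2)
    (.of_forall fun x => ?_)
  rw [norm_pow, norm_norm, pow_two]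
  exact mul_le_mul_of_nonneg_right (hbd x) (norm_nonneg _)

lemma bargmann_weyl_of_integrable (hq : Integrable q) (φ : 𝓢(Pos n, ℂ))
    (z : Φ) : bargmann (weyl q φ) z = ∫ v, (q v : ℂ) * wigFun φ z v := by
  obtain ⟨C, hC0, hC⟩ := exists_schwartz_le φ
  have hI : Integrable (uncurry fun (x : Pos n) (v : Φ) =>
      conj (coherent z x) * ((q v : ℂ) * refl φ v x)) (volume.prod volume) := by
    have h0 : Integrable (fun p => ‖coherent z p.1‖ * (‖q p.2‖ * C))
        (volume.prod volume) :=
      (coherent z).integrable.norm.mul_prod (hq.norm.mul_const C)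
    refine h0.mono' ?_ (.of_forall fun p => ?_)
    · have hc : Continuous fun p : Pos n × Φ => conj (coherent z p.1) := by
        fun_prop
      exact hc.aestronglyMeasurable.mul
        ((aesmeas_ofReal hq).comp_snd.mul (cont_refl φ).aestronglyMeasurable)
    · simp only [uncurry, norm_mul, norm_refl, norm_real, RCLike.norm_conj]; gcongr; exact hC _
  rw [bargmann_eq_integral]
  have h1 : ∀ x, conj (coherent z x) * weyl q φ x =
      ((Real.pi ^ n)⁻¹ : ℝ) * ∫ v, conj (coherent z x) * ((q v : ℂ) * refl φ v x) := fun x => by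
    rw [weyl_eq_integral_refl hq, integral_const_mul]; ring
  simp only [h1]
  rw [integral_const_mul, integral_integral_swap hI, ← integral_const_mul]
  refine integral_ext fun v => ?_
  have h2 : ∫ x, conj (coherent z x) * ((q v : ℂ) * refl φ v x) = (q v : ℂ) * bargmann (refl φ v) z := by
    rw [bargmann_eq_integral, ← integral_const_mul]; grind
  simp only [h2, bargmann_refl, wigFun]
  ring

/-! ### Admissible symbols -/

/-- The sum of the weighted integrals of the derivatives of `q` up to order `m`. -/
def symSize (m K : ℕ) (q : Φ → ℝ) (c : Φ) : ℝ≥0∞ :=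
  wtInt K q c + ∑ j : 𝕁, ∑ i ∈ Finset.range (m + 1), wtInt K ((dph j)^[i] q) c

/-- Smooth symbols all of whose pure derivatives are integrable with a polynomial weight. -/
structure IsAdm (K : ℕ) (q : Φ → ℝ) : Prop where
  smooth : ContDiff ℝ ∞ q
  ne_top : ∀ m, symSize m K q 0 ≠ ⊤

lemma wtInt_le_mul (K : ℕ) (q : Φ → ℝ) (c c' : Φ) :
    wtInt K q c ≤ ofReal ((1 + ‖c - c'‖) ^ K) * wtInt K q c' := by
  rw [wtInt, wtInt, ← lintegral_const_mul' _ _ ofReal_ne_top]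
  refine lintegral_mono fun v => ?_
  rw [← ofReal_mul (by positivity)]
  refine ofReal_le_ofReal ?_
  have h := wt_sub_le K (v - c') (c - c')
  rw [sub_sub_sub_cancel_right] at h
  calc |q v| * wt K (v - c) ≤ |q v| * ((1 + ‖c - c'‖) ^ K * wt K (v - c')) := by gcongr
    _ = _ := by ring

lemma symSize_le_mul (m K : ℕ) (q : Φ → ℝ) (c c' : Φ) :
    symSize m K q c ≤ ofReal ((1 + ‖c - c'‖) ^ K) * symSize m K q c' := by
  rw [symSize, symSize, mul_add, mul_sum]
  refine add_le_add (wtInt_le_mul _ _ _ _) (sum_le_sum fun j _ => ?_)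
  rw [mul_sum]
  exact sum_le_sum fun i _ => wtInt_le_mul _ _ _ _

lemma norm_mid_sub_le (z w c : Φ) : ‖mid z w - c‖ ≤ ‖z - c‖ + ‖w - c‖ := by
  have : mid z w - c = (1 / 2 : ℝ) • (z - c) + (1 / 2 : ℝ) • (w - c) := by rw [mid]; module
  rw [this]
  refine (norm_add_le _ _).trans ?_
  rw [norm_smul, norm_smul]
  norm_num
  linarith [norm_nonneg (z - c), norm_nonneg (w - c)]

lemma norm_mid_sub_left : ‖mid z w - z‖ ≤ ‖z - w‖ := by
  have := norm_mid_sub_le z w z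
  rwa [sub_self, norm_zero, zero_add, norm_sub_rev w z] at this

lemma exists_symKer_le (n m K : ℕ) : ∃ C, 0 < C ∧
    ∀ (q : Φ → ℝ) (B : ℝ), ContDiff ℝ ∞ q → 0 ≤ B →
      symSize (m + K) K q 0 ≤ ofReal B → ∀ z w,
        ‖symKer q z w‖ ≤ C * B * ((1 + ‖z‖) ^ K * wt m (z - w)) := by
  obtain ⟨C, hC, h⟩ := exists_decay_symKer n (m + K) K
  refine ⟨C, hC, fun q B hq hB0 hB z w => ?_⟩
  have h1 := h q hq z w
  have h2 : symSize (m + K) K q (mid z w) ≤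
      ofReal (((1 + ‖z‖) * (1 + ‖z - w‖)) ^ K) * ofReal B := by
    refine (symSize_le_mul (m + K) K q (mid z w) 0).trans ?_; gcongr; rw [sub_zero]
    have := norm_mid_sub_left z w
    have h3 : ‖mid z w‖ ≤ ‖z‖ + ‖z - w‖ := by
      calc ‖mid z w‖ = ‖z + (mid z w - z)‖ := by abel
        _ ≤ _ := (norm_add_le _ _).trans (by linarith)
    nlinarith [norm_nonneg z, norm_nonneg (z - w), mul_nonneg (norm_nonneg z) (norm_nonneg (z - w))]
  have h3 := h1.trans (mul_le_mul_right h2 _)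
  rw [← ofReal_norm, ← ofReal_mul (by positivity), ← ofReal_mul (by positivity),
    ← ofReal_mul hC.le, ofReal_le_ofReal_iff (by positivity)] at h3
  rw [← mul_assoc, le_mul_wt_iff]
  have h4 : 0 < (1 + ‖z - w‖) ^ K := by positivity
  refine le_of_mul_le_mul_right ?_ h4
  calc ‖symKer q z w‖ * (1 + ‖z - w‖) ^ m * (1 + ‖z - w‖) ^ K
      = (1 + ‖z - w‖) ^ (m + K) * ‖symKer q z w‖ := by ring
    _ ≤ _ := h3
    _ = _ := by rw [mul_pow]; ring

lemma IsAdm.integrable (hq : IsAdm K q) (c : Φ) :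
    Integrable fun v => |q v| * wt K (v - c) := by
  refine integrable_of_wtInt_ne_top hq.smooth.continuous ?_
  refine ne_top_of_le_ne_top ?_ (wtInt_le_mul K q c 0)
  exact mul_ne_top ofReal_ne_top (add_ne_top.1 (hq.ne_top 0)).1

lemma IsAdm.wtInt_ne_top (hq : IsAdm K q) (j : 𝕁) (i : ℕ) :
    wtInt K ((dph j)^[i] q) 0 ≠ ⊤ :=
  sum_ne_top.1 (sum_ne_top.1 (add_ne_top.1 (hq.ne_top i)).2 j
    (Finset.mem_univ j)) i (Finset.self_mem_range_succ i)

/-! ### Regularisation -/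

/-- Gaussian cutoff functions. -/
def cutoff (s : ℝ) (v : Φ) : ℝ := realGauss n (s • v)

lemma contDiff_cutoff (s : ℝ) : ContDiff ℝ ∞ (cutoff s : Φ → ℝ) :=
  ((realGauss n).smooth ⊤).comp (contDiff_const_smul s)

lemma cutoff_nonneg (s : ℝ) (v : Φ) : 0 ≤ cutoff s v := (Real.exp_pos _).le

lemma cutoff_le_one (s : ℝ) (v : Φ) : cutoff s v ≤ 1 := by
  rw [cutoff, realGauss_apply, Real.exp_le_one_iff]
  have := sq_norm_le_sqNorm (s • v)
  nlinarith [sq_nonneg ‖s • v‖]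

lemma tendsto_cutoff : Tendsto (fun k : ℕ => cutoff (1 / ((k : ℝ) + 1)) v)
    atTop (nhds 1) := by
  have h1 : Continuous fun s : ℝ => cutoff s v := by
    unfold cutoff; fun_prop
  have h2 := (h1.tendsto 0).comp tendsto_one_div_add_atTop_nhds_zero_nat
  have h3 : cutoff 0 v = 1 := by simp [cutoff, realGauss_apply, sqNorm]
  rwa [h3] at h2

lemma exists_dirD_cutoff_le (n m : ℕ) : ∃ C, 0 ≤ C ∧ ∀ s ∈ 𝕋,
    ∀ (j : 𝕁), ∀ i ≤ m, ∀ v, ‖(dph j)^[i] (cutoff s) v‖ ≤ C := by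
  have : ∀ j, ∃ A, 0 ≤ A ∧ ∀ i ≤ m, ∀ x,
      ‖(dph j)^[i] (realGauss n) x‖ ≤ A := fun j => by
    obtain ⟨A, hA0, hA⟩ := schwartz_norm_iterD_le_wt (realGauss n) (ph j) m 0
    exact ⟨A, hA0, fun i hi x => by simpa [wt] using hA i hi x⟩
  choose A hA0 hA using this
  refine ⟨∑ j, A j, sum_nonneg fun j _ => hA0 j, fun s hs j i hi v => ?_⟩
  have h1 := iterD_comp_smul ((realGauss n).smooth ⊤) (ph j) s i
  change ‖(dph j)^[i] (fun v => realGauss n (s • v)) v‖ ≤ _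
  rw [h1, norm_smul, norm_pow, norm_of_nonneg hs.1]
  calc s ^ i * ‖(dph j)^[i] (realGauss n) (s • v)‖ ≤ 1 * A j :=
        mul_le_mul (pow_le_one₀ hs.1 hs.2) (hA j i hi _) (norm_nonneg _) zero_le_one
    _ ≤ ∑ j, A j := by
        rw [one_mul]; exact single_le_sum (f := A) (fun j _ => hA0 j) (Finset.mem_univ j)

lemma IsAdm.exists_symSize_cutoff_le (hq : IsAdm K q) (m : ℕ) :
    ∃ B, 0 ≤ B ∧ ∀ s ∈ 𝕋,
      symSize m K (fun v => q v * cutoff s v) 0 ≤ ofReal B := by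
  obtain ⟨C, hC0, hC⟩ := exists_dirD_cutoff_le n m
  set R : ℝ≥0∞ := wtInt K q 0 + ∑ j, ∑ i ∈ Finset.range (m + 1),
    ofReal (2 ^ i * C) * ∑ k ∈ Finset.range (i + 1), wtInt K ((dph j)^[k] q) 0 with hR
  have hRtop : R ≠ ⊤ := by
    refine add_ne_top.2 ⟨(add_ne_top.1 (hq.ne_top 0)).1, ?_⟩
    exact sum_ne_top.2 fun j _ => sum_ne_top.2 fun i _ =>
      mul_ne_top ofReal_ne_top (sum_ne_top.2 fun k _ => hq.wtInt_ne_top j k)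
  refine ⟨R.toReal, toReal_nonneg, fun s hs => ?_⟩
  rw [ofReal_toReal hRtop, symSize, hR]
  refine add_le_add (lintegral_mono fun v => ofReal_le_ofReal ?_)
    (sum_le_sum fun j _ => sum_le_sum fun i hi => ?_)
  · rw [abs_mul, abs_of_nonneg (cutoff_nonneg s v)]; have := wt_nonneg K (v - 0); gcongr
    exact mul_le_of_le_one_right (abs_nonneg _) (cutoff_le_one s v)
  · have him : i ≤ m := Nat.lt_succ_iff.1 (Finset.mem_range.1 hi); simp only [wtInt]
    rw [← lintegral_finsetSum', ← lintegral_const_mul' _ _ ofReal_ne_top]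
    · refine lintegral_mono fun v => ?_; have hw := wt_nonneg K (v - 0)
      rw [← ofReal_sum_of_nonneg fun k _ => mul_nonneg (abs_nonneg _) hw,
        ← ofReal_mul (by positivity)]
      refine ofReal_le_ofReal ?_
      have h1 := norm_iterD_mul_le hq.smooth (contDiff_cutoff s) (ph j) i v (G := C)
        (fun k hk => hC s hs j k (hk.trans him) v)
      simp only [norm_eq_abs] at h1; rw [← sum_mul]
      calc _ ≤ 2 ^ i * ((∑ k ∈ Finset.range (i + 1), |(dph j)^[k] q v|) * C) *
            wt K (v - 0) := by gcongr
        _ = _ := by ring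
    · intro k _; have := (contDiff_iterD hq.smooth (ph j) k).continuous; fun_prop

lemma IsAdm.integrable_mul_cutoff (hq : IsAdm K q) {s : ℝ} (hs : 0 < s) :
    Integrable fun v => q v * cutoff s v := by
  obtain ⟨C, hC0, hC⟩ := schwartz_norm_le_wt (realGauss n) K
  have h1 : ∀ v, cutoff s v ≤ C * ((max 1 s⁻¹) ^ K * wt K v) := fun v => by
    have : ‖cutoff s v‖ ≤ C * wt K (s • v) := hC (s • v)
    rw [norm_of_nonneg (cutoff_nonneg s v)] at this; refine this.trans ?_; gcongr
    refine wt_le_of_norm_le K (le_max_left _ _) ?_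
    rw [norm_smul, norm_of_nonneg hs.le, ← mul_assoc]
    refine le_mul_of_one_le_left (norm_nonneg _) ?_
    calc 1 = s⁻¹ * s := (inv_mul_cancel₀ hs.ne').symm
      _ ≤ _ := by gcongr; exact le_max_right _ _
  have h2 := (hq.integrable 0).const_mul (C * (max 1 s⁻¹) ^ K)
  refine h2.mono' (hq.smooth.continuous.mul (contDiff_cutoff s).continuous).aestronglyMeasurable
    (.of_forall fun v => ?_)
  rw [norm_mul, norm_eq_abs, norm_of_nonneg (cutoff_nonneg s v), sub_zero]
  calc |q v| * cutoff s v ≤ |q v| * (C * ((max 1 s⁻¹) ^ K * wt K v)) := by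
        gcongr; exact h1 v
    _ = _ := by ring

lemma exists_wigFun_le (K : ℕ) : ∃ C, 0 ≤ C ∧ ∀ z v,
    ‖wigFun φ z v‖ ≤ C * ((1 + ‖z‖) ^ K * wt K v) := by
  obtain ⟨C, hC0, hC⟩ := exists_bargmann_schwartz_le φ K
  refine ⟨(Real.pi ^ n)⁻¹ * C, by positivity, fun z v => ?_⟩
  rw [wigFun, norm_mul, norm_mul, norm_exp_ofReal_mul_I, mul_one, norm_real,
    norm_of_nonneg (by positivity), mul_assoc]
  gcongr
  refine (hC _).trans ?_
  gcongr
  exact wt_two_smul_sub_le K v z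

lemma cont_bargmann_schwartz : Continuous (bargmann φ) := by
  have := cont_bargmann ((memLp_schwartz φ).toLp φ)
  rwa [bargmann_congr (memLp_schwartz φ).coeFn_toLp] at this

lemma cont_wigFun (z : Φ) : Continuous (wigFun φ z) := by
  have h := cont_bargmann_schwartz φ
  unfold wigFun
  fun_prop

lemma IsAdm.integrable_mul_wigFun (hq : IsAdm K q) (φ : 𝓢(Pos n, ℂ))
    (z : Φ) : Integrable fun v => (q v : ℂ) * wigFun φ z v := by
  obtain ⟨C, hC0, hC⟩ := exists_wigFun_le φ K
  have hc : Continuous fun v => (q v : ℂ) * wigFun φ z v :=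
    (Complex.continuous_ofReal.comp hq.smooth.continuous).mul (cont_wigFun φ z)
  refine ((hq.integrable 0).const_mul (C * (1 + ‖z‖) ^ K)).mono' hc.aestronglyMeasurable
    (.of_forall fun v => ?_)
  rw [norm_mul, norm_real, norm_eq_abs, sub_zero]
  calc |q v| * ‖wigFun φ z v‖ ≤ |q v| * (C * ((1 + ‖z‖) ^ K * wt K v)) := by gcongr; exact hC z v
    _ = _ := by ring

lemma finrank_phase (n : ℕ) : Module.finrank ℝ Φ = 2 * n := by
  rw [Module.finrank_prod, finrank_euclideanSpace_fin, two_mul]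

lemma cont_wig_comp {α : Type*} [TopologicalSpace α] {f g h : α → Φ}
    (hf : Continuous f) (hg : Continuous g) (hh : Continuous h) :
    Continuous fun p => wig (f p) (g p) (h p) := by
  have := (cont_wig (n := n)).comp (hf.prodMk (hg.prodMk hh))
  simpa only [comp_def] using this

lemma IsAdm.integral_mul_wigFun (hq : IsAdm K q) (φ : 𝓢(Pos n, ℂ))
    (z : Φ) : ∫ v, (q v : ℂ) * wigFun φ z v = ∫ w, symKer q z w * bargmann φ w := by
  have hcφ := cont_bargmann_schwartz φ
  obtain ⟨C1, hC10, hC1⟩ := exists_wig_le n K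
  obtain ⟨C2, hC20, hC2⟩ := exists_bargmann_schwartz_le φ (K + d₁)
  have hI : Integrable (uncurry fun (v w : Φ) =>
      (q v : ℂ) * (wig z w v * bargmann φ w)) (volume.prod volume) := by
    have h0 := ((hq.integrable 0).const_mul (C1 * (1 + ‖z‖) ^ K)).mul_prod
      ((integrable_wt (μ := (volume : Measure Φ)) (K := d₁)
        (by rw [finrank_phase]; omega)).const_mul C2)
    refine h0.mono' ?_ (.of_forall fun p => ?_)
    · have c1 : Continuous fun p : Φ × Φ => wig z p.2 p.1 :=
        cont_wig_comp continuous_const continuous_snd continuous_fst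
      have c2 := hq.smooth.continuous; fun_prop
    · obtain ⟨v, w⟩ := p; simp only [uncurry, norm_mul, norm_real, norm_eq_abs, sub_zero]
      have h1 := wt_sub_le K v (mid z w)
      have h2 : (1 + ‖mid z w‖) ^ K ≤ (1 + ‖z‖) ^ K * (1 + ‖w‖) ^ K := by
        rw [← mul_pow]; gcongr; have := norm_mid_sub_le z w 0; simp only [sub_zero] at this
        nlinarith [norm_nonneg z, norm_nonneg w, mul_nonneg (norm_nonneg z) (norm_nonneg w)]
      have w0 := wt_nonneg K v
      calc |q v| * (‖wig z w v‖ * ‖bargmann φ w‖)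
          ≤ |q v| * ((C1 * ((1 + ‖z‖) ^ K * (1 + ‖w‖) ^ K * wt K v)) *
              (C2 * wt (K + d₁) w)) := by
            gcongr
            · exact (hC1 z w v).trans (mul_le_mul_of_nonneg_left (h1.trans (by gcongr)) hC10)
            · exact hC2 w
        _ = C1 * (1 + ‖z‖) ^ K * (|q v| * wt K v) * (C2 * wt d₁ w) *
              (wt K w * (1 + ‖w‖) ^ K) := by rw [wt_add]; ring
        _ = _ := by rw [wt_mul_pow, mul_one]
  simp only [wigFun_eq_integral]
  calc ∫ v, (q v : ℂ) * ∫ w, wig z w v * bargmann φ w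
      = ∫ v, ∫ w, (q v : ℂ) * (wig z w v * bargmann φ w) := by simp only [integral_const_mul]
    _ = ∫ w, ∫ v, (q v : ℂ) * (wig z w v * bargmann φ w) := integral_integral_swap hI
    _ = _ := by
      refine integral_ext fun w => ?_; simp only [symKer]; rw [← integral_mul_const]
      simp only [mul_assoc]

lemma integrable_wt_phase : Integrable (wt d₁ : Φ → ℝ) :=
  integrable_wt (by rw [finrank_phase]; omega)

lemma exists_integral_wigFun_le (K r : ℕ) : ∃ C, 0 ≤ C ∧ ∃ m,
    ∀ (q : Φ → ℝ) (B : ℝ), IsAdm K q → 0 ≤ B → symSize m K q 0 ≤ ofReal B →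
      ∀ z, ‖∫ v, (q v : ℂ) * wigFun φ z v‖ ≤ C * B * wt r z := by
  set m := K + r + d₁ with hm
  have hm' : Module.finrank ℝ Φ < m := by rw [finrank_phase]; omega
  obtain ⟨C1, hC10, hC1⟩ := exists_symKer_le n m K
  obtain ⟨C2, hC20, hC2⟩ := exists_bargmann_schwartz_le φ m
  set I := ∫ w : Φ, wt m w with hI
  have hI0 : 0 ≤ I := integral_nonneg fun w => wt_nonneg _ _
  refine ⟨C1 * C2 * (2 ^ (m + 1) * I), by positivity, m + K, fun q B hq hB0 hB z => ?_⟩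
  have hb := hC1 q B hq.smooth hB0 hB z
  rw [hq.integral_mul_wigFun]
  have h1 := integral_wt_mul_wt_le (μ := (volume : Measure Φ)) hm' z 0
  have hi := integrable_wt_mul_wt (μ := (volume : Measure Φ)) hm' z 0
  simp only [sub_zero] at h1 hi
  calc ‖∫ w, symKer q z w * bargmann φ w‖
      ≤ ∫ w, C1 * B * (1 + ‖z‖) ^ K * C2 * (wt m (z - w) * wt m w) := by
        refine norm_integral_le_of_norm_le (hi.const_mul _) (.of_forall fun w => ?_); rw [norm_mul]
        have w1 := wt_nonneg m (z - w)
        calc _ ≤ C1 * B * ((1 + ‖z‖) ^ K * wt m (z - w)) * (C2 * wt m w) :=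
              mul_le_mul (hb w) (hC2 w) (norm_nonneg _) (by positivity)
          _ = _ := by ring
    _ ≤ C1 * B * (1 + ‖z‖) ^ K * C2 * (2 ^ (m + 1) * I * wt m z) := by
        rw [integral_const_mul]; gcongr
    _ = C1 * C2 * (2 ^ (m + 1) * I) * B * (wt K z * (1 + ‖z‖) ^ K) * wt r z * wt d₁ z := by
        rw [hm, wt_add, wt_add]; ring
    _ ≤ _ := by
        rw [wt_mul_pow, mul_one]
        exact mul_le_of_le_one_right (mul_nonneg (by positivity) (wt_nonneg _ _)) (wt_le_one _ _)

lemma iterD_comp_affine {E G F : Type*} [NormedAddCommGroup E] [NormedSpace ℝ E]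
    [NormedAddCommGroup G] [NormedSpace ℝ G] [NormedAddCommGroup F] [NormedSpace ℝ F]
    {f : G → F} (hf : ContDiff ℝ ∞ f) (A : E →L[ℝ] G) (c : G) (e : E) (m : ℕ) :
    (dirD e)^[m] (fun x => f (A x + c)) = fun x => (dirD (A e))^[m] f (A x + c) := by
  induction m generalizing f with
  | zero => rfl
  | succ m ih =>
    rw [iterate_succ_apply, iterate_succ_apply, ← ih (contDiff_dirD hf (A e))]; congr 1; funext x
    have h1 : HasFDerivAt (fun x => A x + c) A x := A.hasFDerivAt.add_const c
    have h2 := ((hf.differentiable (by simp)) (A x + c)).hasFDerivAt.comp x h1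
    exact DFunLike.congr_fun h2.fderiv e

/-- The sum of the `x`-derivatives up to order `K`. -/
def sliceSum (K : ℕ) (q : Φ → ℝ) (v : Φ) : ℝ :=
  |q v| + ∑ j : Fin n, ∑ i ∈ Finset.range (K + 1), |(dirD (ph (inl j)))^[i] q v|

lemma cont_sliceSum (K : ℕ) (hq : ContDiff ℝ ∞ q) :
    Continuous (sliceSum K q) := by
  have h0 := hq.continuous
  refine h0.abs.add (continuous_finsetSum _ fun j _ => continuous_finsetSum _ fun i _ => ?_)
  exact (contDiff_iterD hq (ph (inl j)) i).continuous.abs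

lemma sliceSum_nonneg (K : ℕ) (q : Φ → ℝ) (v : Φ) : 0 ≤ sliceSum K q v :=
  add_nonneg (abs_nonneg _) (sum_nonneg fun _ _ => sum_nonneg fun _ _ => abs_nonneg _)

lemma IsAdm.integrable_sliceSum (hq : IsAdm K q) :
    Integrable fun v => sliceSum K q v * wt K v := by
  simp only [sliceSum, add_mul, sum_mul]
  have h0 := hq.integrable 0
  simp only [sub_zero] at h0
  refine h0.add (integrable_finsetSum _ fun j _ => integrable_finsetSum _ fun i _ => ?_)
  have := integrable_of_wtInt_ne_top
    (contDiff_iterD hq.smooth (ph (inl j)) i).continuous (hq.wtInt_ne_top (inl j) i)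
  simpa only [sub_zero] using this

/-- The regularised integrand of `weyl q φ x`, without the oscillating factor. -/
def regIntegrand (q : Φ → ℝ) (φ : Pos n → ℂ) (x : Pos n) (s : ℝ) (v : Φ) : ℂ :=
  (q v : ℂ) * ((cutoff s v : ℂ) * φ ((2 : ℝ) • v.1 - x))

lemma contDiff_ofReal {E : Type*} [NormedAddCommGroup E] [NormedSpace ℝ E] {q : E → ℝ}
    (hq : ContDiff ℝ ∞ q) : ContDiff ℝ ∞ fun v => (q v : ℂ) :=
  ofRealCLM.contDiff.comp hq

lemma contDiff_schwartz_affine (x : Pos n) :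
    ContDiff ℝ ∞ fun v : Φ => φ ((2 : ℝ) • v.1 - x) :=
  (φ.smooth ⊤).comp ((contDiff_fst.const_smul (2 : ℝ)).sub contDiff_const)

lemma contDiff_regIntegrand (hq : ContDiff ℝ ∞ q) (φ : 𝓢(Pos n, ℂ)) (x : Pos n)
    (s : ℝ) : ContDiff ℝ ∞ (regIntegrand q φ x s) :=
  (contDiff_ofReal hq).mul ((contDiff_ofReal (contDiff_cutoff s)).mul (contDiff_schwartz_affine φ x))

lemma exists_dirD_regIntegrand_le (x : Pos n) (K : ℕ) :
    ∃ A, 0 ≤ A ∧ ∀ q, ContDiff ℝ ∞ q → ∀ s ∈ 𝕋, ∀ v,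
      ‖regIntegrand q φ x s v‖ ≤ A * (sliceSum K q v * wt K v.1) ∧
      ∀ (j : Fin n), ∀ i ≤ K,
        ‖(dirD (ph (inl j)))^[i] (regIntegrand q φ x s) v‖ ≤
          A * (sliceSum K q v * wt K v.1) := by
  obtain ⟨C, hC0, hC⟩ := exists_dirD_cutoff_le n K
  have hP : ∀ j, ∃ B, 0 ≤ B ∧ ∀ i ≤ K, ∀ u,
      ‖(dirD ((2 : ℝ) • (ph (inl j) : Φ).1))^[i] φ u‖ ≤ B * wt K u := fun j =>
    schwartz_norm_iterD_le_wt φ _ K K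
  choose B hB0 hB using hP
  obtain ⟨B₁, hB₁0, hB₁⟩ := schwartz_norm_le_wt φ K
  set b := B₁ + ∑ j, B j with hb
  have hsB : 0 ≤ ∑ j, B j := sum_nonneg fun j _ => hB0 j
  have hb0 : 0 ≤ b := add_nonneg hB₁0 hsB
  have hpe : ∀ v : Φ, _ := fun v => wt_two_smul_sub_le K v.1 x
  set p := (1 + ‖x‖) ^ K with hp
  refine ⟨b * p + 2 ^ K * (2 ^ K * (((K + 1) * C) * (b * p))), by positivity, fun q hq s hs v => ?_⟩
  have hS := sliceSum_nonneg K q v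
  have hw := wt_nonneg K v.1
  constructor
  · rw [regIntegrand, norm_mul, norm_mul, norm_real, norm_real,
      norm_of_nonneg (cutoff_nonneg s v)]
    have h1 : ‖(q v : ℝ)‖ ≤ sliceSum K q v := by
      exact le_add_of_nonneg_right (sum_nonneg fun _ _ => sum_nonneg fun _ _ => abs_nonneg _)
    have h2 : ‖φ ((2 : ℝ) • v.1 - x)‖ ≤ b * (p * wt K v.1) :=
      (hB₁ _).trans (mul_le_mul (by linarith) (hpe v) (wt_nonneg _ _) hb0)
    calc ‖(q v : ℝ)‖ * (cutoff s v * ‖φ ((2 : ℝ) • v.1 - x)‖)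
        ≤ sliceSum K q v * (1 * (b * (p * wt K v.1))) := by
          have := cutoff_nonneg s v; gcongr; exact cutoff_le_one s v
      _ = b * p * (sliceSum K q v * wt K v.1) := by ring
      _ ≤ _ := by
          gcongr; exact le_add_of_nonneg_right (by positivity)
  · intro j i hi
    have hφ : ∀ k ≤ i, ‖(dirD (ph (inl j)))^[k] (fun v => φ ((2 : ℝ) • v.1 - x)) v‖ ≤
        b * (p * wt K v.1) := fun k hk => by
      have h1 := iterD_comp_affine (φ.smooth ⊤)
        ((2 : ℝ) • ContinuousLinearMap.fst ℝ (Pos n) (Pos n)) (-x) (ph (inl j)) k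
      have h2 := congrFun h1 v
      refine (le_of_eq (congrArg _ h2)).trans ((hB j k (hk.trans hi) _).trans ?_)
      refine mul_le_mul ?_ (hpe v) (wt_nonneg _ _) hb0
      have := single_le_sum (f := B) (fun j _ => hB0 j) (Finset.mem_univ j); linarith
    have hcut : ∀ k ≤ i, ‖(dirD (ph (inl j)))^[k] (fun v => (cutoff s v : ℂ)) v‖ ≤ C :=
      fun k hk => by
        rw [iterD_ofReal (contDiff_cutoff s), norm_real]; exact hC s hs _ k (hk.trans hi) v
    have hprod : ∀ k ≤ i, ‖(dirD (ph (inl j)))^[k] (fun v =>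
        (cutoff s v : ℂ) * φ ((2 : ℝ) • v.1 - x)) v‖ ≤
          2 ^ K * (((K + 1) * C) * (b * (p * wt K v.1))) := fun k hk => by
      refine (norm_iterD_mul_le (contDiff_ofReal (contDiff_cutoff s))
        (contDiff_schwartz_affine φ x) _ k v (fun l hl => hφ l (hl.trans hk))).trans ?_
      have h3 : ∑ l ∈ Finset.range (k + 1), ‖(dirD (ph (inl j)))^[l]
          (fun v => (cutoff s v : ℂ)) v‖ ≤ (K + 1) * C := by
        calc _ ≤ ∑ l ∈ Finset.range (k + 1), C := sum_le_sum fun l hl =>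
              hcut l ((Nat.lt_succ_iff.1 (Finset.mem_range.1 hl)).trans hk)
          _ = (k + 1) * C := by simp
          _ ≤ _ := by
              have : (k : ℝ) ≤ K := by exact_mod_cast hk.trans hi
              gcongr
      gcongr
      · exact one_le_two
      · exact hk.trans hi
    refine (norm_iterD_mul_le (contDiff_ofReal hq)
      ((contDiff_ofReal (contDiff_cutoff s)).mul (contDiff_schwartz_affine φ x)) _ i v hprod).trans ?_
    have h4 : ∑ l ∈ Finset.range (i + 1), ‖(dirD (ph (inl j)))^[l]
        (fun v => (q v : ℂ)) v‖ ≤ sliceSum K q v := by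
      refine le_trans ?_ (le_add_of_nonneg_left (abs_nonneg _))
      calc _ = ∑ l ∈ Finset.range (i + 1), |(dirD (ph (inl j)))^[l] q v| := by
            refine sum_congr rfl fun l _ => ?_; rw [iterD_ofReal hq, norm_real, norm_eq_abs]
        _ ≤ ∑ l ∈ Finset.range (K + 1), |(dirD (ph (inl j)))^[l] q v| :=
            Finset.sum_le_sum_of_subset_of_nonneg
              (Finset.range_mono (by omega)) fun _ _ _ => abs_nonneg _
        _ ≤ _ := single_le_sum (f := fun j => ∑ l ∈ Finset.range (K + 1),
            |(dirD (ph (inl j)))^[l] q v|)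
            (fun j _ => sum_nonneg fun _ _ => abs_nonneg _) (Finset.mem_univ j)
    calc _ ≤ 2 ^ K * (sliceSum K q v * (2 ^ K * (((K + 1) * C) * (b * (p * wt K v.1))))) := by
          gcongr; exact one_le_two
      _ = 2 ^ K * (2 ^ K * (((K + 1) * C) * (b * p))) * (sliceSum K q v * wt K v.1) := by ring
      _ ≤ _ := by
          gcongr; exact le_add_of_nonneg_left (by positivity)

/-- The inner integral in `weyl_eq`. -/
def regSlice (q : Φ → ℝ) (φ : Pos n → ℂ) (x : Pos n) (s : ℝ) (ξ : Pos n) : ℂ :=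
  ∫ u : Pos n, cis (2 * inner ℝ (x - u) ξ) * regIntegrand q φ x s (u, ξ)

lemma weyl_mul_cutoff (q : Φ → ℝ) (φ : Pos n → ℂ) (x : Pos n) (s : ℝ) :
    weyl (fun v => q v * cutoff s v) φ x = ((Real.pi ^ n)⁻¹ : ℝ) * ∫ ξ, regSlice q φ x s ξ := by
  rw [weyl_eq]
  simp only [regSlice, regIntegrand, Complex.ofReal_mul, mul_assoc]

lemma cutoff_zero : cutoff 0 v = 1 := by
  simp [cutoff, realGauss_apply, sqNorm]

lemma wt_fst_le (K : ℕ) (u ξ : Pos n) : wt K u ≤ (1 + ‖ξ‖) ^ K * wt K (u, ξ) := by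
  have h := wt_fst_mul_wt_snd_le K (u, ξ)
  calc wt K u = wt K u * wt K ξ * (1 + ‖ξ‖) ^ K := by rw [mul_assoc, wt_mul_pow, mul_one]
    _ ≤ wt K (u, ξ) * (1 + ‖ξ‖) ^ K := by gcongr
    _ = _ := mul_comm _ _

lemma exists_regSlice_le (x : Pos n) (K : ℕ) :
    ∃ A, 0 ≤ A ∧ ∀ q, ContDiff ℝ ∞ q → ∀ ξ,
      Integrable (fun u => sliceSum K q (u, ξ) * wt K (u, ξ)) → ∀ s ∈ 𝕋,
      ‖regSlice q φ x s ξ‖ ≤ A * ∫ u, sliceSum K q (u, ξ) * wt K (u, ξ) := by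
  obtain ⟨A, hA0, hA⟩ := exists_dirD_regIntegrand_le φ x K
  obtain ⟨C, hC0, hC⟩ := exists_decay_integral_cexp (F := Pos n)
    (fun i => (single i (1 : ℝ) : Pos n)) K
  refine ⟨C * ((1 + n) * A), by positivity, fun q hq ξ hint s hs => ?_⟩
  set R := regIntegrand q φ x s with hR
  have hRs := contDiff_regIntegrand hq φ x s
  set f : Pos n → ℂ := fun u => R (u, ξ) with hf
  have hslice : ContDiff ℝ ∞ f := hRs.comp (contDiff_id.prodMk contDiff_const)
  have hD : ∀ (j : Fin n) (i : ℕ), (dirD (single j (1 : ℝ) : Pos n))^[i] f =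
      fun u => (dirD (ph (inl j)))^[i] R (u, ξ) := fun j i => by
    have := iterD_comp_affine hRs (ContinuousLinearMap.inl ℝ (Pos n) (Pos n)) (0, ξ)
      (single j (1 : ℝ)) i
    have e1 : ∀ u, ContinuousLinearMap.inl ℝ (Pos n) (Pos n) u + (0, ξ) = (u, ξ) :=
      fun u => by simp
    simp only [e1] at this; exact this
  have hd : Integrable fun u => sliceSum K q (u, ξ) * wt K u := by
    have hcS := cont_sliceSum K hq
    refine ((hint.const_mul ((1 + ‖ξ‖) ^ K)).mono' (by fun_prop : Continuous fun u =>
      sliceSum K q (u, ξ) * wt K u).aestronglyMeasurable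
      (.of_forall fun u => ?_))
    have h0 := sliceSum_nonneg K q (u, ξ); rw [norm_of_nonneg (mul_nonneg h0 (wt_nonneg _ _))]
    calc _ ≤ sliceSum K q (u, ξ) * ((1 + ‖ξ‖) ^ K * wt K (u, ξ)) := by
          gcongr; exact wt_fst_le K u ξ
      _ = _ := by ring
  have hdom := hd.const_mul A
  have hfi : Integrable f := hdom.mono' hslice.continuous.aestronglyMeasurable
    (.of_forall fun u => (hA q hq s hs (u, ξ)).1)
  have hDle : ∀ j, ∀ i ≤ K, ∀ u, ‖(dirD (single j (1 : ℝ) : Pos n))^[i] f u‖ ≤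
      A * (sliceSum K q (u, ξ) * wt K u) := fun j i hi u => by
    rw [hD]; exact (hA q hq s hs (u, ξ)).2 j i hi
  have hDi : ∀ j, ∀ i ≤ K, Integrable ((dirD (single j (1 : ℝ) : Pos n))^[i] f) :=
    fun j i hi => hdom.mono' (contDiff_iterD hslice _ i).continuous.aestronglyMeasurable
      (.of_forall fun u => hDle j i hi u)
  set l : Pos n →L[ℝ] ℝ := (-2 : ℝ) • innerSL ℝ ξ with hl
  have hle : ‖ξ‖ ≤ ∑ j, |l (single j (1 : ℝ))| := by
    refine (norm_le_sum_abs_coord ξ).trans (sum_le_sum fun j _ => ?_)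
    have : l (single j (1 : ℝ)) = -2 * ξ j := by
      simp [hl, inner_single_right]
    rw [this, abs_mul]; norm_num; linarith [abs_nonneg (ξ j)]
  have hmain := hC volume l ξ f hle hslice hfi hDi
  have hnorm : ‖regSlice q φ x s ξ‖ = ‖∫ y, exp ((l y : ℂ) * I) * f y‖ := by
    have : regSlice q φ x s ξ = cis (2 * inner ℝ x ξ) *
        ∫ y, exp ((l y : ℂ) * I) * f y := by
      rw [regSlice, ← integral_const_mul]; refine integral_ext fun u => ?_; simp only [← mul_assoc]
      rw [← exp_add]; congr 2; rw [hl]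
      simp only [inner_sub_left, smul_apply, smul_eq_mul, innerSL_apply_apply,
        real_inner_comm u ξ]
      push_cast; ring
    rw [this, norm_mul, norm_exp_ofReal_mul_I, one_mul]
  rw [hnorm]
  set J := ∫ u, sliceSum K q (u, ξ) * wt K u with hJ
  have h1 : ∫ y, ‖f y‖ ≤ A * J := by
    rw [hJ, ← integral_const_mul]
    exact integral_mono hfi.norm hdom fun u => (hA q hq s hs (u, ξ)).1
  have h3 : ∑ j, ∫ y, ‖(dirD (single j (1 : ℝ) : Pos n))^[K] f y‖ ≤
      n * (A * J) := by
    calc _ ≤ ∑ _j, A * J := sum_le_sum fun j _ => by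
          rw [hJ, ← integral_const_mul]
          exact integral_mono (hDi j K le_rfl).norm hdom fun u => hDle j K le_rfl u
      _ = _ := by simp
  have h4 : ‖∫ y, exp ((l y : ℂ) * I) * f y‖ ≤ C * ((1 + n) * (A * J)) * wt K ξ := by
    rw [le_mul_wt_iff, mul_comm]; refine hmain.trans ?_; gcongr; linarith
  have h5 : J * wt K ξ ≤ ∫ u, sliceSum K q (u, ξ) * wt K (u, ξ) := by
    rw [hJ, ← integral_mul_const]; refine integral_mono (hd.mul_const _) hint fun u => ?_
    simp only [mul_assoc]
    exact mul_le_mul_of_nonneg_left (wt_fst_mul_wt_snd_le K (u, ξ)) (sliceSum_nonneg K q _)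
  calc _ ≤ _ := h4
    _ = C * ((1 + n) * A) * (J * wt K ξ) := by ring
    _ ≤ _ := by gcongr

lemma one_div_succ_mem (k : ℕ) : 1 / ((k : ℝ) + 1) ∈ 𝕋 :=
  ⟨by positivity, by rw [div_le_one (by positivity)]; linarith [k.cast_nonneg (α := ℝ)]⟩

lemma IsAdm.tendsto_weyl_cutoff (hq : IsAdm K q) (φ : 𝓢(Pos n, ℂ)) (x : Pos n) : Tendsto
      (fun k : ℕ => weyl (fun v => q v * cutoff (1 / ((k : ℝ) + 1)) v) φ x)
      atTop (nhds (weyl q φ x)) := by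
  have h0 : weyl q φ x = ((Real.pi ^ n)⁻¹ : ℝ) * ∫ ξ, regSlice q φ x 0 ξ := by
    rw [← weyl_mul_cutoff]; simp only [cutoff_zero, mul_one]
  rw [h0]
  simp only [weyl_mul_cutoff]
  refine Tendsto.const_mul _ ?_
  obtain ⟨A, hA0, hA⟩ := exists_regSlice_le φ x K
  obtain ⟨A', hA'0, hA'⟩ := exists_dirD_regIntegrand_le φ x K
  have hr := fun k : ℕ => (contDiff_regIntegrand hq.smooth φ x (1 / ((k : ℝ) + 1))).continuous
  have hint := hq.integrable_sliceSum
  have hae := hint.prod_left_ae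
  refine tendsto_integral_of_dominated_convergence
    (fun ξ => A * ∫ u, sliceSum K q (u, ξ) * wt K (u, ξ)) (fun k => ?_)
    (hint.integral_prod_right.const_mul A) (fun k => ?_) ?_
  · have hc : Continuous fun p : Pos n × Pos n => cis (2 * inner ℝ (x - p.2) p.1) * regIntegrand q φ x (1 / ((k : ℝ) + 1)) (p.2, p.1) := by
      have := hr k; fun_prop
    exact (hc.stronglyMeasurable.integral_prod_right (f := fun ξ u => exp
      ((2 * inner ℝ (x - u) ξ : ℝ) * I) *
        regIntegrand q φ x (1 / ((k : ℝ) + 1)) (u, ξ))).aestronglyMeasurable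
  · filter_upwards [hae] with ξ hξ; exact hA q hq.smooth ξ hξ _ (one_div_succ_mem k)
  · filter_upwards [hae] with ξ hξ
    refine tendsto_integral_of_dominated_convergence
      (fun u => A' * ((1 + ‖ξ‖) ^ K * (sliceSum K q (u, ξ) * wt K (u, ξ)))) (fun k => ?_)
      ((hξ.const_mul _).const_mul _) (fun k => ?_) ?_
    · have := hr k; fun_prop
    · refine Filter.Eventually.of_forall fun u => ?_; rw [norm_mul, norm_exp_ofReal_mul_I, one_mul]
      refine (hA' q hq.smooth _ (one_div_succ_mem k) (u, ξ)).1.trans ?_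
      have h0 := sliceSum_nonneg K q (u, ξ)
      calc _ ≤ A' * (sliceSum K q (u, ξ) * ((1 + ‖ξ‖) ^ K * wt K (u, ξ))) := by
            gcongr; exact wt_fst_le K u ξ
        _ = _ := by ring
    · refine Filter.Eventually.of_forall fun u => Tendsto.const_mul _ ?_
      refine Tendsto.const_mul _ (Tendsto.mul_const _ ?_); rw [cutoff_zero]
      exact (Complex.continuous_ofReal.tendsto 1).comp (tendsto_cutoff (u, ξ))

lemma IsAdm.memLp_weyl_and_bargmann (hq : IsAdm K q) (φ : 𝓢(Pos n, ℂ)) :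
    MemLp (weyl q φ) 2 volume ∧ ∀ z, bargmann (weyl q φ) z = ∫ v, (q v : ℂ) * wigFun φ z v := by
  set Q : ℕ → Φ → ℝ := fun k v => q v * cutoff (1 / ((k : ℝ) + 1)) v with hQ
  have hQi : ∀ k, Integrable (Q k) := fun k => hq.integrable_mul_cutoff (by positivity)
  have hQadm : ∀ k, IsAdm K (Q k) := fun k => ⟨hq.smooth.mul (contDiff_cutoff _), fun m => by
    obtain ⟨B, hB0, hB⟩ := hq.exists_symSize_cutoff_le m
    exact ne_top_of_le_ne_top ofReal_ne_top (hB _ (one_div_succ_mem k))⟩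
  have hF : ∀ k, MemLp (weyl (Q k) φ) 2 volume := fun k => memLp_weyl_of_integrable (hQi k) φ
  have hBF : ∀ k z, bargmann (weyl (Q k) φ) z = ∫ v, (Q k v : ℂ) * wigFun φ z v := fun k z =>
    bargmann_weyl_of_integrable (hQi k) φ z
  set h : Φ → ℂ := fun z => ∫ v, (q v : ℂ) * wigFun φ z v with hh
  have hlim : ∀ z, Tendsto (fun k => ∫ v, (Q k v : ℂ) * wigFun φ z v) atTop
      (nhds (h z)) := fun z => by
    have hI := hq.integrable_mul_wigFun φ z
    refine tendsto_integral_of_dominated_convergence (fun v => ‖(q v : ℂ) * wigFun φ z v‖)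
      (fun k => ((hQadm k).integrable_mul_wigFun φ z).1) hI.norm
      (fun k => Filter.Eventually.of_forall fun v => ?_) (.of_forall fun v => ?_)
    · rw [hQ, Complex.ofReal_mul, norm_mul, norm_mul, norm_mul, norm_real (cutoff _ v),
        norm_of_nonneg (cutoff_nonneg _ v)]
      gcongr; exact mul_le_of_le_one_right (norm_nonneg _) (cutoff_le_one _ v)
    · refine Tendsto.mul_const _ ?_; refine (Complex.continuous_ofReal.tendsto _).comp ?_
      have := (tendsto_cutoff v).const_mul (q v)
      rwa [mul_one] at this
  obtain ⟨C, hC0, m, hC⟩ := exists_integral_wigFun_le φ K d₁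
  obtain ⟨B, hB0, hB⟩ := hq.exists_symSize_cutoff_le m
  have hbound : ∀ k z, ‖bargmann (weyl (Q k) φ) z‖ ≤ C * B * wt d₁ z := fun k z => by
    rw [hBF]; exact hC (Q k) B (hQadm k) hB0 (hB _ (one_div_succ_mem k)) z
  have hhb : ∀ z, ‖h z‖ ≤ C * B * wt d₁ z := fun z =>
    le_of_tendsto (hlim z).norm (.of_forall fun k => by
      rw [← hBF]; exact hbound k z)
  have hg : MemLp (fun z : Φ => C * B * wt d₁ z) 2 := by
    have hc : Continuous fun z : Φ => C * B * wt d₁ z := by fun_prop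
    refine (memLp_two_iff_integrable_sq hc.aestronglyMeasurable).2 ?_
    refine (integrable_wt_phase.const_mul ((C * B) ^ 2)).mono' (hc.pow 2).aestronglyMeasurable
      (.of_forall fun z => ?_)
    rw [norm_of_nonneg (sq_nonneg _), mul_pow]; gcongr; rw [sq]
    exact mul_le_of_le_one_right (wt_nonneg _ _) (wt_le_one _ _)
  have hhm : AEStronglyMeasurable h volume :=
    aestronglyMeasurable_of_tendsto_ae atTop (fun k => (bargmann_memLp (hF k)).1)
      (.of_forall fun z => by simp only [hBF]; exact hlim z)
  have hhL : MemLp h 2 := hg.of_le hhm (.of_forall fun z =>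
    (hhb z).trans (le_abs_self _))
  have hT := tendsto_toLp_of_dominated (l := atTop) hg (fun k => bargmann_memLp (hF k)) hhL
    (fun k => Filter.Eventually.of_forall (hbound k))
    (.of_forall fun z => by simp only [hBF]; exact hlim z)
  set F : ℕ → L2Pos n := fun k => (hF k).toLp _ with hFdef
  have hTF : ∀ k, bargmannL2 n (F k) = (bargmann_memLp (hF k)).toLp _ := fun k => by
    change (bargmann_memLp (Lp.memLp (F k))).toLp (bargmann (F k)) = _
    exact MemLp.toLp_congr _ _ (.of_forall fun z => by
      rw [bargmann_congr (hF k).coeFn_toLp])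
  have hcl : IsClosed (Set.range (bargmannL2 n)) := (bargmannL2 n).isometry.isClosedEmbedding.isClosed_range
  obtain ⟨f, hf⟩ : hhL.toLp h ∈ Set.range (bargmannL2 n) :=
    hcl.mem_of_tendsto hT (.of_forall fun k => ⟨F k, hTF k⟩)
  have hFf : Tendsto F atTop (nhds f) := by
    rw [(bargmannL2 n).isometry.isEmbedding.tendsto_nhds_iff, hf]
    exact hT.congr fun k => (hTF k).symm
  obtain ⟨ns, hns, hsub⟩ := (tendstoInMeasure_of_tendsto_Lp hFf).exists_seq_tendsto_ae
  have hae : weyl q φ =ᵐ[volume] f := by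
    have hall : ∀ᵐ x, ∀ k, F k x = weyl (Q k) φ x := ae_all_iff.2 fun k => (hF k).coeFn_toLp
    filter_upwards [hsub, hall] with x hx1 hx2
    refine tendsto_nhds_unique ((hq.tendsto_weyl_cutoff φ x).comp hns.tendsto_atTop) ?_
    refine hx1.congr fun k => ?_; rw [hx2]; rfl
  have hm : MemLp (weyl q φ) 2 volume := (memLp_congr_ae hae).2 (Lp.memLp f)
  refine ⟨hm, fun z => ?_⟩
  rw [bargmann_congr hae]
  refine tendsto_nhds_unique ?_ (hlim z)
  simp only [← hBF]
  have h1 : ∀ k, bargmann (weyl (Q k) φ) z = inner ℂ (cohL2 z) (F k) := fun k => by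
    rw [← bargmann_eq_inner, bargmann_congr (hF k).coeFn_toLp]
  simp only [h1]
  rw [bargmann_eq_inner]
  exact Tendsto.inner (𝕜 := ℂ) tendsto_const_nhds hFf

lemma IsAdm.bargmann_weyl (hq : IsAdm K q) (φ : 𝓢(Pos n, ℂ))
    (z : Φ) : bargmann (weyl q φ) z = ∫ w, symKer q z w * bargmann φ w :=
  ((hq.memLp_weyl_and_bargmann φ).2 z).trans (hq.integral_mul_wigFun φ z)

lemma IsAdm.bargmann_weyl_coherent (hq : IsAdm K q) (z w : Φ) :
    bargmann (weyl q (coherent w)) z = symKer q z w := by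
  rw [(hq.memLp_weyl_and_bargmann (coherent w)).2 z]
  simp only [wigFun_coherent, symKer]

/-! ### Integral bounds along the flow -/

/-- The integral of `|g|` along the trajectory through `v` grows at most like `‖v - w₀‖ ^ p`. -/
def FlowBound (X : ℝ → Φ → Φ) (w₀ : Φ) (κ : ℝ) (p : ℕ) (g : ℝ → Φ → ℝ) :
    Prop :=
  ∀ v, ∫⁻ τ in 𝕋, ‖g τ (X τ v)‖ₑ ≤ ofReal (κ * (1 + ‖v - w₀‖) ^ p)

section FlowBound

variable {L κ κ' : ℝ} {w₀ : Φ} {p p' : ℕ}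
  {g g' : ℝ → Φ → ℝ}

lemma FlowBound.of_le (h : FlowBound X w₀ κ p g) (hg : ∀ τ ∈ 𝕋, ∀ v, |g' τ v| ≤ |g τ v|) :
    FlowBound X w₀ κ p g' := fun v =>
  (setLIntegral_mono' measurableSet_Icc fun τ hτ => by
    rw [enorm_le_iff_norm_le, norm_eq_abs, norm_eq_abs]; exact hg τ hτ _).trans (h v)

lemma FlowBound.mono (h : FlowBound X w₀ κ p g) (hκ : 0 ≤ κ) (hk : κ ≤ κ') (hp : p ≤ p') :
    FlowBound X w₀ κ' p' g := fun v => (h v).trans <| ofReal_le_ofReal <|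
  mul_le_mul hk (pow_le_pow_right₀ (by linarith [norm_nonneg (v - w₀)]) hp) (by positivity)
    (hκ.trans hk)

lemma FlowBound.add (h : FlowBound X w₀ κ p g) (h' : FlowBound X w₀ κ' p g') (hκ : 0 ≤ κ)
    (hκ' : 0 ≤ κ') (hm : Measurable fun q : ℝ × Φ => g q.1 q.2)
    (hX : Measurable fun q : ℝ × Φ => X q.1 q.2) :
    FlowBound X w₀ (κ + κ') p (fun τ v => |g τ v| + |g' τ v|) := fun v => by
  have h1 : Measurable fun τ => ‖g τ (X τ v)‖ₑ :=
    (hm.comp (measurable_id.prodMk (hX.comp (measurable_id.prodMk measurable_const)))).enorm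
  calc ∫⁻ τ in 𝕋, ‖|g τ (X τ v)| + |g' τ (X τ v)|‖ₑ
      ≤ ∫⁻ τ in 𝕋, (‖g τ (X τ v)‖ₑ + ‖g' τ (X τ v)‖ₑ) := by
        refine lintegral_mono fun τ => (enorm_add_le _ _).trans ?_
        rw [Real.enorm_abs, Real.enorm_abs]
    _ ≤ _ := by
        rw [lintegral_add_left h1, add_mul, ofReal_add (by positivity) (by positivity)]
        exact add_le_add (h v) (h' v)

lemma FlowBound.sum {ι : Type*} [Fintype ι] {G : ι → ℝ → Φ → ℝ} (h : ∀ j, FlowBound X w₀ κ p (G j))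
    (hm : ∀ j, Measurable fun q : ℝ × Φ => G j q.1 q.2)
    (hX : Measurable fun q : ℝ × Φ => X q.1 q.2) :
    FlowBound X w₀ (Fintype.card ι * κ) p (fun τ v => ∑ j, |G j τ v|) := fun v => by
  have h1 : ∀ j, Measurable fun τ => ‖G j τ (X τ v)‖ₑ := fun j =>
    ((hm j).comp (measurable_id.prodMk (hX.comp (measurable_id.prodMk measurable_const)))).enorm
  calc ∫⁻ τ in 𝕋, ‖∑ j, |G j τ (X τ v)|‖ₑ
      ≤ ∫⁻ τ in 𝕋, ∑ j, ‖G j τ (X τ v)‖ₑ := by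
        refine lintegral_mono fun τ => (enorm_sum_le _ _).trans ?_
        simp only [Real.enorm_abs, le_refl]
    _ = ∑ j, ∫⁻ τ in 𝕋, ‖G j τ (X τ v)‖ₑ :=
        lintegral_finsetSum _ fun j _ => h1 j
    _ ≤ ∑ _j, ofReal (κ * (1 + ‖v - w₀‖) ^ p) := sum_le_sum fun j _ => h j v
    _ = _ := by
        rw [Finset.sum_const, nsmul_eq_mul, Finset.card_univ, mul_assoc,
          ofReal_mul (Nat.cast_nonneg _), ENNReal.ofReal_natCast]

lemma FlowBound.increment (hX : IsPhaseFlow a X Y L) (hκ : 0 ≤ κ) (hs : ∀ τ, ContDiff ℝ ∞ (g τ))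
    (hc : Continuous fun q : ℝ × Φ => gradSum (g q.1) q.2)
    (h : FlowBound X w₀ κ p fun τ => gradSum (g τ)) :
    FlowBound X w₀ (L * κ) (p + 1) fun τ v => g τ v - g τ (X τ w₀) := fun v => by
  have hL := hX.one_le
  set l := L * ‖v - w₀‖ with hl
  have hl0 : 0 ≤ l := by positivity
  set P : ℝ → Φ := fun θ => w₀ + θ • (v - w₀) with hP
  have hPc : Continuous P := by fun_prop
  have hXc : Continuous fun q : ℝ × ℝ => X q.1 (P q.2) :=
    hX.continuous.comp (continuous_fst.prodMk (hPc.comp continuous_snd))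
  have hgc : Continuous fun q : ℝ × ℝ => l * gradSum (g q.1) (X q.1 (P q.2)) :=
    continuous_const.mul (hc.comp (continuous_fst.prodMk hXc))
  have key : ∀ τ, ‖g τ (X τ v) - g τ (X τ w₀)‖ₑ ≤
      ∫⁻ θ in 𝕋, ofReal (l * gradSum (g τ) (X τ (P θ))) := fun τ => by
    have h1 := abs_sub_le_integral_gradSum (hs τ) (γ := fun θ => X τ (P θ)) hl0 (fun θ θ' => by
      refine (hX.lip τ _ _).trans (le_of_eq ?_)
      have : P θ - P θ' = (θ - θ') • (v - w₀) := by module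
      rw [this, norm_smul, norm_eq_abs, hl]; ring)
    simp only [hP, one_smul, zero_smul, add_zero, add_sub_cancel] at h1
    have hcτ : Continuous fun θ => l * gradSum (g τ) (X τ (w₀ + θ • (v - w₀))) :=
      hgc.comp (continuous_const.prodMk continuous_id)
    rw [integral_of_le zero_le_one, ← integral_Icc_eq_integral_Ioc] at h1
    rw [← ofReal_norm, norm_eq_abs, ← ofReal_integral_eq_lintegral_ofReal
      (hcτ.continuousOn.integrableOn_compact isCompact_Icc)
      (.of_forall fun θ => mul_nonneg hl0 (gradSum_nonneg _ _))]
    exact ofReal_le_ofReal h1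
  calc ∫⁻ τ in 𝕋, ‖g τ (X τ v) - g τ (X τ w₀)‖ₑ
      ≤ ∫⁻ τ in 𝕋, ∫⁻ θ in 𝕋,
          ofReal (l * gradSum (g τ) (X τ (P θ))) := lintegral_mono key
    _ = ∫⁻ θ in 𝕋, ∫⁻ τ in 𝕋,
          ofReal (l * gradSum (g τ) (X τ (P θ))) :=
        lintegral_lintegral_swap (ENNReal.continuous_ofReal.comp hgc).measurable.aemeasurable
    _ ≤ ∫⁻ _θ in 𝕋, ofReal (L * κ * (1 + ‖v - w₀‖) ^ (p + 1)) := by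
        refine setLIntegral_mono' measurableSet_Icc fun θ hθ => ?_
        have e : ∀ τ, ofReal (l * gradSum (g τ) (X τ (P θ))) =
            ofReal l * ‖gradSum (g τ) (X τ (P θ))‖ₑ := fun τ => by
          rw [ofReal_mul hl0, ← ofReal_norm, norm_of_nonneg (gradSum_nonneg _ _)]
        simp only [e]; rw [lintegral_const_mul' _ _ ofReal_ne_top]
        refine (mul_le_mul_right (h (P θ)) _).trans ?_; rw [← ofReal_mul hl0]
        refine ofReal_le_ofReal ?_
        have h2 : ‖P θ - w₀‖ ≤ ‖v - w₀‖ := by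
          simp only [hP, add_sub_cancel_left, norm_smul, norm_of_nonneg hθ.1]
          exact mul_le_of_le_one_left (norm_nonneg _) hθ.2
        calc l * (κ * (1 + ‖P θ - w₀‖) ^ p)
            ≤ (L * (1 + ‖v - w₀‖)) * (κ * (1 + ‖v - w₀‖) ^ p) := by
              gcongr; linarith
          _ = _ := by ring
    _ = _ := by simp

lemma FlowBound.lintegral_wtInt_le (hX : IsPhaseFlow a X Y L) (ha : IsTimeSym a) (hκ : 0 ≤ κ)
    (hg : Continuous fun q : ℝ × Φ => g q.1 q.2) (h : FlowBound X w₀ κ 2 g) (c : Φ) :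
    ∫⁻ τ in 𝕋, wtInt d₃ (g τ) (X τ c) ≤
      ofReal (L ^ d₃ * (∫ v : Φ, wt d₁ v) * κ * (1 + ‖c - w₀‖) ^ 2) := by
  have hL := hX.one_le
  set K := d₃ with hK
  have hcomp : Continuous fun q : ℝ × Φ => g q.1 (X q.1 q.2) :=
    hg.comp (continuous_fst.prodMk hX.continuous)
  have h1 : ∀ τ ∈ 𝕋, wtInt K (g τ) (X τ c) ≤
      ∫⁻ v, ‖g τ (X τ v)‖ₑ * ofReal (L ^ K * wt K (v - c)) := fun τ hτ => by
    have hm : Measurable fun v => ofReal (|g τ v| * wt K (v - X τ c)) :=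
      (ENNReal.continuous_ofReal.comp (by fun_prop : Continuous fun v =>
        |g τ v| * wt K (v - X τ c))).measurable
    rw [wtInt, ← (hX.measurePreserving ha hτ).lintegral_comp hm]; refine lintegral_mono fun v => ?_
    rw [← ofReal_norm, ← ofReal_mul (norm_nonneg _), norm_eq_abs]
    refine ofReal_le_ofReal (mul_le_mul_of_nonneg_left ?_ (abs_nonneg _))
    refine wt_le_of_norm_le K hL ?_; have := hX.lip_inv τ (X τ v) (X τ c)
    rwa [hX.left_inv, hX.left_inv] at this
  have hpe : ∀ v, κ * (1 + ‖v - w₀‖) ^ 2 * (L ^ K * wt K (v - c)) ≤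
      L ^ K * κ * (1 + ‖c - w₀‖) ^ 2 * wt d₁ (v - c) := fun v => by
    have h2 : (1 + ‖v - w₀‖) ^ 2 ≤ ((1 + ‖c - w₀‖) * (1 + ‖v - c‖)) ^ 2 := by
      gcongr; have : ‖v - w₀‖ ≤ ‖v - c‖ + ‖c - w₀‖ := norm_sub_le_norm_sub_add_norm_sub _ _ _
      nlinarith [norm_nonneg (v - c), norm_nonneg (c - w₀),
        mul_nonneg (norm_nonneg (v - c)) (norm_nonneg (c - w₀))]
    have hw := wt_nonneg K (v - c)
    calc _ ≤ κ * ((1 + ‖c - w₀‖) * (1 + ‖v - c‖)) ^ 2 * (L ^ K * wt K (v - c)) := by gcongr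
      _ = L ^ K * κ * (1 + ‖c - w₀‖) ^ 2 * wt d₁ (v - c) *
          (wt 2 (v - c) * (1 + ‖v - c‖) ^ 2) := by
          rw [hK, show 2 * n + 3 = d₁ + 2 by ring, wt_add]; ring
      _ = _ := by rw [wt_mul_pow, mul_one]
  have hint : Integrable fun v =>
      L ^ K * κ * (1 + ‖c - w₀‖) ^ 2 * wt d₁ (v - c) :=
    (integrable_wt_phase.comp_sub_right c).const_mul _
  calc ∫⁻ τ in 𝕋, wtInt K (g τ) (X τ c)
      ≤ ∫⁻ τ in 𝕋, ∫⁻ v, ‖g τ (X τ v)‖ₑ * ofReal (L ^ K * wt K (v - c)) :=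
        setLIntegral_mono' measurableSet_Icc h1
    _ = ∫⁻ v, ∫⁻ τ in 𝕋, ‖g τ (X τ v)‖ₑ * ofReal (L ^ K * wt K (v - c)) := by
        refine lintegral_lintegral_swap (Measurable.aemeasurable ?_)
        refine hcomp.measurable.enorm.mul (ENNReal.continuous_ofReal.comp
          (by fun_prop : Continuous fun q : ℝ × Φ => L ^ K * wt K (q.2 - c))).measurable
    _ ≤ ∫⁻ v, ofReal (L ^ K * κ * (1 + ‖c - w₀‖) ^ 2 * wt d₁ (v - c)) := by
        refine lintegral_mono fun v => ?_; rw [lintegral_mul_const' _ _ ofReal_ne_top]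
        refine (mul_le_mul_left (h v) _).trans ?_; rw [← ofReal_mul (by positivity)]
        exact ofReal_le_ofReal (hpe v)
    _ = ofReal (∫ v, L ^ K * κ * (1 + ‖c - w₀‖) ^ 2 * wt d₁ (v - c)) :=
        (ofReal_integral_eq_lintegral_ofReal hint (.of_forall fun v =>
          mul_nonneg (by positivity) (wt_nonneg _ _))).symm
    _ = _ := by
        rw [integral_const_mul, integral_sub_right_eq_self (wt d₁)]; ring

end FlowBound

/-! ### Families of symbols -/

/-- A family of smooth functions whose pure derivatives are jointly continuous. -/
structure IsSmoothFamily (q : ℝ → Φ → ℝ) : Prop where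
  smooth : ∀ t, ContDiff ℝ ∞ (q t)
  cont_uncurry : Continuous fun p : ℝ × Φ => q p.1 p.2
  cont : ∀ j m, Continuous fun p : ℝ × Φ => (dph j)^[m] (q p.1) p.2

lemma IsTimeSym.isSmoothFamily {q : ℝ → Φ → ℝ} (hq : IsTimeSym q) :
    IsSmoothFamily q :=
  ⟨hq.smooth, hq.cont_uncurry, fun j m => hq.cont_iterate (ph j) m⟩

/-- Bounds for the integrals along the flow of the pure derivatives up to order `m`. -/
structure SymBound (X : ℝ → Φ → Φ) (w₀ : Φ) (κ : ℝ) (m : ℕ) (q : ℝ → Φ → ℝ) : Prop where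
  zero : FlowBound X w₀ κ 2 q
  deriv : ∀ j, ∀ i ≤ m, FlowBound X w₀ κ 2 fun τ => (dph j)^[i] (q τ)

section SymBound

variable {a q : ℝ → Φ → ℝ} {L κ : ℝ} {w₀ : Φ} {m : ℕ}

lemma measurable_wtInt {g : ℝ → Φ → ℝ} (hg : Continuous fun q : ℝ × Φ => g q.1 q.2)
    {c : ℝ → Φ} (hc : Continuous c) (K : ℕ) : Measurable fun τ => wtInt K (g τ) (c τ) := by
  have h : Continuous fun p : ℝ × Φ => |g p.1 p.2| * wt K (p.2 - c p.1) := by fun_prop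
  exact (ENNReal.continuous_ofReal.comp h).measurable.lintegral_prod_right'

lemma IsSmoothFamily.measurable_symSize (hq : IsSmoothFamily q) {c : ℝ → Φ}
    (hc : Continuous c) (m K : ℕ) : Measurable fun τ => symSize m K (q τ) (c τ) := by
  exact (measurable_wtInt hq.cont_uncurry hc K).add
    (Finset.measurable_fun_sum _ fun j _ => Finset.measurable_fun_sum _ fun i _ =>
      measurable_wtInt (hq.cont j i) hc K)

lemma IsPhaseFlow.cont_path (hX : IsPhaseFlow a X Y L) (z : Φ) :
    Continuous fun τ => X τ z := hX.continuous.comp (continuous_id.prodMk continuous_const)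

lemma SymBound.lintegral_symSize_le (hX : IsPhaseFlow a X Y L) (ha : IsTimeSym a)
    (hκ : 0 ≤ κ) (hq : IsSmoothFamily q) (h : SymBound X w₀ κ m q) (c : Φ) :
    ∫⁻ τ in 𝕋, symSize m d₃ (q τ) (X τ c) ≤
      ofReal ((1 + 2 * n * (m + 1)) * (L ^ d₃ * (∫ v : Φ, wt d₁ v) *
        κ * (1 + ‖c - w₀‖) ^ 2)) := by
  set R := L ^ d₃ * (∫ v : Φ, wt d₁ v) * κ * (1 + ‖c - w₀‖) ^ 2 with hR
  have hL := hX.one_le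
  have hI : 0 ≤ ∫ v : Φ, wt d₁ v := integral_nonneg fun v => wt_nonneg _ _
  have hR0 : 0 ≤ R := by positivity
  have hXc := hX.cont_path c
  have hm : ∀ j i, Measurable fun τ => wtInt d₃ ((dph j)^[i] (q τ)) (X τ c) :=
    fun j i => measurable_wtInt (hq.cont j i) hXc _
  simp only [symSize]
  rw [lintegral_add_left (measurable_wtInt hq.cont_uncurry hXc _),
    lintegral_finsetSum _ (fun j _ => Finset.measurable_fun_sum _ fun i _ => hm j i)]
  simp only [lintegral_finsetSum _ (fun i _ => hm _ i)]
  calc _ ≤ ofReal R + ∑ _j, ∑ _i ∈ Finset.range (m + 1), ofReal R := by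
        refine add_le_add (h.zero.lintegral_wtInt_le hX ha hκ hq.cont_uncurry c)
          (sum_le_sum fun j _ => sum_le_sum fun i hi => ?_)
        exact (h.deriv j i (Nat.lt_succ_iff.1 (Finset.mem_range.1 hi))).lintegral_wtInt_le hX ha hκ
          (hq.cont j i) c
    _ = _ := by
        rw [← ofReal_sum_of_nonneg (fun _ _ => hR0),
          ← ofReal_sum_of_nonneg (fun _ _ => sum_nonneg fun _ _ => hR0),
          ← ofReal_add hR0 (by positivity)]
        simp; ring

lemma exists_lintegral_symKer_le (n m : ℕ) (L : ℝ) : ∃ C, 0 < C ∧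
    ∀ (X Y : ℝ → Φ → Φ) (a q : ℝ → Φ → ℝ) (κ : ℝ) (w : Φ),
      IsPhaseFlow a X Y L → IsTimeSym a → 0 ≤ κ → IsSmoothFamily q → SymBound X w κ m q →
      ∀ z, ofReal ((1 + ‖z - w‖) ^ m) *
          ∫⁻ τ in 𝕋, ‖symKer (q τ) (X τ z) (X τ w)‖ₑ ≤
        ofReal (C * κ * (1 + ‖z - w‖) ^ d₃) := by
  obtain ⟨C, hC, hdec⟩ := exists_decay_symKer n m d₃
  set I := ∫ v : Φ, wt d₁ v with hI
  have hI0 : 0 ≤ I := integral_nonneg fun v => wt_nonneg _ _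
  set K := d₃ with hK
  refine ⟨|L| ^ m * C * |L| ^ K * ((1 + 2 * n * (m + 1)) * (|L| ^ K * I)) + 1, by positivity,
    fun X Y a q κ w hX ha hκ hq h z => ?_⟩
  have hL := hX.one_le
  rw [abs_of_pos (by linarith : 0 < L)]
  set r := ‖z - w‖ with hr
  have hr0 : 0 ≤ r := norm_nonneg _
  have hone : ∀ τ, ofReal ((1 + r) ^ m) * ‖symKer (q τ) (X τ z) (X τ w)‖ₑ ≤
      ofReal (L ^ m * C * (L ^ K * (1 + r) ^ K)) * symSize m K (q τ) (X τ w) := fun τ => by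
    have h1 : r ≤ L * ‖X τ z - X τ w‖ := by
      have := hX.lip_inv τ (X τ z) (X τ w)
      rwa [hX.left_inv, hX.left_inv] at this
    have h2 : ofReal ((1 + r) ^ m) ≤
        ofReal (L ^ m) * ofReal ((1 + ‖X τ z - X τ w‖) ^ m) := by
      rw [← ofReal_mul (by positivity), ← mul_pow]; refine ofReal_le_ofReal ?_; gcongr; linarith
    have h3 : symSize m K (q τ) (mid (X τ z) (X τ w)) ≤
        ofReal (L ^ K * (1 + r) ^ K) * symSize m K (q τ) (X τ w) := by
      refine (symSize_le_mul m K (q τ) _ (X τ w)).trans ?_; gcongr; rw [← mul_pow]; gcongr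
      have e1 := norm_mid_sub_left (X τ w) (X τ z); rw [mid_comm, norm_sub_rev (X τ w)] at e1
      have e2 := hX.lip τ z w; nlinarith
    calc ofReal ((1 + r) ^ m) * ‖symKer (q τ) (X τ z) (X τ w)‖ₑ
        ≤ ofReal (L ^ m) * (ofReal ((1 + ‖X τ z - X τ w‖) ^ m) *
            ‖symKer (q τ) (X τ z) (X τ w)‖ₑ) := by
          rw [← mul_assoc]; gcongr
      _ ≤ ofReal (L ^ m) * (ofReal C *
            (ofReal (L ^ K * (1 + r) ^ K) * symSize m K (q τ) (X τ w))) := by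
          exact mul_le_mul_right ((hdec (q τ) (hq.smooth τ) _ _).trans (mul_le_mul_right h3 _)) _
      _ = _ := by
          rw [ofReal_mul (by positivity : 0 ≤ L ^ m * C),
            ofReal_mul (by positivity : 0 ≤ L ^ m)]
          ring
  rw [← lintegral_const_mul' _ _ ofReal_ne_top]
  refine (lintegral_mono hone).trans ?_
  rw [lintegral_const_mul' _ _ ofReal_ne_top]
  refine (mul_le_mul_right (h.lintegral_symSize_le hX ha hκ hq w) _).trans ?_
  rw [sub_self, norm_zero, ← ofReal_mul (by positivity)]
  refine ofReal_le_ofReal ?_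
  rw [← hI, ← hK]
  have : 0 ≤ κ * (1 + r) ^ K := by positivity
  linarith

end SymBound

/-! ### Taylor remainders -/

/-- The first order Taylor polynomial of `q` at `W`. -/
def linPart (q : Φ → ℝ) (W v : Φ) : ℝ := q W + fderiv ℝ q W (v - W)

/-- The first order Taylor remainder of `q` at `W`. -/
def taylorRem (q : Φ → ℝ) (W v : Φ) : ℝ := q v - linPart q W v

/-- The increment of `q` from `W`. -/
def incRem (q : Φ → ℝ) (W v : Φ) : ℝ := q v - q W

lemma contDiff_linPart (q : Φ → ℝ) (W : Φ) : ContDiff ℝ ∞ (linPart q W) := by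
  unfold linPart; fun_prop

lemma contDiff_taylorRem (hq : ContDiff ℝ ∞ q) (W : Φ) :
    ContDiff ℝ ∞ (taylorRem q W) := hq.sub (contDiff_linPart q W)

lemma contDiff_incRem (hq : ContDiff ℝ ∞ q) (W : Φ) :
    ContDiff ℝ ∞ (incRem q W) := hq.sub contDiff_const

lemma dirD_sub_const (e : Φ) (c : ℝ) :
    dirD e (fun v => q v - c) = dirD e q := by
  funext v
  simp only [dirD, fderiv_sub_const]

lemma dirD_const {E F : Type*} [NormedAddCommGroup E] [NormedSpace ℝ E] [NormedAddCommGroup F]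
    [NormedSpace ℝ F] (e : E) (c : F) : dirD e (fun _ => c) = fun _ => 0 := by
  funext v
  simp [dirD]

lemma iterD_zero {E F : Type*} [NormedAddCommGroup E] [NormedSpace ℝ E]
    [NormedAddCommGroup F] [NormedSpace ℝ F] (e : E) (m : ℕ) :
    (dirD e)^[m] (fun _ => (0 : F)) = fun _ => 0 := by
  induction m with
  | zero => rfl
  | succ m ih => rw [iterate_succ_apply, dirD_const, ih]

lemma dirD_linPart (q : Φ → ℝ) (e W : Φ) :
    dirD e (linPart q W) = fun _ => fderiv ℝ q W e := by
  funext v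
  have h : HasFDerivAt (linPart q W) (fderiv ℝ q W) v :=
    ((fderiv ℝ q W).hasFDerivAt.comp v ((hasFDerivAt_id v).sub_const W)).const_add (q W)
  rw [dirD, h.fderiv]

lemma dirD_taylorRem (hq : ContDiff ℝ ∞ q) (e W : Φ) :
    dirD e (taylorRem q W) = fun v => dirD e q v - dirD e q W := by
  funext v
  have h1 := (hq.differentiable (by simp)) v
  have h2 := ((contDiff_linPart q W).differentiable (by simp)) v
  have := congrFun (dirD_linPart q e W) v
  change fderiv ℝ (fun v => q v - linPart q W v) v e = _
  rw [fderiv_fun_sub h1 h2]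
  simp only [dirD] at this ⊢
  rw [sub_apply, this]

lemma iterD_taylorRem (hq : ContDiff ℝ ∞ q) (e W : Φ) (m : ℕ) :
    (dirD e)^[m + 2] (taylorRem q W) = (dirD e)^[m + 2] q := by
  rw [iterate_succ_apply, iterate_succ_apply, dirD_taylorRem hq,
    dirD_sub_const]
  rfl

lemma iterD_incRem (q : Φ → ℝ) (e W : Φ) (m : ℕ) :
    (dirD e)^[m + 1] (incRem q W) = (dirD e)^[m + 1] q := by
  rw [iterate_succ_apply, iterate_succ_apply]
  congr 1
  exact dirD_sub_const e (q W)

lemma linPart_self (q : Φ → ℝ) (W : Φ) : linPart q W W = q W := by simp [linPart]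

lemma taylorRem_self (q : Φ → ℝ) (W : Φ) : taylorRem q W W = 0 := by
  simp [taylorRem, linPart_self]

lemma abs_linPart_le (q : Φ → ℝ) (W v : Φ) :
    |linPart q W v| ≤ |q W| + gradSum q W * ‖v - W‖ :=
  (abs_add_le _ _).trans (add_le_add_right (abs_fderiv_le_gradSum q W (v - W)) _)

section Family

variable {L κ : ℝ} {w₀ : Φ} {m : ℕ}

@[fun_prop]
lemma cont_pc : Continuous (pc j : Φ → ℝ) := by
  unfold pc
  rcases j with i | i <;> simp only [Sum.elim_inl, Sum.elim_inr] <;> fun_prop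

lemma IsTimeSym.cont_linPart (hb : IsTimeSym b) {p : ℝ → Φ} (hp : Continuous p) :
    Continuous fun q : ℝ × Φ => linPart (b q.1) (p q.1) q.2 := by
  have hp' : Continuous fun q : ℝ × Φ => p q.1 := hp.comp continuous_fst
  simp only [linPart, fderiv_eq_sum]
  refine (hb.cont_uncurry.comp (continuous_fst.prodMk hp')).add
    (continuous_finsetSum _ fun j _ => ?_)
  exact ((cont_pc j).comp (continuous_snd.sub hp')).mul
    ((hb.cont_partialD (ph j)).comp (continuous_fst.prodMk hp'))

lemma abs_add_le_abs_add (x y : ℝ) : |x + y| ≤ |(|x| + |y|)| :=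
  (abs_add_le x y).trans (le_abs_self _)

lemma isSmoothFamily_taylorRem (hX : IsPhaseFlow a X Y L) (ha : IsTimeSym a) (w : Φ) :
    IsSmoothFamily fun τ => taylorRem (a τ) (X τ w) := by
  have hp := hX.cont_path w
  have hp' : Continuous fun p : ℝ × Φ => X p.1 w := hp.comp continuous_fst
  have h0 : Continuous fun p : ℝ × Φ => taylorRem (a p.1) (X p.1 w) p.2 := by
    exact ha.cont_uncurry.sub (ha.cont_linPart hp)
  refine ⟨fun τ => contDiff_taylorRem (ha.smooth τ) _, h0, fun j m => ?_⟩
  match m with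
  | 0 => exact h0
  | 1 =>
    simp only [iterate_one, dirD_taylorRem (ha.smooth _)]
    exact (ha.cont_partialD (ph j)).sub ((ha.cont_partialD (ph j)).comp
      (continuous_fst.prodMk hp'))
  | m + 2 =>
    simp only [iterD_taylorRem (ha.smooth _)]; exact ha.cont_iterate (ph j) (m + 2)

lemma isSmoothFamily_incRem (hX : IsPhaseFlow a X Y L) (hb : IsTimeSym b) (w : Φ) :
    IsSmoothFamily fun τ => incRem (b τ) (X τ w) := by
  have hp := hX.cont_path w
  have hp' : Continuous fun p : ℝ × Φ => X p.1 w := hp.comp continuous_fst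
  have h0 : Continuous fun p : ℝ × Φ => incRem (b p.1) (X p.1 w) p.2 := by
    exact hb.cont_uncurry.sub (hb.cont_uncurry.comp (continuous_fst.prodMk hp'))
  refine ⟨fun τ => contDiff_incRem (hb.smooth τ) _, h0, fun j m => ?_⟩
  match m with
  | 0 => exact h0
  | m + 1 =>
    simp only [iterD_incRem]; exact hb.cont_iterate (ph j) (m + 1)

lemma symBound_taylorRem (hX : IsPhaseFlow a X Y L) (ha : IsTimeSym a) (hκ : 0 ≤ κ)
    (hess : FlowBound X w₀ κ 0 fun τ => hessSum (a τ))
    (high : ∀ j, ∀ i, 2 ≤ i → i ≤ m → FlowBound X w₀ κ 0 fun τ => (dph j)^[i] (a τ)) :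
    SymBound X w₀ ((1 + L + L * (2 * n * L)) * κ) m fun τ => taylorRem (a τ) (X τ w₀) := by
  have hL := hX.one_le
  have hfam := isSmoothFamily_taylorRem hX ha w₀
  have h1 : ∀ j, FlowBound X w₀ (L * κ) 1 fun τ => dph j (taylorRem (a τ) (X τ w₀)) :=
    fun j => by
      simp only [dirD_taylorRem (ha.smooth _)]
      refine FlowBound.increment (g := fun τ => dph j (a τ)) hX hκ
        (fun τ => contDiff_dirD (ha.smooth τ) _) ?_ (hess.of_le fun τ _ v => ?_)
      · exact continuous_finsetSum _ fun l _ =>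
          (ha.cont_partialD_partialD (ph l) (ph j)).abs
      · rw [abs_of_nonneg (gradSum_nonneg _ _), abs_of_nonneg (hessSum_nonneg _ _)]
        exact single_le_sum (f := fun j => gradSum (pd j (a τ)) v)
          (fun j _ => gradSum_nonneg _ _) (Finset.mem_univ j)
  have hgs : FlowBound X w₀ (2 * n * L * κ) 1 fun τ => gradSum (taylorRem (a τ) (X τ w₀)) := by
    have := FlowBound.sum h1 (fun j => (hfam.cont j 1).measurable) hX.continuous.measurable
    have e : ((Fintype.card 𝕁 : ℕ) : ℝ) * (L * κ) = 2 * n * L * κ := by simp; ring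
    rw [e] at this; exact this
  have h2 : FlowBound X w₀ (L * (2 * n * L * κ)) 2 fun τ => taylorRem (a τ) (X τ w₀) := by
    have := FlowBound.increment hX (by positivity) hfam.smooth (by
      exact continuous_finsetSum _ fun l _ => (hfam.cont l 1).abs) hgs
    simpa only [taylorRem_self, sub_zero] using this
  have h2' := h2.mono (by positivity) (κ' := (1 + L + L * (2 * n * L)) * κ)
    (by nlinarith [mul_nonneg (by linarith : 0 ≤ L) hκ]) le_rfl
  refine ⟨h2', fun j i hi => ?_⟩
  match i with
  | 0 => exact h2'
  | 1 =>
    refine (h1 j).mono (by positivity) ?_ one_le_two; have : 0 ≤ L * (2 * n * L) := by positivity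
    gcongr; linarith
  | i + 2 =>
    simp only [iterD_taylorRem (ha.smooth _)]
    refine (high j (i + 2) (by omega) hi).mono hκ ?_ (Nat.zero_le 2)
    have : 0 ≤ L * (2 * n * L) := by positivity
    nlinarith

lemma symBound_incRem (hX : IsPhaseFlow a X Y L) (hb : IsTimeSym b) (hκ : 0 ≤ κ)
    (hgrad : FlowBound X w₀ κ 0 fun τ => gradSum (b τ))
    (high : ∀ j, ∀ i, 1 ≤ i → i ≤ m → FlowBound X w₀ κ 0 fun τ => (dph j)^[i] (b τ)) :
    SymBound X w₀ ((1 + L + L * (2 * n * L)) * κ) m fun τ => incRem (b τ) (X τ w₀) := by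
  have hL := hX.one_le
  have hLn : 0 ≤ L * (2 * n * L) := by positivity
  have h2 : FlowBound X w₀ (L * κ) 1 fun τ => incRem (b τ) (X τ w₀) :=
    FlowBound.increment hX hκ hb.smooth hb.cont_gradSum hgrad
  have h2' := h2.mono (by positivity) (κ' := (1 + L + L * (2 * n * L)) * κ) (p' := 2)
    (by gcongr; linarith) one_le_two
  refine ⟨h2', fun j i hi => ?_⟩
  match i with
  | 0 => exact h2'
  | i + 1 =>
    simp only [iterD_incRem]; refine (high j (i + 1) (by omega) hi).mono hκ ?_ (Nat.zero_le 2)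
    nlinarith

lemma flowBound_of_le {g : ℝ → Φ → ℝ} {p : ℕ}
    (hg : ∀ τ ∈ 𝕋, ∀ v, |g τ (X τ v)| ≤ κ * (1 + ‖v - w₀‖) ^ p) :
    FlowBound X w₀ κ p g := fun v => by
  calc ∫⁻ τ in 𝕋, ‖g τ (X τ v)‖ₑ
      ≤ ∫⁻ _τ in 𝕋, ofReal (κ * (1 + ‖v - w₀‖) ^ p) :=
        setLIntegral_mono' measurableSet_Icc fun τ hτ => by
          rw [← ofReal_norm, norm_eq_abs]; exact ofReal_le_ofReal (hg τ hτ _)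
    _ = _ := by simp

lemma exists_symBound_of_taylorRem (hX : IsPhaseFlow a X Y L) (hb : IsTimeSym b)
    (hκ : 0 ≤ κ) (h : SymBound X w₀ κ m fun τ => taylorRem (b τ) (X τ w₀)) :
    ∃ κ', 0 ≤ κ' ∧ SymBound X w₀ κ' m b := by
  have hL := hX.one_le
  have hp := hX.cont_path w₀
  have hc : Continuous fun τ => |b τ (X τ w₀)| + gradSum (b τ) (X τ w₀) :=
    (hb.cont_uncurry.comp (continuous_id.prodMk hp)).abs.add
      (hb.cont_gradSum.comp (continuous_id.prodMk hp))
  obtain ⟨A, hA⟩ := isCompact_Icc.exists_bound_of_continuousOn (hc.continuousOn (s := 𝕋))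
  have hA' : ∀ τ ∈ 𝕋, |b τ (X τ w₀)| + gradSum (b τ) (X τ w₀) ≤ A := fun τ hτ =>
    (le_abs_self _).trans (hA τ hτ)
  have hA0 : 0 ≤ A := (norm_nonneg _).trans (hA 0 ⟨le_rfl, zero_le_one⟩)
  have hlin : ∀ τ ∈ 𝕋, ∀ v, |linPart (b τ) (X τ w₀) (X τ v)| ≤
      A * L * (1 + ‖v - w₀‖) ^ 2 := fun τ hτ v => by
    have h1 := hA' τ hτ; have h2 := abs_nonneg (b τ (X τ w₀))
    have h3 := gradSum_nonneg (b τ) (X τ w₀); have h4 := hX.lip τ v w₀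
    have h5 := norm_nonneg (v - w₀)
    calc _ ≤ |b τ (X τ w₀)| + gradSum (b τ) (X τ w₀) * ‖X τ v - X τ w₀‖ := abs_linPart_le _ _ _
      _ ≤ |b τ (X τ w₀)| * (L * (1 + ‖v - w₀‖)) + gradSum (b τ) (X τ w₀) * (L * (1 + ‖v - w₀‖)) := by
          refine add_le_add (le_mul_of_one_le_right h2 (by nlinarith)) (by nlinarith)
      _ = (|b τ (X τ w₀)| + gradSum (b τ) (X τ w₀)) * L * (1 + ‖v - w₀‖) ^ 1 := by ring
      _ ≤ _ := by
          gcongr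
          · linarith
          · norm_num
  have hconst : ∀ j, ∀ τ ∈ 𝕋, |dph j (b τ) (X τ w₀)| ≤ A * L := fun j τ hτ => by
    have h1 := hA' τ hτ; have h2 := abs_nonneg (b τ (X τ w₀))
    have h3 : |dph j (b τ) (X τ w₀)| ≤ gradSum (b τ) (X τ w₀) :=
      single_le_sum (f := fun j => |pd j (b τ) (X τ w₀)|)
        (fun j _ => abs_nonneg _) (Finset.mem_univ j)
    nlinarith
  have hp' : Continuous fun p : ℝ × Φ => X p.1 w₀ := hp.comp continuous_fst
  have hlinm : Measurable fun p : ℝ × Φ => linPart (b p.1) (X p.1 w₀) p.2 :=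
    (hb.cont_linPart hp).measurable
  have hzero : FlowBound X w₀ (A * L + κ) 2 b := by
    refine (FlowBound.add (g := fun τ => linPart (b τ) (X τ w₀)) (flowBound_of_le hlin) h.zero
      (by positivity) hκ hlinm hX.continuous.measurable).of_le fun τ _ v => ?_
    have : b τ v = linPart (b τ) (X τ w₀) v + taylorRem (b τ) (X τ w₀) v := by simp [taylorRem]
    rw [this]; exact abs_add_le_abs_add _ _
  refine ⟨A * L + κ, by positivity, hzero, fun j i hi => ?_⟩
  match i with
  | 0 => exact hzero
  | 1 =>
    refine (FlowBound.add (g := fun τ _ => dph j (b τ) (X τ w₀)) (flowBound_of_le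
      fun τ hτ v => (hconst j τ hτ).trans (le_mul_of_one_le_right (by positivity)
        (one_le_pow₀ (by linarith [norm_nonneg (v - w₀)])))) (h.deriv j 1 hi)
      (by positivity) hκ (((hb.cont_partialD (ph j)).comp
        (continuous_fst.prodMk hp')).measurable) hX.continuous.measurable).of_le fun τ _ v => ?_
    have : dph j (b τ) v = dph j (b τ) (X τ w₀) +
        dph j (taylorRem (b τ) (X τ w₀)) v := by
      rw [dirD_taylorRem (hb.smooth τ)]; ring
    simp only [iterate_one]; rw [this]; exact abs_add_le_abs_add _ _
  | i + 2 =>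
    have := h.deriv j (i + 2) hi; simp only [iterD_taylorRem (hb.smooth _)] at this
    exact this.mono hκ (by nlinarith) le_rfl

lemma exists_symBound_of_incRem (hX : IsPhaseFlow a X Y L) (hb : IsTimeSym b)
    (hκ : 0 ≤ κ) (h : SymBound X w₀ κ m fun τ => incRem (b τ) (X τ w₀)) :
    ∃ κ', 0 ≤ κ' ∧ SymBound X w₀ κ' m b := by
  have hp := hX.cont_path w₀
  have hc := (hb.cont_uncurry.comp (continuous_id.prodMk hp)).continuousOn (s := 𝕋)
  obtain ⟨A, hA⟩ := isCompact_Icc.exists_bound_of_continuousOn hc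
  have hA0 : 0 ≤ A := (norm_nonneg _).trans (hA 0 ⟨le_rfl, zero_le_one⟩)
  have hp' : Continuous fun p : ℝ × Φ => X p.1 w₀ := hp.comp continuous_fst
  have hzero : FlowBound X w₀ (A + κ) 2 b := by
    refine (FlowBound.add (g := fun τ _ => b τ (X τ w₀)) (flowBound_of_le
      fun τ hτ v => (hA τ hτ).trans (le_mul_of_one_le_right hA0
        (one_le_pow₀ (by linarith [norm_nonneg (v - w₀)])))) h.zero
      hA0 hκ (hb.cont_uncurry.comp (continuous_fst.prodMk hp')).measurable
        hX.continuous.measurable).of_le fun τ _ v => ?_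
    have : b τ v = b τ (X τ w₀) + incRem (b τ) (X τ w₀) v := by simp [incRem]
    rw [this]; exact abs_add_le_abs_add _ _
  refine ⟨A + κ, by positivity, hzero, fun j i hi => ?_⟩
  match i with
  | 0 => exact hzero
  | i + 1 =>
    have := h.deriv j (i + 1) hi; simp only [iterD_incRem] at this
    exact this.mono hκ (by linarith) le_rfl

end Family

/-! ### Algebra of admissible symbols -/

lemma wtInt_ne_top_of_le {g : Φ → ℝ} {A : ℝ} (h : ∀ v, |g v| ≤ A * (1 + ‖v‖) ^ 2) :
    wtInt d₃ g 0 ≠ ⊤ := by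
  have hle : wtInt d₃ g 0 ≤ ∫⁻ v : Φ, ofReal (A * wt d₁ v) := by
    refine lintegral_mono fun v => ofReal_le_ofReal ?_
    rw [sub_zero, show 2 * n + 3 = d₁ + 2 by ring, wt_add]; have h1 := wt_nonneg d₁ v
    have h2 := wt_nonneg 2 v
    calc |g v| * (wt d₁ v * wt 2 v)
        ≤ A * (1 + ‖v‖) ^ 2 * (wt d₁ v * wt 2 v) := by gcongr; exact h v
      _ = A * wt d₁ v * (wt 2 v * (1 + ‖v‖) ^ 2) := by ring
      _ = _ := by rw [wt_mul_pow, mul_one]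
  exact ne_top_of_le_ne_top (integrable_wt_phase.const_mul A).lintegral_lt_top.ne hle

lemma symSize_ne_top_iff {m K : ℕ} {c : Φ} : symSize m K q c ≠ ⊤ ↔
    wtInt K q c ≠ ⊤ ∧ ∀ j, ∀ i ≤ m, wtInt K ((dph j)^[i] q) c ≠ ⊤ := by
  rw [symSize, add_ne_top, sum_ne_top]
  simp

lemma isAdm_linPart (q : Φ → ℝ) (W : Φ) : IsAdm d₃ (linPart q W) := by
  have hconst : ∀ c, wtInt d₃ (fun _ => c) 0 ≠ ⊤ := fun c =>
    wtInt_ne_top_of_le (A := |c|) fun v => le_mul_of_one_le_right (abs_nonneg _)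
      (one_le_pow₀ (by linarith [norm_nonneg v]))
  have h0 : wtInt d₃ (linPart q W) 0 ≠ ⊤ := by
    have hg := gradSum_nonneg q W
    refine wtInt_ne_top_of_le (A := |q W| + gradSum q W * (1 + ‖W‖)) fun v =>
      (abs_linPart_le q W v).trans ?_
    have h1 : ‖v - W‖ ≤ (1 + ‖W‖) * (1 + ‖v‖) := by
      refine (norm_sub_le _ _).trans ?_
      nlinarith [norm_nonneg v, norm_nonneg W, mul_nonneg (norm_nonneg v) (norm_nonneg W)]
    calc |q W| + gradSum q W * ‖v - W‖
        ≤ |q W| * (1 + ‖v‖) + gradSum q W * ((1 + ‖W‖) * (1 + ‖v‖)) := by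
          gcongr; exact le_mul_of_one_le_right (abs_nonneg _) (by linarith [norm_nonneg v])
      _ = (|q W| + gradSum q W * (1 + ‖W‖)) * (1 + ‖v‖) ^ 1 := by ring
      _ ≤ _ := by
          gcongr
          · linarith [norm_nonneg v]
          · norm_num
  refine ⟨contDiff_linPart q W, fun m => symSize_ne_top_iff.2 ⟨h0, fun j i _ => ?_⟩⟩
  match i with
  | 0 => exact h0
  | i + 1 =>
    rw [iterate_succ_apply, dirD_linPart]
    match i with
    | 0 => exact hconst _
    | i + 1 => rw [iterate_succ_apply, dirD_const, iterD_zero]; exact hconst 0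

lemma iterD_neg (e : Φ) (m : ℕ) :
    (dirD e)^[m] (fun v => -q v) = fun v => -(dirD e)^[m] q v := by
  induction m generalizing q with
  | zero => rfl
  | succ m ih =>
    rw [iterate_succ_apply, iterate_succ_apply, ← ih]; congr 1; funext v
    simp only [dirD, fderiv_fun_neg, neg_apply]

lemma wtInt_sub_ne_top {f g : Φ → ℝ} (hfc : Continuous f)
    (hf : wtInt K f 0 ≠ ⊤) (hg : wtInt K g 0 ≠ ⊤) : wtInt K (fun v => f v - g v) 0 ≠ ⊤ := by
  have hle : wtInt K (fun v => f v - g v) 0 ≤ wtInt K f 0 + wtInt K g 0 := by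
    have hm : Measurable fun v => ofReal (|f v| * wt K (v - 0)) :=
      (ENNReal.continuous_ofReal.comp (by fun_prop : Continuous fun v =>
        |f v| * wt K (v - 0))).measurable
    rw [wtInt, wtInt, wtInt, ← lintegral_add_left hm]; refine lintegral_mono fun v => ?_
    have hw := wt_nonneg K (v - 0); rw [← ofReal_add (by positivity) (by positivity), ← add_mul]
    refine ofReal_le_ofReal (mul_le_mul_of_nonneg_right ?_ hw); exact abs_sub _ _
  exact ne_top_of_le_ne_top (add_ne_top.2 ⟨hf, hg⟩) hle

lemma IsAdm.sub {q r : Φ → ℝ} (hq : IsAdm K q) (hr : IsAdm K r) :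
    IsAdm K fun v => q v - r v := by
  refine ⟨hq.smooth.sub hr.smooth, fun m => symSize_ne_top_iff.2 ⟨?_, fun j i _ => ?_⟩⟩
  · exact wtInt_sub_ne_top hq.smooth.continuous (symSize_ne_top_iff.1 (hq.ne_top 0)).1
      (symSize_ne_top_iff.1 (hr.ne_top 0)).1
  · have : (dph j)^[i] (fun v => q v - r v) =
        fun v => (dph j)^[i] q v - (dph j)^[i] r v := by
      simp only [sub_eq_add_neg]; rw [iterD_add hq.smooth hr.smooth.neg, iterD_neg]
    rw [this]
    exact wtInt_sub_ne_top (contDiff_iterD hq.smooth _ _).continuous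
      (hq.wtInt_ne_top j i) (hr.wtInt_ne_top j i)

lemma IsAdm.taylorRem (hq : IsAdm d₃ q) (W : Φ) :
    IsAdm d₃ (taylorRem q W) := hq.sub (isAdm_linPart q W)

lemma isAdm_const (c : ℝ) : IsAdm d₃ fun _ : Φ => c := by
  have := isAdm_linPart (fun _ : Φ => c) 0
  have e : linPart (fun _ : Φ => c) 0 = fun _ => c := by funext v; simp [linPart]
  rwa [e] at this

lemma IsAdm.incRem (hq : IsAdm d₃ q) (W : Φ) :
    IsAdm d₃ (incRem q W) := hq.sub (isAdm_const (q W))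

lemma IsAdm.integrable_mul_wig (hq : IsAdm K q) (z w : Φ) :
    Integrable fun v => (q v : ℂ) * wig z w v := by
  have := hq.integrable_mul_wigFun (coherent w) z
  simpa only [wigFun_coherent] using this

lemma symKer_sub {q r : Φ → ℝ} (hq : IsAdm K q) (hr : IsAdm K r) (z w : Φ) :
    symKer (fun v => q v - r v) z w = symKer q z w - symKer r z w := by
  rw [symKer, symKer, symKer, ← integral_sub (hq.integrable_mul_wig z w) (hr.integrable_mul_wig z w)]
  simp only [Complex.ofReal_sub, sub_mul]

lemma IsAdm.integral_symKer_mul_repKer (hq : IsAdm K q)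
    (z u : Φ) : ∫ w, symKer q z w * repKer w u = symKer q z u := by
  have := hq.integral_mul_wigFun (coherent u) z
  simp only [wigFun_coherent, bargmann_coherent] at this
  exact this.symm

lemma IsAdm.integral_repKer_mul_symKer (hq : IsAdm K q)
    (z u : Φ) : ∫ w, repKer z w * symKer q w u = symKer q z u := by
  have := congrArg conj (hq.integral_symKer_mul_repKer u z)
  rw [← integral_conj, conj_symKer] at this
  simp only [map_mul, conj_symKer, conj_repKer] at this
  rw [← this]
  grind

/-! ### The kernel of an affine symbol -/

/-- The kernel of the first order Taylor polynomial at the right base point. -/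
def linKer (q : Φ → ℝ) (z w : Φ) : ℂ :=
  repKer z w * (q w + ∑ j, (pd j q w : ℂ) *
    (1 / 2 * pc j (z - w) + I / 2 * wigPhase (z - w) (ph j)))

lemma pc_add (u v : Φ) : pc j (u + v) = pc j u + pc j v := by
  rcases j with i | i <;> simp [pc]

lemma pc_smul (c : ℝ) (v : Φ) : pc j (c • v) = c * pc j v := by
  rcases j with i | i <;> simp [pc]

lemma integrable_wig : Integrable fun v => wig z w v := by
  have := (isAdm_const (n := n) 1).integrable_mul_wig z w
  simpa using this

lemma symKer_const (c : ℝ) (z w : Φ) : symKer (fun _ => c) z w = c * repKer z w := by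
  rw [symKer, integral_const_mul, integral_wig]

lemma symKer_linPart (q : Φ → ℝ) (z w : Φ) :
    symKer (linPart q w) z w = linKer q z w := by
  have h1 : ∀ v, (linPart q w v : ℂ) * wig z w v = (q w : ℂ) * wig z w v +
      ∑ j, ((pd j q w : ℂ) * (1 / 2 * pc j (z - w)) * wig z w v +
        (pd j q w : ℂ) * ((pc j (v - mid z w) : ℂ) * wig z w v)) := fun v => by
    have e : v - w = (v - mid z w) + (1 / 2 : ℝ) • (z - w) := by rw [mid]; module
    rw [linPart, fderiv_eq_sum, e]; simp only [pc_add, pc_smul]; push_cast; rw [add_mul, sum_mul]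
    grind
  rw [symKer]
  simp only [h1]
  have hi : ∀ j, Integrable fun v =>
      ((pd j q w : ℂ) * (1 / 2 * pc j (z - w)) * wig z w v +
        (pd j q w : ℂ) * ((pc j (v - mid z w) : ℂ) * wig z w v)) := fun j =>
    ((integrable_wig z w).const_mul _).add ((integrable_pc_mul_wig j z w).const_mul _)
  rw [integral_add ((integrable_wig z w).const_mul _) (integrable_finsetSum _ fun j _ => hi j),
    integral_finsetSum _ (fun j _ => hi j), integral_const_mul, integral_wig, linKer, mul_add,
    mul_sum]
  congr 1
  · ring
  refine sum_congr rfl fun j _ => ?_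
  rw [integral_add ((integrable_wig z w).const_mul _) ((integrable_pc_mul_wig j z w).const_mul _),
    integral_const_mul, integral_const_mul, integral_wig, integral_pc_mul_wig]
  ring

lemma IsAdm.symKer_taylorRem (hq : IsAdm d₃ q) (z w : Φ) :
    symKer (PhaseSpace.taylorRem q w) z w = symKer q z w - linKer q z w := by
  rw [← symKer_linPart]
  exact symKer_sub hq (isAdm_linPart q w) z w

lemma IsAdm.symKer_incRem (hq : IsAdm d₃ q) (c z w : Φ) :
    symKer (PhaseSpace.incRem q c) z w = symKer q z w - q c * repKer z w := by
  rw [← symKer_const]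
  exact symKer_sub hq (isAdm_const (q c)) z w

lemma wigPhase_ph (ζ : Φ) (j : 𝕁) : wigPhase ζ (ph j) =
    inner ℝ ζ.1 (phDual j).1 + inner ℝ ζ.2 (phDual j).2 := by
  rcases j with i | i <;> simp [wigPhase_apply, ph, phDual, dirX, dirXi]

lemma linKer_eq {t : ℝ} {w : Φ} (ha : Differentiable ℝ (a t))
    (z : Φ) : linKer (a t) z w = repKer z w * (a t w +
      (1 / 2 * sympl n (hamField a t w) (z - w) : ℝ) + I / 2 *
      (inner ℝ (z - w).1 (hamField a t w).1 + inner ℝ (z - w).2 (hamField a t w).2 : ℝ)) := by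
  have h1 : sympl n (hamField a t w) (z - w) = ∑ j, pd j (a t) w * pc j (z - w) := by
    rw [hamField_eq ha]; simp [map_sum, sympl_phDual]
  have h2 : inner ℝ (z - w).1 (hamField a t w).1 + inner ℝ (z - w).2 (hamField a t w).2 =
      ∑ j, pd j (a t) w * wigPhase (z - w) (ph j) := by
    rw [hamField_eq ha]
    simp only [Prod.fst_sum, Prod.snd_sum, inner_sum, smul_fst, smul_snd, inner_smul_right,
      wigPhase_ph, mul_add, sum_add_distrib]
  rw [linKer, h1, h2]
  push_cast
  rw [add_assoc, mul_sum, mul_sum, ← sum_add_distrib]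
  grind

/-- The phase of a coherent state that moves along the flow. -/
def actionRate (a : ℝ → Φ → ℝ) (t : ℝ) (v : Φ) : ℝ :=
  inner ℝ v.2 (hamField a t v).1 - a t v

lemma hasDerivWithinAt_repKer {p : ℝ → Φ} {s : Set ℝ} {t : ℝ}
    (ha : Differentiable ℝ (a t)) (hp : HasDerivWithinAt p (hamField a t (p t)) s t) (z : Φ) :
    HasDerivWithinAt (fun τ => repKer z (p τ)) (-I * linKer (a t) z (p t) -
      I * actionRate a t (p t) * repKer z (p t)) s t := by
  set H := hamField a t (p t) with hH
  have p1 := (hasFDerivAt_fst.comp_hasDerivWithinAt t hp)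
  have p2 := (hasFDerivAt_snd.comp_hasDerivWithinAt t hp)
  have d1 : HasDerivWithinAt (fun τ => z.1 - (p τ).1) (-H.1) s t := p1.const_sub z.1
  have d2 : HasDerivWithinAt (fun τ => z.2 - (p τ).2) (-H.2) s t := p2.const_sub z.2
  have d3 : HasDerivWithinAt (fun τ => z.2 + (p τ).2) H.2 s t := p2.const_add z.2
  have e1 := ((d1.norm_sq).add d2.norm_sq).const_mul (-(1 / 4 : ℝ))
  have e2 := ((d3.inner ℝ d1).const_mul (1 / 2 : ℝ)).ofReal_comp.mul_const I
  have e3 := (e1.exp.const_mul (((2 * Real.pi) ^ n)⁻¹)).ofReal_comp.mul e2.cexp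
  refine e3.congr_deriv ?_
  rw [linKer_eq ha, repKer, actionRate, ← hH, sympl_apply]
  simp only [Pi.add_apply, sqNorm, fst_sub, snd_sub, inner_sub_left, inner_sub_right,
    inner_add_left, inner_neg_right, real_inner_comm _ H.1, real_inner_comm _ H.2]
  push_cast
  ring_nf
  rw [I_sq]
  ring_nf

/-! ### Kernels of the generator -/

/-- Symbols `a`, `b` with integral bounds along the Hamilton flow `X` of `a`. -/
structure IsEvol (a b : ℝ → Φ → ℝ) (X Y : ℝ → Φ → Φ) (L : ℝ) : Prop where
  symb_a : IsTimeSym a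
  symb_b : IsTimeSym b
  flow : IsPhaseFlow a X Y L
  bound_a : ∀ m, ∃ κ, 0 ≤ κ ∧ SymBound X 0 κ m a
  bound_b : ∀ m, ∃ κ, 0 ≤ κ ∧ SymBound X 0 κ m b

/-- The kernel of the generator `-i a^w + b^w` in the coherent state representation. -/
def genKer (a b : ℝ → Φ → ℝ) (τ : ℝ) (z w : Φ) : ℂ :=
  -I * symKer (a τ) z w + symKer (b τ) z w

/-- The approximation of `genKer` by Taylor expansion of the symbols at `w`. -/
def cenKer (a b : ℝ → Φ → ℝ) (τ : ℝ) (z w : Φ) : ℂ :=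
  -I * linKer (a τ) z w + b τ w * repKer z w

/-- The approximation of `genKer` by Taylor expansion of the symbols at `z`. -/
def cenKerL (a b : ℝ → Φ → ℝ) (τ : ℝ) (z w : Φ) : ℂ :=
  -I * conj (linKer (a τ) w z) + b τ z * repKer z w

lemma integrable_wt_phase_sub : Integrable fun w => wt d₁ (z - w) :=
  integrable_wt_sub (μ := volume) (by rw [finrank_phase]; omega) z

lemma smeas_symKer {q : ℝ → Φ → ℝ} (hq : Continuous fun p : ℝ × Φ => q p.1 p.2) :
    StronglyMeasurable fun p : ℝ × Φ × Φ => symKer (q p.1) p.2.1 p.2.2 := by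
  have hc : Continuous fun p : (ℝ × Φ × Φ) × Φ =>
      (q p.1.1 p.2 : ℂ) * wig p.1.2.1 p.1.2.2 p.2 := by
    have h2 : Continuous fun p : (ℝ × Φ × Φ) × Φ => wig p.1.2.1 p.1.2.2 p.2 :=
      cont_wig_comp (by fun_prop) (by fun_prop) (by fun_prop)
    fun_prop
  exact hc.stronglyMeasurable.integral_prod_right (f := fun (p : ℝ × Φ × Φ) v =>
    (q p.1 v : ℂ) * wig p.2.1 p.2.2 v)

lemma smeas_genKer (ha : IsTimeSym a) (hb : IsTimeSym b) :
    StronglyMeasurable fun p : ℝ × Φ × Φ => genKer a b p.1 p.2.1 p.2.2 :=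
  ((smeas_symKer ha.cont_uncurry).const_mul _).add
    (smeas_symKer hb.cont_uncurry)

lemma cont_repKer_comp {α : Type*} [TopologicalSpace α] {f g : α → Φ}
    (hf : Continuous f) (hg : Continuous g) : Continuous fun p => repKer (f p) (g p) := by fun_prop

section Comp
variable {α : Type*} [TopologicalSpace α] {f : α → ℝ} {g h : α → Φ} (ha : IsTimeSym a)
  (hb : IsTimeSym b) (hf : Continuous f) (hg : Continuous g) (hh : Continuous h)
include ha hf hg hh

lemma IsTimeSym.cont_linKer_comp :
    Continuous fun p => linKer (a (f p)) (g p) (h p) := by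
  have h0 := cont_repKer_comp hg hh
  have h1 : Continuous fun p => a (f p) (h p) := ha.cont_uncurry.comp (hf.prodMk hh)
  have h2 : ∀ j, Continuous fun p => pd j (a (f p)) (h p) := fun j =>
    (ha.cont_partialD (ph j)).comp (hf.prodMk hh)
  have h3 : ∀ j, Continuous fun p => wigPhase (g p - h p) (ph j) := fun j => by
    simp only [wigPhase_apply]; fun_prop
  refine h0.mul ((Complex.continuous_ofReal.comp h1).add (continuous_finsetSum _ fun j _ => ?_))
  fun_prop

include hb

lemma cont_cenKer_comp :
    Continuous fun p => cenKer a b (f p) (g p) (h p) := by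
  have h0 := cont_repKer_comp hg hh
  have h1 : Continuous fun p => b (f p) (h p) := hb.cont_uncurry.comp (hf.prodMk hh)
  have h2 := ha.cont_linKer_comp hf hg hh
  exact (continuous_const.mul h2).add ((Complex.continuous_ofReal.comp h1).mul h0)

lemma cont_cenKerL_comp :
    Continuous fun p => cenKerL a b (f p) (g p) (h p) := by
  have h0 := cont_repKer_comp hg hh
  have h1 : Continuous fun p => b (f p) (g p) := hb.cont_uncurry.comp (hf.prodMk hg)
  have h2 := ha.cont_linKer_comp hf hh hg
  exact (continuous_const.mul (Complex.continuous_conj.comp h2)).add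
    ((Complex.continuous_ofReal.comp h1).mul h0)

end Comp

/-- The size of the Taylor polynomials of the symbols at `w`. -/
def jetSize (a b : ℝ → Φ → ℝ) (τ : ℝ) (w : Φ) : ℝ :=
  |a τ w| + ∑ j, |dph j (a τ) w| + |b τ w|

lemma jetSize_nonneg (a b : ℝ → Φ → ℝ) (τ : ℝ) (w : Φ) : 0 ≤ jetSize a b τ w := by
  unfold jetSize; positivity

lemma cont_jetSize (ha : IsTimeSym a) (hb : IsTimeSym b) :
    Continuous fun p : ℝ × Φ => jetSize a b p.1 p.2 := by
  exact (ha.cont_uncurry.abs.add (continuous_finsetSum _ fun j _ =>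
    (ha.cont_partialD (ph j)).abs)).add hb.cont_uncurry.abs

lemma abs_wigPhase_ph_le (ζ : Φ) (j : 𝕁) : |wigPhase ζ (ph j)| ≤ ‖ζ‖ := by
  rcases j with i | i
  · rw [wigPhase_inl, abs_neg]; exact abs_pc_le (inr i) ζ
  · rw [wigPhase_inr]; exact abs_pc_le (inl i) ζ

lemma norm_cenKer_le_repKer (a b : ℝ → Φ → ℝ) (τ : ℝ) (z w : Φ) :
    ‖linKer (a τ) z w‖ + ‖(b τ w : ℂ) * repKer z w‖ ≤
      ‖repKer z w‖ * (jetSize a b τ w * (1 + ‖z - w‖)) := by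
  have h1 : ‖(a τ w : ℂ) + ∑ j, (pd j (a τ) w : ℂ) *
      (1 / 2 * pc j (z - w) + I / 2 * wigPhase (z - w) (ph j))‖ ≤
      |a τ w| + (∑ j, |dph j (a τ) w|) * ‖z - w‖ := by
    refine (norm_add_le _ _).trans (add_le_add (by rw [norm_real, norm_eq_abs]) ?_); rw [sum_mul]
    refine (norm_sum_le _ _).trans (sum_le_sum fun j _ => ?_); rw [norm_mul, norm_real]
    refine mul_le_mul_of_nonneg_left ((norm_add_le _ _).trans ?_) (norm_nonneg _)
    have h2 := abs_pc_le j (z - w); have h3 := abs_wigPhase_ph_le (z - w) j; norm_num; linarith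
  rw [linKer, norm_mul, norm_mul, norm_real, norm_eq_abs, mul_comm |b τ w|, ← mul_add]
  gcongr
  have hs : 0 ≤ ∑ j, |dph j (a τ) w| := sum_nonneg fun _ _ => abs_nonneg _
  have hr := norm_nonneg (z - w)
  have := mul_nonneg (abs_nonneg (a τ w)) hr
  have := mul_nonneg (abs_nonneg (b τ w)) hr
  rw [jetSize]
  nlinarith

lemma exists_cenKer_le (n m : ℕ) : ∃ C, 0 ≤ C ∧
    ∀ (a b : ℝ → Φ → ℝ) (τ : ℝ) (z w : Φ),
      ‖cenKer a b τ z w‖ ≤ C * (jetSize a b τ w * wt m (z - w)) ∧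
      ‖cenKerL a b τ w z‖ ≤ C * (jetSize a b τ w * wt m (z - w)) := by
  obtain ⟨C, hC0, hC⟩ := exists_repKer_le n (m + 1)
  refine ⟨C, hC0, fun a b τ z w => ?_⟩
  have hj := jetSize_nonneg a b τ w
  have h3 := (norm_cenKer_le_repKer a b τ z w).trans <| calc
    _ ≤ C * wt (m + 1) (z - w) * (jetSize a b τ w * (1 + ‖z - w‖)) := by
          gcongr; exact hC z w
    _ = C * (jetSize a b τ w * wt m (z - w)) * (wt 1 (z - w) * (1 + ‖z - w‖) ^ 1) := by
          rw [wt_add]; ring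
    _ = C * (jetSize a b τ w * wt m (z - w)) := by rw [wt_mul_pow, mul_one]
  constructor <;> refine (norm_add_le _ _).trans (le_trans (le_of_eq ?_) h3)
  · rw [norm_mul, norm_neg, norm_I, one_mul]
  · rw [norm_mul, norm_neg, norm_I, one_mul, RCLike.norm_conj, norm_mul, norm_mul,
      ← conj_repKer z w, RCLike.norm_conj]

lemma ae_fst {α : Type*} [MeasurableSpace α] {μ : Measure ℝ} {ν : Measure α} {P : ℝ → Prop}
    (h : ∀ᵐ τ ∂μ, P τ) : ∀ᵐ p ∂μ.prod ν, P p.1 := quasiMeasurePreserving_fst.ae h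

lemma ae_fst_mem {α : Type*} [MeasurableSpace α] {ν : Measure α} :
    ∀ᵐ p ∂(μ𝕋).prod ν, p.1 ∈ 𝕋 := ae_fst (ae_restrict_mem measurableSet_Icc)

lemma exists_wt_path_le {f : ℝ → Φ} (hf : Continuous f) (m : ℕ) : ∃ C, 0 ≤ C ∧ ∀ τ ∈ 𝕋, ∀ w,
    wt m (f τ - w) ≤ C * wt m w := by
  obtain ⟨R, hR⟩ := isCompact_Icc.exists_bound_of_continuousOn (hf.continuousOn (s := 𝕋))
  refine ⟨(1 + ‖R‖) ^ m, by positivity, fun τ hτ w => ?_⟩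
  rw [wt_sub_comm]
  have := wt_nonneg m w
  exact (wt_sub_le m w _).trans (by gcongr; exact (hR τ hτ).trans (Real.le_norm_self R))

namespace IsEvol

variable (D : IsEvol a b X Y L)
include D

lemma cont_flow_comp {α : Type*} [TopologicalSpace α] {f : α → ℝ} {g : α → Φ}
    (hf : Continuous f) (hg : Continuous g) : Continuous fun p => X (f p) (g p) :=
  D.flow.continuous.comp (hf.prodMk hg)

lemma cont_inv_comp {α : Type*} [TopologicalSpace α] {f : α → ℝ} {g : α → Φ}
    (hf : Continuous f) (hg : Continuous g) : Continuous fun p => Y (f p) (g p) :=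
  D.flow.cont_inv.comp (hf.prodMk hg)

lemma exists_integrable_symSize {q : ℝ → Φ → ℝ} (hq : IsTimeSym q) {m : ℕ}
    (h : ∃ κ, 0 ≤ κ ∧ SymBound X 0 κ m q) : ∃ B,
    Integrable B μ𝕋 ∧ (∀ τ, 0 ≤ B τ) ∧
    ∀ᵐ τ ∂μ𝕋, symSize m d₃ (q τ) 0 ≤ ofReal (B τ) := by
  obtain ⟨κ, hκ, h⟩ := h
  obtain ⟨R, hR⟩ := isCompact_Icc.exists_bound_of_continuousOn
    ((D.flow.cont_path 0).continuousOn (s := 𝕋))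
  have hle : ∀ τ ∈ 𝕋, symSize m d₃ (q τ) 0 ≤
      ofReal ((1 + R) ^ d₃) * symSize m d₃ (q τ) (X τ 0) := fun τ hτ => by
    refine (symSize_le_mul _ _ _ _ (X τ 0)).trans ?_; gcongr; rw [zero_sub, norm_neg]; exact hR τ hτ
  have hm := hq.isSmoothFamily.measurable_symSize (c := fun _ => 0) continuous_const m d₃
  have hfin : ∫⁻ τ in 𝕋, symSize m d₃ (q τ) 0 ≠ ⊤ := by
    refine ne_top_of_le_ne_top ?_ (setLIntegral_mono' measurableSet_Icc hle)
    rw [lintegral_const_mul' _ _ ofReal_ne_top]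
    exact mul_ne_top ofReal_ne_top (ne_top_of_le_ne_top ofReal_ne_top
      (h.lintegral_symSize_le D.flow D.symb_a hκ hq.isSmoothFamily 0))
  refine ⟨fun τ => (symSize m d₃ (q τ) 0).toReal,
    integrable_toReal_of_lintegral_ne_top hm.aemeasurable hfin, fun _ => toReal_nonneg, ?_⟩
  filter_upwards [ae_lt_top hm hfin] with τ hτ
  rw [ofReal_toReal hτ.ne]

lemma ae_isAdm_of_bound {q : ℝ → Φ → ℝ} (hq : IsTimeSym q)
    (h : ∀ m, ∃ κ, 0 ≤ κ ∧ SymBound X 0 κ m q) :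
    ∀ᵐ τ ∂μ𝕋, IsAdm d₃ (q τ) := by
  have : ∀ m, ∀ᵐ τ ∂μ𝕋, symSize m d₃ (q τ) 0 ≠ ⊤ := fun m => by
    obtain ⟨B, -, -, hB⟩ := D.exists_integrable_symSize hq (h m); filter_upwards [hB] with τ hτ
    exact ne_top_of_le_ne_top ofReal_ne_top hτ
  filter_upwards [ae_all_iff.2 this] with τ hτ
  exact ⟨hq.smooth τ, hτ⟩

lemma ae_isAdm : ∀ᵐ τ ∂μ𝕋,
    IsAdm d₃ (a τ) ∧ IsAdm d₃ (b τ) :=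
  (D.ae_isAdm_of_bound D.symb_a D.bound_a).and (D.ae_isAdm_of_bound D.symb_b D.bound_b)

lemma exists_genKer_le (m : ℕ) : ∃ B,
    Integrable B μ𝕋 ∧ (∀ τ, 0 ≤ B τ) ∧
    ∀ᵐ τ ∂μ𝕋, ∀ z w,
      ‖genKer a b τ z w‖ ≤ B τ * ((1 + ‖z‖) ^ d₃ * wt m (z - w)) := by
  obtain ⟨C, hC0, hC⟩ := exists_symKer_le n m d₃
  obtain ⟨B₁, i₁, n₁, h₁⟩ := D.exists_integrable_symSize D.symb_a (D.bound_a (m + d₃))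
  obtain ⟨B₂, i₂, n₂, h₂⟩ := D.exists_integrable_symSize D.symb_b (D.bound_b (m + d₃))
  refine ⟨fun τ => C * B₁ τ + C * B₂ τ, (i₁.const_mul C).add (i₂.const_mul C), fun τ => ?_, ?_⟩
  · have := n₁ τ; have := n₂ τ; positivity
  · filter_upwards [h₁, h₂] with τ h1 h2 z w; refine (norm_add_le _ _).trans ?_
    rw [norm_mul, norm_neg, norm_I, one_mul, add_mul]
    exact add_le_add (hC _ _ (D.symb_a.smooth τ) (n₁ τ) h1 z w)
      (hC _ _ (D.symb_b.smooth τ) (n₂ τ) h2 z w)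

lemma exists_flowBound_jetSize : ∃ κ, 0 ≤ κ ∧ FlowBound X 0 κ 2 (jetSize a b) := by
  obtain ⟨κ₁, h₁, b₁⟩ := D.bound_a 1
  obtain ⟨κ₂, h₂, b₂⟩ := D.bound_b 1
  have hX := D.flow.continuous.measurable
  have m1 : ∀ j, Measurable fun p : ℝ × Φ => dph j (a p.1) p.2 := fun j =>
    (D.symb_a.cont_partialD (ph j)).measurable
  have s1 := FlowBound.sum (fun j => b₁.deriv j 1 le_rfl) m1 hX
  have s2 := FlowBound.add b₁.zero s1 h₁ (by positivity) D.symb_a.cont_uncurry.measurable hX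
  have s3 := FlowBound.add s2 b₂.zero (by positivity) h₂ (D.symb_a.cont_uncurry.abs.add
      (continuous_finsetSum _ fun j _ => (D.symb_a.cont_partialD (ph j)).abs).abs).measurable hX
  refine ⟨_, by positivity, s3.of_le fun τ _ v => ?_⟩
  have e : 0 ≤ ∑ j, |dph j (a τ) v| := sum_nonneg fun _ _ => abs_nonneg _
  simp only [jetSize, iterate_one]
  grind

lemma exists_wt_flow_le (m : ℕ) (z : Φ) : ∃ C, 0 ≤ C ∧ ∀ τ ∈ 𝕋, ∀ w,
    wt m (z - X τ w) ≤ C * wt m w := by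
  obtain ⟨C, hC0, hC⟩ := exists_wt_path_le (D.cont_inv_comp continuous_id continuous_const) m
  have hL := D.flow.one_le
  refine ⟨L ^ m * C, by positivity, fun τ hτ w => ?_⟩
  have := D.flow.lip_inv τ z (X τ w)
  rw [D.flow.left_inv] at this
  rw [mul_assoc]
  exact (wt_le_of_norm_le m hL this).trans (by gcongr; exact hC τ hτ w)

lemma integrable_cenKer : Integrable (fun p => cenKer a b p.1 z (X p.1 p.2))
    ν𝕋 := by
  obtain ⟨κ, hκ, hb⟩ := D.exists_flowBound_jetSize
  obtain ⟨C, hC0, hC⟩ := exists_cenKer_le n d₃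
  obtain ⟨C', hC'0, hC'⟩ := D.exists_wt_flow_le d₃ z
  have hcont : Continuous fun p : ℝ × Φ => cenKer a b p.1 z (X p.1 p.2) :=
    cont_cenKer_comp D.symb_a D.symb_b continuous_fst continuous_const D.flow.continuous
  refine ⟨hcont.aestronglyMeasurable, ?_⟩
  rw [HasFiniteIntegral, lintegral_prod_symm' _ hcont.measurable.enorm]
  have hle : ∀ w, ∫⁻ τ in 𝕋, ‖cenKer a b τ z (X τ w)‖ₑ ≤
      ofReal (C * C' * κ * wt d₁ w) := fun w => by
    have hw := wt_nonneg d₃ w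
    calc _ ≤ ∫⁻ τ in 𝕋, ofReal (C * C' * wt d₃ w) *
          ‖jetSize a b τ (X τ w)‖ₑ := by
          refine setLIntegral_mono' measurableSet_Icc fun τ hτ => ?_
          have hj := jetSize_nonneg a b τ (X τ w)
          rw [← ofReal_norm, ← ofReal_norm, ← ofReal_mul (by positivity),
            norm_of_nonneg hj]
          refine ofReal_le_ofReal ((hC a b τ z (X τ w)).1.trans ?_)
          calc _ ≤ C * (jetSize a b τ (X τ w) * (C' * wt d₃ w)) := by
                gcongr; exact hC' τ hτ w
            _ = _ := by ring
      _ ≤ ofReal (C * C' * wt d₃ w) * ofReal (κ * (1 + ‖w - 0‖) ^ 2) := by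
          rw [lintegral_const_mul' _ _ ofReal_ne_top]; exact mul_le_mul_right (hb w) _
      _ = ofReal (C * C' * κ * wt d₁ w * (wt 2 w * (1 + ‖w‖) ^ 2)) := by
          rw [← ofReal_mul (by positivity), sub_zero,
            show 2 * n + 3 = d₁ + 2 by ring, wt_add]
          ring
      _ = _ := by rw [wt_mul_pow, mul_one]
  exact (lintegral_mono hle).trans_lt (integrable_wt_phase.const_mul _).lintegral_lt_top

lemma integrable_cenKerL : Integrable (fun p => cenKerL a b p.1 (X p.1 z) p.2)
    ν𝕋 := by
  obtain ⟨C, hC0, hC⟩ := exists_cenKer_le n d₁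
  obtain ⟨C', hC'0, hC'⟩ := exists_wt_path_le (D.flow.cont_path z) d₁
  have hcont : Continuous fun p : ℝ × Φ => cenKerL a b p.1 (X p.1 z) p.2 :=
    cont_cenKerL_comp D.symb_a D.symb_b continuous_fst
      ((D.flow.cont_path z).comp continuous_fst) continuous_snd
  have hj : Continuous fun τ => jetSize a b τ (X τ z) :=
    (cont_jetSize D.symb_a D.symb_b).comp (continuous_id.prodMk (D.flow.cont_path z))
  have hj' : IntegrableOn (fun τ => jetSize a b τ (X τ z)) 𝕋 volume :=
    hj.continuousOn.integrableOn_compact isCompact_Icc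
  have hint := hj'.mul_prod ((integrable_wt_phase (n := n)).const_mul (C * C'))
  refine hint.mono' hcont.aestronglyMeasurable ?_
  filter_upwards [ae_fst_mem] with p hp
  refine (hC a b p.1 p.2 (X p.1 z)).2.trans ?_
  have := jetSize_nonneg a b p.1 (X p.1 z)
  rw [wt_sub_comm]
  calc _ ≤ C * (jetSize a b p.1 (X p.1 z) * (C' * wt d₁ p.2)) := by
        gcongr; exact hC' p.1 hp p.2
    _ = _ := by ring

omit D in
lemma smeas_comp {α : Type*} [MeasurableSpace α] {G : ℝ → Φ → Φ → ℂ}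
    (hG : StronglyMeasurable fun p : ℝ × Φ × Φ => G p.1 p.2.1 p.2.2)
    {f : α → ℝ} {g h : α → Φ} (hf : Measurable f) (hg : Measurable g) (hh : Measurable h) :
    StronglyMeasurable fun x => G (f x) (g x) (h x) :=
  hG.comp_measurable (hf.prodMk (hg.prodMk hh))

lemma integrable_genKer_comp {f g : ℝ × Φ → Φ} (hf : Measurable f) (hg : Measurable g) {C : ℝ}
    (h : ∀ p, p.1 ∈ 𝕋 → (1 + ‖f p‖) ^ d₃ * wt d₁ (f p - g p) ≤
      C * wt d₁ p.2) : Integrable (fun p => genKer a b p.1 (f p) (g p)) ν𝕋 := by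
  obtain ⟨B, hB, hB0, hle⟩ := D.exists_genKer_le d₁
  refine (hB.mul_prod ((integrable_wt_phase (n := n)).const_mul C)).mono' (smeas_comp
    (smeas_genKer D.symb_a D.symb_b) measurable_fst hf hg).aestronglyMeasurable ?_
  filter_upwards [ae_fst hle, ae_fst_mem] with p hp hp'
  exact (hp _ _).trans (mul_le_mul_of_nonneg_left (h p hp') (hB0 _))

lemma integrable_genKer : Integrable (fun p => genKer a b p.1 z p.2) ν𝕋 := by
  obtain ⟨C, -, hC⟩ := exists_wt_path_le (f := fun _ => z) continuous_const d₁
  refine D.integrable_genKer_comp (C := (1 + ‖z‖) ^ d₃ * C) measurable_const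
    measurable_snd fun p hp => ?_
  rw [mul_assoc]; gcongr; exact hC p.1 hp p.2

lemma integrable_genKer_flow :
    Integrable (fun p => genKer a b p.1 z (X p.1 p.2)) ν𝕋 := by
  obtain ⟨C, -, hC⟩ := D.exists_wt_flow_le d₁ z
  refine D.integrable_genKer_comp (C := (1 + ‖z‖) ^ d₃ * C) measurable_const
    D.flow.continuous.measurable fun p hp => ?_
  rw [mul_assoc]; gcongr; exact hC p.1 hp p.2

lemma integrable_genKer_path :
    Integrable (fun p => genKer a b p.1 (X p.1 z) p.2) ν𝕋 := by
  have hc := D.flow.cont_path z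
  obtain ⟨C, -, hC⟩ := exists_wt_path_le hc d₁
  obtain ⟨R, hR⟩ := isCompact_Icc.exists_bound_of_continuousOn (hc.continuousOn (s := 𝕋))
  refine D.integrable_genKer_comp (C := (1 + R) ^ d₃ * C)
    (hc.measurable.comp measurable_fst) measurable_snd fun p hp => ?_
  have hR0 := (norm_nonneg _).trans (hR p.1 hp)
  rw [mul_assoc]
  gcongr
  · exact wt_nonneg _ _
  · exact hR p.1 hp
  · exact hC p.1 hp p.2

end IsEvol

/-! ### Error kernels -/

/-- The error of the approximation at the right base point. -/
def errKer (a b : ℝ → Φ → ℝ) (τ : ℝ) (z w : Φ) : ℂ :=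
  genKer a b τ z w - cenKer a b τ z w

/-- The error of the approximation at the left base point. -/
def errKerL (a b : ℝ → Φ → ℝ) (τ : ℝ) (z w : Φ) : ℂ :=
  genKer a b τ z w - cenKerL a b τ z w

section Kernels

variable {τ : ℝ}

lemma errKer_eq (ha : IsAdm d₃ (a τ)) (hb : IsAdm d₃ (b τ)) (z w : Φ) :
    errKer a b τ z w = -I * symKer (taylorRem (a τ) w) z w + symKer (incRem (b τ) w) z w := by
  rw [ha.symKer_taylorRem, hb.symKer_incRem, errKer, genKer, cenKer]
  ring

lemma errKerL_eq (ha : IsAdm d₃ (a τ)) (hb : IsAdm d₃ (b τ)) (z w : Φ) :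
    errKerL a b τ z w =
      -I * symKer (taylorRem (a τ) z) z w + symKer (incRem (b τ) z) z w := by
  rw [← conj_symKer _ w z, ha.symKer_taylorRem, hb.symKer_incRem, errKerL, genKer, cenKerL, map_sub,
    conj_symKer]
  ring

lemma integrable_repKer_mul_symKer (hq : IsAdm d₃ q) (z u : Φ) :
    Integrable fun w => repKer z w * symKer q w u := by
  obtain ⟨C, hC0, hC⟩ := exists_repKer_le n (2 * n + 3 + d₁)
  obtain ⟨C', hC'0, hC'⟩ := exists_symKer_le n 0 d₃
  have hB := hq.ne_top (0 + d₃)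
  have hm : StronglyMeasurable fun w => symKer q w u := by
    have := smeas_symKer (q := fun _ => q) (hq.smooth.continuous.comp continuous_snd)
    exact this.comp_measurable (g := fun w => ((0 : ℝ), w, u)) (by fun_prop)
  set B := (symSize (0 + d₃) d₃ q 0).toReal with hBdef
  have hint := (integrable_wt_phase_sub z).const_mul (C * (C' * B) * (1 + ‖z‖) ^ d₃)
  refine hint.mono' ((cont_repKer_comp continuous_const continuous_id).aestronglyMeasurable.mul
    hm.aestronglyMeasurable) (.of_forall fun w => ?_)
  have h1 := hC' q B hq.smooth toReal_nonneg (ofReal_toReal hB).ge w u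
  have h2 : (1 + ‖w‖) ^ d₃ ≤ ((1 + ‖z‖) * (1 + ‖z - w‖)) ^ d₃ := by
    gcongr; have := norm_sub_le z (z - w); rw [sub_sub_cancel] at this
    nlinarith [norm_nonneg z, norm_nonneg (z - w), mul_nonneg (norm_nonneg z) (norm_nonneg (z - w))]
  rw [norm_mul]
  calc ‖repKer z w‖ * ‖symKer q w u‖
      ≤ (C * wt (2 * n + 3 + d₁) (z - w)) *
        (C' * B * (((1 + ‖z‖) * (1 + ‖z - w‖)) ^ d₃ * 1)) := by
        refine mul_le_mul (hC z w) (h1.trans ?_) (norm_nonneg _) (mul_nonneg hC0 (wt_nonneg _ _))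
        have := wt_le_one 0 (w - u); gcongr; exact wt_nonneg _ _
    _ = C * (C' * B) * (1 + ‖z‖) ^ d₃ * wt d₁ (z - w) *
          (wt d₃ (z - w) * (1 + ‖z - w‖) ^ d₃) := by
        rw [wt_add, mul_pow]; ring
    _ = _ := by rw [wt_mul_pow, mul_one]

lemma integral_repKer_mul_errKer (ha : IsAdm d₃ (a τ)) (hb : IsAdm d₃ (b τ))
    (z w : Φ) : ∫ u, repKer z u * errKer a b τ u w = errKer a b τ z w := by
  simp only [errKer_eq ha hb, mul_add, mul_left_comm (repKer z _)]
  rw [integral_add ((integrable_repKer_mul_symKer (ha.taylorRem w) z w).const_mul _)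
    (integrable_repKer_mul_symKer (hb.incRem w) z w), integral_const_mul,
    (ha.taylorRem w).integral_repKer_mul_symKer, (hb.incRem w).integral_repKer_mul_symKer]

lemma integral_repKer_mul_genKer (ha : IsAdm d₃ (a τ)) (hb : IsAdm d₃ (b τ))
    (z w : Φ) : ∫ u, repKer z u * genKer a b τ u w = genKer a b τ z w := by
  simp only [genKer, mul_add, mul_left_comm (repKer z _)]
  rw [integral_add ((integrable_repKer_mul_symKer ha z w).const_mul _)
    (integrable_repKer_mul_symKer hb z w), integral_const_mul,
    ha.integral_repKer_mul_symKer, hb.integral_repKer_mul_symKer]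

lemma integrable_symKer_mul_repKer (hq : IsAdm d₃ q) (z u : Φ) :
    Integrable fun w => symKer q z w * repKer w u := by
  have h := integrable_repKer_mul_symKer hq u z
  have h2 := Complex.conjCLE.toContinuousLinearMap.integrable_comp h
  refine h2.congr (.of_forall fun w => ?_)
  change conj (repKer u w * symKer q w z) = _
  rw [map_mul, conj_repKer, conj_symKer, mul_comm]

lemma integral_genKer_mul_repKer (ha : IsAdm d₃ (a τ)) (hb : IsAdm d₃ (b τ))
    (z w : Φ) : ∫ u, genKer a b τ z u * repKer u w = genKer a b τ z w := by
  simp only [genKer, add_mul, mul_assoc]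
  rw [integral_add ((integrable_symKer_mul_repKer ha z w).const_mul _)
    (integrable_symKer_mul_repKer hb z w), integral_const_mul,
    ha.integral_symKer_mul_repKer, hb.integral_symKer_mul_repKer]

end Kernels

/-! ### A product rule -/

lemma mul_primitive_sub_eq_integral {π π' k : ℝ → ℂ} {s t : ℝ} (hst : s ≤ t)
    (hπ : ∀ τ ∈ Icc s t, HasDerivWithinAt π (π' τ) (Icc s t) τ) (hπ' : ContinuousOn π' (Icc s t))
    (hk : IntervalIntegrable k volume s t) (c : ℂ) :
    π t * (c + ∫ τ in s..t, k τ) - π s * c =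
      ∫ τ in s..t, (π' τ * (c + ∫ σ in s..τ, k σ) + π τ * k τ) := by
  have hπc : ContinuousOn π (Icc s t) := fun τ hτ => (hπ τ hτ).continuousWithinAt
  have hftc : ∀ σ ∈ Icc s t, ∫ τ in σ..t, π' τ = π t - π σ := fun σ hσ => by
    refine intervalIntegral.integral_eq_sub_of_hasDeriv_right_of_le hσ.2
      (hπc.mono (Icc_subset_Icc hσ.1 le_rfl)) (fun x hx => ?_) ?_
    · have hx' : x ∈ Icc s t := ⟨hσ.1.trans hx.1.le, hx.2.le⟩
      exact ((hπ x hx').mono_of_mem_nhdsWithin (Icc_mem_nhdsGT_of_mem ⟨hx'.1, hx.2⟩))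
    · exact (hπ'.mono (Icc_subset_Icc hσ.1 le_rfl)).intervalIntegrable_of_Icc hσ.2
  have hk' : IntegrableOn k (Ioc s t) := (intervalIntegrable_iff_integrableOn_Ioc_of_le hst).1 hk
  have hπi : IntegrableOn π' (Ioc s t) :=
    (intervalIntegrable_iff_integrableOn_Ioc_of_le hst).1 (hπ'.intervalIntegrable_of_Icc hst)
  have hmeas : MeasurableSet {p : ℝ × ℝ | p.2 ≤ p.1} := measurableSet_le measurable_snd measurable_fst
  have hJ : Integrable (fun p => {p : ℝ × ℝ | p.2 ≤ p.1}.indicator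
      (fun p => π' p.1 * k p.2) p) ((volume.restrict (Ioc s t)).prod (volume.restrict (Ioc s t))) :=
    (hπi.mul_prod hk').indicator hmeas
  have hswap := integral_integral_swap (f := fun τ σ => {p : ℝ × ℝ | p.2 ≤ p.1}.indicator
      (fun p => π' p.1 * k p.2) (τ, σ)) hJ
  have e1 : ∀ τ ∈ Ioc s t, ∫ σ in Ioc s t, {p : ℝ × ℝ | p.2 ≤ p.1}.indicator
      (fun p => π' p.1 * k p.2) (τ, σ) = π' τ * ∫ σ in s..τ, k σ := fun τ hτ => by
    have : ∀ σ, {p : ℝ × ℝ | p.2 ≤ p.1}.indicator (fun p => π' p.1 * k p.2) (τ, σ) =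
        (Iic τ).indicator (fun σ => π' τ * k σ) σ := fun σ => by
      simp only [indicator, mem_ofPred_eq, mem_Iic]
    simp only [this]
    rw [setIntegral_indicator measurableSet_Iic, Ioc_inter_Iic, min_eq_right hτ.2,
      integral_const_mul, integral_of_le hτ.1.le]
  have e2 : ∀ σ ∈ Ioc s t, ∫ τ in Ioc s t, {p : ℝ × ℝ | p.2 ≤ p.1}.indicator
      (fun p => π' p.1 * k p.2) (τ, σ) = (π t - π σ) * k σ := fun σ hσ => by
    have : ∀ τ, {p : ℝ × ℝ | p.2 ≤ p.1}.indicator (fun p => π' p.1 * k p.2) (τ, σ) =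
        (Ici σ).indicator (fun τ => π' τ * k σ) τ := fun τ => by
      simp only [indicator, mem_ofPred_eq, mem_Ici]
    simp only [this]; have hset : Ioc s t ∩ Ici σ = Icc σ t := by grind
    rw [setIntegral_indicator measurableSet_Ici, hset, integral_mul_const, integral_Icc_eq_integral_Ioc,
      ← integral_of_le hσ.2, hftc σ ⟨hσ.1.le, hσ.2⟩]
  rw [setIntegral_congr_fun measurableSet_Ioc e1, setIntegral_congr_fun measurableSet_Ioc e2] at hswap
  have hπb : IntegrableOn (fun σ => π σ * k σ) (Ioc s t) := by
    obtain ⟨R, hR⟩ := isCompact_Icc.exists_bound_of_continuousOn hπc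
    refine hk'.bdd_mul (c := R)
      ((hπc.mono Ioc_subset_Icc_self).aestronglyMeasurable measurableSet_Ioc) ?_
    filter_upwards [ae_restrict_mem measurableSet_Ioc] with σ hσ
    exact hR σ (Ioc_subset_Icc_self hσ)
  have hP : IntegrableOn (fun τ => π' τ * ∫ σ in s..τ, k σ) (Ioc s t) := by
    refine Integrable.congr hJ.integral_prod_left ?_
    filter_upwards [ae_restrict_mem measurableSet_Ioc] with τ hτ; exact e1 τ hτ
  have hf0 := hftc s ⟨le_rfl, hst⟩
  rw [integral_of_le hst] at hf0
  simp only [mul_add]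
  rw [integral_of_le hst, integral_of_le hst,
    integral_add (f := fun τ => π' τ * c + π' τ * ∫ σ in s..τ, k σ) ((hπi.mul_const c).add hP) hπb,
    integral_add (hπi.mul_const c) hP, hswap, integral_mul_const, hf0]
  simp only [sub_mul]
  rw [integral_sub (hk'.const_mul _) hπb, integral_const_mul]
  ring

lemma mul_sub_mul_eq_integral {π π' h k : ℝ → ℂ} {s t : ℝ} (hst : s ≤ t)
    (hπ : ∀ τ ∈ Icc s t, HasDerivWithinAt π (π' τ) (Icc s t) τ) (hπ' : ContinuousOn π' (Icc s t))
    (hk : IntervalIntegrable k volume s t)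
    (hh : ∀ τ ∈ Icc s t, h τ = h s + ∫ σ in s..τ, k σ) :
    π t * h t - π s * h s = ∫ τ in s..t, (π' τ * h τ + π τ * k τ) := by
  rw [hh t ⟨hst, le_rfl⟩, mul_primitive_sub_eq_integral hst hπ hπ' hk]
  refine intervalIntegral.integral_congr fun τ hτ => ?_
  rw [uIcc_of_le hst] at hτ
  simp only [hh τ hτ]

/-! ### Coherent states moving along the flow -/

/-- The logarithmic derivative of the amplitude of a moving coherent state. -/
def expRate (a b : ℝ → Φ → ℝ) (t : ℝ) (v : Φ) : ℂ :=
  I * actionRate a t v + b t v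

/-- The logarithm of the amplitude of a moving coherent state. -/
def flowExp (a b : ℝ → Φ → ℝ) (X : ℝ → Φ → Φ) (t : ℝ) (z : Φ) :
    ℂ :=
  ∫ τ in (0 : ℝ)..t, expRate a b τ (X τ z)

lemma cont_expRate (ha : IsTimeSym a) (hb : IsTimeSym b) :
    Continuous fun p : ℝ × Φ => expRate a b p.1 p.2 := by
  have h1 : Continuous fun p : ℝ × Φ => hamField a p.1 p.2 := ha.isLipField.cont
  have h2 := ha.cont_uncurry
  have h3 := hb.cont_uncurry
  exact (continuous_const.mul (Complex.continuous_ofReal.comp (((continuous_snd.comp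
    continuous_snd).inner (continuous_fst.comp h1)).sub h2))).add (Complex.continuous_ofReal.comp h3)

namespace IsEvol

variable (D : IsEvol a b X Y L)
include D

lemma cont_expRate_flow : Continuous fun p : Φ × ℝ => expRate a b p.2 (X p.2 p.1) := by
  have := (cont_expRate D.symb_a D.symb_b).comp
    (continuous_snd.prodMk (D.cont_flow_comp continuous_snd continuous_fst))
  simpa only [comp_def] using this

lemma cont_flowExp : Continuous fun p : ℝ × Φ => flowExp a b X p.1 p.2 := by
  refine intervalIntegral.continuous_parametric_intervalIntegral_of_continuous
    (f := fun (p : ℝ × Φ) τ => expRate a b τ (X τ p.2)) ?_ continuous_fst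
  have := D.cont_expRate_flow.comp (f := fun p : (ℝ × Φ) × ℝ => (p.1.2, p.2)) (by fun_prop)
  fun_prop

lemma cont_flowExp_comp {α : Type*} [TopologicalSpace α] {f : α → ℝ} {g : α → Φ}
    (hf : Continuous f) (hg : Continuous g) : Continuous fun p => flowExp a b X (f p) (g p) := by
  have := D.cont_flowExp.comp (hf.prodMk hg)
  simpa only [comp_def] using this

lemma cont_expRate_path : Continuous fun τ => expRate a b τ (X τ z) := by
  have := D.cont_expRate_flow.comp (f := fun τ : ℝ => (z, τ)) (by fun_prop)
  simpa only [comp_def] using this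

lemma hasDerivAt_flowExp (t : ℝ) (z : Φ) :
    HasDerivAt (fun t => flowExp a b X t z) (expRate a b t (X t z)) t := by
  have hc := D.cont_expRate_path z
  exact intervalIntegral.integral_hasDerivAt_right (hc.intervalIntegrable _ _)
    (hc.stronglyMeasurableAtFilter _ _) hc.continuousAt

lemma flowExp_sub_re (s t : ℝ) (z : Φ) :
    (flowExp a b X t z - flowExp a b X s z).re = ∫ τ in s..t, b τ (X τ z) := by
  have hc := D.cont_expRate_path z
  rw [flowExp, flowExp, intervalIntegral.integral_interval_sub_left (hc.intervalIntegrable _ _)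
    (hc.intervalIntegrable _ _)]
  have := Complex.reCLM.intervalIntegral_comp_comm (hc.intervalIntegrable (μ := volume) s t)
  simp only [Complex.reCLM_apply] at this
  rw [← this]
  simp [expRate]

lemma hasDerivWithinAt_movingKer {t : ℝ} (ht : t ∈ 𝕋) :
    HasDerivWithinAt (fun τ => exp (flowExp a b X τ w) * repKer z (X τ w))
      (exp (flowExp a b X t w) * cenKer a b t z (X t w)) 𝕋 t := by
  have h1 := (D.hasDerivAt_flowExp t w).cexp.hasDerivWithinAt (s := 𝕋)
  have h2 := hasDerivWithinAt_repKer ((D.symb_a.smooth t).differentiable (by simp))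
    (D.flow.deriv w t ht) z
  refine (h1.mul h2).congr_deriv ?_
  rw [cenKer, expRate]
  ring

lemma hasDerivWithinAt_movingKerL {t : ℝ} (ht : t ∈ 𝕋) :
    HasDerivWithinAt (fun τ => exp (-flowExp a b X τ z) * repKer (X τ z) w)
      (-(exp (-flowExp a b X t z) * cenKerL a b t (X t z) w)) 𝕋 t := by
  have h1 := (D.hasDerivAt_flowExp t z).neg.cexp.hasDerivWithinAt (s := 𝕋)
  have h2 := (hasDerivWithinAt_repKer ((D.symb_a.smooth t).differentiable (by simp))
    (D.flow.deriv z t ht) w)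
  have h3 := Complex.conjCLE.toContinuousLinearMap.hasFDerivAt.comp_hasDerivWithinAt t h2
  have h4 : HasDerivWithinAt (fun τ => repKer (X τ z) w) (I * conj (linKer (a t) w (X t z)) +
        I * actionRate a t (X t z) * repKer (X t z) w) 𝕋 t := by
    refine (h3.congr_deriv ?_).congr (fun τ _ => ?_) ?_
    · change conj _ = _
      rw [map_sub, map_mul, map_mul, map_mul, map_neg, conj_I, conj_repKer, conj_ofReal]; ring
    · exact (conj_repKer _ _).symm
    · exact (conj_repKer _ _).symm
  refine (h1.mul h4).congr_deriv ?_
  rw [cenKerL, expRate, Pi.neg_apply]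
  ring

end IsEvol

/-! ### Volterra equations with small kernels -/

/-- A time dependent kernel `E` and an exponent `θ` whose increments have bounded exponentials. -/
structure IsVolterra {α : Type*} [MeasurableSpace α] (E : ℝ → α → α → ℂ) (θ : ℝ → α → ℂ)
    (A : ℝ) : Prop where
  meas_kernel : StronglyMeasurable fun p : ℝ × α × α => E p.1 p.2.1 p.2.2
  meas_exp : StronglyMeasurable fun p : ℝ × α => θ p.1 p.2
  growth : ∀ z, ∀ s t, 0 ≤ s → s ≤ t → t ≤ 1 → ‖exp (θ t z - θ s z)‖ ≤ A

/-- The integrand of the Volterra operator. -/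
def voltKer {α : Type*} (E : ℝ → α → α → ℂ) (θ : ℝ → α → ℂ) (s t : ℝ) (z : α)
    (f : ℝ → α → ℂ) (p : ℝ × α) : ℂ :=
  {p : ℝ × α | s < p.1 ∧ p.1 ≤ t}.indicator
    (fun p => exp (θ t z - θ p.1 z) * E p.1 z p.2 * f p.1 p.2) p

section Volterra

variable {α : Type*} [MeasurableSpace α] {μ : Measure α} [SFinite μ]
  {E : ℝ → α → α → ℂ} {θ : ℝ → α → ℂ} {A ρ B s t : ℝ} {g : α → ℝ} {f : ℝ → α → ℂ}

lemma IsVolterra.one_le (D : IsVolterra E θ A) (z : α) : 1 ≤ A := by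
  simpa using D.growth z 0 0 le_rfl le_rfl zero_le_one

lemma IsVolterra.smeas_kernel_comp (D : IsVolterra E θ A) {β : Type*}
    [MeasurableSpace β] {u : β → ℝ} {v w : β → α} (hu : Measurable u) (hv : Measurable v)
    (hw : Measurable w) : StronglyMeasurable fun x => E (u x) (v x) (w x) :=
  D.meas_kernel.comp_measurable (hu.prodMk (hv.prodMk hw))

lemma IsVolterra.smeas_exp_comp (D : IsVolterra E θ A) {β : Type*}
    [MeasurableSpace β] {u : β → ℝ} {v : β → α} (hu : Measurable u) (hv : Measurable v) :
    StronglyMeasurable fun x => θ (u x) (v x) :=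
  D.meas_exp.comp_measurable (hu.prodMk hv)

lemma IsVolterra.smeas_voltKer (D : IsVolterra E θ A) (s : ℝ)
    (hf : StronglyMeasurable fun p : ℝ × α => f p.1 p.2) :
    StronglyMeasurable fun q : (ℝ × α) × ℝ × α => voltKer E θ s q.1.1 q.1.2 f q.2 := by
  have h1 : StronglyMeasurable fun q : (ℝ × α) × ℝ × α => θ q.1.1 q.1.2 :=
    D.smeas_exp_comp (by fun_prop) (by fun_prop)
  have h2 : StronglyMeasurable fun q : (ℝ × α) × ℝ × α => θ q.2.1 q.1.2 :=
    D.smeas_exp_comp (by fun_prop) (by fun_prop)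
  have h3 : StronglyMeasurable fun q : (ℝ × α) × ℝ × α => E q.2.1 q.1.2 q.2.2 :=
    D.smeas_kernel_comp (by fun_prop) (by fun_prop) (by fun_prop)
  have h4 : StronglyMeasurable fun q : (ℝ × α) × ℝ × α => f q.2.1 q.2.2 :=
    hf.comp_measurable measurable_snd
  have m1 : Measurable fun q : (ℝ × α) × ℝ × α => q.2.1 := by fun_prop
  have m2 : Measurable fun q : (ℝ × α) × ℝ × α => q.1.1 := by fun_prop
  have hs : MeasurableSet {q : (ℝ × α) × ℝ × α | s < q.2.1 ∧ q.2.1 ≤ q.1.1} :=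
    (measurableSet_lt measurable_const m1).inter (measurableSet_le m1 m2)
  exact (((Complex.continuous_exp.comp_stronglyMeasurable (h1.sub h2)).mul h3).mul h4).indicator hs

lemma IsVolterra.enorm_voltKer_le (D : IsVolterra E θ A) (hs : 0 ≤ s) (ht : t ≤ 1)
    (hB : 0 ≤ B) (hf : ∀ τ ∈ Icc s t, ∀ w, ‖f τ w‖ ≤ B * g w) (z : α) (p : ℝ × α) :
    ‖voltKer E θ s t z f p‖ₑ ≤ ofReal (A * B) * (‖E p.1 z p.2‖ₑ * ofReal (g p.2)) := by
  have hA := D.one_le z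
  by_cases hp : s < p.1 ∧ p.1 ≤ t
  · rw [voltKer, indicator_of_mem (by exact hp), enorm_mul, enorm_mul,
      ofReal_mul (by linarith)]
    have h1 : ‖exp (θ t z - θ p.1 z)‖ₑ ≤ ofReal A := by
      rw [← ofReal_norm]; exact ofReal_le_ofReal (D.growth z p.1 t (hs.trans hp.1.le) hp.2 ht)
    have h2 : ‖f p.1 p.2‖ₑ ≤ ofReal B * ofReal (g p.2) := by
      rw [← ofReal_norm, ← ofReal_mul hB]; exact ofReal_le_ofReal (hf p.1 ⟨hp.1.le, hp.2⟩ p.2)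
    calc _ ≤ ofReal A * ‖E p.1 z p.2‖ₑ * (ofReal B * ofReal (g p.2)) := by
          gcongr
      _ = _ := by ring
  · rw [voltKer, indicator_of_notMem (by exact hp)]; simp

omit [SFinite μ] in
lemma IsVolterra.lintegral_voltKer_le (D : IsVolterra E θ A) (hs : 0 ≤ s) (ht : t ≤ 1)
    (hB : 0 ≤ B) (z : α)
    (hE : ∫⁻ p, ‖E p.1 z p.2‖ₑ * ofReal (g p.2) ∂(μ𝕋).prod μ ≤
      ofReal (ρ * g z))
    (hf : ∀ τ ∈ Icc s t, ∀ w, ‖f τ w‖ ≤ B * g w) :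
    ∫⁻ p, ‖voltKer E θ s t z f p‖ₑ ∂(μ𝕋).prod μ ≤
      ofReal (A * ρ * (B * g z)) := by
  have hA := D.one_le z
  refine (lintegral_mono (D.enorm_voltKer_le hs ht hB hf z)).trans ?_
  rw [lintegral_const_mul' _ _ ofReal_ne_top]
  refine (mul_le_mul_right hE _).trans ?_
  rw [← ofReal_mul (by positivity)]
  exact le_of_eq (by ring)

omit [SFinite μ] in
lemma IsVolterra.integrable_voltKer (D : IsVolterra E θ A) (hs : 0 ≤ s) (ht : t ≤ 1)
    (hB : 0 ≤ B) (z : α)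
    (hE : ∫⁻ p, ‖E p.1 z p.2‖ₑ * ofReal (g p.2) ∂(μ𝕋).prod μ ≤
      ofReal (ρ * g z))
    (hfm : StronglyMeasurable fun p : ℝ × α => f p.1 p.2)
    (hf : ∀ τ ∈ Icc s t, ∀ w, ‖f τ w‖ ≤ B * g w) :
    Integrable (voltKer E θ s t z f) ((μ𝕋).prod μ) :=
  ⟨((D.smeas_voltKer s hfm).comp_measurable
    (measurable_const.prodMk measurable_id : Measurable fun p : ℝ × α => ((t, z), p))).aestronglyMeasurable,
    (D.lintegral_voltKer_le hs ht hB z hE hf).trans_lt ENNReal.ofReal_lt_top⟩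

omit [SFinite μ] in
lemma IsVolterra.norm_integral_voltKer_le (D : IsVolterra E θ A) (hs : 0 ≤ s) (ht : t ≤ 1)
    (hB : 0 ≤ B) (hρ : 0 ≤ ρ) (z : α) (hg : 0 ≤ g z)
    (hE : ∫⁻ p, ‖E p.1 z p.2‖ₑ * ofReal (g p.2) ∂(μ𝕋).prod μ ≤
      ofReal (ρ * g z))
    (hf : ∀ τ ∈ Icc s t, ∀ w, ‖f τ w‖ ≤ B * g w) :
    ‖∫ p, voltKer E θ s t z f p ∂(μ𝕋).prod μ‖ ≤
      A * ρ * (B * g z) := by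
  have hA := D.one_le z
  have := (enorm_integral_le_lintegral_enorm _).trans (D.lintegral_voltKer_le hs ht hB z hE hf)
  rw [← ofReal_norm] at this
  exact (ofReal_le_ofReal_iff (by positivity)).1 this

lemma integral_voltKer_eq (hs : 0 ≤ s) (hst : s ≤ t) (ht : t ≤ 1) (z : α)
    (hint : Integrable (voltKer E θ s t z f) ((μ𝕋).prod μ)) :
    IntervalIntegrable (fun τ => exp (θ t z - θ τ z) * ∫ w, E τ z w * f τ w ∂μ) volume s t ∧
    ∫ p, voltKer E θ s t z f p ∂(μ𝕋).prod μ =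
      ∫ τ in s..t, exp (θ t z - θ τ z) * ∫ w, E τ z w * f τ w ∂μ := by
  have e : ∀ τ, ∫ w, voltKer E θ s t z f (τ, w) ∂μ = (Ioc s t).indicator
      (fun τ => exp (θ t z - θ τ z) * ∫ w, E τ z w * f τ w ∂μ) τ := fun τ => by
    by_cases hτ : τ ∈ Ioc s t
    · rw [indicator_of_mem hτ, ← integral_const_mul]; refine integral_ext fun w => ?_
      simp only [voltKer]; rw [indicator_of_mem (by exact hτ), mul_assoc]
    · rw [indicator_of_notMem hτ]; refine (integral_ext (fun w => ?_)).trans (integral_zero _ _)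
      simp only [voltKer]; rw [indicator_of_notMem (by exact hτ)]
  have hsub : 𝕋 ∩ Ioc s t = Ioc s t :=
    inter_eq_right.2 fun τ hτ => ⟨hs.trans hτ.1.le, hτ.2.trans ht⟩
  constructor
  · have h := hint.integral_prod_left; simp only [e] at h
    rw [integrable_indicator_iff measurableSet_Ioc, IntegrableOn,
      Measure.restrict_restrict measurableSet_Ioc, inter_comm, hsub] at h
    exact (intervalIntegrable_iff_integrableOn_Ioc_of_le hst).2 h
  · rw [integral_prod _ hint]; simp only [e]
    rw [setIntegral_indicator measurableSet_Ioc, hsub, integral_of_le hst]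

/-- The iterates of the Volterra operator. -/
def voltIter (μ : Measure α) (E : ℝ → α → α → ℂ) (θ : ℝ → α → ℂ) (s : ℝ) (φ : α → ℂ) :
    ℕ → ℝ → α → ℂ
  | 0 => fun t z => (Icc s 1).indicator (fun t => exp (θ t z - θ s z) * φ z) t
  | k + 1 => fun t z => (Icc s 1).indicator (fun t =>
      ∫ p, voltKer E θ s t z (voltIter μ E θ s φ k) p ∂(μ𝕋).prod μ) t

lemma IsVolterra.smeas_voltIter (D : IsVolterra E θ A) (s : ℝ) {φ : α → ℂ}
    (hφ : StronglyMeasurable φ) (k : ℕ) :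
    StronglyMeasurable fun p : ℝ × α => voltIter μ E θ s φ k p.1 p.2 := by
  have hI : MeasurableSet {p : ℝ × α | p.1 ∈ Icc s 1} := measurableSet_Icc.preimage measurable_fst
  induction k with
  | zero =>
    have h1 : StronglyMeasurable fun p : ℝ × α => θ s p.2 :=
      D.smeas_exp_comp measurable_const measurable_snd
    exact ((Complex.continuous_exp.comp_stronglyMeasurable (D.meas_exp.sub h1)).mul
      (hφ.comp_measurable measurable_snd)).indicator hI
  | succ k ih =>
    have h := (D.smeas_voltKer s ih).integral_prod_right (ν := (μ𝕋).prod μ)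
      (f := fun (q : ℝ × α) p => voltKer E θ s q.1 q.2 (voltIter μ E θ s φ k) p)
    exact h.indicator hI

omit [SFinite μ] in
lemma IsVolterra.norm_voltIter_le (D : IsVolterra E θ A) (hs : 0 ≤ s) {φ : α → ℂ}
    (hρ : 0 ≤ ρ) (hAρ : A * ρ ≤ 1 / 2) (hg : ∀ z, 0 ≤ g z)
    (hE : ∀ z, ∫⁻ p, ‖E p.1 z p.2‖ₑ * ofReal (g p.2)
      ∂(μ𝕋).prod μ ≤ ofReal (ρ * g z))
    (hφ : ∀ z, ‖φ z‖ ≤ g z) (k : ℕ) (t : ℝ) (z : α) :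
    ‖voltIter μ E θ s φ k t z‖ ≤ A * (1 / 2) ^ k * g z := by
  have hA := D.one_le z
  induction k generalizing t z with
  | zero =>
    have hgz := hg z; rw [voltIter]
    dsimp only
    by_cases ht : t ∈ Icc s 1
    · rw [indicator_of_mem ht, norm_mul, pow_zero, mul_one]
      exact mul_le_mul (D.growth z s t hs ht.1 ht.2) (hφ z) (norm_nonneg _) (by linarith)
    · rw [indicator_of_notMem ht, norm_zero]; positivity
  | succ k ih =>
    have hgz := hg z; rw [voltIter]
    dsimp only
    by_cases ht : t ∈ Icc s 1
    · rw [indicator_of_mem ht]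
      refine (D.norm_integral_voltKer_le hs ht.2 (by positivity) hρ z (hg z) (hE z)
        (fun τ _ w => ih τ w)).trans ?_
      calc A * ρ * (A * (1 / 2) ^ k * g z) ≤ 1 / 2 * (A * (1 / 2) ^ k * g z) := by gcongr
        _ = _ := by ring
    · rw [indicator_of_notMem ht, norm_zero]; positivity

lemma IsVolterra.exists_solution (D : IsVolterra E θ A) (hs : 0 ≤ s) {φ : α → ℂ}
    (hφm : StronglyMeasurable φ)
    (hρ : 0 ≤ ρ) (hAρ : A * ρ ≤ 1 / 2) (hg : ∀ z, 0 ≤ g z)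
    (hE : ∀ z, ∫⁻ p, ‖E p.1 z p.2‖ₑ * ofReal (g p.2)
      ∂(μ𝕋).prod μ ≤ ofReal (ρ * g z))
    (hφ : ∀ z, ‖φ z‖ ≤ g z) :
    ∃ f : ℝ → α → ℂ, (StronglyMeasurable fun p : ℝ × α => f p.1 p.2) ∧
      (∀ t z, ‖f t z‖ ≤ 2 * A * g z) ∧
      ∀ t ∈ Icc s 1, ∀ z,
        f t z = exp (θ t z - θ s z) * φ z +
          ∫ p, voltKer E θ s t z f p ∂(μ𝕋).prod μ := by
  have hb := D.norm_voltIter_le hs hρ hAρ hg hE hφ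
  set F := voltIter μ E θ s φ with hF
  have hgeo : ∀ z, HasSum (fun k => A * (1 / 2 : ℝ) ^ k * g z) (2 * A * g z) := fun z => by
    have := (hasSum_geometric_two.mul_left A).mul_right (g z)
    rwa [mul_comm A 2] at this
  have hsum : ∀ t z, Summable fun k => F k t z := fun t z =>
    Summable.of_norm_bounded (hgeo z).summable fun k => hb k t z
  have hmS : ∀ N : ℕ, StronglyMeasurable fun p : ℝ × α => ∑ k ∈ Finset.range N, F k p.1 p.2 := fun N =>
    Finset.stronglyMeasurable_fun_sum _ fun k _ => D.smeas_voltIter s hφm k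
  set f : ℝ → α → ℂ := fun t z => ∑' k, F k t z with hfdef
  have hfm : StronglyMeasurable fun p : ℝ × α => f p.1 p.2 := by
    refine stronglyMeasurable_of_tendsto (u := atTop) hmS ?_; rw [tendsto_pi_nhds]
    exact fun p => (hsum p.1 p.2).hasSum.tendsto_sum_nat
  have hfb : ∀ t z, ‖f t z‖ ≤ 2 * A * g z := fun t z =>
    tsum_of_norm_bounded (hgeo z) fun k => hb k t z
  refine ⟨f, hfm, hfb, fun t ht z => ?_⟩
  have hA := D.one_le z
  have htail : ∀ N, ∀ τ w, ‖f τ w - ∑ k ∈ Finset.range N, F k τ w‖ ≤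
      2 * A * (1 / 2) ^ N * g w := fun N τ w => by
    rw [hfdef]; simp only; rw [← (hsum τ w).sum_add_tsum_nat_add N, add_sub_cancel_left]
    refine tsum_of_norm_bounded (g := fun k => A * (1 / 2 : ℝ) ^ (k + N) * g w) ?_
      fun k => hb (k + N) τ w
    have := (hgeo w).mul_left ((1 / 2 : ℝ) ^ N)
    rw [show 2 * A * (1 / 2) ^ N * g w = (1 / 2) ^ N * (2 * A * g w) by ring]; grind
  have hIf := D.integrable_voltKer hs ht.2 (by positivity) z (hE z) hfm (fun τ _ w => hfb τ w)
  have hIF : ∀ k, Integrable (voltKer E θ s t z (F k)) ((μ𝕋).prod μ) :=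
    fun k => D.integrable_voltKer hs ht.2 (by positivity) z (hE z)
      (D.smeas_voltIter s hφm k) (fun τ _ w => hb k τ w)
  have hsplit : ∀ N, ∫ p, voltKer E θ s t z f p ∂(μ𝕋).prod μ =
      (∑ k ∈ Finset.range N, F (k + 1) t z) +
      ∫ p, voltKer E θ s t z (fun τ w => f τ w - ∑ k ∈ Finset.range N, F k τ w) p
        ∂(μ𝕋).prod μ := fun N => by
    have e1 : ∀ k, F (k + 1) t z =
        ∫ p, voltKer E θ s t z (F k) p ∂(μ𝕋).prod μ := fun k => by
      rw [hF, voltIter]; exact indicator_of_mem ht _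
    simp only [e1]; rw [← integral_finsetSum _ fun k _ => hIF k]
    have e2 : ∀ p, voltKer E θ s t z (fun τ w => f τ w - ∑ k ∈ Finset.range N, F k τ w) p =
        voltKer E θ s t z f p - ∑ k ∈ Finset.range N, voltKer E θ s t z (F k) p := fun p => by
      simp only [voltKer, indicator]; split_ifs
      · rw [mul_sub, mul_sum]
      · simp
    simp only [e2]; rw [integral_sub hIf (integrable_finsetSum _ fun k _ => hIF k), add_sub_cancel]
  have hle : ∀ N, ‖f t z - (exp (θ t z - θ s z) * φ z +
      ∫ p, voltKer E θ s t z f p ∂(μ𝕋).prod μ)‖ ≤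
      (1 / 2) ^ N * (4 * A * g z) := fun N => by
    have e0 : F 0 t z = exp (θ t z - θ s z) * φ z := by
      rw [hF, voltIter]; exact indicator_of_mem ht _
    have e3 : f t z - (exp (θ t z - θ s z) * φ z +
        ∫ p, voltKer E θ s t z f p ∂(μ𝕋).prod μ) =
        (f t z - ∑ k ∈ Finset.range (N + 1), F k t z) -
        ∫ p, voltKer E θ s t z (fun τ w => f τ w - ∑ k ∈ Finset.range N, F k τ w) p
        ∂(μ𝕋).prod μ := by
      rw [hsplit N, Finset.sum_range_succ', e0]; ring
    rw [e3]; refine (norm_sub_le _ _).trans ?_; have h1 := htail (N + 1) t z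
    have h2 := D.norm_integral_voltKer_le (f := fun τ w => f τ w - ∑ k ∈ Finset.range N, F k τ w)
      hs ht.2 (by positivity) hρ z (hg z) (hE z) (fun τ _ w => htail N τ w)
    rw [pow_succ] at h1
    have h4 : 0 ≤ A * (1 / 2) ^ N * g z := by
      have := hg z; positivity
    nlinarith
  have hlim : Tendsto (fun N => (1 / 2 : ℝ) ^ N * (4 * A * g z)) atTop (nhds 0) := by
    have := (tendsto_pow_atTop_nhds_zero_of_lt_one (r := (1 / 2 : ℝ)) (by norm_num)
      (by norm_num)).mul_const (4 * A * g z)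
    rwa [zero_mul] at this
  exact sub_eq_zero.1 (norm_le_zero_iff.1 (ge_of_tendsto' hlim hle))

omit [SFinite μ] in
/-- A bounded solution of the homogeneous Volterra equation vanishes. -/
lemma IsVolterra.eq_zero (D : IsVolterra E θ A) (hs : 0 ≤ s) {T : ℝ} (hT : T ≤ 1)
    (hρ : 0 ≤ ρ) (hAρ : A * ρ ≤ 1 / 2)
    (hE : ∀ z, ∫⁻ p, ‖E p.1 z p.2‖ₑ ∂(μ𝕋).prod μ ≤ ofReal ρ)
    (hB : 0 ≤ B) (hf : ∀ t ∈ Icc s T, ∀ z, ‖f t z‖ ≤ B)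
    (heq : ∀ t ∈ Icc s T, ∀ z, f t z =
      ∫ p, voltKer E θ s t z f p ∂(μ𝕋).prod μ) :
    ∀ t ∈ Icc s T, ∀ z, f t z = 0 := by
  have hk : ∀ k, ∀ t ∈ Icc s T, ∀ z, ‖f t z‖ ≤ (1 / 2) ^ k * B := fun k => by
    induction k with
    | zero => simpa using hf
    | succ k ih =>
      intro t ht z; rw [heq t ht z]
      refine (D.norm_integral_voltKer_le (g := fun _ => 1) (B := (1 / 2) ^ k * B) hs (ht.2.trans hT)
        (by positivity) hρ z zero_le_one (by simpa using hE z) (fun τ hτ w => ?_)).trans ?_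
      · grind
      · calc A * ρ * ((1 / 2) ^ k * B * 1) ≤ 1 / 2 * ((1 / 2) ^ k * B * 1) := by gcongr
          _ = _ := by ring
  intro t ht z
  have hlim : Tendsto (fun N => (1 / 2 : ℝ) ^ N * B) atTop (nhds 0) := by
    have := (tendsto_pow_atTop_nhds_zero_of_lt_one (r := (1 / 2 : ℝ)) (by norm_num)
      (by norm_num)).mul_const B
    rwa [zero_mul] at this
  exact norm_le_zero_iff.1 (ge_of_tendsto' hlim fun k => hk k t ht z)

end Volterra

/-! ### Weak solutions in phase space -/

lemma bargmann_linear {f g : Pos n → ℂ} (hf : MemLp f 2) (hg : MemLp g 2) (c : ℂ) (z : Φ) :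
    bargmann (fun x => c * f x + g x) z = c * bargmann f z + bargmann g z := by
  have h1 := bargmann_integrable hf z
  have h2 := bargmann_integrable hg z
  unfold bargmann
  rw [mul_left_comm, ← mul_add, ← integral_const_mul c, ← integral_add (h1.const_mul c) h2]
  congr 2
  funext y
  ring

lemma cont_bargmann_comp {α : Type*} [TopologicalSpace α] {u : α → L2Pos n} {g : α → Φ}
    (hu : Continuous u) (hg : Continuous g) : Continuous fun x => bargmann (u x) (g x) := by
  simp only [bargmann_eq_inner]
  exact (cont_cohL2.comp hg).inner hu

lemma integral_wt_sub (K : ℕ) (z : Φ) : ∫ w, wt K (z - w) = ∫ w : Φ, wt K w := by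
  simp only [wt_sub_comm K z]
  exact integral_sub_right_eq_self (fun w => wt K w) z

lemma integrable_wt_mul_wt_sub : Integrable
    (fun p : Φ × Φ => wt d₁ p.1 * wt d₁ (p.1 - p.2))
    (volume.prod volume) := by
  have hc : Continuous fun p : Φ × Φ => wt d₁ p.1 * wt d₁ (p.1 - p.2) :=
    ((cont_wt _).comp continuous_fst).mul ((cont_wt _).comp
      (continuous_fst.sub continuous_snd))
  rw [integrable_prod_iff hc.aestronglyMeasurable]
  refine ⟨Filter.Eventually.of_forall fun w => (integrable_wt_phase_sub w).const_mul (wt d₁ w), ?_⟩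
  have e : ∀ w : Φ, ∫ z, ‖wt d₁ w * wt d₁ (w - z)‖ =
      wt d₁ w * ∫ z : Φ, wt d₁ z := fun w => by
    rw [← integral_wt_sub _ w,
      ← integral_const_mul]
    refine integral_ext fun z => ?_
    exact norm_of_nonneg (mul_nonneg (wt_nonneg _ _) (wt_nonneg _ _))
  simp only [e]
  exact integrable_wt_phase.mul_const _

section Pairing

variable {τ : ℝ}

lemma conj_genKer :
    conj (genKer a b τ z w) = I * symKer (a τ) w z + symKer (b τ) w z := by
  rw [genKer, map_add, map_mul, map_neg, conj_I, conj_symKer, conj_symKer, neg_neg]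

lemma memLp_adjGen (ha : IsAdm d₃ (a τ)) (hb : IsAdm d₃ (b τ))
    (φ : 𝓢(Pos n, ℂ)) : MemLp (adjGen a b τ φ) 2 volume :=
  ((ha.memLp_weyl_and_bargmann φ).1.const_mul I).add (hb.memLp_weyl_and_bargmann φ).1

lemma bargmann_adjGen (ha : IsAdm d₃ (a τ)) (hb : IsAdm d₃ (b τ))
    (φ : 𝓢(Pos n, ℂ)) (z : Φ) :
    bargmann (adjGen a b τ φ) z =
      I * bargmann (weyl (a τ) φ) z + bargmann (weyl (b τ) φ) z :=
  bargmann_linear (ha.memLp_weyl_and_bargmann φ).1 (hb.memLp_weyl_and_bargmann φ).1 _ z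

lemma integral_conj_adjGen_coherent_mul (ha : IsAdm d₃ (a τ))
    (hb : IsAdm d₃ (b τ)) (z : Φ) (v : L2Pos n) :
    ∫ x, conj (adjGen a b τ (coherent z) x) * v x = ∫ w, genKer a b τ z w * bargmann v w := by
  rw [← integral_conj_bargmann_mul' (memLp_adjGen ha hb _) (Lp.memLp v)]
  refine integral_ext fun w => ?_
  rw [bargmann_adjGen ha hb, ha.bargmann_weyl_coherent, hb.bargmann_weyl_coherent, ← conj_genKer,
    Complex.conj_conj]

lemma integrable_symKer_mul_bargmann (hq : IsAdm d₃ q) (z : Φ)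
    (v : L2Pos n) : Integrable fun w => symKer q z w * bargmann v w := by
  obtain ⟨C', hC'0, hC'⟩ := exists_symKer_le n d₁ d₃
  have hB := hq.ne_top (2 * n + 1 + d₃)
  have hm : StronglyMeasurable fun w => symKer q z w := by
    have := smeas_symKer (q := fun _ => q) (hq.smooth.continuous.comp continuous_snd)
    exact this.comp_measurable (g := fun w => ((0 : ℝ), z, w)) (by fun_prop)
  set B := (symSize (2 * n + 1 + d₃) d₃ q 0).toReal with hBdef
  have hint := (integrable_wt_phase_sub z).const_mul (C' * B * (1 + ‖z‖) ^ d₃)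
  refine Integrable.mul_bdd (c := ‖v‖) (hint.mono' hm.aestronglyMeasurable
    (.of_forall fun w => ?_)) (cont_bargmann v).aestronglyMeasurable
    (.of_forall fun w => norm_bargmann_le v w)
  refine (hC' q B hq.smooth toReal_nonneg (ofReal_toReal hB).ge z w).trans (le_of_eq (by ring))

lemma integral_conj_adjGen_mul (ha : IsAdm d₃ (a τ)) (hb : IsAdm d₃ (b τ))
    (hm : StronglyMeasurable fun p : Φ × Φ => genKer a b τ p.1 p.2) {B : ℝ} (hB0 : 0 ≤ B)
    (hB : ∀ z w, ‖genKer a b τ z w‖ ≤ B * ((1 + ‖z‖) ^ d₃ * wt d₁ (z - w)))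
    (φ : 𝓢(Pos n, ℂ)) (v : L2Pos n) :
    ∫ x, conj (adjGen a b τ φ x) * v x =
      ∫ w, conj (bargmann φ w) * ∫ z, genKer a b τ w z * bargmann v z := by
  obtain ⟨C, hC0, hC⟩ := exists_bargmann_schwartz_le φ (2 * n + 1 + d₃)
  have hφc := cont_bargmann_schwartz φ
  have hint : Integrable (fun p : Φ × Φ =>
      conj (bargmann φ p.1) * (genKer a b τ p.1 p.2 * bargmann v p.2)) (volume.prod volume) := by
    refine ((integrable_wt_mul_wt_sub (n := n)).const_mul (C * B * ‖v‖)).mono'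
      ((((Complex.continuous_conj.comp hφc).comp continuous_fst).aestronglyMeasurable).mul
        (hm.aestronglyMeasurable.mul ((cont_bargmann v).comp
          continuous_snd).aestronglyMeasurable)) (.of_forall fun p => ?_)
    rw [norm_mul, norm_mul, RCLike.norm_conj]; have h1 := hC p.1; have h2 := hB p.1 p.2
    have h3 := norm_bargmann_le v p.2; have hw := wt_nonneg (2 * n + 1 + d₃) p.1
    have hw' := wt_nonneg d₁ (p.1 - p.2)
    calc _ ≤ C * wt (2 * n + 1 + d₃) p.1 *
          (B * ((1 + ‖p.1‖) ^ d₃ * wt d₁ (p.1 - p.2)) * ‖v‖) := by gcongr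
      _ = C * B * ‖v‖ * (wt d₁ p.1 * wt d₁ (p.1 - p.2)) *
          (wt d₃ p.1 * (1 + ‖p.1‖) ^ d₃) := by rw [wt_add]; ring
      _ = _ := by rw [wt_mul_pow, mul_one]
  have hswap := integral_integral_swap (f := fun w z =>
    conj (bargmann φ w) * (genKer a b τ w z * bargmann v z)) hint
  simp only [integral_const_mul] at hswap
  rw [hswap, ← integral_conj_bargmann_mul' (memLp_adjGen ha hb _) (Lp.memLp v)]
  refine integral_ext fun z => ?_
  have hφL := (memLp_schwartz φ).coeFn_toLp
  have i1 := integrable_symKer_mul_bargmann ha z ((memLp_schwartz φ).toLp φ)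
  have i2 := integrable_symKer_mul_bargmann hb z ((memLp_schwartz φ).toLp φ)
  rw [bargmann_congr hφL] at i1 i2
  rw [bargmann_adjGen ha hb, ha.bargmann_weyl, hb.bargmann_weyl, ← integral_const_mul,
    ← integral_add (i1.const_mul _) i2, ← integral_conj, ← integral_mul_const]
  refine integral_ext fun w => ?_
  rw [← mul_assoc, ← add_mul, ← conj_genKer, map_mul, Complex.conj_conj]
  ring

end Pairing

namespace IsEvol

variable (D : IsEvol a b X Y L)
include D

lemma bargmann_sub_eq_of_isWeakSolution {s T : ℝ} (hs : 0 ≤ s) (hT : T ≤ 1) {u : ℝ → L2Pos n}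
    (hu : IsWeakSolution a b s T u) {t : ℝ} (ht : t ∈ Icc s T) (z : Φ) :
    bargmann (u t) z - bargmann (u s) z =
      ∫ τ in s..t, ∫ w, genKer a b τ z w * bargmann (u τ) w := by
  have h := (hu.2 (coherent z)).2.2 t ht
  rw [bargmann_eq_integral, bargmann_eq_integral, h]
  refine intervalIntegral.integral_congr_ae ?_
  have hae := (ae_restrict_iff' measurableSet_Icc).1 D.ae_isAdm
  filter_upwards [hae] with τ hτ hτ'
  rw [uIoc_of_le ht.1] at hτ'
  obtain ⟨h1, h2⟩ := hτ ⟨hs.trans hτ'.1.le, hτ'.2.trans (ht.2.trans hT)⟩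
  exact integral_conj_adjGen_coherent_mul h1 h2 z (u τ)

lemma smeas_integral_genKer_mul_bargmann {u : ℝ → L2Pos n} (hu : Continuous u) :
    StronglyMeasurable fun p : ℝ × Φ => ∫ w, genKer a b p.1 p.2 w * bargmann (u p.1) w := by
  have h1 : StronglyMeasurable fun p : (ℝ × Φ) × Φ => genKer a b p.1.1 p.1.2 p.2 :=
    smeas_comp (smeas_genKer D.symb_a D.symb_b) (by fun_prop)
      (by fun_prop) (by fun_prop)
  have h2 : Continuous fun p : (ℝ × Φ) × Φ => bargmann (u p.1.1) p.2 :=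
    cont_bargmann_comp (hu.comp (by fun_prop)) continuous_snd
  exact (h1.mul h2.stronglyMeasurable).integral_prod_right
    (f := fun (p : ℝ × Φ) w => genKer a b p.1 p.2 w * bargmann (u p.1) w)

lemma isWeakSolution_of_bargmann_sub_eq {s T : ℝ} (hs : 0 ≤ s) (hsT : s ≤ T) (hT : T ≤ 1)
    {u : ℝ → L2Pos n} (huc : ContinuousOn u (Icc s T))
    (hu : ∀ t ∈ Icc s T, ∀ z, bargmann (u t) z - bargmann (u s) z =
      ∫ τ in s..t, ∫ w, genKer a b τ z w * bargmann (u τ) w) :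
    IsWeakSolution a b s T u := by
  obtain ⟨B, hB, hB0, hBle⟩ := D.exists_genKer_le d₁
  have hsub : Icc s T ⊆ 𝕋 := Icc_subset_Icc hs hT
  obtain ⟨R, hR⟩ := isCompact_Icc.exists_bound_of_continuousOn huc
  set u' : ℝ → L2Pos n := fun τ => u (projIcc s T hsT τ) with hu'
  have hu'c : Continuous u' := by
    have := continuousOn_iff_continuous_domRestrict.1 huc; exact this.comp continuous_projIcc
  have hu'eq : ∀ τ ∈ Icc s T, u' τ = u τ := fun τ hτ => by rw [hu']; simp only; rw [projIcc_of_mem hsT hτ]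
  have hu'b : ∀ τ, ‖u' τ‖ ≤ R := fun τ => hR _ (projIcc s T hsT τ).2
  have hGm := D.smeas_integral_genKer_mul_bargmann hu'c
  have hBle' : ∀ᵐ τ ∂volume.restrict (Icc s T), ∀ z w : Φ,
      ‖genKer a b τ z w‖ ≤ B τ * ((1 + ‖z‖) ^ d₃ * wt d₁ (z - w)) :=
    ae_mono (restrict_mono hsub le_rfl) hBle
  have hadm : ∀ᵐ τ ∂volume.restrict (Icc s T), IsAdm d₃ (a τ) ∧ IsAdm d₃ (b τ) :=
    ae_mono (restrict_mono hsub le_rfl) D.ae_isAdm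
  set I := ∫ v : Φ, wt d₁ v with hI
  have hGle : ∀ᵐ τ ∂volume.restrict (Icc s T), ∀ z : Φ,
      ‖∫ w, genKer a b τ z w * bargmann (u' τ) w‖ ≤ B τ * ((1 + ‖z‖) ^ d₃ * I * R) := by
    filter_upwards [hBle'] with τ hτ z
    have := norm_integral_le_of_norm_le (f := fun w => genKer a b τ z w * bargmann (u' τ) w)
      ((integrable_wt_phase_sub z).const_mul (B τ * (1 + ‖z‖) ^ d₃ * R))
      (.of_forall fun w => by
        rw [norm_mul]; have h1 := hτ z w; have h2 := (norm_bargmann_le (u' τ) w).trans (hu'b τ)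
        have h3 := hB0 τ; have h4 := wt_nonneg d₁ (z - w)
        calc _ ≤ B τ * ((1 + ‖z‖) ^ d₃ * wt d₁ (z - w)) * R := by gcongr
          _ = _ := by ring)
    refine this.trans (le_of_eq ?_); rw [integral_const_mul, integral_wt_sub]; ring
  refine ⟨huc, fun φ => ?_⟩
  obtain ⟨C, hC0, hC⟩ := exists_bargmann_schwartz_le φ (2 * n + 1 + d₃)
  have hφc := cont_bargmann_schwartz φ
  have hBi : Integrable B (volume.restrict (Icc s T)) := hB.mono_measure (restrict_mono hsub le_rfl)
  have hint : Integrable (fun p => conj (bargmann φ p.2) *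
      ∫ w, genKer a b p.1 p.2 w * bargmann (u' p.1) w) ((volume.restrict (Icc s T)).prod volume) := by
    refine (hBi.mul_prod ((integrable_wt_phase (n := n)).const_mul (C * I * R))).mono'
      ((Complex.continuous_conj.comp (hφc.comp continuous_snd)).aestronglyMeasurable.mul
        hGm.aestronglyMeasurable) ?_
    filter_upwards [ae_fst hGle] with p hp; rw [norm_mul, RCLike.norm_conj]
    have hw := wt_nonneg (2 * n + 1 + d₃) p.2
    calc _ ≤ C * wt (2 * n + 1 + d₃) p.2 * (B p.1 * ((1 + ‖p.2‖) ^ d₃ * I * R)) :=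
          mul_le_mul (hC p.2) (hp p.2) (norm_nonneg _) (by positivity)
      _ = B p.1 * (C * I * R * wt d₁ p.2) *
          (wt d₃ p.2 * (1 + ‖p.2‖) ^ d₃) := by rw [wt_add]; ring
      _ = _ := by rw [wt_mul_pow, mul_one]
  have hpair : ∀ᵐ τ ∂volume.restrict (Icc s T), ∫ w, conj (bargmann φ w) *
      ∫ z, genKer a b τ w z * bargmann (u' τ) z = ∫ x, conj (adjGen a b τ φ x) * u τ x := by
    filter_upwards [hBle', hadm, ae_restrict_mem measurableSet_Icc] with τ h1 h2 h3; rw [hu'eq τ h3]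
    refine (integral_conj_adjGen_mul h2.1 h2.2 ?_ (hB0 τ) h1 φ (u τ)).symm
    exact smeas_comp (smeas_genKer D.symb_a D.symb_b) measurable_const
      measurable_fst measurable_snd
  refine ⟨?_, ?_, fun t ht => ?_⟩
  · filter_upwards [hadm] with τ hτ; exact memLp_adjGen hτ.1 hτ.2 φ
  · rw [intervalIntegrable_iff_integrableOn_Icc_of_le hsT]
    exact hint.integral_prod_left.congr hpair
  · have hst : Icc s t ⊆ Icc s T := Icc_subset_Icc_right ht.2
    have hint' := hint.mono_measure (Measure.prod_mono (restrict_mono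
      (Ioc_subset_Icc_self.trans hst) le_rfl) le_rfl : (volume.restrict (Ioc s t)).prod volume ≤ _)
    have hpair' := ae_mono (restrict_mono (Ioc_subset_Icc_self.trans hst) le_rfl) hpair
    rw [← integral_conj_bargmann_mul' (memLp_schwartz φ) (Lp.memLp (u t)),
      ← integral_conj_bargmann_mul' (memLp_schwartz φ) (Lp.memLp (u s))]
    have hi : ∀ v : L2Pos n, Integrable fun z => conj (bargmann φ z) * bargmann v z := fun v =>
      (bargmann_memLp (memLp_schwartz φ)).star.integrable_mul (bargmann_memLp (Lp.memLp v))
    rw [← integral_sub (hi _) (hi _)]; simp only [← mul_sub, hu t ht]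
    rw [integral_of_le ht.1, ← integral_congr_ae hpair', integral_integral_swap (f := fun τ z => conj (bargmann φ z) *
      ∫ w, genKer a b τ z w * bargmann (u' τ) w) hint']
    refine integral_ext fun z => ?_; rw [integral_const_mul, integral_of_le ht.1]; congr 1
    refine setIntegral_congr_fun measurableSet_Ioc fun τ hτ => ?_; grind

end IsEvol

/-! ### Evolution equations with small error kernels -/

/-- The error kernel `errKer` in the moving frame. -/
def errFlow (a b : ℝ → Φ → ℝ) (X : ℝ → Φ → Φ) (τ : ℝ) (z w : Φ) : ℂ := errKer a b τ (X τ z) (X τ w)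

/-- The error kernel `errKerL` in the moving frame. -/
def errFlowL (a b : ℝ → Φ → ℝ) (X : ℝ → Φ → Φ) (τ : ℝ)
    (z w : Φ) : ℂ := errKerL a b τ (X τ z) (X τ w)

/-- A nonnegative function whose convolution with `wt K` is bounded by a multiple of itself. -/
structure IsWtMajorant (K : ℕ) (C : ℝ) (g : Φ → ℝ) : Prop where
  meas : Measurable g
  nonneg : ∀ z, 0 ≤ g z
  le : ∀ z, ∫⁻ w, ofReal (wt K (z - w)) * ofReal (g w) ≤ ofReal (C * g z)

/-- Evolution data for which the error kernels are small along the flow. -/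
structure IsSmallEvol (a b : ℝ → Φ → ℝ) (X Y : ℝ → Φ → Φ) (L : ℝ) (K : ℕ)
    (M δ C : ℝ) : Prop extends IsEvol a b X Y L where
  delta_nonneg : 0 ≤ δ
  const_nonneg : 0 ≤ C
  one_majorant : IsWtMajorant K C fun _ : Φ => 1
  small : ∀ z w, ∫⁻ τ in 𝕋, ‖errFlow a b X τ z w‖ₑ ≤ ofReal (δ * wt K (z - w))
  smallL : ∀ z w, ∫⁻ τ in 𝕋, ‖errFlowL a b X τ z w‖ₑ ≤ ofReal (δ * wt K (z - w))
  growth : ∀ z s t, 0 ≤ s → s ≤ t → t ≤ 1 → ∫ τ in s..t, b τ (X τ z) ≤ M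
  le_half : rexp M * (δ * C) ≤ 1 / 2

namespace IsEvol

variable (D : IsEvol a b X Y L)
include D

lemma smeas_errFlow :
    StronglyMeasurable fun p : ℝ × Φ × Φ => errFlow a b X p.1 p.2.1 p.2.2 := by
  have h1 : Continuous fun p : ℝ × Φ × Φ => X p.1 p.2.1 :=
    D.cont_flow_comp (by fun_prop) (by fun_prop)
  have h2 : Continuous fun p : ℝ × Φ × Φ => X p.1 p.2.2 :=
    D.cont_flow_comp (by fun_prop) (by fun_prop)
  exact (smeas_comp (smeas_genKer D.symb_a D.symb_b) measurable_fst
    h1.measurable h2.measurable).sub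
    (cont_cenKer_comp D.symb_a D.symb_b continuous_fst h1 h2).stronglyMeasurable

lemma smeas_errFlowL :
    StronglyMeasurable fun p : ℝ × Φ × Φ => errFlowL a b X p.1 p.2.1 p.2.2 := by
  have h1 : Continuous fun p : ℝ × Φ × Φ => X p.1 p.2.1 :=
    D.cont_flow_comp (by fun_prop) (by fun_prop)
  have h2 : Continuous fun p : ℝ × Φ × Φ => X p.1 p.2.2 :=
    D.cont_flow_comp (by fun_prop) (by fun_prop)
  exact (smeas_comp (smeas_genKer D.symb_a D.symb_b) measurable_fst
    h1.measurable h2.measurable).sub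
    (cont_cenKerL_comp D.symb_a D.symb_b continuous_fst h1 h2).stronglyMeasurable

lemma cont_flow_at (t : ℝ) : Continuous (X t) :=
  D.cont_flow_comp continuous_const continuous_id

lemma cont_inv_at (t : ℝ) : Continuous (Y t) :=
  D.cont_inv_comp continuous_const continuous_id

lemma measurableEmbedding_flow (t : ℝ) : MeasurableEmbedding (X t) :=
  (MeasurableEquiv.mk ⟨X t, Y t, D.flow.left_inv t, D.flow.right_inv t⟩
    (D.cont_flow_at t).measurable (D.cont_inv_at t).measurable).measurableEmbedding

lemma integral_comp_flow {t : ℝ} (ht : t ∈ 𝕋) (h : Φ → ℂ) :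
    ∫ w, h (X t w) = ∫ w, h w :=
  (D.flow.measurePreserving D.symb_a ht).integral_comp (D.measurableEmbedding_flow t) h

lemma exists_repKer_flow_le (m : ℕ) (z : Φ) : ∃ C, 0 ≤ C ∧
    ∀ τ ∈ 𝕋, ∀ w, ‖repKer z (X τ w)‖ ≤ C * wt m w := by
  obtain ⟨C, hC0, hC⟩ := exists_repKer_le n m
  obtain ⟨C', hC'0, hC'⟩ := D.exists_wt_flow_le m z
  refine ⟨C * C', by positivity, fun τ hτ w => (hC z _).trans ?_⟩
  rw [mul_assoc]
  exact mul_le_mul_of_nonneg_left (hC' τ hτ w) hC0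

lemma exists_repKer_path_le (m : ℕ) (z : Φ) : ∃ C, 0 ≤ C ∧
    ∀ τ ∈ 𝕋, ∀ w, ‖repKer (X τ z) w‖ ≤ C * wt m w := by
  obtain ⟨C, hC0, hC⟩ := exists_repKer_le n m
  obtain ⟨C', hC'0, hC'⟩ := exists_wt_path_le (D.flow.cont_path z) m
  refine ⟨C * C', by positivity, fun τ hτ w => (hC _ w).trans ?_⟩
  rw [mul_assoc]
  exact mul_le_mul_of_nonneg_left (hC' τ hτ w) hC0

end IsEvol

namespace IsSmallEvol

variable {M δ C : ℝ} (D : IsSmallEvol a b X Y L K M δ C)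
include D

lemma norm_cexp_flowExp_sub_le (s t : ℝ) (hs : 0 ≤ s) (hst : s ≤ t) (ht : t ≤ 1) :
    ‖exp (flowExp a b X t z - flowExp a b X s z)‖ ≤ rexp M := by
  rw [Complex.norm_exp, D.flowExp_sub_re]
  exact Real.exp_le_exp.2 (D.growth z s t hs hst ht)

lemma isVolterra : IsVolterra (errFlow a b X) (flowExp a b X) (rexp M) :=
  ⟨D.smeas_errFlow, D.cont_flowExp.stronglyMeasurable, D.norm_cexp_flowExp_sub_le⟩

lemma isVolterraL : IsVolterra (errFlowL a b X) (flowExp a b X) (rexp M) :=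
  ⟨D.smeas_errFlowL, D.cont_flowExp.stronglyMeasurable, D.norm_cexp_flowExp_sub_le⟩

omit D in
lemma lintegral_kernel_mul_le {E : ℝ → Φ → Φ → ℂ}
    (hE : StronglyMeasurable fun p : ℝ × Φ × Φ => E p.1 p.2.1 p.2.2) (hδ : 0 ≤ δ)
    (hs : ∀ z w, ∫⁻ τ in 𝕋, ‖E τ z w‖ₑ ≤ ofReal (δ * wt K (z - w)))
    {g : Φ → ℝ} (hg : IsWtMajorant K C g) (z : Φ) :
    ∫⁻ p, ‖E p.1 z p.2‖ₑ * ofReal (g p.2)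
      ∂ν𝕋 ≤ ofReal (δ * C * g z) := by
  have hm : StronglyMeasurable fun p : ℝ × Φ => E p.1 z p.2 :=
    hE.comp_measurable (g := fun p : ℝ × Φ => (p.1, z, p.2)) (by fun_prop)
  have hm2 : Measurable fun p : ℝ × Φ => ‖E p.1 z p.2‖ₑ * ofReal (g p.2) :=
    hm.measurable.enorm.mul (hg.meas.comp measurable_snd).ennreal_ofReal
  rw [lintegral_prod_symm' _ hm2]
  calc _ ≤ ∫⁻ w, ofReal δ * (ofReal (wt K (z - w)) * ofReal (g w)) := by
        refine lintegral_mono fun w => ?_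
        dsimp only
        rw [lintegral_mul_const' _ _ ofReal_ne_top, ← mul_assoc, ← ofReal_mul hδ]
        exact mul_le_mul_left (hs z w) _
    _ ≤ ofReal δ * ofReal (C * g z) := by
        rw [lintegral_const_mul' _ _ ofReal_ne_top]; exact mul_le_mul_right (hg.le z) _
    _ = _ := by rw [← ofReal_mul hδ, mul_assoc]

lemma lintegral_errFlow_mul_le {g : Φ → ℝ} (hg : IsWtMajorant K C g) (z : Φ) :
    ∫⁻ p, ‖errFlow a b X p.1 z p.2‖ₑ * ofReal (g p.2)
      ∂ν𝕋 ≤ ofReal (δ * C * g z) :=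
  lintegral_kernel_mul_le D.smeas_errFlow D.delta_nonneg D.small hg z

lemma lintegral_errFlow_le :
    ∫⁻ p, ‖errFlow a b X p.1 z p.2‖ₑ
      ∂ν𝕋 ≤ ofReal (δ * C) := by
  simpa using D.lintegral_errFlow_mul_le D.one_majorant z

lemma lintegral_errFlowL_le :
    ∫⁻ p, ‖errFlowL a b X p.1 z p.2‖ₑ
      ∂ν𝕋 ≤ ofReal (δ * C) := by
  simpa using lintegral_kernel_mul_le D.smeas_errFlowL D.delta_nonneg D.smallL
    D.one_majorant z

/-! ### From the moving frame to phase space -/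

lemma integrable_repKer_mul_errFlow_mul {f : ℝ → Φ → ℂ} {R : ℝ}
    (hfm : StronglyMeasurable fun p : ℝ × Φ => f p.1 p.2) (hR : ∀ t z, ‖f t z‖ ≤ R)
    (z : Φ) :
    Integrable (fun q : (ℝ × Φ) × Φ =>
      repKer z (X q.1.1 q.1.2) * (errFlow a b X q.1.1 q.1.2 q.2 * f q.1.1 q.2))
      ((ν𝕋).prod volume) := by
  obtain ⟨c, hc0, hc⟩ := D.exists_repKer_flow_le d₁ z
  have hR0 : 0 ≤ R := (norm_nonneg _).trans (hR 0 0)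
  have m1 : Continuous fun q : (ℝ × Φ) × Φ => repKer z (X q.1.1 q.1.2) :=
    cont_repKer_comp continuous_const (D.cont_flow_comp (by fun_prop) (by fun_prop))
  have m2 : StronglyMeasurable fun q : (ℝ × Φ) × Φ => errFlow a b X q.1.1 q.1.2 q.2 :=
    IsEvol.smeas_comp D.smeas_errFlow (by fun_prop) (by fun_prop)
      (by fun_prop)
  have m3 : StronglyMeasurable fun q : (ℝ × Φ) × Φ => f q.1.1 q.2 :=
    hfm.comp_measurable (g := fun q : (ℝ × Φ) × Φ => (q.1.1, q.2)) (by fun_prop)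
  have hm : StronglyMeasurable fun q : (ℝ × Φ) × Φ =>
      repKer z (X q.1.1 q.1.2) * (errFlow a b X q.1.1 q.1.2 q.2 * f q.1.1 q.2) :=
    m1.stronglyMeasurable.mul (m2.mul m3)
  refine ⟨hm.aestronglyMeasurable, ?_⟩
  rw [HasFiniteIntegral, lintegral_prod _ hm.measurable.enorm.aemeasurable,
    lintegral_prod_symm' _ hm.measurable.enorm.lintegral_prod_right']
  have hle : ∀ w, ∫⁻ τ in 𝕋, ∫⁻ w', ‖repKer z (X τ w) * (errFlow a b X τ w w' * f τ w')‖ₑ ≤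
      ofReal (c * R * (δ * C) * wt d₁ w) := fun w => by
    have hw := wt_nonneg d₁ w
    calc _ ≤ ∫⁻ τ in 𝕋, ∫⁻ w', ofReal (c * wt d₁ w * R) *
          ‖errFlow a b X τ w w'‖ₑ := by
          refine setLIntegral_mono' measurableSet_Icc fun τ hτ => lintegral_mono fun w' => ?_
          rw [← ofReal_norm, ← ofReal_norm, ← ofReal_mul (by positivity), norm_mul, norm_mul]
          refine ofReal_le_ofReal ?_
          calc _ ≤ c * wt d₁ w * (‖errFlow a b X τ w w'‖ * R) := by
                gcongr
                · exact hc τ hτ w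
                · exact hR τ w'
            _ = _ := by ring
      _ = ofReal (c * wt d₁ w * R) *
          ∫⁻ p, ‖errFlow a b X p.1 w p.2‖ₑ ∂ν𝕋 := by
          have hm' : StronglyMeasurable fun p : ℝ × Φ => errFlow a b X p.1 w p.2 :=
            IsEvol.smeas_comp D.smeas_errFlow (by fun_prop)
              (by fun_prop) (by fun_prop)
          rw [lintegral_prod _ hm'.measurable.enorm.aemeasurable,
            ← lintegral_const_mul' _ _ ofReal_ne_top]
          refine lintegral_congr fun τ => ?_; rw [lintegral_const_mul' _ _ ofReal_ne_top]
      _ ≤ ofReal (c * wt d₁ w * R) * ofReal (δ * C) :=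
          mul_le_mul_right (D.lintegral_errFlow_le w) _
      _ = _ := by
          rw [← ofReal_mul (by positivity)]; ring
  exact (lintegral_mono hle).trans_lt (integrable_wt_phase.const_mul _).lintegral_lt_top

lemma ae_integral_repKer_mul_integral_errFlow {f : ℝ → Φ → ℂ} {R : ℝ}
    (hfm : StronglyMeasurable fun p : ℝ × Φ => f p.1 p.2) (hR : ∀ t z, ‖f t z‖ ≤ R)
    (z : Φ) : ∀ᵐ τ ∂μ𝕋,
      ∫ w, repKer z (X τ w) * ∫ w', errFlow a b X τ w w' * f τ w' =
        ∫ w, errKer a b τ z (X τ w) * f τ w := by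
  have h := (measurePreserving_prodAssoc μ𝕋
    (volume : Measure Φ) (volume : Measure Φ)).symm.integrable_comp_emb
    MeasurableEquiv.prodAssoc.symm.measurableEmbedding |>.2
    (D.integrable_repKer_mul_errFlow_mul hfm hR z)
  filter_upwards [h.prod_right_ae, D.ae_isAdm, ae_restrict_mem measurableSet_Icc] with τ h1 h2 hτ
  have h3 : Integrable (fun p => repKer z (X τ p.1) *
      (errFlow a b X τ p.1 p.2 * f τ p.2)) (volume.prod volume) := h1
  have hsw := integral_integral_swap (f := fun w w' => repKer z (X τ w) *
    (errFlow a b X τ w w' * f τ w')) h3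
  simp only [integral_const_mul] at hsw
  rw [hsw]
  refine integral_ext (fun w' => ?_)
  simp only [← mul_assoc]
  rw [integral_mul_const]
  rw [← integral_repKer_mul_errKer h2.1 h2.2 z (X τ w'),
    ← D.integral_comp_flow hτ fun u => repKer z u * errKer a b τ u (X τ w')]
  rfl

end IsSmallEvol

/-! ### Existence of weak solutions -/

/-- A bounded solution of the integral equation along the flow. -/
structure IsFlowSol (a b : ℝ → Φ → ℝ) (X : ℝ → Φ → Φ) (s R : ℝ) (f : ℝ → Φ → ℂ) : Prop where
  meas : StronglyMeasurable fun p : ℝ × Φ => f p.1 p.2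
  bound : ∀ t z, ‖f t z‖ ≤ R
  eq : ∀ t ∈ Icc s 1, ∀ z, f t z =
    exp (flowExp a b X t z - flowExp a b X s z) * f s z +
      ∫ p, voltKer (errFlow a b X) (flowExp a b X) s t z f p
        ∂ν𝕋

namespace IsFlowSol

variable {M δ C : ℝ}
  {s R : ℝ} {f : ℝ → Φ → ℂ}

lemma bound_nonneg (F : IsFlowSol a b X s R f) : 0 ≤ R := (norm_nonneg _).trans (F.bound 0 0)

lemma measurable_at (F : IsFlowSol a b X s R f) (t : ℝ) : StronglyMeasurable (f t) :=
  F.meas.comp_measurable (g := fun z => (t, z)) (by fun_prop)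

lemma integral_eq (F : IsFlowSol a b X s R f) (D : IsSmallEvol a b X Y L K M δ C)
    (hs : 0 ≤ s) {t : ℝ} (ht : t ∈ Icc s 1) (w : Φ) :
    IntervalIntegrable (fun τ => exp (-flowExp a b X τ w) *
      ∫ w', errFlow a b X τ w w' * f τ w') volume s t ∧
    exp (-flowExp a b X t w) * f t w = exp (-flowExp a b X s w) * f s w +
      ∫ τ in s..t, exp (-flowExp a b X τ w) * ∫ w', errFlow a b X τ w w' * f τ w' := by
  have hint := D.isVolterra.integrable_voltKer (g := fun _ => 1) hs ht.2 F.bound_nonneg w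
    (by simpa using D.lintegral_errFlow_le w) F.meas (fun τ _ w => by rw [mul_one]; exact F.bound τ w)
  obtain ⟨h1, h2⟩ := integral_voltKer_eq hs ht.1 ht.2 w hint
  have e : ∀ τ, exp (-flowExp a b X τ w) * ∫ w', errFlow a b X τ w w' * f τ w' =
      exp (-flowExp a b X t w) * (exp (flowExp a b X t w - flowExp a b X τ w) *
        ∫ w', errFlow a b X τ w w' * f τ w') := fun τ => by
    rw [← mul_assoc, ← exp_add]; ring
  simp only [e]
  refine ⟨h1.const_mul _, ?_⟩
  rw [F.eq t ht w, h2, intervalIntegral.integral_const_mul, mul_add, ← mul_assoc, ← exp_add]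
  ring

lemma continuousOn (F : IsFlowSol a b X s R f) (D : IsSmallEvol a b X Y L K M δ C)
    (hs : 0 ≤ s) (hs1 : s ≤ 1) (w : Φ) : ContinuousOn (fun t => f t w) (Icc s 1) := by
  have h1 := (F.integral_eq D hs ⟨hs1, le_rfl⟩ w).1
  have h2 := intervalIntegral.continuousOn_primitive_interval' h1 left_mem_uIcc
  rw [uIcc_of_le hs1] at h2
  have h3 : Continuous fun t => exp (flowExp a b X t w) :=
    Complex.continuous_exp.comp (D.cont_flowExp_comp continuous_id continuous_const)
  refine (h3.continuousOn.mul ((continuousOn_const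
    (c := exp (-flowExp a b X s w) * f s w)).add h2)).congr fun t ht => ?_
  simp only [Pi.mul_apply, Pi.add_apply]
  rw [← (F.integral_eq D hs ht w).2, ← mul_assoc, ← exp_add, add_neg_cancel, Complex.exp_zero,
    one_mul]

lemma integrable_repKer_mul (F : IsFlowSol a b X s R f) (D : IsEvol a b X Y L) {t : ℝ}
    (ht : t ∈ 𝕋) (z : Φ) : Integrable fun w => repKer z (X t w) * f t w := by
  obtain ⟨c, hc0, hc⟩ := D.exists_repKer_flow_le d₁ z
  refine Integrable.mul_bdd (c := R) ((integrable_wt_phase.const_mul c).mono'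
    (cont_repKer_comp continuous_const (D.cont_flow_at t)).aestronglyMeasurable
    (.of_forall fun w => hc t ht w)) (F.measurable_at t).aestronglyMeasurable
    (.of_forall fun w => F.bound t w)

lemma integrable_mul_comp {G : ℝ × Φ → ℂ} (F : IsFlowSol a b X s R f) (hG : Integrable G ν𝕋) :
    Integrable (fun p => G p * f p.1 p.2) ν𝕋 :=
  hG.mul_bdd (c := R) F.meas.aestronglyMeasurable (.of_forall fun p => F.bound p.1 p.2)

lemma integral_repKer_mul_sub (F : IsFlowSol a b X s R f)
    (D : IsSmallEvol a b X Y L K M δ C) (hs : 0 ≤ s) {t : ℝ} (ht : t ∈ Icc s 1) (z : Φ) :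
    (∫ w, repKer z (X t w) * f t w) - ∫ w, repKer z (X s w) * f s w =
      ∫ τ in s..t, ∫ w, genKer a b τ z (X τ w) * f τ w := by
  have hs1 : s ≤ 1 := ht.1.trans ht.2
  have hsub : Ioc s t ⊆ 𝕋 := fun τ hτ => ⟨hs.trans hτ.1.le, hτ.2.trans ht.2⟩
  have hmono : (volume.restrict (Ioc s t)).prod (volume : Measure Φ) ≤ ν𝕋 :=
    Measure.prod_mono (restrict_mono hsub le_rfl) le_rfl
  have hw : ∀ w, repKer z (X t w) * f t w - repKer z (X s w) * f s w =
      ∫ τ in s..t, (cenKer a b τ z (X τ w) * f τ w +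
        repKer z (X τ w) * ∫ w', errFlow a b X τ w w' * f τ w') := fun w => by
    have e0 : ∀ τ, ∀ x y, exp (flowExp a b X τ w) * x * (exp (-flowExp a b X τ w) * y) =
        x * y := fun τ x y => by
      have : exp (flowExp a b X τ w) * exp (-flowExp a b X τ w) = 1 := by
        rw [← exp_add, add_neg_cancel, Complex.exp_zero]
      grind
    have hcX : Continuous fun τ => X τ w := D.cont_flow_comp continuous_id continuous_const
    have h := mul_sub_mul_eq_integral (π := fun τ => exp (flowExp a b X τ w) * repKer z (X τ w))
      (π' := fun τ => exp (flowExp a b X τ w) * cenKer a b τ z (X τ w))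
      (h := fun τ => exp (-flowExp a b X τ w) * f τ w)
      (k := fun τ => exp (-flowExp a b X τ w) * ∫ w', errFlow a b X τ w w' * f τ w') ht.1
      (fun τ hτ => (D.hasDerivWithinAt_movingKer z w
        ⟨hs.trans hτ.1, hτ.2.trans ht.2⟩).mono (Icc_subset_Icc hs ht.2))
      ((Complex.continuous_exp.comp (D.cont_flowExp_comp continuous_id continuous_const)).mul
        (cont_cenKer_comp D.symb_a D.symb_b continuous_id continuous_const hcX)).continuousOn
      (F.integral_eq D hs ht w).1
      (fun τ hτ => (F.integral_eq D hs ⟨hτ.1, hτ.2.trans ht.2⟩ w).2)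
    simp only [e0] at h; exact h
  have i1 : Integrable (fun p => cenKer a b p.1 z (X p.1 p.2) * f p.1 p.2)
      ((volume.restrict (Ioc s t)).prod volume) :=
    (F.integrable_mul_comp (D.integrable_cenKer z)).mono_measure hmono
  have i2 : Integrable (fun p => repKer z (X p.1 p.2) *
      ∫ w', errFlow a b X p.1 p.2 w' * f p.1 w') ((volume.restrict (Ioc s t)).prod volume) := by
    have := (D.integrable_repKer_mul_errFlow_mul F.meas F.bound z).integral_prod_left
    simp only [integral_const_mul] at this; exact this.mono_measure hmono
  rw [← integral_sub (F.integrable_repKer_mul D.toIsEvol ⟨hs.trans ht.1, ht.2⟩ z)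
    (F.integrable_repKer_mul D.toIsEvol ⟨hs, hs1⟩ z)]
  simp only [hw, integral_of_le ht.1]
  have hsw := integral_integral_swap (f := fun τ w => cenKer a b τ z (X τ w) * f τ w +
        repKer z (X τ w) * ∫ w', errFlow a b X τ w w' * f τ w') (i1.add i2)
  rw [← hsw]
  refine integral_congr_ae ?_
  have i3 := (F.integrable_mul_comp (D.integrable_genKer_flow z)).prod_right_ae
  filter_upwards [i1.prod_right_ae, i2.prod_right_ae,
    ae_mono (restrict_mono hsub le_rfl) (D.ae_integral_repKer_mul_integral_errFlow F.meas F.bound z),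
    ae_mono (restrict_mono hsub le_rfl) i3] with τ h1 h2 h3 h4
  rw [integral_add h1 h2, h3, ← integral_add h1]
  · refine integral_ext fun w => ?_; simp only [errKer]; ring
  · refine (h4.sub h1).congr (.of_forall fun w => ?_); simp only [errKer, Pi.sub_apply]; ring

lemma ae_integral_genKer_mul_integral (F : IsFlowSol a b X s R f) (D : IsEvol a b X Y L)
    (z : Φ) : ∀ᵐ τ ∂μ𝕋,
      ∫ v, genKer a b τ z v * ∫ w, repKer v (X τ w) * f τ w =
        ∫ w, genKer a b τ z (X τ w) * f τ w := by
  obtain ⟨c, hc0, hc⟩ := exists_repKer_le n d₁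
  filter_upwards [(D.integrable_genKer z).prod_right_ae, D.ae_isAdm,
    ae_restrict_mem measurableSet_Icc] with τ h1 h2 hτ
  have hX := D.flow.measurePreserving D.symb_a hτ
  have hmv : StronglyMeasurable fun p : Φ × Φ => genKer a b τ z p.1 :=
    IsEvol.smeas_comp (smeas_genKer D.symb_a D.symb_b) measurable_const
      measurable_const measurable_fst
  have hmr : Continuous fun p : Φ × Φ => repKer p.1 (X τ p.2) :=
    cont_repKer_comp continuous_fst ((D.cont_flow_at τ).comp continuous_snd)
  have hmf : StronglyMeasurable fun p : Φ × Φ => f τ p.2 :=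
    (F.measurable_at τ).comp_measurable measurable_snd
  have hm : StronglyMeasurable fun p : Φ × Φ =>
      genKer a b τ z p.1 * (repKer p.1 (X τ p.2) * f τ p.2) :=
    hmv.mul (hmr.stronglyMeasurable.mul hmf)
  have hint : Integrable (fun p =>
      genKer a b τ z p.1 * (repKer p.1 (X τ p.2) * f τ p.2)) (volume.prod volume) := by
    rw [integrable_prod_iff hm.aestronglyMeasurable]
    refine ⟨Filter.Eventually.of_forall fun v =>
      (F.integrable_repKer_mul D hτ v).const_mul (genKer a b τ z v), ?_⟩
    refine (h1.norm.mul_const (c * (∫ w : Φ, wt d₁ w) * R)).mono'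
      hm.norm.integral_prod_right'.aestronglyMeasurable (.of_forall fun v => ?_)
    rw [norm_of_nonneg (integral_nonneg fun _ => norm_nonneg _)]
    have hi : Integrable fun w => wt d₁ (v - X τ w) :=
      hX.integrable_comp_emb (D.measurableEmbedding_flow τ) |>.2 (integrable_wt_phase_sub v)
    have he : ∫ w, wt d₁ (v - X τ w) = ∫ w, wt d₁ w :=
      (hX.integral_comp (D.measurableEmbedding_flow τ) fun w => wt d₁ (v - w)).trans
        (integral_wt_sub _ v)
    rw [← he, ← integral_const_mul, ← integral_mul_const, ← integral_const_mul]
    refine integral_mono_of_nonneg (.of_forall fun _ => norm_nonneg _)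
      (((hi.const_mul c).mul_const R).const_mul _) (.of_forall fun w => ?_)
    simp only [norm_mul]; have := mul_nonneg hc0 (wt_nonneg d₁ (v - X τ w)); gcongr
    · exact hc v _
    · exact F.bound τ w
  have hsw := integral_integral_swap (f := fun v w =>
    genKer a b τ z v * (repKer v (X τ w) * f τ w)) hint
  simp only [integral_const_mul] at hsw
  rw [hsw]
  refine integral_ext fun w => ?_
  simp only [← mul_assoc]
  rw [integral_mul_const, integral_genKer_mul_repKer h2.1 h2.2]

end IsFlowSol

lemma bargmann_adjoint (F : L2Phase n) (z : Φ) :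
    bargmann (adjoint (bargmannL2 n).toContinuousLinearMap F) z =
      ∫ w, repKer z w * F w := by
  rw [bargmann_eq_inner, ContinuousLinearMap.adjoint_inner_right, ← integral_conj_mul_eq_inner_phase]
  refine integral_congr_ae ?_
  filter_upwards [bargmannL2_ae (cohL2 z)] with w hw
  have h : bargmann (cohL2 z) w = repKer w z := by
    rw [← bargmann_coherent]
    exact congrFun (bargmann_congr (memLp_schwartz (coherent z)).coeFn_toLp) w
  change conj (bargmannL2 n (cohL2 z) w) * F w = _
  rw [hw, h, conj_repKer]

lemma eq_of_bargmann_eq {f g : L2Pos n} (h : ∀ z, bargmann f z = bargmann g z) : f = g := by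
  apply (bargmannL2 n).injective
  apply Lp.ext
  filter_upwards [bargmannL2_ae f, bargmannL2_ae g] with z h1 h2
  rw [h1, h2, h]

lemma norm_adjoint_bargmannL2_le (F : L2Phase n) :
    ‖adjoint (bargmannL2 n).toContinuousLinearMap F‖ ≤ ‖F‖ := by
  refine (ContinuousLinearMap.le_opNorm _ _).trans ?_
  rw [LinearIsometryEquiv.norm_map]
  exact mul_le_of_le_one_left (norm_nonneg _) (bargmannL2 n).norm_toContinuousLinearMap_le

namespace IsSmallEvol

variable {M δ C : ℝ} (D : IsSmallEvol a b X Y L K M δ C)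
include D

lemma exists_isFlowSol {s : ℝ} (hs : s ∈ 𝕋) {φ : Φ → ℂ}
    (hφm : StronglyMeasurable φ) {g : Φ → ℝ} (hg : IsWtMajorant K C g) {R : ℝ}
    (hR : ∀ z, g z ≤ R) (hφ : ∀ z, ‖φ z‖ ≤ g z) :
    ∃ f, IsFlowSol a b X s (2 * rexp M * R) f ∧ (∀ t z, ‖f t z‖ ≤ 2 * rexp M * g z) ∧
      ∀ z, f s z = φ z := by
  obtain ⟨f, hfm, hfb, hfe⟩ := D.isVolterra.exists_solution hs.1 hφm
    (mul_nonneg D.delta_nonneg D.const_nonneg) D.le_half hg.nonneg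
    (fun z => D.lintegral_errFlow_mul_le hg z) hφ
  have h0 : ∀ z, f s z = φ z := fun z => by
    have h := hfe s ⟨le_rfl, hs.2⟩ z
    have e : ∀ p, voltKer (errFlow a b X) (flowExp a b X) s s z f p = 0 := fun p => by
      rw [voltKer, indicator_of_notMem]; simp
    simpa [e] using h
  refine ⟨f, ⟨hfm, fun t z => (hfb t z).trans ?_, fun t ht z => ?_⟩, hfb, h0⟩
  · exact mul_le_mul_of_nonneg_left (hR z) (by positivity)
  · rw [h0]; exact hfe t ht z

lemma exists_isWeakSolution {s : ℝ} (hs : s ∈ 𝕋) (u₀ : L2Pos n) {g : Φ → ℝ}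
    (hg : IsWtMajorant K C g) (hg2 : MemLp g 2) {R : ℝ} (hR : ∀ z, g z ≤ R)
    (hu₀ : ∀ w, ‖bargmann u₀ (X s w)‖ ≤ g w) :
    ∃ u, IsWeakSolution a b s 1 u ∧ u s = u₀ ∧
      (∀ t ∈ Icc s 1, ‖u t‖ ≤ 2 * rexp M * (eLpNorm g 2).toReal) ∧
      ∀ t ∈ Icc s 1, ∀ z, ‖bargmann (u t) z‖ ≤ 2 * rexp M * ∫ w, ‖repKer z (X t w)‖ * g w := by
  have hφc : Continuous fun w => bargmann u₀ (X s w) :=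
    (cont_bargmann u₀).comp (D.cont_flow_at s)
  obtain ⟨f, F, hfb, hfs⟩ := D.exists_isFlowSol hs hφc.stronglyMeasurable hg hR hu₀
  have hfL : ∀ t, MemLp (f t) 2 := fun t =>
    MemLp.of_le (hg2.const_mul (2 * rexp M)) (F.measurable_at t).aestronglyMeasurable
      (.of_forall fun z => (hfb t z).trans (le_abs_self _))
  have hYm : ∀ t : Icc s (1 : ℝ), MeasurePreserving (Y t) := fun t => by
    have ht : (t : ℝ) ∈ 𝕋 := ⟨hs.1.trans t.2.1, t.2.2⟩
    exact (D.flow.measurePreserving D.symb_a ht).symm (MeasurableEquiv.mk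
      ⟨X t, Y t, D.flow.left_inv t, D.flow.right_inv t⟩
      (D.cont_flow_at t).measurable (D.cont_inv_at t).measurable)
  set G : Icc s (1 : ℝ) → L2Phase n := fun t =>
    Lp.compMeasurePreserving (Y t) (hYm t) ((hfL t).toLp (f t)) with hG
  set u : ℝ → L2Pos n := fun t =>
    adjoint (bargmannL2 n).toContinuousLinearMap (G (projIcc s 1 hs.2 t)) with hu
  have hut : ∀ t, ∀ ht, u t =
      adjoint (bargmannL2 n).toContinuousLinearMap (G ⟨t, ht⟩) := fun t ht => by
    simp only [hu, projIcc_of_mem hs.2 ht]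
  have hmem : ∀ t ∈ Icc s 1, t ∈ 𝕋 := fun t ht => ⟨hs.1.trans ht.1, ht.2⟩
  have hBu : ∀ t ∈ Icc s 1, ∀ z, bargmann (u t) z = ∫ w, repKer z (X t w) * f t w := fun t ht z => by
    rw [hut t ht, bargmann_adjoint]
    have h1 : G ⟨t, ht⟩ =ᵐ[volume] fun w => f t (Y t w) :=
      (Lp.coeFn_compMeasurePreserving _ (hYm ⟨t, ht⟩)).trans
        ((hYm ⟨t, ht⟩).quasiMeasurePreserving.ae_eq_comp (hfL t).coeFn_toLp)
    rw [integral_congr_ae (g := fun w => repKer z w * f t (Y t w)) (by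
      filter_upwards [h1] with w hw; rw [hw]), ← D.integral_comp_flow (hmem t ht)]
    simp only [D.flow.left_inv]
  have hus : u s = u₀ := eq_of_bargmann_eq fun z => by
    rw [hBu s ⟨le_rfl, hs.2⟩]; simp only [hfs]
    rw [D.integral_comp_flow hs fun w => repKer z w * bargmann u₀ w,
      ← bargmann_eq_integral_repKer (Lp.memLp u₀)]
  have hGc : Continuous G := by
    have h1 : Continuous fun t : Icc s (1 : ℝ) => (hfL t).toLp (f t) := by
      rw [continuous_iff_continuousAt]; intro t
      refine tendsto_toLp_of_dominated (hg2.const_mul (2 * rexp M)) (fun t : Icc s (1 : ℝ) => hfL t)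
        (hfL t) (fun t => Filter.Eventually.of_forall fun z => hfb t z)
        (.of_forall fun z => ?_)
      have := continuousOn_iff_continuous_domRestrict.1 (F.continuousOn D hs.1 hs.2 z)
      exact this.tendsto t
    let Yc : Icc s (1 : ℝ) → C(Φ, Φ) := fun t => ⟨Y t, D.cont_inv_at t⟩
    have h2 : Continuous Yc := by
      refine ContinuousMap.continuous_of_continuous_uncurry _ ?_
      exact D.cont_inv_comp (continuous_subtype_val.comp continuous_fst) continuous_snd
    exact h1.compMeasurePreservingLp h2 hYm (by norm_num)
  have huc : ContinuousOn u (Icc s 1) :=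
    ((ContinuousLinearMap.continuous _).comp (hGc.comp continuous_projIcc)).continuousOn
  refine ⟨u, D.isWeakSolution_of_bargmann_sub_eq hs.1 hs.2 le_rfl huc fun t ht z => ?_, hus,
    fun t ht => ?_, fun t ht z => ?_⟩
  · rw [hBu t ht, hBu s ⟨le_rfl, hs.2⟩, F.integral_repKer_mul_sub D hs.1 ht]
    refine intervalIntegral.integral_congr_ae ?_
    have hae := (ae_restrict_iff' measurableSet_Icc).1 (F.ae_integral_genKer_mul_integral D.toIsEvol z)
    filter_upwards [hae] with τ hτ hτ'; rw [uIoc_of_le ht.1] at hτ'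
    have hτs : τ ∈ Icc s 1 := ⟨hτ'.1.le, hτ'.2.trans ht.2⟩; rw [← hτ (hmem τ hτs)]
    simp only [hBu τ hτs]
  · rw [hut t ht]; refine (norm_adjoint_bargmannL2_le _).trans ?_
    rw [Lp.norm_compMeasurePreserving, Lp.norm_toLp]
    have h1 : eLpNorm (f t) 2 volume ≤ ofReal (2 * rexp M) * eLpNorm g 2 volume := by
      refine eLpNorm_le_mul_eLpNorm_of_ae_le_mul (.of_forall fun z => ?_) 2
      rw [norm_of_nonneg (hg.nonneg z)]; exact hfb t z
    have h2 := ENNReal.toReal_mono (mul_ne_top ofReal_ne_top hg2.2.ne) h1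
    rwa [ENNReal.toReal_mul, ENNReal.toReal_ofReal (by positivity)] at h2
  · rw [hBu t ht, ← integral_const_mul]; obtain ⟨c, hc0, hc⟩ := D.exists_repKer_flow_le d₁ z
    have hi : Integrable fun w => ‖repKer z (X t w)‖ * g w := by
      refine Integrable.mul_bdd (c := R) ((integrable_wt_phase.const_mul c).mono'
        (cont_repKer_comp continuous_const (D.cont_flow_at t)).norm.aestronglyMeasurable
        (.of_forall fun w => ?_)) hg.meas.aestronglyMeasurable
        (.of_forall fun w => ?_)
      · rw [norm_norm]; exact hc t (hmem t ht) w
      · rw [norm_of_nonneg (hg.nonneg w)]; exact hR w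
    refine norm_integral_le_of_norm_le (hi.const_mul _) (.of_forall fun w => ?_)
    rw [norm_mul, mul_left_comm]; exact mul_le_mul_of_nonneg_left (hfb t w) (norm_nonneg _)

end IsSmallEvol

/-! ### Uniqueness of weak solutions -/

namespace IsEvol

variable (D : IsEvol a b X Y L)
include D

lemma integrable_repKer_path_mul_genKer {U : ℝ → Φ → ℂ} {R : ℝ}
    (hU : StronglyMeasurable fun p : ℝ × Φ => U p.1 p.2) (hR : ∀ τ w, ‖U τ w‖ ≤ R)
    (z : Φ) : Integrable (fun q : ℝ × Φ × Φ =>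
      repKer (X q.1 z) q.2.1 * (genKer a b q.1 q.2.1 q.2.2 * U q.1 q.2.2))
      ((μ𝕋).prod (volume.prod volume)) := by
  obtain ⟨B, hB, hB0, hBle⟩ := D.exists_genKer_le d₁
  obtain ⟨c, hc0, hc⟩ := D.exists_repKer_path_le (2 * n + 1 + d₃) z
  have m1 : Continuous fun q : ℝ × Φ × Φ => repKer (X q.1 z) q.2.1 :=
    cont_repKer_comp (D.cont_flow_comp continuous_fst continuous_const) (by fun_prop)
  have m2 : StronglyMeasurable fun q : ℝ × Φ × Φ => genKer a b q.1 q.2.1 q.2.2 :=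
    smeas_genKer D.symb_a D.symb_b
  have m3 : StronglyMeasurable fun q : ℝ × Φ × Φ => U q.1 q.2.2 :=
    hU.comp_measurable (g := fun q : ℝ × Φ × Φ => (q.1, q.2.2)) (by fun_prop)
  have hw : Integrable (fun p : Φ × Φ =>
      c * R * (wt d₁ p.1 * wt d₁ (p.1 - p.2))) (volume.prod volume) :=
    integrable_wt_mul_wt_sub.const_mul _
  refine (hB.mul_prod hw).mono' (m1.stronglyMeasurable.mul (m2.mul m3)).aestronglyMeasurable ?_
  filter_upwards [ae_fst hBle, ae_fst_mem] with q h1 h2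
  rw [norm_mul, norm_mul]
  have h3 := hc q.1 h2 q.2.1
  have h4 := h1 q.2.1 q.2.2
  have h5 := hR q.1 q.2.2
  have h6 := hB0 q.1
  have hw := wt_nonneg (2 * n + 1 + d₃) q.2.1
  have hw' := wt_nonneg d₁ (q.2.1 - q.2.2)
  calc _ ≤ c * wt (2 * n + 1 + d₃) q.2.1 *
        (B q.1 * ((1 + ‖q.2.1‖) ^ d₃ * wt d₁ (q.2.1 - q.2.2)) * R) := by gcongr
    _ = B q.1 * (c * R * (wt d₁ q.2.1 * wt d₁ (q.2.1 - q.2.2))) *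
        (wt d₃ q.2.1 * (1 + ‖q.2.1‖) ^ d₃) := by rw [wt_add]; ring
    _ = _ := by rw [wt_mul_pow, mul_one]

lemma ae_integral_repKer_path_mul_integral_genKer {U : ℝ → Φ → ℂ} {R : ℝ}
    (hU : StronglyMeasurable fun p : ℝ × Φ => U p.1 p.2) (hR : ∀ τ w, ‖U τ w‖ ≤ R)
    (z : Φ) : ∀ᵐ τ ∂μ𝕋,
      ∫ v, repKer (X τ z) v * ∫ w, genKer a b τ v w * U τ w =
        ∫ w, genKer a b τ (X τ z) w * U τ w := by
  filter_upwards [(D.integrable_repKer_path_mul_genKer hU hR z).prod_right_ae, D.ae_isAdm] with τ h1 h2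
  have hsw := integral_integral_swap (f := fun v w => repKer (X τ z) v *
    (genKer a b τ v w * U τ w)) h1
  simp only [integral_const_mul] at hsw
  rw [hsw]
  refine integral_ext fun w => ?_
  simp only [← mul_assoc]
  rw [integral_mul_const, integral_repKer_mul_genKer h2.1 h2.2]

lemma integrable_cexp_mul {G : ℝ × Φ → ℂ} (hG : Integrable G ν𝕋) :
    Integrable (fun p => exp (-flowExp a b X p.1 z) * G p) ν𝕋 := by
  have hc : Continuous fun τ => exp (-flowExp a b X τ z) :=
    Complex.continuous_exp.comp (D.cont_flowExp_comp continuous_id continuous_const).neg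
  obtain ⟨c, hc'⟩ := isCompact_Icc.exists_bound_of_continuousOn (hc.continuousOn (s := 𝕋))
  refine hG.bdd_mul (c := c) (hc.comp continuous_fst).aestronglyMeasurable ?_
  filter_upwards [ae_fst_mem] with p hp
  exact hc' p.1 hp

lemma cexp_mul_bargmann_flow_eq {s t : ℝ} (hs : 0 ≤ s) (hst : s ≤ t) (ht : t ≤ 1) {u : ℝ → L2Pos n}
    (huc : Continuous u) {R : ℝ} (hR : ∀ τ, ‖u τ‖ ≤ R) (hus : u s = 0)
    (hu : ∀ τ ∈ Icc s t, ∀ z, bargmann (u τ) z = ∫ σ in s..τ, ∫ w, genKer a b σ z w * bargmann (u σ) w)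
    (z : Φ) : exp (-flowExp a b X t z) * bargmann (u t) (X t z) =
      ∫ τ in s..t, exp (-flowExp a b X τ z) *
        ∫ w, errFlowL a b X τ z w * bargmann (u τ) (X τ w) := by
  have hUc : Continuous fun p : ℝ × Φ => bargmann (u p.1) p.2 :=
    cont_bargmann_comp (huc.comp continuous_fst) continuous_snd
  have hUR : ∀ τ w, ‖bargmann (u τ) w‖ ≤ R := fun τ w => (norm_bargmann_le _ w).trans (hR τ)
  have hsub : Ioc s t ⊆ 𝕋 := fun τ hτ => ⟨hs.trans hτ.1.le, hτ.2.trans ht⟩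
  have hmono : (volume.restrict (Ioc s t)).prod (volume : Measure Φ) ≤ ν𝕋 :=
    Measure.prod_mono (restrict_mono hsub le_rfl) le_rfl
  have hbdd : ∀ {G : ℝ × Φ → ℂ},
      Integrable G ν𝕋 →
      Integrable (fun p => G p * bargmann (u p.1) p.2) ν𝕋 := fun hG =>
    hG.mul_bdd (c := R) hUc.aestronglyMeasurable (.of_forall fun p => hUR p.1 p.2)
  have hv : ∀ v, exp (-flowExp a b X t z) * repKer (X t z) v * bargmann (u t) v =
      ∫ τ in s..t, (-(exp (-flowExp a b X τ z) * (cenKerL a b τ (X τ z) v * bargmann (u τ) v)) +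
        exp (-flowExp a b X τ z) *
          (repKer (X τ z) v * ∫ w, genKer a b τ v w * bargmann (u τ) w)) := fun v => by
    have hcX : Continuous fun τ => X τ z := D.cont_flow_comp continuous_id continuous_const
    have hk : IntervalIntegrable (fun τ => ∫ w, genKer a b τ v w * bargmann (u τ) w) volume s t := by
      rw [intervalIntegrable_iff_integrableOn_Ioc_of_le hst]
      exact ((hbdd (D.integrable_genKer v)).mono_measure hmono).integral_prod_left
    have hus' : bargmann (u s) v = 0 := by
      rw [hus, bargmann_eq_inner, inner_zero_right]
    have h := mul_sub_mul_eq_integral (π := fun τ => exp (-flowExp a b X τ z) * repKer (X τ z) v)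
      (π' := fun τ => -(exp (-flowExp a b X τ z) * cenKerL a b τ (X τ z) v))
      (h := fun τ => bargmann (u τ) v)
      (k := fun τ => ∫ w, genKer a b τ v w * bargmann (u τ) w) hst
      (fun τ hτ => (D.hasDerivWithinAt_movingKerL z v
        ⟨hs.trans hτ.1, hτ.2.trans ht⟩).mono (Icc_subset_Icc hs ht))
      ((Complex.continuous_exp.comp
        (D.cont_flowExp_comp continuous_id continuous_const).neg).mul
        (cont_cenKerL_comp D.symb_a D.symb_b continuous_id hcX
          continuous_const)).neg.continuousOn
      hk (fun τ hτ => by simp only [hus', zero_add, hu τ hτ v])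
    simp only [hus', mul_zero, sub_zero] at h; rw [h]; grind
  have i1 : Integrable (fun p => -(exp (-flowExp a b X p.1 z) *
      (cenKerL a b p.1 (X p.1 z) p.2 * bargmann (u p.1) p.2)))
      ((volume.restrict (Ioc s t)).prod volume) :=
    ((D.integrable_cexp_mul z (hbdd (D.integrable_cenKerL z))).mono_measure hmono).neg
  have i2 : Integrable (fun p => exp (-flowExp a b X p.1 z) *
      (repKer (X p.1 z) p.2 * ∫ w, genKer a b p.1 p.2 w * bargmann (u p.1) w))
      ((volume.restrict (Ioc s t)).prod volume) := by
    have h0 := (measurePreserving_prodAssoc μ𝕋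
      (volume : Measure Φ) (volume : Measure Φ)).integrable_comp_emb
      MeasurableEquiv.prodAssoc.measurableEmbedding |>.2
      (D.integrable_repKer_path_mul_genKer hUc.stronglyMeasurable hUR z)
    have h1 : Integrable (fun p => repKer (X p.1 z) p.2 *
        ∫ w, genKer a b p.1 p.2 w * bargmann (u p.1) w)
        ν𝕋 := by
      refine h0.integral_prod_left.congr (.of_forall fun p => ?_)
      exact integral_const_mul (repKer (X p.1 z) p.2) fun w =>
        genKer a b p.1 p.2 w * bargmann (u p.1) w
    exact (D.integrable_cexp_mul z h1).mono_measure hmono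
  rw [bargmann_eq_integral_repKer (Lp.memLp (u t)), ← integral_const_mul]
  simp only [← mul_assoc, hv, integral_of_le hst]
  have hsw := integral_integral_swap (f := fun τ v =>
    -(exp (-flowExp a b X τ z) * (cenKerL a b τ (X τ z) v * bargmann (u τ) v)) +
        exp (-flowExp a b X τ z) *
          (repKer (X τ z) v * ∫ w, genKer a b τ v w * bargmann (u τ) w)) (i1.add i2)
  simp only [mul_assoc] at hsw ⊢
  rw [← hsw]
  refine integral_congr_ae ?_
  filter_upwards [i1.prod_right_ae, i2.prod_right_ae, ae_restrict_mem measurableSet_Ioc,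
    ae_mono (restrict_mono hsub le_rfl)
      (D.ae_integral_repKer_path_mul_integral_genKer hUc.stronglyMeasurable hUR z),
    ae_mono (restrict_mono hsub le_rfl) (hbdd (D.integrable_genKer_path z)).prod_right_ae,
    ae_mono (restrict_mono hsub le_rfl) (hbdd (D.integrable_cenKerL z)).prod_right_ae]
    with τ h1 h2 hτ h3 h4 h5
  rw [integral_add h1 h2, integral_neg, integral_const_mul, integral_const_mul, h3, neg_add_eq_sub,
    ← mul_sub, ← integral_sub h4 h5]
  congr 1
  rw [← D.integral_comp_flow (hsub hτ)]
  refine integral_ext fun w => ?_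
  simp only [errFlowL, errKerL]
  ring

end IsEvol

namespace IsSmallEvol

variable {M δ C : ℝ} (D : IsSmallEvol a b X Y L K M δ C)
include D

lemma eq_zero_of_isWeakSolution {s T : ℝ} (hs : 0 ≤ s) (hsT : s ≤ T) (hT : T ≤ 1) {u : ℝ → L2Pos n}
    (hu : IsWeakSolution a b s T u) (hus : u s = 0) : ∀ t ∈ Icc s T, u t = 0 := by
  obtain ⟨R, hR⟩ := isCompact_Icc.exists_bound_of_continuousOn hu.1
  have hR0 : 0 ≤ R := (norm_nonneg _).trans (hR s ⟨le_rfl, hsT⟩)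
  set v : ℝ → L2Pos n := fun τ => u (projIcc s T hsT τ) with hv
  have hvc : Continuous v := by
    have := continuousOn_iff_continuous_domRestrict.1 hu.1; exact this.comp continuous_projIcc
  have hveq : ∀ τ ∈ Icc s T, v τ = u τ := fun τ hτ => by rw [hv]; simp only; rw [projIcc_of_mem hsT hτ]
  have hvR : ∀ τ, ‖v τ‖ ≤ R := fun τ => hR _ (projIcc s T hsT τ).2
  have hvs : v s = 0 := by rw [hveq s ⟨le_rfl, hsT⟩, hus]
  have hVc : Continuous fun p : ℝ × Φ => bargmann (v p.1) (X p.1 p.2) :=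
    cont_bargmann_comp (hvc.comp continuous_fst) D.flow.continuous
  have hVR : ∀ τ w, ‖bargmann (v τ) (X τ w)‖ ≤ R := fun τ w => (norm_bargmann_le _ _).trans (hvR τ)
  have hveq' : ∀ t ∈ Icc s T, ∀ z, bargmann (v t) z =
      ∫ σ in s..t, ∫ w, genKer a b σ z w * bargmann (v σ) w := fun t ht z => by
    have h := D.bargmann_sub_eq_of_isWeakSolution hs hT hu ht z
    rw [hus, bargmann_eq_inner 0, inner_zero_right, sub_zero, ← hveq t ht] at h; rw [h]
    refine intervalIntegral.integral_congr fun τ hτ => ?_; rw [uIcc_of_le ht.1] at hτ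
    simp only [hveq τ ⟨hτ.1, hτ.2.trans ht.2⟩]
  have hzero := D.isVolterraL.eq_zero (f := fun τ w => bargmann (v τ) (X τ w)) hs hT
    (mul_nonneg D.delta_nonneg D.const_nonneg) D.le_half D.lintegral_errFlowL_le hR0
    (fun t _ z => hVR t z) (fun t ht z => by
      have hint := D.isVolterraL.integrable_voltKer (g := fun _ => 1) hs (ht.2.trans hT) hR0 z
        (by simpa using D.lintegral_errFlowL_le z) hVc.stronglyMeasurable
        (fun τ _ w => by rw [mul_one]; exact hVR τ w)
      rw [(integral_voltKer_eq hs ht.1 (ht.2.trans hT) z hint).2]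
      have h := D.cexp_mul_bargmann_flow_eq hs ht.1 (ht.2.trans hT) hvc hvR hvs
        (fun τ hτ => hveq' τ ⟨hτ.1, hτ.2.trans ht.2⟩) z
      have e : ∀ τ, exp (flowExp a b X t z - flowExp a b X τ z) *
          ∫ w, errFlowL a b X τ z w * bargmann (v τ) (X τ w) =
          exp (flowExp a b X t z) * (exp (-flowExp a b X τ z) *
          ∫ w, errFlowL a b X τ z w * bargmann (v τ) (X τ w)) := fun τ => by
        rw [← mul_assoc, ← exp_add, sub_eq_add_neg]
      simp only [e]
      rw [intervalIntegral.integral_const_mul, ← h, ← mul_assoc, ← exp_add, add_neg_cancel,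
        Complex.exp_zero, one_mul])
  intro t ht
  refine eq_of_bargmann_eq fun z => ?_
  have h := hzero t ht (Y t z)
  rw [D.flow.right_inv, hveq t ht] at h
  rw [h, bargmann_eq_inner, inner_zero_right]

end IsSmallEvol

/-! ### Majorants -/

/-- The constant of the convolution inequality for weights. -/
def wtConst (n K : ℕ) : ℝ := 1 + 2 ^ (K + 1) * ∫ v : Φ, wt K v

lemma integral_wt_nonneg (n K : ℕ) : 0 ≤ ∫ v : Φ, wt K v := integral_nonneg fun _ => wt_nonneg _ _

lemma wtConst_nonneg (n K : ℕ) : 0 ≤ wtConst n K := by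
  have := integral_wt_nonneg n K
  unfold wtConst; positivity

lemma integral_wt_le_wtConst (n K : ℕ) : ∫ v : Φ, wt K v ≤ wtConst n K := by
  have h := integral_wt_nonneg n K
  have h2 : (1 : ℝ) ≤ 2 ^ (K + 1) := one_le_pow₀ one_le_two
  unfold wtConst
  nlinarith

section Majorants

variable (hK : 2 * n < K)
include hK

lemma integrable_wt_sub_of_lt : Integrable fun w => wt K (z - w) :=
  integrable_wt_sub (μ := volume) (by rwa [finrank_phase]) z

lemma lintegral_wt_sub :
    ∫⁻ w, ofReal (wt K (z - w)) = ofReal (∫ v : Φ, wt K v) := by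
  rw [← integral_wt_sub K z, ofReal_integral_eq_lintegral_ofReal (integrable_wt_sub_of_lt z hK)
    (.of_forall fun _ => wt_nonneg _ _)]

lemma lintegral_wt_mul_wt_le (z u : Φ) :
    ∫⁻ w, ofReal (wt K (z - w)) * ofReal (wt K (w - u)) ≤
      ofReal (2 ^ (K + 1) * (∫ v : Φ, wt K v) * wt K (z - u)) := by
  have hf : Module.finrank ℝ Φ < K := by rwa [finrank_phase]
  simp only [← ofReal_mul (wt_nonneg K _)]
  rw [← ofReal_integral_eq_lintegral_ofReal (integrable_wt_mul_wt (μ := volume) hf z u)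
    (.of_forall fun _ => mul_nonneg (wt_nonneg _ _) (wt_nonneg _ _))]
  exact ofReal_le_ofReal (integral_wt_mul_wt_le hf z u)

lemma isWtMajorant_one : IsWtMajorant K (wtConst n K) fun _ : Φ => 1 := by
  refine ⟨measurable_const, fun _ => zero_le_one, fun z => ?_⟩
  simp only [ENNReal.ofReal_one, mul_one]
  rw [lintegral_wt_sub _ hK]
  exact ofReal_le_ofReal (integral_wt_le_wtConst n K)

lemma isWtMajorant_wt {c : ℝ} (hc : 0 ≤ c) (p : Φ) :
    IsWtMajorant K (wtConst n K) fun w => c * wt K (w - p) := by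
  refine ⟨(((cont_wt K).comp (continuous_id.sub continuous_const)).const_mul c).measurable,
    fun w => mul_nonneg hc (wt_nonneg _ _), fun z => ?_⟩
  simp only [ofReal_mul hc, mul_left_comm _ (ofReal c)]
  rw [lintegral_const_mul' _ _ ofReal_ne_top]
  refine (mul_le_mul_right (lintegral_wt_mul_wt_le hK z p) _).trans ?_
  rw [← ofReal_mul hc]
  refine ofReal_le_ofReal ?_
  rw [wtConst, mul_left_comm]
  refine mul_le_mul_of_nonneg_right ?_ (mul_nonneg hc (wt_nonneg _ _))
  linarith

lemma memLp_wt_sub (p : Φ) : MemLp (fun w => wt K (w - p)) 2 := by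
  have hc : Continuous fun w => wt K (w - p) :=
    (cont_wt K).comp (continuous_id.sub continuous_const)
  rw [memLp_two_iff_integrable_sq hc.aestronglyMeasurable]
  have hi := integrable_wt_sub_of_lt p hK
  simp only [wt_sub_comm K p] at hi
  refine hi.mono' (hc.pow 2).aestronglyMeasurable (.of_forall fun w => ?_)
  have h0 := wt_nonneg K (w - p)
  have h1 := wt_le_one K (w - p)
  rw [norm_of_nonneg (by positivity)]
  nlinarith

/-- The convolution of a function with `wt K`. -/
def wtConv (K : ℕ) (ψ : Φ → ℝ) (z : Φ) : ℝ := ∫ u, wt K (z - u) * ψ u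

variable {ψ : Φ → ℝ} {R : ℝ} (hψ : Continuous ψ) (hψ0 : ∀ z, 0 ≤ ψ z) (hψR : ∀ z, ψ z ≤ R)
include hψ hψ0 hψR

lemma integrable_wt_mul : Integrable fun u => wt K (z - u) * ψ u :=
  (integrable_wt_sub_of_lt z hK).mul_bdd (c := R) hψ.aestronglyMeasurable
    (.of_forall fun u => by rw [norm_of_nonneg (hψ0 u)]; exact hψR u)

lemma ofReal_wtConv : ofReal (wtConv K ψ z) =
    ∫⁻ u, ofReal (wt K (z - u)) * ofReal (ψ u) := by
  rw [wtConv, ofReal_integral_eq_lintegral_ofReal (integrable_wt_mul z hK hψ hψ0 hψR)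
    (.of_forall fun u => mul_nonneg (wt_nonneg _ _) (hψ0 u))]
  simp only [← ofReal_mul (wt_nonneg K _)]

omit hK hψ0 hψR in
lemma smeas_wtConv : StronglyMeasurable (wtConv K ψ) := by
  have hc : Continuous fun p : Φ × Φ => wt K (p.1 - p.2) * ψ p.2 :=
    ((cont_wt K).comp (continuous_fst.sub continuous_snd)).mul (hψ.comp continuous_snd)
  exact hc.stronglyMeasurable.integral_prod_right (f := fun z u => wt K (z - u) * ψ u)

omit hK hψ hψR in
lemma wtConv_nonneg (z : Φ) : 0 ≤ wtConv K ψ z :=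
  integral_nonneg fun u => mul_nonneg (wt_nonneg _ _) (hψ0 u)

lemma wtConv_le (z : Φ) : wtConv K ψ z ≤ (∫ v : Φ, wt K v) * R := by
  rw [← integral_wt_sub K z, ← integral_mul_const]
  exact integral_mono (integrable_wt_mul z hK hψ hψ0 hψR) ((integrable_wt_sub_of_lt z hK).mul_const R)
    fun u => mul_le_mul_of_nonneg_left (hψR u) (wt_nonneg _ _)

lemma lintegral_wtConv_sq_le : ∫⁻ z, ofReal (wtConv K ψ z) ^ 2 ≤
    ofReal (∫ v : Φ, wt K v) ^ 2 * ∫⁻ u, ofReal (ψ u) ^ 2 := by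
  set J := ofReal (∫ v : Φ, wt K v) with hJ
  have hwm : ∀ z : Φ, Measurable fun u => ofReal (wt K (z - u)) := fun z =>
    (((cont_wt K).comp (continuous_const.sub continuous_id)).measurable).ennreal_ofReal
  have hψm : Measurable fun u => ofReal (ψ u) := hψ.measurable.ennreal_ofReal
  have hcs : ∀ z, ofReal (wtConv K ψ z) ^ 2 ≤
      J * ∫⁻ u, ofReal (wt K (z - u)) * ofReal (ψ u) ^ 2 := fun z => by
    rw [ofReal_wtConv _ hK hψ hψ0 hψR, hJ, ← lintegral_wt_sub z hK]
    set κw : Φ → ℝ≥0∞ := fun u => ofReal (wt K (z - u)) with hκw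
    have h2 : ∀ x, (x ^ (1 / 2 : ℝ)) ^ (2 : ℝ) = x := fun x => by
      rw [← ENNReal.rpow_mul]; norm_num
    have hH := ENNReal.lintegral_mul_le_Lp_mul_Lq volume (Real.HolderConjugate.two_two)
      (f := fun u => κw u ^ (1 / 2 : ℝ)) (g := fun u => κw u ^ (1 / 2 : ℝ) * ofReal (ψ u))
      ((hwm z).pow_const _).aemeasurable (((hwm z).pow_const _).mul hψm).aemeasurable
    have e : ∀ u, ((fun u => κw u ^ (1 / 2 : ℝ)) * fun u => κw u ^ (1 / 2 : ℝ) * ofReal (ψ u)) u =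
        κw u * ofReal (ψ u) := fun u => by
      simp only [Pi.mul_apply]
      rw [← mul_assoc, ← ENNReal.rpow_add_of_nonneg _ _ (by norm_num) (by norm_num)]; norm_num
    simp only [e, h2, ENNReal.mul_rpow_of_nonneg _ _ zero_le_two] at hH
    have h3 := pow_le_pow_left' hH 2; rw [mul_pow] at h3; simp only [← ENNReal.rpow_two, h2] at h3 ⊢
    exact h3
  have hm : Measurable fun p : Φ × Φ =>
      ofReal (wt K (p.1 - p.2)) * ofReal (ψ p.2) ^ 2 :=
    (((cont_wt K).comp (continuous_fst.sub continuous_snd)).measurable.ennreal_ofReal).mul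
      ((hψm.comp measurable_snd).pow_const 2)
  calc _ ≤ ∫⁻ z, J * ∫⁻ u, ofReal (wt K (z - u)) * ofReal (ψ u) ^ 2 := lintegral_mono hcs
    _ = J * ∫⁻ u, ∫⁻ z, ofReal (wt K (z - u)) * ofReal (ψ u) ^ 2 := by
        rw [lintegral_const_mul' _ _ ofReal_ne_top, lintegral_lintegral_swap hm.aemeasurable]
    _ = J * ∫⁻ u, J * ofReal (ψ u) ^ 2 := by
        congr 1; refine lintegral_congr fun u => ?_
        rw [lintegral_mul_const' _ _ (ENNReal.pow_ne_top ofReal_ne_top)]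
        simp only [wt_sub_comm K _ u]; rw [lintegral_wt_sub _ hK]
    _ = _ := by
        rw [lintegral_const_mul' _ _ ofReal_ne_top]; ring

lemma eLpNorm_wtConv_le :
    eLpNorm (wtConv K ψ) 2 volume ≤ ofReal (∫ v : Φ, wt K v) * eLpNorm ψ 2 volume := by
  have e : ∀ f : Φ → ℝ, (∀ z, 0 ≤ f z) →
      eLpNorm f 2 volume = (∫⁻ z, ofReal (f z) ^ 2) ^ (1 / 2 : ℝ) := fun f hf => by
    rw [eLpNorm_eq_lintegral_rpow_enorm_toReal (by norm_num) (by norm_num)]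
    simp only [ENNReal.toReal_ofNat, ENNReal.rpow_ofNat]; congr 2; funext z
    rw [← ofReal_norm, norm_of_nonneg (hf z)]
  rw [e _ (wtConv_nonneg hψ0), e _ hψ0]
  refine (ENNReal.rpow_le_rpow (lintegral_wtConv_sq_le hK hψ hψ0 hψR) (by norm_num)).trans ?_
  rw [ENNReal.mul_rpow_of_nonneg _ _ (by norm_num), ← ENNReal.rpow_two, ← ENNReal.rpow_mul]
  norm_num

lemma isWtMajorant_add_wtConv : IsWtMajorant K (wtConst n K) fun z => ψ z + wtConv K ψ z := by
  have hI := integral_wt_nonneg n K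
  have hcm := (smeas_wtConv (K := K) hψ).measurable
  have hψm : Measurable fun u => ofReal (ψ u) := hψ.measurable.ennreal_ofReal
  have hwm : ∀ z : Φ, Measurable fun u => ofReal (wt K (z - u)) := fun z =>
    (((cont_wt K).comp (continuous_const.sub continuous_id)).measurable).ennreal_ofReal
  refine ⟨hψ.measurable.add hcm, fun z => add_nonneg (hψ0 z) (wtConv_nonneg hψ0 z), fun z => ?_⟩
  have h1 : ∫⁻ w, ofReal (wt K (z - w)) * ofReal (wtConv K ψ w) ≤
      ofReal (2 ^ (K + 1) * (∫ v : Φ, wt K v) * wtConv K ψ z) := by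
    have hm : Measurable fun p : Φ × Φ => ofReal (wt K (z - p.1)) *
        (ofReal (wt K (p.1 - p.2)) * ofReal (ψ p.2)) :=
      ((hwm z).comp measurable_fst).mul
        ((((cont_wt K).comp (continuous_fst.sub continuous_snd)).measurable.ennreal_ofReal).mul
        (hψm.comp measurable_snd))
    calc _ = ∫⁻ w, ∫⁻ u, ofReal (wt K (z - w)) * (ofReal (wt K (w - u)) * ofReal (ψ u)) := by
          refine lintegral_congr fun w => ?_
          rw [lintegral_const_mul' _ _ ofReal_ne_top, ofReal_wtConv _ hK hψ hψ0 hψR]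
      _ = ∫⁻ u, (∫⁻ w, ofReal (wt K (z - w)) * ofReal (wt K (w - u))) *
          ofReal (ψ u) := by
          rw [lintegral_lintegral_swap hm.aemeasurable]; refine lintegral_congr fun u => ?_
          rw [← lintegral_mul_const' _ _ ofReal_ne_top]; simp only [mul_assoc]
      _ ≤ ∫⁻ u, ofReal (2 ^ (K + 1) * (∫ v : Φ, wt K v)) *
          (ofReal (wt K (z - u)) * ofReal (ψ u)) := by
          refine lintegral_mono fun u => ?_; rw [← mul_assoc, ← ofReal_mul (by positivity)]
          exact mul_le_mul_left (lintegral_wt_mul_wt_le hK z u) _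
      _ = _ := by
          rw [lintegral_const_mul' _ _ ofReal_ne_top, ← ofReal_wtConv _ hK hψ hψ0 hψR,
            ← ofReal_mul (by positivity)]
  have h2 : ∀ w, ofReal (wt K (z - w)) * ofReal (ψ w + wtConv K ψ w) =
      ofReal (wt K (z - w)) * ofReal (ψ w) +
        ofReal (wt K (z - w)) * ofReal (wtConv K ψ w) := fun w => by
    rw [ofReal_add (hψ0 w) (wtConv_nonneg hψ0 w), mul_add]
  simp only [h2]
  have hm0 : Measurable fun w => ofReal (wt K (z - w)) * ofReal (ψ w) := (hwm z).mul hψm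
  rw [lintegral_add_left hm0, ← ofReal_wtConv _ hK hψ hψ0 hψR]
  refine (add_le_add_right h1 _).trans ?_
  have hc := wtConv_nonneg (K := K) hψ0 z
  rw [← ofReal_add hc (by positivity)]
  refine ofReal_le_ofReal ?_
  have h3 : wtConst n K * wtConv K ψ z ≤ wtConst n K * (ψ z + wtConv K ψ z) :=
    mul_le_mul_of_nonneg_left (by linarith [hψ0 z]) (wtConst_nonneg n K)
  refine le_trans (le_of_eq ?_) h3
  rw [wtConst]; ring

end Majorants

/-! ### Evolution operators -/

section WeakSolution

variable {s T : ℝ} {u v : ℝ → L2Pos n}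

lemma IsWeakSolution.congr {a' b' : ℝ → Φ → ℝ} (hsT : s ≤ T) (hu : IsWeakSolution a b s T u)
    (ha : ∀ τ ∈ Icc s T, a' τ = a τ) (hb : ∀ τ ∈ Icc s T, b' τ = b τ) (h : ∀ τ ∈ Icc s T, v τ = u τ) :
    IsWeakSolution a' b' s T v := by
  have e : ∀ τ ∈ Icc s T, ∀ φ : 𝓢(Pos n, ℂ), adjGen a' b' τ φ = adjGen a b τ φ := fun τ hτ φ => by
    funext x; simp only [adjGen, ha τ hτ, hb τ hτ]
  refine ⟨hu.1.congr h, fun φ => ?_⟩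
  obtain ⟨h1, h2, h3⟩ := hu.2 φ
  refine ⟨?_, h2.congr fun τ hτ => ?_, fun t ht => ?_⟩
  · filter_upwards [h1, ae_restrict_mem measurableSet_Icc] with τ h1τ hτ
    rwa [e τ hτ]
  · rw [uIoc_of_le hsT] at hτ; have hτ' : τ ∈ Icc s T := Ioc_subset_Icc_self hτ
    simp only [e τ hτ', h τ hτ']
  · rw [h t ht, h s ⟨le_rfl, hsT⟩, h3 t ht]; refine intervalIntegral.integral_congr fun τ hτ => ?_
    rw [uIcc_of_le ht.1] at hτ; have hτ' : τ ∈ Icc s T := ⟨hτ.1, hτ.2.trans ht.2⟩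
    simp only [e τ hτ', h τ hτ']

lemma IsWeakSolution.mono {T' : ℝ} (hsT' : s ≤ T') (hT' : T' ≤ T) (hu : IsWeakSolution a b s T u) :
    IsWeakSolution a b s T' u := by
  have hss : Icc s T' ⊆ Icc s T := Icc_subset_Icc_right hT'
  refine ⟨hu.1.mono hss, fun φ => ?_⟩
  obtain ⟨h1, h2, h3⟩ := hu.2 φ
  refine ⟨ae_restrict_of_ae_restrict_of_subset hss h1, h2.mono_set ?_, fun t ht => h3 t (hss ht)⟩
  rw [uIcc_of_le hsT', uIcc_of_le (hsT'.trans hT')]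
  exact hss

lemma integral_conj_mul_linear {ψ : Pos n → ℂ} (hψ : MemLp ψ 2) (c : ℂ) (f g : L2Pos n) :
    ∫ x, conj (ψ x) * (c • f + g : L2Pos n) x =
      c * (∫ x, conj (ψ x) * f x) + ∫ x, conj (ψ x) * g x := by
  have h : ∀ f, ∫ x, conj (ψ x) * f x = inner ℂ (hψ.toLp ψ) f := fun f => by
    rw [← integral_conj_mul_eq_inner]; refine integral_congr_ae ?_
    filter_upwards [hψ.coeFn_toLp] with x hx; rw [hx]
  rw [h, h, h, inner_add_right, inner_smul_right]

lemma IsWeakSolution.linear (hsT : s ≤ T) (hu : IsWeakSolution a b s T u)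
    (hv : IsWeakSolution a b s T v) (c : ℂ) : IsWeakSolution a b s T fun t => c • u t + v t := by
  refine ⟨(hu.1.const_smul c).add hv.1, fun φ => ?_⟩
  obtain ⟨h1, h2, h3⟩ := hu.2 φ
  obtain ⟨-, h2', h3'⟩ := hv.2 φ
  have e : ∀ᵐ τ ∂volume.restrict (Icc s T), c * (∫ x, conj (adjGen a b τ φ x) * u τ x) +
      (∫ x, conj (adjGen a b τ φ x) * v τ x) =
      ∫ x, conj (adjGen a b τ φ x) * (c • u τ + v τ : L2Pos n) x := by
    filter_upwards [h1] with τ hτ; rw [integral_conj_mul_linear hτ]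
  refine ⟨h1, ((h2.const_mul c).add h2').congr_ae ?_, fun t ht => ?_⟩
  · rw [uIoc_of_le hsT]; exact ae_restrict_of_ae_restrict_of_subset Ioc_subset_Icc_self e
  · have hI : uIcc s t ⊆ uIcc s T := by
      rw [uIcc_of_le ht.1, uIcc_of_le hsT]; exact Icc_subset_Icc_right ht.2
    have e2 : ∫ τ in s..t, ∫ x, conj (adjGen a b τ φ x) * (c • u τ + v τ : L2Pos n) x =
        ∫ τ in s..t, (c * (∫ x, conj (adjGen a b τ φ x) * u τ x) +
          ∫ x, conj (adjGen a b τ φ x) * v τ x) := by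
      refine intervalIntegral.integral_congr_ae_restrict ?_; rw [uIoc_of_le ht.1]
      refine ae_restrict_of_ae_restrict_of_subset
        (Ioc_subset_Icc_self.trans (Icc_subset_Icc_right ht.2)) ?_
      filter_upwards [e] with τ hτ using hτ.symm
    rw [e2, intervalIntegral.integral_add ((h2.mono_set hI).const_mul c) (h2'.mono_set hI),
      intervalIntegral.integral_const_mul, ← h3 t ht, ← h3' t ht,
      integral_conj_mul_linear (memLp_schwartz φ), integral_conj_mul_linear (memLp_schwartz φ)]
    ring

end WeakSolution

namespace IsSmallEvol

variable {M δ : ℝ}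

section

variable {C : ℝ} (D : IsSmallEvol a b X Y L K M δ C)
include D

lemma eq_of_isWeakSolution {s T : ℝ} (hs : 0 ≤ s) (hsT : s ≤ T) (hT : T ≤ 1) {u v : ℝ → L2Pos n}
    (hu : IsWeakSolution a b s T u) (hv : IsWeakSolution a b s T v) (h : u s = v s) :
    ∀ t ∈ Icc s T, u t = v t := fun t ht => by
  have := D.eq_zero_of_isWeakSolution hs hsT hT (hu.linear hsT hv (-1)) (by simp [h]) t ht
  simpa [neg_add_eq_zero] using this

end

variable (hK : 2 * n < K) (D : IsSmallEvol a b X Y L K M δ (wtConst n K))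
include hK D

lemma exists_isWeakSolution_norm_le {s : ℝ} (hs : s ∈ 𝕋) (u₀ : L2Pos n) :
    ∃ u : ℝ → L2Pos n, IsWeakSolution a b s 1 u ∧ u s = u₀ ∧
      ∀ t ∈ Icc s 1, ‖u t‖ ≤ 2 * rexp M * (1 + ∫ v : Φ, wt K v) * ‖u₀‖ := by
  set ψ : Φ → ℝ := fun w => ‖bargmann u₀ (X s w)‖ with hψ
  have hJ := integral_wt_nonneg n K
  have hψc : Continuous ψ := ((cont_bargmann u₀).comp (D.cont_flow_at s)).norm
  have hψ0 : ∀ w, 0 ≤ ψ w := fun w => norm_nonneg _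
  have hψR : ∀ w, ψ w ≤ ‖u₀‖ := fun w => norm_bargmann_le _ _
  have hψ2 : eLpNorm ψ 2 volume = ‖u₀‖ₑ := by
    have h1 : eLpNorm ψ 2 volume = eLpNorm (bargmann u₀ ∘ X s) 2 volume := eLpNorm_norm _
    rw [h1, eLpNorm_comp_measurePreserving (cont_bargmann u₀).aestronglyMeasurable
      (D.flow.measurePreserving D.symb_a hs), eLpNorm_bargmann (Lp.memLp u₀), Lp.enorm_def]
  have hψL : MemLp ψ 2 := ⟨hψc.aestronglyMeasurable, by rw [hψ2]; exact enorm_lt_top⟩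
  have hcs := (smeas_wtConv (K := K) hψc).aestronglyMeasurable (μ := volume)
  have hc2 := eLpNorm_wtConv_le hK hψc hψ0 hψR
  rw [hψ2] at hc2
  have hcL : MemLp (wtConv K ψ) 2 :=
    ⟨hcs, hc2.trans_lt (ENNReal.mul_lt_top ENNReal.ofReal_lt_top enorm_lt_top)⟩
  obtain ⟨u, h1, h2, h3, -⟩ := D.exists_isWeakSolution hs u₀
    (isWtMajorant_add_wtConv hK hψc hψ0 hψR) (hψL.add hcL)
    (fun z => add_le_add (hψR z) (wtConv_le hK hψc hψ0 hψR z))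
    (fun w => le_add_of_nonneg_right (wtConv_nonneg hψ0 w))
  refine ⟨u, h1, h2, fun t ht => (h3 t ht).trans ?_⟩
  rw [mul_assoc (2 * rexp M)]
  refine mul_le_mul_of_nonneg_left ?_ (by positivity)
  refine ENNReal.toReal_le_of_le_ofReal (by positivity) ?_
  refine (eLpNorm_add_le hψL.1 hcs one_le_two).trans ?_
  refine (add_le_add hψ2.le hc2).trans (le_of_eq ?_)
  rw [← ofReal_norm, ← ofReal_mul hJ, ← ofReal_add (norm_nonneg _) (by positivity)]
  ring

lemma exists_propagator {s : ℝ} (hs : s ∈ 𝕋) : ∃ V : ℝ → L2Pos n →L[ℂ] L2Pos n,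
    ∀ u₀, V s u₀ = u₀ ∧ IsWeakSolution a b s 1 fun t => V t u₀ := by
  choose u hu1 hu2 hu3 using fun u₀ => D.exists_isWeakSolution_norm_le hK hs u₀
  have hlin : ∀ (c : ℂ) (f g : L2Pos n), ∀ t ∈ Icc s 1, u (c • f + g) t = c • u f t + u g t :=
    fun c f g => D.eq_of_isWeakSolution hs.1 hs.2 le_rfl (hu1 _) ((hu1 f).linear hs.2 (hu1 g) c)
      (by simp only [hu2])
  have hzero : ∀ t ∈ Icc s 1, u 0 t = 0 := fun t ht => by simpa using hlin (-1) 0 0 t ht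
  classical
  set V : ℝ → L2Pos n →L[ℂ] L2Pos n := fun t => if ht : t ∈ Icc s 1 then
    LinearMap.mkContinuous
      { toFun := fun f => u f t
        map_add' := fun f g => by simpa using hlin 1 f g t ht
        map_smul' := fun c f => by simpa [hzero t ht] using hlin c f 0 t ht }
      _ (fun f => hu3 f t ht) else 0 with hV
  have hVu : ∀ t ∈ Icc s 1, ∀ f, V t f = u f t := fun t ht f => by
    simp only [hV, dif_pos ht]; rfl
  exact ⟨V, fun u₀ => ⟨by rw [hVu s ⟨le_rfl, hs.2⟩, hu2],
    (hu1 u₀).congr hs.2 (fun _ _ => rfl) (fun _ _ => rfl) fun t ht => hVu t ht u₀⟩⟩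

lemma exists_isEvolution : ∃ S : ℝ → ℝ → L2Pos n →L[ℂ] L2Pos n, IsEvolution a b S := by
  choose! V hV using fun s hs => D.exists_propagator hK (s := s) hs
  refine ⟨fun t s => V s t, fun s T hs hsT hT => ?_⟩
  have hs' : s ∈ 𝕋 := ⟨hs, hsT.trans hT⟩
  have h : ∀ u₀, IsWeakSolution a b s T fun t => V s t u₀ := fun u₀ => (hV s hs' u₀).2.mono hsT hT
  exact ⟨fun u₀ => ⟨(hV s hs' u₀).1, h u₀⟩, fun u hu =>
    D.eq_of_isWeakSolution hs hsT hT hu (h (u s)) (hV s hs' _).1.symm⟩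

end IsSmallEvol

/-! ### The kernel of an operator in phase space -/

lemma cont_uncurry_bargmann {u : Φ → L2Pos n} (hu : Continuous u) :
    Continuous (uncurry fun z w => bargmann (u w) z) := by
  have h : Continuous fun p : Φ × Φ => u p.2 := hu.comp continuous_snd
  exact cont_bargmann_comp h continuous_fst

/-- The kernel of `T A T*`. -/
def opKer (A : L2Pos n →L[ℂ] L2Pos n) (z w : Φ) : ℂ := bargmann (A (cohL2 w)) z

lemma cont_opKer (A : L2Pos n →L[ℂ] L2Pos n) : Continuous (uncurry (opKer A)) := by
  have h : Continuous fun w => A (cohL2 w) := A.continuous.comp cont_cohL2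
  exact cont_uncurry_bargmann h

lemma opKer_eq_conj (A : L2Pos n →L[ℂ] L2Pos n) (z w : Φ) :
    opKer A z w = conj (bargmann (adjoint A (cohL2 z)) w) := by
  rw [opKer, bargmann_eq_inner, bargmann_eq_inner, inner_conj_symm,
    ContinuousLinearMap.adjoint_inner_left]

lemma phaseConj_ae (A : L2Pos n →L[ℂ] L2Pos n) (v : L2Phase n) : phaseConj A v =ᵐ[volume]
    bargmann (A (adjoint (bargmannL2 n).toContinuousLinearMap v)) :=
  bargmannL2_ae _

lemma inner_adjoint_bargmannL2 (f : L2Pos n) (v : L2Phase n) :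
    inner ℂ f (adjoint (bargmannL2 n).toContinuousLinearMap v) =
      ∫ w, conj (bargmann f w) * v w := by
  rw [ContinuousLinearMap.adjoint_inner_right, ← integral_conj_mul_eq_inner_phase]
  refine integral_congr_ae ?_
  filter_upwards [bargmannL2_ae f] with w hw
  exact congrArg (fun c => conj c * v w) hw

lemma isIntegralKernel_opKer (A : L2Pos n →L[ℂ] L2Pos n) : IsIntegralKernel (phaseConj A) (opKer A) := by
  intro v
  filter_upwards [phaseConj_ae A v] with z hz
  simp only [opKer_eq_conj]
  refine ⟨(bargmann_memLp (Lp.memLp _)).star.integrable_mul (Lp.memLp v), ?_⟩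
  rw [hz, bargmann_eq_inner, ← ContinuousLinearMap.adjoint_inner_left, inner_adjoint_bargmannL2]

lemma exists_opKer_le (hK : 2 * n < K) : ∃ C, 0 ≤ C ∧
    ∀ (a b : ℝ → Φ → ℝ) (X Y : ℝ → Φ → Φ) (M δ : ℝ)
      (S : ℝ → ℝ → L2Pos n →L[ℂ] L2Pos n), IsSmallEvol a b X Y L K M δ (wtConst n K) →
      IsEvolution a b S → ∀ s t, 0 ≤ s → s ≤ t → t ≤ 1 → ∀ z w,
        ‖opKer (S t s) z w‖ ≤ C * rexp M * wt K (z - X t (Y s w)) := by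
  obtain ⟨c, hc0, hc⟩ := exists_repKer_le n K
  have hJ := integral_wt_nonneg n K
  by_cases hL : 1 ≤ L
  swap
  · exact ⟨0, le_rfl, fun a b X Y M δ S D => absurd D.flow.one_le hL⟩
  set e := c * L ^ K with he
  have he0 : 0 ≤ e := by positivity
  refine ⟨2 * (e * e * (2 ^ (K + 1) * ∫ v, wt K v)) * L ^ K, by positivity,
    fun a b X Y M δ S D hS s t hs hst ht z w => ?_⟩
  have hs' : s ∈ 𝕋 := ⟨hs, hst.trans ht⟩
  have hwt : ∀ τ z w, wt K (X τ w - z) ≤ L ^ K * wt K (w - Y τ z) := fun τ z w =>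
    wt_le_of_norm_le K hL (by
      have := D.flow.lip_inv τ (X τ w) z
      rwa [D.flow.left_inv] at this)
  have hwt' : ∀ τ z w, wt K (Y τ w - z) ≤ L ^ K * wt K (w - X τ z) := fun τ z w =>
    wt_le_of_norm_le K hL (by
      have := D.flow.lip τ (Y τ w) z
      rwa [D.flow.right_inv] at this)
  have hg := isWtMajorant_wt hK he0 (Y s w)
  obtain ⟨u, hu, hus, -, hub⟩ := D.exists_isWeakSolution hs' (cohL2 w) hg
    ((memLp_wt_sub hK (Y s w)).const_mul e) (R := e)
    (fun z => mul_le_of_le_one_right he0 (wt_le_one _ _)) (fun v => by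
      rw [bargmann_eq_inner, inner_cohL2]; refine (hc _ _).trans ?_; rw [he, mul_assoc]
      exact mul_le_mul_of_nonneg_left (hwt s w v) hc0)
  have hut : u t = S t s (cohL2 w) := by
    rw [(hS s 1 hs (hst.trans ht) le_rfl).2 u hu t ⟨hst, ht⟩, hus]
  rw [opKer, ← hut]
  refine (hub t ⟨hst, ht⟩ z).trans ?_
  have hf : Module.finrank ℝ Φ < K := by rwa [finrank_phase]
  have h1 : ∀ v, ‖repKer z (X t v)‖ ≤ e * wt K (Y t z - v) := fun v => by
    refine (hc _ _).trans ?_; rw [he, mul_assoc, wt_sub_comm K z, wt_sub_comm K (Y t z)]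
    exact mul_le_mul_of_nonneg_left (hwt t z v) hc0
  have h2 : ∫ v, ‖repKer z (X t v)‖ * (e * wt K (v - Y s w)) ≤
      ∫ v, e * e * (wt K (Y t z - v) * wt K (v - Y s w)) := by
    refine integral_mono_of_nonneg (.of_forall fun v =>
      mul_nonneg (norm_nonneg _) (mul_nonneg he0 (wt_nonneg _ _)))
      ((integrable_wt_mul_wt (μ := volume) hf _ _).const_mul _) (.of_forall fun v => ?_)
    refine (mul_le_mul_of_nonneg_right (h1 v) (mul_nonneg he0 (wt_nonneg _ _))).trans (le_of_eq ?_)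
    ring
  have h3 := integral_wt_mul_wt_le (μ := volume) hf (Y t z) (Y s w)
  rw [integral_const_mul] at h2
  calc _ ≤ 2 * rexp M * (e * e * (2 ^ (K + 1) * (∫ v, wt K v) *
        (L ^ K * wt K (z - X t (Y s w))))) := by
        refine mul_le_mul_of_nonneg_left (h2.trans ?_) (by positivity)
        refine mul_le_mul_of_nonneg_left (h3.trans ?_) (by positivity)
        exact mul_le_mul_of_nonneg_left (hwt' t (Y s w) z) (by positivity)
    _ = _ := by ring

/-! ### Evolution data of a pair of symbols -/

/-- The flow of `χ` from time `0`, frozen outside of `[0, 1]`. -/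
def flowFrom (χ : ℝ → ℝ → Φ → Φ) (t : ℝ) : Φ → Φ :=
  χ (projIcc (0 : ℝ) 1 zero_le_one t) 0

/-- The flow of `χ` back to time `0`, frozen outside of `[0, 1]`. -/
def flowTo (χ : ℝ → ℝ → Φ → Φ) (t : ℝ) : Φ → Φ :=
  χ 0 (projIcc (0 : ℝ) 1 zero_le_one t)

lemma flowFrom_eq (χ : ℝ → ℝ → Φ → Φ) {t : ℝ} (ht : t ∈ 𝕋) :
    flowFrom χ t = χ t 0 := by
  rw [flowFrom, projIcc_of_mem _ ht]

lemma flowFrom_flowTo (ha : IsSymbol a) {χ : ℝ → ℝ → Φ → Φ}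
    (hχ : IsHamiltonFlow a χ) {s t : ℝ} (hs : s ∈ 𝕋) (ht : t ∈ 𝕋) (w : Φ) :
    flowFrom χ t (flowTo χ s w) = χ t s w := by
  have hχ' := isCurve_of_isHamiltonFlow hχ
  rw [flowFrom_eq χ ht, flowTo, projIcc_of_mem _ hs]
  exact (ha.isTimeSym.isLipField.curve_eq hχ' le_rfl le_rfl (hχ' s hs w).2 ⟨le_rfl, zero_le_one⟩
    ht).symm

section SymbolBound

variable {a q : ℝ → Φ → ℝ} {χ : ℝ → ℝ → Φ → Φ} {k : ℕ}
  {c : (Fin n → ℕ) → (Fin n → ℕ) → ℝ} (hX : IsPhaseFlow (clamp a) (flowFrom χ) (flowTo χ) L)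
  (hχ : IsHamiltonFlow a χ) (hc : SymbolBound k a q c) (w₀ : Φ)
include hX hχ hc

lemma flowBound_of_multiD {α β : Fin n → ℕ} (hk : k ≤ order α β) {κ : ℝ} (hκ : c α β ≤ κ)
    {G : ℝ → Φ → ℝ} (hG : Continuous fun p : ℝ × Φ => G p.1 p.2)
    (h : ∀ τ ∈ 𝕋, G τ = multiD α β (q τ)) : FlowBound (flowFrom χ) w₀ κ 0 G := fun v => by
  have h0 : (0 : ℝ) ∈ 𝕋 := ⟨le_rfl, zero_le_one⟩
  have hcont : Continuous fun τ => |G τ (flowFrom χ τ v)| :=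
    (hG.comp (continuous_id.prodMk (hX.cont_path v))).abs
  have h1 := hc α β hk 1 ⟨zero_le_one, le_rfl⟩ (fun t => χ t 0 v) (hχ 0 h0 v).2
  have h2 : ∫ τ in 𝕋, |G τ (flowFrom χ τ v)| ≤ κ := by
    rw [integral_Icc_eq_integral_Ioc, ← integral_of_le zero_le_one]
    refine le_trans (le_of_eq ?_) (h1.trans hκ)
    refine intervalIntegral.integral_congr fun τ hτ => ?_; rw [uIcc_of_le zero_le_one] at hτ
    simp only [h τ hτ, flowFrom_eq χ hτ]
  rw [pow_zero, mul_one]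
  refine le_trans (le_of_eq ?_) (ofReal_le_ofReal h2)
  rw [ofReal_integral_eq_lintegral_ofReal (hcont.integrableOn_Icc (μ := volume))
    (.of_forall fun _ => abs_nonneg _)]
  exact lintegral_congr fun τ => by rw [← ofReal_norm, norm_eq_abs]

variable (hq : IsSymbol q) {m : ℕ}
include hq

lemma flowBound_iterD {i : ℕ} (hk : k ≤ i) (him : i ≤ m) :
    FlowBound (flowFrom χ) w₀ (maxBound c k m) 0 fun τ => (dph j)^[i] (clamp q τ) := by
  obtain ⟨α, β, h1, h2⟩ := exists_multiD_pure j i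
  refine flowBound_of_multiD hX hχ hc w₀ (α := α) (β := β) (by rwa [h1])
    (le_maxBound c (by rwa [h1]) (by rwa [h1])) (hq.isTimeSym.cont_iterate (ph j) i)
    fun τ hτ => ?_
  rw [h2, clamp_eq q hτ]
  rfl

lemma flowBound_gradSum (hk : k ≤ 1) (hm : 1 ≤ m) :
    FlowBound (flowFrom χ) w₀ (2 * n * maxBound c k m) 0 fun τ => gradSum (clamp q τ) := by
  have := FlowBound.sum (G := fun j τ => pd j (clamp q τ))
    (fun j => flowBound_iterD j hX hχ hc w₀ hq hk hm)
    (fun j => (hq.isTimeSym.cont_partialD (ph j)).measurable) hX.continuous.measurable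
  rw [Fintype.card_sum, Fintype.card_fin, Nat.cast_add, ← two_mul] at this
  exact this

lemma flowBound_hessSum (hk : k ≤ 2) (hm : 2 ≤ m) :
    FlowBound (flowFrom χ) w₀ ((2 * n) ^ 2 * maxBound c k m) 0 fun τ => hessSum (clamp q τ) := by
  have hts := hq.isTimeSym
  have hjl : ∀ j : 𝕁 × 𝕁, FlowBound (flowFrom χ) w₀ (maxBound c k m) 0
      fun τ => partialD (ph j.2) (partialD (ph j.1) (clamp q τ)) := fun j => by
    obtain ⟨α, β, h1, h2⟩ := exists_multiD_mixed j.2 j.1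
    refine flowBound_of_multiD hX hχ hc w₀ (α := α) (β := β) (by rwa [h1])
      (le_maxBound c (by rwa [h1]) (by rwa [h1])) (hts.cont_partialD_partialD _ _) fun τ hτ => ?_
    rw [clamp_eq q hτ, h2 _ (hq.1 τ hτ)]
  have := FlowBound.sum hjl (fun j => (hts.cont_partialD_partialD _ _).measurable)
    hX.continuous.measurable
  have e : (Fintype.card (𝕁 × 𝕁) : ℝ) = (2 * n) ^ 2 := by
    simp; ring
  rw [e] at this
  simp only [Fintype.sum_prod_type] at this
  exact this

end SymbolBound

/-- The constant in the bounds for the remainders of symbols. -/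
def remConst (n : ℕ) (L : ℝ) : ℝ := (1 + L + L * (2 * n * L)) * (1 + 2 * n + (2 * n) ^ 2)

lemma remConst_nonneg (hL : 1 ≤ L) : 0 ≤ remConst n L := by unfold remConst; positivity

section Rem

variable {χ : ℝ → ℝ → Φ → Φ}
  {c : (Fin n → ℕ) → (Fin n → ℕ) → ℝ} (hX : IsPhaseFlow (clamp a) (flowFrom χ) (flowTo χ) L)
  (hχ : IsHamiltonFlow a χ)
include hX hχ

lemma symBound_taylorRem_of_symbolBound (ha : IsSymbol a) (hc : SymbolBound 2 a a c)
    (w₀ : Φ) (m : ℕ) : SymBound (flowFrom χ) w₀ (remConst n L * maxBound c 2 (max 2 m)) m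
      fun τ => taylorRem (clamp a τ) (flowFrom χ τ w₀) := by
  have h0 := maxBound_nonneg c hc.nonneg (m := max 2 m)
  rw [remConst, mul_assoc]
  refine symBound_taylorRem hX ha.isTimeSym (by positivity) ?_ fun j i h2 hi => ?_
  · refine (flowBound_hessSum hX hχ hc w₀ ha le_rfl (le_max_left 2 m)).mono (by positivity) ?_ le_rfl
    refine mul_le_mul_of_nonneg_right ?_ h0; linarith
  · refine (flowBound_iterD j hX hχ hc w₀ ha h2 (hi.trans (le_max_right 2 m))).mono h0 ?_ le_rfl
    nlinarith

lemma symBound_incRem_of_symbolBound (hb : IsSymbol b) (hc : SymbolBound 1 a b c)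
    (w₀ : Φ) (m : ℕ) : SymBound (flowFrom χ) w₀ (remConst n L * maxBound c 1 (max 1 m)) m
      fun τ => incRem (clamp b τ) (flowFrom χ τ w₀) := by
  have h0 := maxBound_nonneg c hc.nonneg (m := max 1 m)
  rw [remConst, mul_assoc]
  refine symBound_incRem hX hb.isTimeSym (by positivity) ?_ fun j i h2 hi => ?_
  · refine (flowBound_gradSum hX hχ hc w₀ hb le_rfl (le_max_left 1 m)).mono (by positivity) ?_ le_rfl
    nlinarith
  · refine (flowBound_iterD j hX hχ hc w₀ hb h2 (hi.trans (le_max_right 1 m))).mono h0 ?_ le_rfl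
    nlinarith

end Rem

lemma le_ofReal_sqrt_mul_wt {I : ℝ≥0∞} {A B : ℝ} {p N : ℕ} (hp : p ≤ 2 * N) (hA : 0 ≤ A)
    (v : Φ) (h0 : I ≤ ofReal (A * (1 + ‖v‖) ^ p))
    (h1 : ofReal ((1 + ‖v‖) ^ (4 * N)) * I ≤ ofReal (B * (1 + ‖v‖) ^ p)) (hB : 0 ≤ B) :
    I ≤ ofReal (√(A * B) * wt (2 * N - p) v) := by
  obtain ⟨i, hi0, rfl⟩ : ∃ i, 0 ≤ i ∧ I = ofReal i := ⟨I.toReal, toReal_nonneg,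
    (ofReal_toReal (ne_top_of_le_ne_top ofReal_ne_top h0)).symm⟩
  set R := 1 + ‖v‖ with hR
  rw [← ofReal_mul (by positivity), ofReal_le_ofReal_iff (by positivity)] at h1
  rw [ofReal_le_ofReal_iff (by positivity)] at h0
  refine ofReal_le_ofReal ?_
  rw [le_mul_wt_iff]
  refine Real.le_sqrt_of_sq_le ?_
  have h2 : (R ^ p) ^ 2 * (i * R ^ (2 * N - p)) ^ 2 ≤ (R ^ p) ^ 2 * (A * B) := by
    have e : (R ^ p) ^ 2 * (i * R ^ (2 * N - p)) ^ 2 = i * (R ^ (4 * N) * i) := by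
      have : R ^ (4 * N) = (R ^ p * R ^ (2 * N - p)) ^ 2 := by
        rw [← pow_add, ← pow_mul]; congr 1; omega
      rw [this]; ring
    rw [e]
    calc _ ≤ (A * R ^ p) * (B * R ^ p) := mul_le_mul h0 h1 (by positivity) (by positivity)
      _ = _ := by ring
  exact le_of_mul_le_mul_left h2 (by positivity)

namespace IsEvol

variable (D : IsEvol a b X Y L)
include D

lemma lintegral_err_le {E : ℝ → ℂ} {q r : ℝ → Φ → ℝ} (hr : IsSmoothFamily r) {z w : Φ}
    (hE : ∀ᵐ τ ∂μ𝕋,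
      E τ = -I * symKer (q τ) (X τ z) (X τ w) + symKer (r τ) (X τ z) (X τ w)) {δ : ℝ} (hδ : 0 ≤ δ)
    (h1 : ∫⁻ τ in 𝕋, ‖symKer (q τ) (X τ z) (X τ w)‖ₑ ≤ ofReal δ)
    (h2 : ∫⁻ τ in 𝕋, ‖symKer (r τ) (X τ z) (X τ w)‖ₑ ≤ ofReal δ) :
    ∫⁻ τ in 𝕋, ‖E τ‖ₑ ≤ ofReal (2 * δ) := by
  have hm : Measurable fun τ => ‖symKer (r τ) (X τ z) (X τ w)‖ₑ :=
    (smeas_comp (G := fun τ => symKer (r τ))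
      (smeas_symKer hr.cont_uncurry) measurable_id
      (D.flow.cont_path z).measurable (D.flow.cont_path w).measurable).measurable.enorm
  calc _ ≤ ∫⁻ τ in 𝕋, (‖symKer (q τ) (X τ z) (X τ w)‖ₑ + ‖symKer (r τ) (X τ z) (X τ w)‖ₑ) := by
        refine lintegral_mono_ae ?_; filter_upwards [hE] with τ hτ; rw [hτ]
        refine (enorm_add_le _ _).trans (le_of_eq ?_); simp [← ofReal_norm]
    _ ≤ _ := by
        rw [lintegral_add_right _ hm, two_mul, ofReal_add hδ hδ]; exact add_le_add h1 h2

end IsEvol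

lemma IsEvol.lintegral_errFlow_le (D : IsEvol a b X Y L) {δ : ℝ} (hδ : 0 ≤ δ)
    (h1 : ∀ z w, ∫⁻ τ in 𝕋, ‖symKer (taylorRem (a τ) (X τ w)) (X τ z) (X τ w)‖ₑ ≤
      ofReal (δ * wt K (z - w)))
    (h2 : ∀ z w, ∫⁻ τ in 𝕋, ‖symKer (incRem (b τ) (X τ w)) (X τ z) (X τ w)‖ₑ ≤
      ofReal (δ * wt K (z - w))) (z w : Φ) :
    ∫⁻ τ in 𝕋, ‖errFlow a b X τ z w‖ₑ ≤ ofReal (2 * δ * wt K (z - w)) ∧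
    ∫⁻ τ in 𝕋, ‖errFlowL a b X τ z w‖ₑ ≤ ofReal (2 * δ * wt K (z - w)) := by
  have hs : ∀ (q : Φ → ℝ) z w, ‖symKer q z w‖ₑ = ‖symKer q w z‖ₑ := fun q z w => by
    rw [← conj_symKer q w z, RCLike.enorm_conj]
  rw [mul_assoc]
  have hd := mul_nonneg hδ (wt_nonneg K (z - w))
  constructor
  · refine D.lintegral_err_le (isSmoothFamily_incRem D.flow D.symb_b w) ?_ hd (h1 z w) (h2 z w)
    filter_upwards [D.ae_isAdm] with τ hτ; exact errKer_eq hτ.1 hτ.2 _ _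
  · refine D.lintegral_err_le (q := fun τ => taylorRem (a τ) (X τ z)) (z := z) (w := w)
      (isSmoothFamily_incRem D.flow D.symb_b z) ?_ hd ?_ ?_
    · filter_upwards [D.ae_isAdm] with τ hτ; exact errKerL_eq hτ.1 hτ.2 _ _
    · simp only [hs _ (X _ z)]; rw [wt_sub_comm]; exact h1 w z
    · simp only [hs _ (X _ z)]; rw [wt_sub_comm]; exact h2 w z

/-- The bilipschitz constant of the Hamilton flow of a symbol with small second derivatives. -/
def flowConst (n : ℕ) : ℝ := rexp ((2 * n) ^ 2 + 1)

lemma exists_isSmallEvol (n N : ℕ) (hN : 2 * n + 3 ≤ N) : ∃ ε, 0 < ε ∧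
    ∀ (a b : ℝ → Φ → ℝ) (ca cb : (Fin n → ℕ) → (Fin n → ℕ) → ℝ)
      (χ : ℝ → ℝ → Φ → Φ) (M : ℝ), IsSymbol a → SymbolBound 2 a a ca → IsSymbol b →
      SymbolBound 1 a b cb → IsHamiltonFlow a χ → IsLUB (growthSet b χ) M →
      rexp (2 * M) * kappaZero ca cb * kappa ca cb (4 * N) ≤ ε →
      ∃ δ, IsSmallEvol (clamp a) (clamp b) (flowFrom χ) (flowTo χ) (flowConst n)
        (2 * N - d₃) M δ (wtConst n (2 * N - d₃)) := by
  obtain ⟨C₀, hC₀, H₀⟩ := exists_lintegral_symKer_le n 0 (flowConst n)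
  obtain ⟨C₁, hC₁, H₁⟩ := exists_lintegral_symKer_le n (4 * N) (flowConst n)
  have hL1 : 1 ≤ flowConst n := one_le_exp (by positivity)
  have hr := remConst_nonneg (n := n) hL1
  set K := 2 * N - d₃ with hK
  set c := (C₀ + C₁) * remConst n (flowConst n) with hc
  have hc0 : 0 ≤ c := by positivity
  set W := wtConst n K with hW
  have hW0 : 0 ≤ W := wtConst_nonneg n K
  refine ⟨1 / (16 * (c * W) ^ 2 + 1), by positivity, fun a b ca cb χ M ha hca hb hcb hχ hM hε => ?_⟩
  set k₀ := kappaZero ca cb with hk₀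
  set k₁ := kappa ca cb (4 * N) with hk₁
  have a0 : 0 ≤ maxBound ca 2 2 := maxBound_nonneg ca hca.nonneg
  have b0 : 0 ≤ maxBound cb 1 1 := maxBound_nonneg cb hcb.nonneg
  have a1 : maxBound ca 2 2 ≤ maxBound ca 2 (4 * N) := maxBound_mono ca (by omega) hca.nonneg
  have b1 : maxBound cb 1 1 ≤ maxBound cb 1 (4 * N) := maxBound_mono cb (by omega) hcb.nonneg
  have k0 : 0 ≤ k₀ := add_nonneg a0 b0
  have k01 : k₀ ≤ k₁ := add_le_add a1 b1
  have k1 : 0 ≤ k₁ := k0.trans k01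
  have hM0 : 0 ≤ M := hM.1 ⟨0, 0, 0, le_rfl, le_rfl, zero_le_one, by simp⟩
  have hε1 : 1 / (16 * (c * W) ^ 2 + 1) ≤ 1 := by
    rw [div_le_one (by positivity)]; nlinarith [sq_nonneg (c * W)]
  have hk0 : k₀ ≤ 1 := by
    have h1 : k₀ * k₀ ≤ rexp (2 * M) * k₀ * k₁ := by
      rw [mul_assoc]; refine (mul_le_mul_of_nonneg_left k01 k0).trans ?_
      exact le_mul_of_one_le_left (by positivity) (one_le_exp (by positivity))
    nlinarith
  have hX : IsPhaseFlow (clamp a) (flowFrom χ) (flowTo χ) (flowConst n) :=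
    isPhaseFlow_of_isHamiltonFlow ha hχ fun γ hγ =>
      (integral_hessSum_le ha hca (B := 1) (fun α β h => (le_maxBound ca h.ge h.le).trans
        ((le_add_of_nonneg_right b0).trans hk0)) ⟨zero_le_one, le_rfl⟩ hγ).trans (by rw [mul_one])
  have hsa := ha.isTimeSym
  have hsb := hb.isTimeSym
  have hta := symBound_taylorRem_of_symbolBound hX hχ ha hca
  have htb := symBound_incRem_of_symbolBound hX hχ hb hcb
  have D : IsEvol (clamp a) (clamp b) (flowFrom χ) (flowTo χ) (flowConst n) :=
    ⟨hsa, hsb, hX,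
      fun m => exists_symBound_of_taylorRem hX hsa
        (mul_nonneg hr (maxBound_nonneg ca hca.nonneg)) (hta 0 m),
      fun m => exists_symBound_of_incRem hX hsb
        (mul_nonneg hr (maxBound_nonneg cb hcb.nonneg)) (htb 0 m)⟩
  have key : ∀ (q : Φ → ℝ → Φ → ℝ) (κ : ℕ → ℝ), (∀ m, 0 ≤ κ m) → κ 0 ≤ k₀ → κ (4 * N) ≤ k₁ →
      (∀ w, IsSmoothFamily (q w)) →
      (∀ w m, SymBound (flowFrom χ) w (remConst n (flowConst n) * κ m) m (q w)) →
      ∀ z w, ∫⁻ τ in 𝕋, ‖symKer (q w τ) (flowFrom χ τ z) (flowFrom χ τ w)‖ₑ ≤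
        ofReal (c * √(k₀ * k₁) * wt K (z - w)) := by
    intro q κ hκ hκ0 hκ1 hq hb z w
    have e : c * √(k₀ * k₁) = √(c * k₀ * (c * k₁)) := by
      rw [show c * k₀ * (c * k₁) = c ^ 2 * (k₀ * k₁) by ring, Real.sqrt_mul (sq_nonneg c),
        Real.sqrt_sq hc0]
    rw [e]; have h0 := H₀ _ _ _ _ _ _ hX hsa (mul_nonneg hr (hκ 0)) (hq w) (hb w 0) z
    have h1 := H₁ _ _ _ _ _ _ hX hsa (mul_nonneg hr (hκ (4 * N))) (hq w) (hb w (4 * N)) z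
    rw [pow_zero, ENNReal.ofReal_one, one_mul] at h0
    refine le_ofReal_sqrt_mul_wt (by omega) (by positivity) (z - w)
      (h0.trans (ofReal_le_ofReal ?_)) (h1.trans (ofReal_le_ofReal ?_)) (by positivity)
    · refine mul_le_mul_of_nonneg_right ?_ (by positivity); rw [hc, ← mul_assoc]
      exact mul_le_mul (mul_le_mul_of_nonneg_right (by linarith) hr) hκ0 (hκ 0) (by positivity)
    · refine mul_le_mul_of_nonneg_right ?_ (by positivity); rw [hc, ← mul_assoc]
      exact mul_le_mul (mul_le_mul_of_nonneg_right (by linarith) hr) hκ1 (hκ _) (by positivity)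
  have m2 : max 2 (4 * N) = 4 * N := max_eq_right (by omega)
  have m1 : max 1 (4 * N) = 4 * N := max_eq_right (by omega)
  have hE := D.lintegral_errFlow_le (K := K) (δ := c * √(k₀ * k₁)) (by positivity)
    (key (fun w τ => taylorRem (clamp a τ) (flowFrom χ τ w)) (fun m => maxBound ca 2 (max 2 m))
      (fun m => maxBound_nonneg ca hca.nonneg) (le_add_of_nonneg_right b0)
      (by simp only [m2]; exact le_add_of_nonneg_right (b0.trans b1))
      (fun w => isSmoothFamily_taylorRem hX hsa w) hta)
    (key (fun w τ => incRem (clamp b τ) (flowFrom χ τ w)) (fun m => maxBound cb 1 (max 1 m))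
      (fun m => maxBound_nonneg cb hcb.nonneg) (le_add_of_nonneg_left a0)
      (by simp only [m1]; exact le_add_of_nonneg_left (a0.trans a1))
      (fun w => isSmoothFamily_incRem hX hsb w) htb)
  refine ⟨2 * (c * √(k₀ * k₁)), ⟨D, by positivity, hW0, isWtMajorant_one (by omega),
    fun z w => (hE z w).1, fun z w => (hE z w).2, fun z s t hs hst ht => ?_, ?_⟩⟩
  · refine hM.1 ⟨s, t, z, hs, hst, ht, ?_⟩; refine intervalIntegral.integral_congr fun τ hτ => ?_
    rw [uIcc_of_le hst] at hτ; have hτ' : τ ∈ 𝕋 := ⟨hs.trans hτ.1, hτ.2.trans ht⟩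
    simp only [clamp_eq b hτ', flowFrom_eq χ hτ']
  · refine (pow_le_pow_iff_left₀ (by positivity) (by norm_num) two_ne_zero).1 ?_
    have h1 : (rexp M * (2 * (c * √(k₀ * k₁)) * W)) ^ 2 =
        4 * (c * W) ^ 2 * (rexp (2 * M) * k₀ * k₁) := by
      rw [show rexp (2 * M) = rexp M ^ 2 by rw [← Real.exp_nat_mul]; norm_num]
      have := Real.sq_sqrt (mul_nonneg k0 k1); grind
    rw [h1]; refine (mul_le_mul_of_nonneg_left hε (by positivity)).trans ?_
    rw [mul_one_div, div_le_iff₀ (by positivity)]; nlinarith [sq_nonneg (c * W)]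

lemma IsEvolution.of_clamp {S : ℝ → ℝ → L2Pos n →L[ℂ] L2Pos n}
    (h : IsEvolution (clamp a) (clamp b) S) : IsEvolution a b S := by
  intro s T hs hsT hT
  have e : ∀ (q : ℝ → Φ → ℝ), ∀ τ ∈ Icc s T, clamp q τ = q τ := fun q τ hτ =>
    clamp_eq q ⟨hs.trans hτ.1, hτ.2.trans hT⟩
  obtain ⟨h1, h2⟩ := h s T hs hsT hT
  exact ⟨fun u₀ => ⟨(h1 u₀).1, (h1 u₀).2.congr hsT (fun τ hτ => (e a τ hτ).symm)
    (fun τ hτ => (e b τ hτ).symm) fun _ _ => rfl⟩,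
    fun u hu => h2 u (hu.congr hsT (e a) (e b) fun _ _ => rfl)⟩

lemma wt_le_phaseDist {K N : ℕ} (h : N ≤ K) (z w : Φ) :
    wt K (z - w) ≤ 2 ^ N * ((1 + phaseDist z w) ^ N)⁻¹ := by
  have h0 : 0 ≤ phaseDist z w := Real.sqrt_nonneg _
  refine (wt_anti h _).trans ?_
  rw [← div_eq_mul_inv, le_div_iff₀ (by positivity), wt, inv_mul_le_iff₀ (by positivity), mul_comm,
    ← mul_pow]
  refine pow_le_pow_left₀ (by positivity) ?_ N
  have := phaseDist_le_norm z w
  linarith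

lemma exists_evolution_kernel_bound (n N : ℕ) (hN : 2 * n + 3 ≤ N) : ∃ ε C, 0 < ε ∧ 0 < C ∧
      ∀ (a b : ℝ → Φ → ℝ) (ca cb : (Fin n → ℕ) → (Fin n → ℕ) → ℝ) (χ : ℝ → ℝ → Φ → Φ) (M : ℝ),
        IsSymbol a → SymbolBound 2 a a ca → IsSymbol b → SymbolBound 1 a b cb →
        IsHamiltonFlow a χ → IsLUB (growthSet b χ) M →
        rexp (2 * M) * kappaZero ca cb * kappa ca cb (4 * N) ≤ ε →
        ∃ S, IsEvolution a b S ∧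
          ∀ s t, 0 ≤ s → s ≤ t → t ≤ 1 →
            ∃ K, Continuous (uncurry K) ∧
              IsIntegralKernel (phaseConj (S t s)) K ∧
              ∀ z w,
                ‖K z w‖ ≤ C * rexp M * ((1 + phaseDist z (χ t s w)) ^ N)⁻¹ := by
  have hK : 2 * n < 2 * N - d₃ := by omega
  obtain ⟨ε, hε, Hε⟩ := exists_isSmallEvol n N hN
  obtain ⟨C, hC, HC⟩ := exists_opKer_le hK (L := flowConst n)
  refine ⟨ε, C * 2 ^ N + 1, hε, by positivity, fun a b ca cb χ M ha hca hb hcb hχ hM hle => ?_⟩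
  obtain ⟨δ, D⟩ := Hε a b ca cb χ M ha hca hb hcb hχ hM hle
  obtain ⟨S, hS⟩ := D.exists_isEvolution hK
  refine ⟨S, hS.of_clamp, fun s t hs hst ht => ⟨opKer (S t s), cont_opKer _,
    isIntegralKernel_opKer _, fun z w => ?_⟩⟩
  have h1 := HC _ _ _ _ _ _ S D hS s t hs hst ht z w
  rw [flowFrom_flowTo ha hχ ⟨hs, hst.trans ht⟩ ⟨hs.trans hst, ht⟩] at h1
  have h0 : 0 ≤ phaseDist z (χ t s w) := Real.sqrt_nonneg _
  refine h1.trans ((mul_le_mul_of_nonneg_left (wt_le_phaseDist (by omega : N ≤ _) z (χ t s w))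
    (by positivity)).trans ?_)
  rw [← mul_assoc]
  refine mul_le_mul_of_nonneg_right ?_ (by positivity)
  have := Real.exp_pos M
  nlinarith

end

end PhaseSpace

theorem theorem2 (n : ℕ) :
    -- part (a)
    (∀ a : ℝ → Phase n → ℝ, InSymbolClass 2 a a →
      ∃ χ : ℝ → ℝ → Phase n → Phase n, IsHamiltonFlow a χ ∧
        (∀ (s T : ℝ) (z : ℝ → Phase n), 0 ≤ s → s ≤ T → T ≤ 1 → IsTrajectory a (Set.Icc s T) z →
          ∀ r ∈ Set.Icc s T, ∀ t ∈ Set.Icc s T, z t = χ t r (z r)) ∧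
        ∃ L : ℝ, 0 < L ∧ ∀ s ∈ Set.Icc (0 : ℝ) 1, ∀ t ∈ Set.Icc (0 : ℝ) 1, ∀ z w : Phase n,
          L⁻¹ * phaseDist z w ≤ phaseDist (χ t s z) (χ t s w) ∧
          phaseDist (χ t s z) (χ t s w) ≤ L * phaseDist z w) ∧
    -- part (b)
    (∃ N₀ : ℕ, ∀ N : ℕ, N₀ ≤ N → ∃ ε C : ℝ, 0 < ε ∧ 0 < C ∧
      ∀ (a b : ℝ → Phase n → ℝ) (ca cb : (Fin n → ℕ) → (Fin n → ℕ) → ℝ)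
        (χ : ℝ → ℝ → Phase n → Phase n) (M : ℝ),
        IsSymbol a → SymbolBound 2 a a ca → IsSymbol b → SymbolBound 1 a b cb →
        IsHamiltonFlow a χ → IsLUB (growthSet b χ) M →
        Real.exp (2 * M) * kappaZero ca cb * kappa ca cb (4 * N) ≤ ε →
        ∃ S : ℝ → ℝ → L2Pos n →L[ℂ] L2Pos n, IsEvolution a b S ∧
          ∀ s t : ℝ, 0 ≤ s → s ≤ t → t ≤ 1 →
            ∃ K : Phase n → Phase n → ℂ, Continuous (Function.uncurry K) ∧
              IsIntegralKernel (phaseConj (S t s)) K ∧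
              ∀ z w : Phase n,
                ‖K z w‖ ≤ C * Real.exp M * ((1 + phaseDist z (χ t s w)) ^ N)⁻¹) := by
  exact ⟨fun _ => hamilton_flow_exists, 2 * n + 3, fun N hN => exists_evolution_kernel_bound n N hN⟩
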